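/- **Setting.** Let $\mathcal S=\mathbb R^3$ with Cartesian coordinates $\sigma^i$, $r=|\sigma|$, $n^i=\sigma^i/r$, $\mathcal S_R=\{r<R\}$ and $\int_{\mathcal S}:=\lim_{R\to\infty}\int_{\mathcal S_R}$. For a smooth Riemannian metric $g_{ij}$ and a smooth symmetric tensor density $\pi^{ij}$ of weight one put $$C=\tfrac1{\sqrt{\det g}}\bigl(\pi_{ij}\pi^{ij}-\tfrac12\pi^2\bigr)-\sqrt{\det g}\,R,\qquad C_j=-2g_{jk}D_i\pi^{ik},\qquad H_{\rm phys}=\sqrt{C^2-g^{ij}C_iC_j},$$ $$N=C/H_{\rm phys},\qquad N^i=-g^{ij}C_j/H_{\rm phys}.$$ Fix a sign $\varepsilon=\pm1$ ($+$: phantom dust, $-$: physical dust). The reduced phase space $\mathcal P$ consists of all $(g_{ij},\pi^{ij})$ with $C^2-g^{ij}C_iC_j>0$ and $\varepsilon C>0$ everywhere (the dust density vanishes nowhere and has constant sign) such that 1. as $r\to\infty$, $$g_{ij}=\delta_{ij}+\tfrac{\bar h_{ij}}r+\tfrac{\log r}{r^2}h^{(\log)}_{ij}+\tfrac{h^{(2)}_{ij}}{r^2}+o(r^{-2}),$$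 $$\pi^{ij}=\tfrac{\bar\pi^{ij}}{r^2}+\tfrac{\log r}{r^3}\pi^{(\log)ij}+\tfrac{\pi^{(2)ij}}{r^3}+\tfrac{\log r}{r^4}\pi^{(ll)ij}+\tfrac{\pi^{(3)ij}}{r^4}+o(r^{-4}),$$ with coefficients that are smooth functions on $S^2$ and remainders whose $k$-th derivatives are $o(r^{-2-k})$, respectively $o(r^{-4-k})$, for every $k$; 2. the angular vector density $\pi^{(\log)rA}$ on $S^2$ is even (in angular coordinates that are odd under the antipodal map; equivalently it is an even $\mathbb R^3$-valued function of $n$ after division by $\sqrt{\bar\gamma}$); 3. $C^{(1)}=0$, and $C_A^{(0)}=C_A^{(\log)}=C_A^{(1)}=C_r^{(1)}=C_r^{(\log)}=C_r^{(2)}=0$, while $C^{(\log)}$ vanishes nowhere on $S^2$; here, in spherical coordinates, $C_r=\frac{C_r^{(1)}}r+\frac{\log r}{r^2}C_r^{(\log)}+\frac{C_r^{(2)}}{r^2}+\cdots$, $C_A=C_A^{(0)}+\frac{\log r}rC_A^{(\log)}+\frac{C_A^{(1)}}r+\cdots$, $C=\frac{C^{(1)}}r+\frac{\log r}{r^2}C^{(\log)}+\cdots$.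 A variation $\delta$ is the derivative at $s=0$ along a smooth curve $s\mapsto(g_s,\pi_s)$ in $\mathcal P$ with smooth coefficients, along which the remainder estimates hold, together with those for the first $s$-derivative, uniformly for $s$ near $0$. A functional $F$ on $\mathcal P$ is differentiable if $\delta F=\int_{\mathcal S}\bigl(\frac{\delta F}{\delta g_{ij}}\delta g_{ij}+\frac{\delta F}{\delta\pi^{ij}}\delta\pi^{ij}\bigr)d^3\sigma$ for all variations, with continuous symmetric $\frac{\delta F}{\delta g_{ij}},\frac{\delta F}{\delta\pi^{ij}}$, and then $\{F,F'\}=\int_{\mathcal S}\bigl(\frac{\delta F}{\delta g_{ij}}\frac{\delta F'}{\delta\pi^{ij}}-\frac{\delta F}{\delta\pi^{ij}}\frac{\delta F'}{\delta g_{ij}}\bigr)d^3\sigma$. Let $(\xi,\vec\xi)$ be smooth, independent of $(g,\pi)$, with $\xi=f+O(r^{-1})$, $\xi^r=W+O(r^{-1})$, $\xi^A=Y^A+\frac1rI^A+O(r^{-2})$ (each Cartesian derivative of a Cartesian remainder gaining one power of $r^{-1}$), where $f,W$ are smooth functions, $I^A$ a smooth vector field and $Y^A$ a Killing field on the unit sphere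 $(S^2,\bar\gamma)$. Put $$J(\xi,\vec\xi)=\int_{\mathcal S}\bigl(\xi H_{\rm phys}+\xi^iC_i\bigr)d^3\sigma.$$ With $\bar\lambda=\frac12\bar h_{rr}$, $\bar\lambda_A=\bar h_{rA}$, $\tilde{\bar k}_{AB}=\frac12\bar h_{AB}+\bar\lambda\bar\gamma_{AB}$, $\bar p=2(\bar\pi^{rr}-\bar\pi^A_A)$ (spherical components, those of $\pi$ containing the density factor $\sqrt{\bar\gamma}$) let $\mathcal B=\mathcal B(f)+\mathcal B(W)+\mathcal B(\vec Y)+\mathcal B(\vec I)$, $$\mathcal B(f)=2\varepsilon\oint_{S^2}\sqrt{\bar\gamma}\,f\,(2\bar\lambda+\bar D_A\bar\lambda^A),\qquad \mathcal B(W)=\oint_{S^2}W(\bar p+2\bar\pi^A_A),\qquad \mathcal B(\vec I)=\oint_{S^2}2I^A\bar\gamma_{AB}\bar\pi^{rB},$$ $$\mathcal B(\vec Y)=\oint_{S^2}Y^A\bigl(4(\tilde{\bar k}_{AB}-\bar\lambda\bar\gamma_{AB})\bar\pi^{rB}+2\bar\gamma_{AB}\pi^{(2)rB}+\bar\lambda_A(\bar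 p+2\bar\pi^B_B)\bigr).$$ Write $\tilde\xi=\xi N$, $\tilde\xi^i=\xi N^i$, $u^i=\xi^i+\tilde\xi^i$ and $$\mathscr G_{ij}=\tfrac{2\tilde\xi}{\sqrt{\det g}}\bigl(\pi_{ij}-\tfrac12g_{ij}\pi\bigr)+\mathcal L_{\vec u}g_{ij},$$ $$\begin{aligned}\mathscr F^{ij}={}&-\tilde\xi\sqrt{\det g}\,\bigl(R^{ij}-\tfrac12g^{ij}R\bigr)+\tfrac{\tilde\xi}{2\sqrt{\det g}}g^{ij}\bigl(\pi_{mn}\pi^{mn}-\tfrac12\pi^2\bigr)-\tfrac{2\tilde\xi}{\sqrt{\det g}}\bigl(\pi^{im}\pi_m{}^j-\tfrac12\pi^{ij}\pi\bigr)\\&+\sqrt{\det g}\,\bigl(D^iD^j\tilde\xi-g^{ij}D^mD_m\tilde\xi\bigr)+\mathcal L_{\vec u}\pi^{ij}-\tfrac\xi2H_{\rm phys}N^iN^j,\end{aligned}$$ $$\begin{aligned}\mathcal K_R=\oint_{r=R}\Bigl[&-2u^i\,\delta(\pi^{jk}g_{ik})\,n_j+u^kn_k\,\pi^{ij}\delta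 g_{ij}-\sqrt{\det g}\,g^{cd}g^{ef}\bigl(\partial_c\tilde\xi\,n_d\,\delta g_{ef}-\partial_e\tilde\xi\,n_c\,\delta g_{df}\bigr)\\&-\sqrt{\det g}\,\tilde\xi\,g^{cd}\bigl(n_e\,\delta\Gamma^e_{cd}-n_c\,\delta\Gamma^e_{ed}\bigr)\Bigr]dS,\end{aligned}$$ where $dS$ is the Euclidean area element. **Claim.** For every such $(\xi,\vec\xi)$: * on $\mathcal P$ the limit defining $J(\xi,\vec\xi)$ exists, and the four boundary charges are integrals of integrable functions, so $G(\xi,\vec\xi)=J(\xi,\vec\xi)+\mathcal B(\xi,\vec\xi)$ is finite; * for every variation and every $R>0$, $\delta\int_{\mathcal S_R}(\xi H_{\rm phys}+\xi^iC_i)\,d^3\sigma=\int_{\mathcal S_R}(\mathscr G_{ij}\delta\pi^{ij}-\mathscr F^{ij}\delta g_{ij})\,d^3\sigma+\mathcal K_R$; as $R\to\infty$ the bulk integral converges and $\mathcal K_R\to\mathcal K(\xi,\vec\xi)=-\delta\mathcal B(\xi,\vec\xi)$, and $\delta J=\int_{\mathcal S}(\mathscr G_{ij}\delta\pi^{ij}-\mathscr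 F^{ij}\delta g_{ij})\,d^3\sigma-\delta\mathcal B$; * consequently $G(\xi,\vec\xi)$ is differentiable on $\mathcal P$, with $\frac{\delta G}{\delta g_{ij}}=-\mathscr F^{ij}$ and $\frac{\delta G}{\delta\pi^{ij}}=\mathscr G_{ij}$; * $\{G(\xi,\vec\xi),\mathbf H_{\rm phys}+\mathbf H_{\rm bdy}\}=0$ on $\mathcal P$, where $\mathbf H_{\rm phys}=\int_{\mathcal S}H_{\rm phys}\,d^3\sigma$ and $\mathbf H_{\rm bdy}=4\varepsilon\oint_{S^2}\sqrt{\bar\gamma}\,\bar\lambda$. -/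

import Mathlib

open MeasureTheory Filter Topology Asymptotics
open scoped Matrix ContDiff

noncomputable section

namespace DustCharge

/-! ### Dust space and local differential geometry in the global coordinates `σ¹, σ², σ³` -/

/-- Dust space, `ℝ³` with its asymptotically Cartesian coordinates. -/
abbrev Space := EuclideanSpace ℝ (Fin 3)

/-- Values of two-index tensors in the Cartesian coordinates. -/
abbrev Mat := Matrix (Fin 3) (Fin 3) ℝ

/-- The partial derivative `∂_i φ`. -/
def pd (i : Fin 3) (φ : Space → ℝ) (x : Space) : ℝ :=
  fderiv ℝ φ x (EuclideanSpace.single i (1 : ℝ))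

/-- `(det g)^{1/2}`. -/
def sqrtDet (g : Space → Mat) (x : Space) : ℝ := Real.sqrt (g x).det

/-- Christoffel symbol `Γ^k_{ij}` of `g`. -/
def christoffel (g : Space → Mat) (k i j : Fin 3) (x : Space) : ℝ :=
  (1 / 2) * ∑ l, (g x)⁻¹ k l *
    (pd i (fun y => g y j l) x + pd j (fun y => g y i l) x - pd l (fun y => g y i j) x)

/-- Ricci tensor `R_{ij}` of `g`. -/
def ricci (g : Space → Mat) (x : Space) : Mat := fun i j =>
  ∑ k, pd k (christoffel g k i j) x - ∑ k, pd j (christoffel g k i k) x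
    + ∑ k, ∑ l, (christoffel g k k l x * christoffel g l i j x
        - christoffel g k j l x * christoffel g l i k x)

/-- Scalar curvature of `g`. -/
def scalarCurv (g : Space → Mat) (x : Space) : ℝ := ((g x)⁻¹ * ricci g x).trace

/-- `R^{ij}`. -/
def ricciUp (g : Space → Mat) (x : Space) : Mat := (g x)⁻¹ * ricci g x * (g x)⁻¹

/-- Covariant Hessian `D_i D_j φ`. -/
def hess (g : Space → Mat) (φ : Space → ℝ) (x : Space) : Mat := fun i j =>
  pd i (pd j φ) x - ∑ m, christoffel g m i j x * pd m φ x

/-- `D^i D^j φ`. -/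
def hessUp (g : Space → Mat) (φ : Space → ℝ) (x : Space) : Mat :=
  (g x)⁻¹ * hess g φ x * (g x)⁻¹

/-- `D^m D_m φ`. -/
def laplace (g : Space → Mat) (φ : Space → ℝ) (x : Space) : ℝ :=
  ((g x)⁻¹ * hess g φ x).trace

/-- `π = g_{ij} π^{ij}`. -/
def trMom (g p : Space → Mat) (x : Space) : ℝ := (g x * p x).trace

/-- `π_{mn} π^{mn}`. -/
def sqMom (g p : Space → Mat) (x : Space) : ℝ := (g x * p x * (g x * p x)).trace

/-- Lie derivative `(L_u g)_{ij}` of a covariant two-tensor. -/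
def lieMetric (u : Space → Fin 3 → ℝ) (g : Space → Mat) (x : Space) : Mat := fun i j =>
  ∑ k, (u x k * pd k (fun y => g y i j) x + g x k j * pd i (fun y => u y k) x
    + g x i k * pd j (fun y => u y k) x)

/-- Lie derivative `(L_u π)^{ij}` of a contravariant two-tensor density of weight one. -/
def lieMom (u : Space → Fin 3 → ℝ) (p : Space → Mat) (x : Space) : Mat := fun i j =>
  ∑ k, (pd k (fun y => u y k * p y i j) x - p x k j * pd k (fun y => u y i) x
    - p x i k * pd k (fun y => u y j) x)

/-! ### The geometric constraint functions and the physical Hamiltonian density -/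

/-- `C = (det g)^{-1/2} (π_{ij} π^{ij} - π²/2) - (det g)^{1/2} R`. -/
def constraintC (g p : Space → Mat) (x : Space) : ℝ :=
  (sqMom g p x - (1 / 2) * trMom g p x ^ 2) / sqrtDet g x - sqrtDet g x * scalarCurv g x

/-- `C_j = -2 g_{jk} D_i π^{ik}`, where for a density of weight one
`D_i π^{ik} = ∂_i π^{ik} + Γ^k_{ij} π^{ij}`. -/
def constraintV (g p : Space → Mat) (x : Space) (j : Fin 3) : ℝ :=
  -2 * ∑ k, g x j k * (∑ i, pd i (fun y => p y i k) x
    + ∑ i, ∑ l, christoffel g k i l x * p x i l)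

/-- `C² - g^{ij} C_i C_j`. -/
def hamSq (g p : Space → Mat) (x : Space) : ℝ :=
  constraintC g p x ^ 2
    - ∑ i, ∑ j, (g x)⁻¹ i j * constraintV g p x i * constraintV g p x j

/-- The physical Hamiltonian density `H_phys`. -/
def hamDensity (g p : Space → Mat) (x : Space) : ℝ := Real.sqrt (hamSq g p x)

/-- The dynamical lapse `N = C / H_phys`. -/
def lapse (g p : Space → Mat) (x : Space) : ℝ := constraintC g p x / hamDensity g p x

/-- The dynamical shift `N^i = - g^{ij} C_j / H_phys`. -/
def shift (g p : Space → Mat) (x : Space) (i : Fin 3) : ℝ :=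
  -(∑ j, (g x)⁻¹ i j * constraintV g p x j) / hamDensity g p x

/-! ### Functions on the unit sphere

Functions and tensors on `S²` are represented by their extensions to `ℝ³ \ {0}` which are
homogeneous of degree zero. A tensor `A_{ij}` (Cartesian components) is split into its
`rr`-, `rA`- and `AB`-parts by the unit radial vector and the projection onto the tangent plane
of the sphere. The spherical components of the density `π^{ij}` carry a factor `√γ̄`, which is
absorbed into the area element of the sphere. -/

/-- The coordinate components of the unit radial vector `x / ‖x‖`. -/
def radialVec (x : Space) : Fin 3 → ℝ := fun i => x i / ‖x‖

/-- Projection onto the tangent plane of the sphere; it represents `γ̄_{AB}`. -/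
def tangProj (x : Space) : Mat := 1 - Matrix.vecMulVec (radialVec x) (radialVec x)

/-- `A_{rr}`. -/
def compRR (A : Space → Mat) (x : Space) : ℝ := radialVec x ⬝ᵥ (A x *ᵥ radialVec x)

/-- `A_{rA}` as a tangent vector. -/
def compRT (A : Space → Mat) (x : Space) : Fin 3 → ℝ := tangProj x *ᵥ (A x *ᵥ radialVec x)

/-- `A_{AB}` as a tangential matrix. -/
def compTT (A : Space → Mat) (x : Space) : Mat := tangProj x * A x * tangProj x

/-- The angular trace `A^A_A`. -/
def traceTT (A : Space → Mat) (x : Space) : ℝ := (compTT A x).trace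

/-- Divergence `D̄_A V^A` on the unit sphere of the tangent field `V`; for a tangential
extension of degree zero it is the Euclidean divergence at points of the unit sphere. -/
def sphereDiv (V : Space → Fin 3 → ℝ) (x : Space) : ℝ := ∑ i, pd i (fun y => V y i) x

/-- Integration over the unit sphere with its standard area measure (of total mass `4π`). -/
def sphereInt (F : Space → ℝ) : ℝ :=
  ∫ n : Metric.sphere (0 : Space) 1, F n ∂((volume : Measure Space).toSphere)

/-- Integrability over the unit sphere. -/
def SphereIntegrable (F : Space → ℝ) : Prop :=
  Integrable (fun n : Metric.sphere (0 : Space) 1 => F n) ((volume : Measure Space).toSphere)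

/-- Smooth function on the unit sphere, in its degree-zero extension. -/
def IsSphereFun (φ : Space → ℝ) : Prop :=
  ContDiffOn ℝ ∞ φ {0}ᶜ ∧ ∀ t : ℝ, 0 < t → ∀ x : Space, φ (t • x) = φ x

/-! ### Asymptotics -/

/-- `ρ = o(r^a)`, every derivative improving the decay by one power. -/
def IsSmallSymbol (a : ℤ) (ρ : Space → ℝ) : Prop :=
  ∀ k : ℕ, (fun x => iteratedFDeriv ℝ k ρ x) =o[Bornology.cobounded Space]
    fun x => ‖x‖ ^ (a - (k : ℤ))

/-- `ρ = O(r^a)`, every derivative improving the decay by one power. -/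
def IsBigSymbol (a : ℤ) (ρ : Space → ℝ) : Prop :=
  ∀ k : ℕ, (fun x => iteratedFDeriv ℝ k ρ x) =O[Bornology.cobounded Space]
    fun x => ‖x‖ ^ (a - (k : ℤ))

/-- A one-parameter family `ρ_s` which, together with its first parameter derivative, is
`o(r^a)` with all its spatial derivatives, uniformly for `s` near `0`. -/
def IsSmallSymbolFamily (a : ℤ) (ρ : ℝ → Space → ℝ) : Prop :=
  ∀ k m : ℕ, m ≤ 1 →
    (fun q : ℝ × Space =>
        iteratedFDeriv ℝ k (fun x => iteratedDeriv m (fun s => ρ s x) q.1) q.2)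
      =o[𝓝 (0 : ℝ) ×ˢ Bornology.cobounded Space] fun q => ‖q.2‖ ^ (a - (k : ℤ))

/-! ### The reduced phase space -/

/-- Canonical fields together with the boundary fields, the coefficients of their expansions. -/
structure Fields where
  /-- the metric `g_{ij}` -/
  g : Space → Mat
  /-- the momentum `π^{ij}` -/
  p : Space → Mat
  /-- `h̄_{ij}` -/
  hBar : Space → Mat
  /-- `h^{(log)}_{ij}` -/
  hLog : Space → Mat
  /-- `h^{(2)}_{ij}` -/
  h2 : Space → Mat
  /-- `π̄^{ij}` -/
  pBar : Space → Mat
  /-- `π^{(log)ij}` -/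
  pLog : Space → Mat
  /-- `π^{(2)ij}` -/
  p2 : Space → Mat
  /-- `π^{(ll)ij}` -/
  pLL : Space → Mat
  /-- `π^{(3)ij}` -/
  p3 : Space → Mat

/-- `g_{ij} - (δ_{ij} + h̄_{ij}/r + (log r/r²) h^{(log)}_{ij} + h^{(2)}_{ij}/r²)`. -/
def metricRem (z : Fields) (i j : Fin 3) (x : Space) : ℝ :=
  z.g x i j - ((1 : Mat) i j + z.hBar x i j / ‖x‖
    + Real.log ‖x‖ / ‖x‖ ^ 2 * z.hLog x i j + z.h2 x i j / ‖x‖ ^ 2)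

/-- `π^{ij}` minus its expansion in `r⁻²`, `r⁻³ log r`, `r⁻³`, `r⁻⁴ log r`, `r⁻⁴`. -/
def momRem (z : Fields) (i j : Fin 3) (x : Space) : ℝ :=
  z.p x i j - (z.pBar x i j / ‖x‖ ^ 2 + Real.log ‖x‖ / ‖x‖ ^ 3 * z.pLog x i j
    + z.p2 x i j / ‖x‖ ^ 3 + Real.log ‖x‖ / ‖x‖ ^ 4 * z.pLL x i j + z.p3 x i j / ‖x‖ ^ 4)

/-- The reduced phase space `𝒫`. The sign `ε` distinguishes phantom dust (`ε = 1`, `N > 0`)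
and physical dust (`ε = -1`, `N < 0`).

The functions `C` and `C_j` of the fields have asymptotic expansions in the powers
`r⁻³, r⁻⁴ log r, r⁻⁴, …`, so the boundary conditions say that successive coefficients, each given
by a limit once the earlier ones vanish, are zero (or non-zero). In spherical components
(`C_r = r² √γ̄ n^j C_j`, `C_A = r³ √γ̄ e_A^j C_j`, and `C` multiplied by `r² √γ̄`) these are the
coefficients `C_r^{(1)}, C_A^{(0)}`; `C_r^{(log)}, C_A^{(log)}`; `C_r^{(2)}, C_A^{(1)}`; and
`C^{(1)}`; `C^{(log)}`. -/
structure InPhaseSpace (ε : ℝ) (z : Fields) : Prop where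
  smooth_g : ∀ i j, ContDiff ℝ ∞ (fun x => z.g x i j)
  smooth_p : ∀ i j, ContDiff ℝ ∞ (fun x => z.p x i j)
  posDef_g : ∀ x, (z.g x).PosDef
  symm_p : ∀ x, (z.p x).IsSymm
  hBar_sphere : ∀ i j, IsSphereFun (fun x => z.hBar x i j)
  hLog_sphere : ∀ i j, IsSphereFun (fun x => z.hLog x i j)
  h2_sphere : ∀ i j, IsSphereFun (fun x => z.h2 x i j)
  pBar_sphere : ∀ i j, IsSphereFun (fun x => z.pBar x i j)
  pLog_sphere : ∀ i j, IsSphereFun (fun x => z.pLog x i j)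
  p2_sphere : ∀ i j, IsSphereFun (fun x => z.p2 x i j)
  pLL_sphere : ∀ i j, IsSphereFun (fun x => z.pLL x i j)
  p3_sphere : ∀ i j, IsSphereFun (fun x => z.p3 x i j)
  falloff_g : ∀ i j, IsSmallSymbol (-2) (metricRem z i j)
  falloff_p : ∀ i j, IsSmallSymbol (-4) (momRem z i j)
  /-- the dust density is nowhere zero and has constant sign -/
  dust_ham : ∀ x, 0 < hamSq z.g z.p x
  dust_sign : ∀ x, 0 < ε * constraintC z.g z.p x
  /-- The angular vector density `π^{(log)rA}` is even: in angular coordinates which are odd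
  under the antipodal map, even components; hence an even `ℝ³`-valued function on the sphere. -/
  parity : ∀ x, x ≠ 0 → compRT z.pLog (-x) = compRT z.pLog x
  c_one : ∀ n : Space, ‖n‖ = 1 →
    Tendsto (fun r : ℝ => r ^ 3 * constraintC z.g z.p (r • n)) atTop (𝓝 0)
  c_log : ∀ n : Space, ‖n‖ = 1 → ∃ c : ℝ, c ≠ 0 ∧
    Tendsto (fun r : ℝ => r ^ 4 / Real.log r * constraintC z.g z.p (r • n)) atTop (𝓝 c)
  v_one : ∀ n : Space, ‖n‖ = 1 → ∀ j,
    Tendsto (fun r : ℝ => r ^ 3 * constraintV z.g z.p (r • n) j) atTop (𝓝 0)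
  v_log : ∀ n : Space, ‖n‖ = 1 → ∀ j,
    Tendsto (fun r : ℝ => r ^ 4 / Real.log r * constraintV z.g z.p (r • n) j) atTop (𝓝 0)
  v_two : ∀ n : Space, ‖n‖ = 1 → ∀ j,
    Tendsto (fun r : ℝ => r ^ 4 * constraintV z.g z.p (r • n) j) atTop (𝓝 0)

/-- Joint smoothness of a one-parameter family of tensor fields. -/
def JointSmooth (A : ℝ → Space → Mat) : Prop :=
  ∀ i j, ContDiff ℝ ∞ (fun q : ℝ × Space => A q.1 q.2 i j)

/-- Joint smoothness away from the origin, for families of boundary fields. -/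
def JointSmoothOff (A : ℝ → Space → Mat) : Prop :=
  ∀ i j, ContDiffOn ℝ ∞ (fun q : ℝ × Space => A q.1 q.2 i j) (Set.univ ×ˢ {(0 : Space)}ᶜ)

/-- A variation: a smooth curve in the phase space, along which the fall-off conditions hold
uniformly together with their parameter derivative. The variation `δ` of a quantity is its
derivative in the parameter at `0`. -/
structure IsVariation (ε : ℝ) (c : ℝ → Fields) : Prop where
  mem : ∀ s, InPhaseSpace ε (c s)
  smooth_g : JointSmooth (fun s => (c s).g)
  smooth_p : JointSmooth (fun s => (c s).p)
  smooth_hBar : JointSmoothOff (fun s => (c s).hBar)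
  smooth_hLog : JointSmoothOff (fun s => (c s).hLog)
  smooth_h2 : JointSmoothOff (fun s => (c s).h2)
  smooth_pBar : JointSmoothOff (fun s => (c s).pBar)
  smooth_pLog : JointSmoothOff (fun s => (c s).pLog)
  smooth_p2 : JointSmoothOff (fun s => (c s).p2)
  smooth_pLL : JointSmoothOff (fun s => (c s).pLL)
  smooth_p3 : JointSmoothOff (fun s => (c s).p3)
  falloff_g : ∀ i j, IsSmallSymbolFamily (-2) (fun s => metricRem (c s) i j)
  falloff_p : ∀ i j, IsSmallSymbolFamily (-4) (fun s => momRem (c s) i j)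

/-- `δ g_{ij}`. -/
def varG (c : ℝ → Fields) (x : Space) : Mat := fun i j => deriv (fun s => (c s).g x i j) 0

/-- `δ π^{ij}`. -/
def varP (c : ℝ → Fields) (x : Space) : Mat := fun i j => deriv (fun s => (c s).p x i j) 0

/-- `δ Γ^k_{ij}`. -/
def varGamma (c : ℝ → Fields) (k i j : Fin 3) (x : Space) : ℝ :=
  deriv (fun s => christoffel (c s).g k i j x) 0

/-- `δ (π^{rk} g_{ik})` with `π^{rk} = n_j π^{jk}`, `n = x / ‖x‖`. -/
def varMixed (c : ℝ → Fields) (i : Fin 3) (x : Space) : ℝ :=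
  deriv (fun s => ∑ j, ∑ k, radialVec x j * (c s).p x j k * (c s).g x i k) 0

/-! ### Functionals, differentiability and Poisson brackets -/

/-- Integral over the ball `𝒮_R`. -/
def ballInt (F : Space → ℝ) (R : ℝ) : ℝ := ∫ x in Metric.ball (0 : Space) R, F x

/-- The integral over dust space, `lim_{R → ∞} ∫_{𝒮_R}`. -/
def bulkInt (F : Space → ℝ) : ℝ := limUnder atTop (ballInt F)

/-- The integrand `F^{ij} δg_{ij} + F_{ij} δπ^{ij}`. -/
def gradPairing (Fg Fp : Space → Mat) (c : ℝ → Fields) (x : Space) : ℝ :=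
  ∑ i, ∑ j, (Fg x i j * varG c x i j + Fp x i j * varP c x i j)

/-- The functional `F` is differentiable at `z` with functional derivatives `δF/δg_{ij} = Fg^{ij}`
and `δF/δπ^{ij} = Fp_{ij}`: along every variation `δF` is the bulk integral of
`Fg^{ij} δg_{ij} + Fp_{ij} δπ^{ij}`, without boundary term. -/
def HasFunctionalDerivs (ε : ℝ) (F : Fields → ℝ) (z : Fields) (Fg Fp : Space → Mat) : Prop :=
  (∀ i j, Continuous (fun x => Fg x i j)) ∧ (∀ i j, Continuous (fun x => Fp x i j)) ∧
  (∀ x, (Fg x).IsSymm) ∧ (∀ x, (Fp x).IsSymm) ∧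
  ∀ c : ℝ → Fields, IsVariation ε c → c 0 = z →
    ∃ d : ℝ, Tendsto (ballInt (gradPairing Fg Fp c)) atTop (𝓝 d) ∧
      HasDerivAt (fun s => F (c s)) d 0

/-- The Poisson bracket `{F, F'}` exists at `z` and has the value `v`:
`v = lim_{R → ∞} ∫_{𝒮_R} (δF/δg_{ij} δF'/δπ^{ij} - δF/δπ^{ij} δF'/δg_{ij})`. -/
def HasPoissonBracket (ε : ℝ) (F F' : Fields → ℝ) (z : Fields) (v : ℝ) : Prop :=
  ∃ Fg Fp Fg' Fp' : Space → Mat,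
    HasFunctionalDerivs ε F z Fg Fp ∧ HasFunctionalDerivs ε F' z Fg' Fp' ∧
    Tendsto (ballInt (fun x => ∑ i, ∑ j, (Fg x i j * Fp' x i j - Fp x i j * Fg' x i j)))
      atTop (𝓝 v)

/-! ### Smearing fields -/

/-- Smearing fields `(ξ, ξ^i)` and their boundary data `f, W, Y^A, I^A` on the sphere; the
tangent fields `Y` and `I` are given by their values in `ℝ³`. -/
structure Smearing where
  ξ : Space → ℝ
  ξv : Space → Fin 3 → ℝ
  f : Space → ℝ
  W : Space → ℝ
  Y : Space → Fin 3 → ℝ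
  I : Space → Fin 3 → ℝ

/-- `ξ = f + O(r⁻¹)`, `ξ^r = W + O(r⁻¹)`, `ξ^A = Y^A + I^A / r + O(r⁻²)` with `Y` a Killing field
of the unit sphere. In Cartesian components the angular vector with components `ξ^A` is
`r Y + I + O(r⁻¹)`. -/
structure Smearing.IsAdmissible (χ : Smearing) : Prop where
  smooth_ξ : ContDiff ℝ ∞ χ.ξ
  smooth_ξv : ∀ i, ContDiff ℝ ∞ (fun x => χ.ξv x i)
  f_sphere : IsSphereFun χ.f
  W_sphere : IsSphereFun χ.W
  Y_sphere : ∀ i, IsSphereFun (fun x => χ.Y x i)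
  I_sphere : ∀ i, IsSphereFun (fun x => χ.I x i)
  Y_tangent : ∀ x, x ≠ 0 → radialVec x ⬝ᵥ χ.Y x = 0
  I_tangent : ∀ x, x ≠ 0 → radialVec x ⬝ᵥ χ.I x = 0
  /-- `D̄_A Y_B + D̄_B Y_A = 0`; the covariant derivative of the sphere is the tangential part of
  the Euclidean one -/
  Y_killing : ∀ x : Space, ‖x‖ = 1 → ∀ u v : Fin 3 → ℝ,
    radialVec x ⬝ᵥ u = 0 → radialVec x ⬝ᵥ v = 0 →
    ∑ i, ∑ j, u i * v j * (pd i (fun y => χ.Y y j) x + pd j (fun y => χ.Y y i) x) = 0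
  falloff_ξ : IsBigSymbol (-1) (fun x => χ.ξ x - χ.f x)
  falloff_ξv : ∀ i, IsBigSymbol (-1)
    (fun x => χ.ξv x i - (‖x‖ * χ.Y x i + χ.W x * radialVec x i + χ.I x i))

/-- `ξ̃ = ξ N`. -/
def tildeξ (χ : Smearing) (g p : Space → Mat) (x : Space) : ℝ := χ.ξ x * lapse g p x

/-- `ξ̃^i = ξ N^i`. -/
def tildeξv (χ : Smearing) (g p : Space → Mat) (x : Space) (i : Fin 3) : ℝ :=
  χ.ξ x * shift g p x i

/-! ### Bulk charge -/

/-- The integrand `ξ H_phys + ξ^i C_i`. -/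
def chargeDensity (χ : Smearing) (z : Fields) (x : Space) : ℝ :=
  χ.ξ x * hamDensity z.g z.p x + ∑ i, χ.ξv x i * constraintV z.g z.p x i

/-- `J(ξ, ξ⃗) = 𝒯(ξ) + 𝒫(ξ⃗)`. -/
def bulkCharge (χ : Smearing) (z : Fields) : ℝ := bulkInt (chargeDensity χ z)

/-- `𝒢_{ij}`, the coefficient of `δπ^{ij}` in the bulk part of `δJ`. -/
def bulkG (χ : Smearing) (g p : Space → Mat) (x : Space) : Mat :=
  (2 * tildeξ χ g p x / sqrtDet g x) • (g x * p x * g x - (1 / 2 * trMom g p x) • g x)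
    + lieMetric χ.ξv g x + lieMetric (tildeξv χ g p) g x

/-- `ℱ^{ij}`, minus the coefficient of `δg_{ij}` in the bulk part of `δJ`. -/
def bulkF (χ : Smearing) (g p : Space → Mat) (x : Space) : Mat :=
  -((tildeξ χ g p x * sqrtDet g x) • (ricciUp g x - (1 / 2 * scalarCurv g x) • (g x)⁻¹))
    + (1 / 2 * tildeξ χ g p x / sqrtDet g x * (sqMom g p x - (1 / 2) * trMom g p x ^ 2))
        • (g x)⁻¹
    - (2 * tildeξ χ g p x / sqrtDet g x) • (p x * g x * p x - (1 / 2 * trMom g p x) • p x)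
    + sqrtDet g x • (hessUp g (tildeξ χ g p) x - laplace g (tildeξ χ g p) x • (g x)⁻¹)
    + lieMom χ.ξv p x + lieMom (tildeξv χ g p) p x
    - (1 / 2 * χ.ξ x * hamDensity g p x) • Matrix.vecMulVec (shift g p x) (shift g p x)

/-- The integrand of the boundary term of `δJ`, at a point `x` of the sphere of radius `‖x‖` with
unit normal `n`; here `u^i = ξ^i + ξ̃^i`:
`-2 u^i δπ_i^r + u^r π^{ij} δg_{ij}
  - √g g^{cd} g^{ef} (D_c ξ̃ n_d δg_{ef} - D_e ξ̃ n_c δg_{df})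
  - √g g^{cd} ξ̃ (- n_c δΓ^e_{ed} + n_e δΓ^e_{cd})`. -/
def boundaryDensity (χ : Smearing) (c : ℝ → Fields) (x : Space) : ℝ :=
  let g := (c 0).g
  let p := (c 0).p
  let n := radialVec x
  let gi := (g x)⁻¹
  let u : Fin 3 → ℝ := fun i => χ.ξv x i + tildeξv χ g p x i
  ∑ i, -2 * (u i * varMixed c i x)
    + (∑ k, u k * n k) * (∑ i, ∑ j, p x i j * varG c x i j)
    - sqrtDet g x * ∑ a, ∑ b, ∑ e, ∑ l, gi a b * gi e l *
        (pd a (tildeξ χ g p) x * n b * varG c x e l - pd e (tildeξ χ g p) x * n a * varG c x b l)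
    - sqrtDet g x * tildeξ χ g p x * ∑ a, ∑ b, ∑ e, gi a b *
        (n e * varGamma c e a b x - n a * varGamma c e e b x)

/-- The boundary term of `δJ` on the sphere of radius `R`; its limit is `𝒦(ξ, ξ⃗)`. -/
def boundaryTerm (χ : Smearing) (c : ℝ → Fields) (R : ℝ) : ℝ :=
  R ^ 2 * sphereInt (fun n => boundaryDensity χ c (R • n))

/-! ### Boundary charges -/

/-- `λ̄ = h̄_{rr} / 2`. -/
def lamBar (z : Fields) (x : Space) : ℝ := (1 / 2) * compRR z.hBar x

/-- `λ̄_A = h̄_{rA}`. -/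
def lamVec (z : Fields) (x : Space) : Fin 3 → ℝ := compRT z.hBar x

/-- `k̃_{AB} = h̄_{AB} / 2 + λ̄ γ̄_{AB}`. -/
def kTilde (z : Fields) (x : Space) : Mat :=
  (1 / 2 : ℝ) • compTT z.hBar x + lamBar z x • tangProj x

/-- `p̄ = 2 (π̄^{rr} - π̄^A_A)`. -/
def pScalar (z : Fields) (x : Space) : ℝ := 2 * (compRR z.pBar x - traceTT z.pBar x)

/-- Integrand of `ℬ(Y)`:
`Y^A (4 (k̃_{AB} - λ̄ γ̄_{AB}) π̄^{rB} + 2 γ̄_{AB} π^{(2)rB} + λ̄_A (p̄ + 2 π̄^B_B))`. -/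
def densY (χ : Smearing) (z : Fields) (x : Space) : ℝ :=
  χ.Y x ⬝ᵥ ((4 : ℝ) • ((kTilde z x - lamBar z x • tangProj x) *ᵥ compRT z.pBar x)
    + (2 : ℝ) • compRT z.p2 x + (pScalar z x + 2 * traceTT z.pBar x) • lamVec z x)

/-- Integrand of `ℬ(I)`: `2 I^A γ̄_{AB} π̄^{rB}`. -/
def densI (χ : Smearing) (z : Fields) (x : Space) : ℝ := 2 * (χ.I x ⬝ᵥ compRT z.pBar x)

/-- Integrand of `ℬ(W)`: `W (p̄ + 2 π̄^A_A)`. -/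
def densW (χ : Smearing) (z : Fields) (x : Space) : ℝ :=
  χ.W x * (pScalar z x + 2 * traceTT z.pBar x)

/-- Integrand of `ℬ(f)`: `± 2 √γ̄ f (2 λ̄ + D̄_A λ̄^A)`. -/
def densf (ε : ℝ) (χ : Smearing) (z : Fields) (x : Space) : ℝ :=
  ε * (2 * χ.f x * (2 * lamBar z x + sphereDiv (lamVec z) x))

/-- The boundary charge `ℬ(ξ, ξ⃗) = ℬ(f) + ℬ(W) + ℬ(Y) + ℬ(I)`. -/
def boundaryCharge (ε : ℝ) (χ : Smearing) (z : Fields) : ℝ :=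
  sphereInt (densf ε χ z) + sphereInt (densW χ z) + sphereInt (densY χ z)
    + sphereInt (densI χ z)

/-- `G(ξ, ξ⃗) = J(ξ, ξ⃗) + ℬ(ξ, ξ⃗)`. -/
def totalCharge (ε : ℝ) (χ : Smearing) (z : Fields) : ℝ :=
  bulkCharge χ z + boundaryCharge ε χ z

/-- The bulk physical Hamiltonian. -/
def physHam (z : Fields) : ℝ := bulkInt (hamDensity z.g z.p)

/-- The boundary Hamiltonian `± 4 ∮ √γ̄ λ̄`. -/
def bdyHam (ε : ℝ) (z : Fields) : ℝ := ε * (4 * sphereInt (lamBar z))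

end DustCharge

end

/-! The proof has a pointwise half, which is algebra, and an asymptotic half, which evaluates
surface integrals at infinity.

Pointwise half. Since H² = C² − g^{ij}C_iC_j, the variation of H is N δC + N^j δC_j + ½ H N^iN^j
δg_ij (`Geom.deriv_H`). Hence the variation of ξH + ξ^iC_i is the classical first variation of the
constraints with lapse ξN and shift ξ^i + ξN^i, plus an undifferentiated term: a pairing with 𝒢 and
−ℱ plus a divergence (`Geom.deriv_density`). This is a polynomial identity in derivatives of the
fields, so it is proved in any commutative algebra with three commuting derivations and a further
derivation δ commuting with them. It is applied to smooth functions of (s, x), with δ = ∂_s. The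
divergence theorem on balls then gives the formula with 𝒦_R for each R.

Decay. The boundary conditions force C = c r⁻⁴ log r + O(r⁻⁴), with c nowhere zero on the sphere,
and C_j = O(r^{-9/2}). Thus C_j/C = O(r^{-1/2}), so that N = ε + O(r⁻¹), N^i = O(r^{-1/2}) and H =
O(r^{-7/2}) (`near_lapse`, `shift_mem`, `ham_mem`). The charge density and its s-derivative are
O(r^{-7/2}), so J converges and may be differentiated under the integral. All these estimates are
made in the symbol classes `Sy`, where each derivative gains a power of r; half-integer orders
absorb logarithms.

Surface term. The radial flux is A/r + B log r/r² + D/r² + O(r^{-5/2}) (`flux_expansion`). The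
coefficient A contracts Y with the variation of π̄. It integrates to zero because rY is a rotation
of ℝ³ (`exists_rotation`) and r⁻²π̄ is divergence free, which is the vanishing of the leading
coefficient of C_j (`sphO_rotFlux`). The coefficient B pairs the odd field Y with the even
π^{(log)rA}, so it integrates to zero as well. The integral of D is −δℬ, after an integration by
parts on the sphere that takes the derivative off f (`sphO_metricFlux`). Convergence of the bulk
integral follows by subtraction.

Bracket. On 𝒫 the functional H_phys + H_bdy is the charge G(1, 0), so its functional derivatives are
known. The integrand of the bracket is a pure divergence (`Geom.bracket_identity`): the lapse-lapse,
shift-shift and mixed terms produce divergences and multiples of the constraints, and the latter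
cancel because N² − g_ijN^iN^j = 1. At infinity the only term of order r⁻² is −ε times the radial
component of ∂_iq_ik − ∂_kq_ii, where q is the leading part of L_u g. Its rotational part is a
derivative along the divergence-free field Y, its gauge part is the divergence of a tangential
field, and both integrate to zero (`sphO_bracketLead`). -/

noncomputable section

namespace DustCharge

/-! ### Christoffel symbols and the Palatini identity in a differential algebra -/

section

/-- A Riemannian metric in coordinates, over an abstract differential algebra: three commuting
derivations, the metric, its inverse, and the square root of its determinant. -/
structure Geom (A : Type*) [CommRing A] [Algebra ℝ A] where
  D : Fin 3 → Derivation ℝ A A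
  comm : ∀ i j a, D i (D j a) = D j (D i a)
  g : Fin 3 → Fin 3 → A
  gi : Fin 3 → Fin 3 → A
  s : A
  si : A
  g_symm : ∀ i j, g i j = g j i
  gi_symm : ∀ i j, gi i j = gi j i
  gi_g : ∀ i j, ∑ k, gi i k * g k j = if i = j then 1 else 0
  s_si : s * si = 1
  D_s : ∀ k, 2 * D k s = s * ∑ i, ∑ j, gi i j * D k (g i j)

namespace Geom

variable {A : Type*} [CommRing A] [Algebra ℝ A] (G : Geom A)

/-- The constant `1/2`. -/
def half (A : Type*) [CommRing A] [Algebra ℝ A] : A := algebraMap ℝ A (1 / 2)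

theorem two_mul_half : (2 : A) * half A = 1 := by
  have : (2 : A) = algebraMap ℝ A 2 := (map_ofNat (algebraMap ℝ A) 2).symm
  rw [this, half, ← map_mul]; norm_num

theorem two_cancel {a b : A} (h : 2 * a = 2 * b) : a = b := by
  linear_combination (half A) * h - (a - b) * two_mul_half (A := A)

@[simp] theorem deriv_half (δ : Derivation ℝ A A) : δ (half A) = 0 := δ.map_algebraMap _

@[simp] theorem deriv_two (δ : Derivation ℝ A A) : δ (2 : A) = 0 := by
  rw [← map_ofNat (algebraMap ℝ A) 2]; exact δ.map_algebraMap _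

theorem g_gi (i j : Fin 3) : ∑ k, G.g i k * G.gi k j = if i = j then 1 else 0 := by
  rw [← show (∑ k, G.gi j k * G.g k i) = ∑ k, G.g i k * G.gi k j from
    Finset.sum_congr rfl fun k _ => by rw [G.gi_symm j k, G.g_symm k i]; ring, G.gi_g]
  simp [eq_comm]

theorem g_gi_sum (c : Fin 3 → A) (m : Fin 3) :
    ∑ l, G.g m l * ∑ n, G.gi l n * c n = c m := by
  simp_rw [Finset.mul_sum, ← mul_assoc]
  rw [Finset.sum_comm]
  simp_rw [← Finset.sum_mul, G.g_gi]; simp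

theorem gi_g_sum (c : Fin 3 → A) (m : Fin 3) :
    ∑ l, G.gi m l * ∑ n, G.g l n * c n = c m := by
  simp_rw [Finset.mul_sum, ← mul_assoc]
  rw [Finset.sum_comm]
  simp_rw [← Finset.sum_mul, G.gi_g]; simp

/-- Christoffel symbols `Γ^k_{ij}`. -/
def Γ (k i j : Fin 3) : A :=
  half A * ∑ l, G.gi k l * (G.D i (G.g j l) + G.D j (G.g i l) - G.D l (G.g i j))

theorem Γ_symm (k i j : Fin 3) : G.Γ k i j = G.Γ k j i := by
  unfold Γ; congr 1; refine Finset.sum_congr rfl fun l _ => ?_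
  rw [G.g_symm i j]; ring

/-- Doubling and lowering the first index removes both `half` and the inverse metric. This is
therefore the form in which the Christoffel symbols are differentiated. -/
theorem low (m i j : Fin 3) :
    2 * ∑ l, G.g m l * G.Γ l i j
      = G.D i (G.g j m) + G.D j (G.g i m) - G.D m (G.g i j) := by
  rw [← G.g_gi_sum (fun m => G.D i (G.g j m) + G.D j (G.g i m) - G.D m (G.g i j)) m,
    Finset.mul_sum]
  refine Finset.sum_congr rfl fun l _ => ?_
  unfold Γ
  linear_combination (G.g m l * ∑ n, G.gi l n *
    (G.D i (G.g j n) + G.D j (G.g i n) - G.D n (G.g i j))) * two_mul_half (A := A)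

/-- Metric compatibility. Together with `D_gi` and `D_s_eq` it trades every first derivative of the
metric data for Christoffel symbols, after which covariant identities become polynomial ones. -/
theorem D_g (k i j : Fin 3) :
    G.D k (G.g i j) = ∑ l, (G.g l j * G.Γ l k i + G.g i l * G.Γ l k j) := by
  apply two_cancel
  have h1 := G.low j k i
  have h2 := G.low i k j
  rw [Finset.sum_add_distrib, mul_add, h2,
    Finset.sum_congr rfl fun l _ => by rw [G.g_symm l j], h1, G.g_symm j i, G.g_symm k j,
    G.g_symm k i]
  ring

/-- Differentiate `gi g = 1` and solve. The derivation is arbitrary because the formula serves both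
the coordinate derivatives and the variation. -/
theorem deriv_gi (δ : Derivation ℝ A A) (i j : Fin 3) :
    δ (G.gi i j) = -∑ a, ∑ b, G.gi i a * δ (G.g a b) * G.gi b j := by
  have h (b : Fin 3) : ∑ a, δ (G.gi i a) * G.g a b = - ∑ a, G.gi i a * δ (G.g a b) := by
    have := congrArg δ (G.gi_g i b)
    rw [map_sum] at this
    simp only [Derivation.leibniz, smul_eq_mul, Finset.sum_add_distrib] at this
    have h0 : δ (if i = b then (1 : A) else 0) = 0 := by split_ifs <;> simp
    rw [h0] at this
    rw [eq_neg_iff_add_eq_zero, ← this, add_comm]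
    congr 1
    exact Finset.sum_congr rfl fun k _ => mul_comm _ _
  have h2 : δ (G.gi i j) = ∑ b, (∑ a, δ (G.gi i a) * G.g a b) * G.gi b j := by
    simp_rw [Finset.sum_mul, mul_assoc]
    rw [Finset.sum_comm]
    simp_rw [← Finset.mul_sum, G.g_gi]; simp
  rw [h2]
  simp_rw [h, neg_mul, Finset.sum_neg_distrib, Finset.sum_mul]
  rw [Finset.sum_comm]

theorem D_gi (k i j : Fin 3) :
    G.D k (G.gi i j) = -∑ l, (G.Γ i k l * G.gi l j + G.Γ j k l * G.gi i l) := by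
  rw [G.deriv_gi]
  simp_rw [G.D_g]
  congr 1
  have e1 := G.gi_g_sum (fun b => ∑ c, G.Γ b k c * G.gi c j) i
  have h1 : ∑ a, ∑ b, G.gi i a * (∑ l, G.g a l * G.Γ l k b) * G.gi b j
      = ∑ l, G.Γ i k l * G.gi l j := by
    rw [← G.gi_g_sum (fun b => ∑ c, G.Γ b k c * G.gi c j) i]
    simp only [Fin.sum_univ_three]; ring
  have h2 : ∑ a, ∑ b, G.gi i a * (∑ l, G.g l b * G.Γ l k a) * G.gi b j
      = ∑ l, G.Γ j k l * G.gi i l := by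
    have := G.gi_g_sum (fun b => ∑ c, G.Γ b k c * G.gi c i) j
    calc _ = ∑ c, G.Γ j k c * G.gi c i := by
          rw [← this]
          simp only [Fin.sum_univ_three, G.gi_symm i, G.gi_symm j, G.g_symm 1 0, G.g_symm 2 0,
            G.g_symm 2 1]
          ring
      _ = _ := Finset.sum_congr rfl fun c _ => by rw [G.gi_symm c i]
  rw [Finset.sum_add_distrib, ← h1, ← h2, add_comm, ← Finset.sum_add_distrib]
  refine Finset.sum_congr rfl fun a _ => ?_
  rw [← Finset.sum_add_distrib]
  refine Finset.sum_congr rfl fun b _ => ?_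
  rw [Finset.sum_add_distrib]; ring

theorem D_s_eq (k : Fin 3) : G.D k G.s = G.s * ∑ l, G.Γ l k l := by
  apply two_cancel
  rw [G.D_s]
  have h (m : Fin 3) := G.gi_g_sum (fun b => G.Γ b k m) m
  have : ∑ i, ∑ j, G.gi i j * G.D k (G.g i j) = 2 * ∑ l, G.Γ l k l := by
    rw [← Finset.sum_congr rfl fun m _ => h m]
    simp_rw [G.D_g]
    simp only [Fin.sum_univ_three, G.gi_symm 1 0, G.gi_symm 2 0, G.gi_symm 2 1, G.g_symm 1 0,
      G.g_symm 2 0, G.g_symm 2 1]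
    ring
  rw [this]; ring

/-- The linearized Christoffel symbols for the metric variation `q`. -/
def dΓ (q : Fin 3 → Fin 3 → A) (k i j : Fin 3) : A :=
  ∑ m, G.gi k m * (half A * (G.D i (q j m) + G.D j (q i m) - G.D m (q i j))
    - ∑ b, q m b * G.Γ b i j)

/-- The linearization of `low` determines the linearized symbols. Both the variation of Γ and its
Lie derivative are identified by checking this relation, which contains no inverse metric. -/
theorem dΓ_unique {q : Fin 3 → Fin 3 → A} {i j : Fin 3} {X : Fin 3 → A}
    (h : ∀ m, 2 * ∑ l, G.g m l * X l = G.D i (q j m) + G.D j (q i m) - G.D m (q i j)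
      - 2 * ∑ b, q m b * G.Γ b i j) (k : Fin 3) : X k = G.dΓ q k i j := by
  rw [← G.gi_g_sum X k]
  unfold dΓ
  refine Finset.sum_congr rfl fun m _ => ?_
  congr 1
  apply two_cancel
  rw [h]
  linear_combination (-(G.D i (q j m) + G.D j (q i m) - G.D m (q i j))) * two_mul_half (A := A)

theorem deriv_Γ (δ : Derivation ℝ A A) (hδ : ∀ i a, δ (G.D i a) = G.D i (δ a))
    (k i j : Fin 3) : δ (G.Γ k i j) = G.dΓ (fun i j => δ (G.g i j)) k i j := by
  refine G.dΓ_unique (X := fun k => δ (G.Γ k i j)) (fun m => ?_) k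
  have := congrArg δ (G.low m i j)
  simp only [Derivation.leibniz, map_sum, map_sub, map_add, smul_eq_mul, deriv_two, hδ] at this
  rw [← this, Finset.sum_add_distrib, Finset.sum_congr rfl fun b _ => mul_comm (δ (G.g m b)) _]
  ring

/-- The linearized Ricci tensor for the variation `X` of the Christoffel symbols. -/
def dRic (X : Fin 3 → Fin 3 → Fin 3 → A) (i j : Fin 3) : A :=
  ∑ k, G.D k (X k i j) - ∑ k, G.D j (X k i k)
    + ∑ k, ∑ l, (X k k l * G.Γ l i j + G.Γ k k l * X l i j
        - (X k j l * G.Γ l i k + G.Γ k j l * X l i k))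

/-- The vector `g^{ij} X^k_{ij} - g^{kj} X^i_{ij}`. -/
def palatini (X : Fin 3 → Fin 3 → Fin 3 → A) (k : Fin 3) : A :=
  ∑ i, ∑ j, (G.gi i j * X k i j - G.gi k j * X i i j)

/-- The terms of the linearized Ricci tensor that are quadratic in Γ and X are exactly what metric
compatibility of `gi` and `s` produces when the coordinate divergence on the right is expanded. -/
theorem palatini_identity (X : Fin 3 → Fin 3 → Fin 3 → A) (hX : ∀ k i j, X k i j = X k j i) :
    G.s * ∑ i, ∑ j, G.gi i j * G.dRic X i j = ∑ k, G.D k (G.s * G.palatini X k) := by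
  unfold dRic palatini
  simp only [Derivation.leibniz, map_sum, map_sub, smul_eq_mul, G.D_gi, G.D_s_eq]
  simp only [Fin.sum_univ_three, G.gi_symm 1 0, G.gi_symm 2 0, G.gi_symm 2 1,
    G.Γ_symm _ 1 0, G.Γ_symm _ 2 0, G.Γ_symm _ 2 1, hX _ 1 0, hX _ 2 0, hX _ 2 1]
  ring

end Geom

end

/-! ### Curvature, and integration by parts against the linearized Christoffel symbols -/

section

namespace Geom

variable {A : Type*} [CommRing A] [Algebra ℝ A] (G : Geom A)

/-- The Ricci tensor. -/
def ric (i j : Fin 3) : A :=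
  ∑ k, G.D k (G.Γ k i j) - ∑ k, G.D j (G.Γ k i k)
    + ∑ k, ∑ l, (G.Γ k k l * G.Γ l i j - G.Γ k j l * G.Γ l i k)

/-- The one derivative term that is not visibly symmetric is ∂_jΓ^k_{ik}; since Γ^k_{ik} = ∂_i s / s
is a logarithmic gradient, it is symmetric too. -/
theorem ric_symm (i j : Fin 3) : G.ric i j = G.ric j i := by
  have h1 : ∑ k, G.D j (G.Γ k i k) = ∑ k, G.D i (G.Γ k j k) := by
    have e (m : Fin 3) : ∑ k, G.Γ k m k = G.si * G.D m G.s := by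
      rw [G.D_s_eq, ← mul_assoc, mul_comm G.si, G.s_si, one_mul]
    have e' (m n : Fin 3) : G.D m G.si * G.D n G.s = G.D n G.si * G.D m G.s := by
      have h (m : Fin 3) : G.D m G.si = - G.si * G.si * G.D m G.s := by
        have := congrArg (G.D m) G.s_si
        simp only [Derivation.leibniz, smul_eq_mul, Derivation.map_one_eq_zero] at this
        linear_combination G.si * this - G.D m G.si * G.s_si
      rw [h, h]; ring
    rw [← map_sum, ← map_sum, e, e]
    simp only [Derivation.leibniz, smul_eq_mul]
    rw [G.comm j i, mul_comm (G.D i G.s), mul_comm (G.D j G.s), e']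
  have h2 : ∑ k, ∑ l, G.Γ k j l * G.Γ l i k = ∑ k, ∑ l, G.Γ k i l * G.Γ l j k := by
    rw [Finset.sum_comm]
    exact Finset.sum_congr rfl fun k _ => Finset.sum_congr rfl fun l _ => mul_comm _ _
  have h3 (k : Fin 3) : G.Γ k i j = G.Γ k j i := G.Γ_symm k i j
  unfold ric
  simp_rw [Finset.sum_sub_distrib]
  rw [h1, h2]
  simp_rw [h3]

/-- The scalar curvature. -/
def R : A := ∑ i, ∑ j, G.gi i j * G.ric i j

/-- The covariant Hessian. -/
def hess (α : A) (i j : Fin 3) : A := G.D i (G.D j α) - ∑ m, G.Γ m i j * G.D m α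

/-- Raise both indices. -/
def up (T : Fin 3 → Fin 3 → A) (i j : Fin 3) : A := ∑ a, ∑ b, G.gi i a * T a b * G.gi b j

/-- The trace with the inverse metric. -/
def tr (T : Fin 3 → Fin 3 → A) : A := ∑ i, ∑ j, G.gi i j * T i j

/-- The vector density `√g (q^{kc} ∂_c α - g^{kc} ∂_c α g^{ab} q_{ab})`. -/
def gradFlux (α : A) (q : Fin 3 → Fin 3 → A) (k : Fin 3) : A :=
  G.s * (∑ c, G.up q k c * G.D c α - (∑ c, G.gi k c * G.D c α) * G.tr q)

/-- In the contracted trace δΓ^i_{ij} the combination ∂_iq_jm − ∂_mq_ij is antisymmetric in the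
contracted pair and drops out; what is left combines with the other trace into an expression free of
`half`. -/
theorem palatini_dΓ (q : Fin 3 → Fin 3 → A) (hq : ∀ i j, q i j = q j i) (k : Fin 3) :
    G.palatini (G.dΓ q) k = ∑ m, ∑ i, ∑ j, G.gi k m * G.gi i j *
        (G.D i (q j m) - G.D m (q i j) - ∑ b, q m b * G.Γ b i j)
      + ∑ i, ∑ j, ∑ m, ∑ b, G.gi k j * G.gi i m * q m b * G.Γ b i j := by
  have h := two_mul_half (A := A)
  have h1 (j : Fin 3) : ∑ i, ∑ m, G.gi i m * (half A *
      (G.D i (q j m) + G.D j (q i m) - G.D m (q i j)))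
      = half A * ∑ i, ∑ m, G.gi i m * G.D j (q i m) := by
    have : ∑ i, ∑ m, G.gi i m * G.D i (q j m) = ∑ i, ∑ m, G.gi i m * G.D m (q i j) := by
      rw [Finset.sum_comm]
      exact Finset.sum_congr rfl fun i _ => Finset.sum_congr rfl fun m _ => by
        rw [G.gi_symm, hq]
    rw [← sub_eq_zero, ← Finset.sum_sub_distrib] at this
    have e : ∑ i, ∑ m, G.gi i m * (half A *
      (G.D i (q j m) + G.D j (q i m) - G.D m (q i j))) =
      half A * ∑ i, ∑ m, G.gi i m * G.D j (q i m) +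
      half A * (∑ i, (∑ m, G.gi i m * G.D i (q j m) - ∑ m, G.gi i m * G.D m (q i j))) := by
      simp only [Fin.sum_univ_three]; ring
    rw [e, this]; ring
  have h2 : ∑ i, ∑ j, G.gi k j * G.dΓ q i i j = half A * ∑ j, ∑ i, ∑ m,
      G.gi k j * G.gi i m * G.D j (q i m) - ∑ i, ∑ j, ∑ m, ∑ b,
        G.gi k j * G.gi i m * q m b * G.Γ b i j := by
    rw [Finset.sum_comm]
    unfold dΓ
    have : ∀ j, ∑ i, G.gi k j * ∑ m, G.gi i m * (half A *
        (G.D i (q j m) + G.D j (q i m) - G.D m (q i j)) - ∑ b, q m b * G.Γ b i j)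
        = G.gi k j * (half A * ∑ i, ∑ m, G.gi i m * G.D j (q i m))
          - ∑ i, ∑ m, ∑ b, G.gi k j * G.gi i m * q m b * G.Γ b i j := by
      intro j; rw [← h1]; simp only [Fin.sum_univ_three]; ring
    simp_rw [this, Finset.sum_sub_distrib]
    congr 1
    · simp only [Finset.mul_sum]
      refine Finset.sum_congr rfl fun i _ => Finset.sum_congr rfl fun m _ =>
        Finset.sum_congr rfl fun m _ => by ring
    · rw [Finset.sum_comm]
  unfold palatini
  simp_rw [Finset.sum_sub_distrib]
  rw [h2, sub_sub_eq_add_sub, add_comm, add_sub_assoc, add_comm]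
  congr 1
  rw [sub_eq_iff_eq_add]
  unfold dΓ
  have h3 : ∑ i, ∑ j, G.gi i j * ∑ m, G.gi k m * (half A *
        (G.D i (q j m) + G.D j (q i m) - G.D m (q i j)) - ∑ b, q m b * G.Γ b i j)
      = ∑ m, ∑ i, ∑ j, G.gi k m * G.gi i j * (2 * half A * G.D i (q j m)
        - half A * G.D m (q i j) - ∑ b, q m b * G.Γ b i j) := by
    simp only [Fin.sum_univ_three, G.gi_symm 1 0, G.gi_symm 2 0, G.gi_symm 2 1]
    ring
  rw [h3, h, Finset.mul_sum, ← Finset.sum_add_distrib]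
  refine Finset.sum_congr rfl fun m _ => ?_
  simp_rw [Finset.mul_sum, ← Finset.sum_add_distrib]
  refine Finset.sum_congr rfl fun i _ => Finset.sum_congr rfl fun j _ => ?_
  linear_combination (- G.gi k m * G.gi i j * G.D m (q i j)) * h

/-- The Leibniz rule moves the remaining derivative of q onto ∂α, which creates the Hessian of α;
the total derivative is collected in `gradFlux`. -/
theorem palatini_by_parts (α : A) (q : Fin 3 → Fin 3 → A) (hq : ∀ i j, q i j = q j i) :
    G.s * ∑ k, G.D k α * G.palatini (G.dΓ q) k
      = ∑ k, G.D k (G.gradFlux α q k)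
        - G.s * ∑ i, ∑ j, (G.up (G.hess α) i j - G.tr (G.hess α) * G.gi i j) * q i j := by
  set v : Fin 3 → A := fun k => ∑ b, G.gi k b * G.D b α with hv
  have hDv (i k : Fin 3) : G.D i (v k) = ∑ b, G.gi k b * G.hess α i b - ∑ l, G.Γ k i l * v l := by
    simp only [hv, map_sum, Derivation.leibniz, smul_eq_mul, G.D_gi, hess]
    simp only [Fin.sum_univ_three, G.gi_symm 1 0, G.gi_symm 2 0, G.gi_symm 2 1]
    ring
  have hY (k : Fin 3) : G.gradFlux α q k
      = G.s * (∑ a, ∑ b, G.gi k a * q a b * v b - v k * G.tr q) := by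
    simp only [gradFlux, up, hv]
    simp only [Fin.sum_univ_three]; ring
  have hT : ∑ k, G.D k α * G.palatini (G.dΓ q) k = ∑ m, ∑ i, ∑ j, v m * G.gi i j *
        (G.D i (q j m) - G.D m (q i j) - ∑ b, q m b * G.Γ b i j)
      + ∑ i, ∑ j, ∑ m, ∑ b, v j * G.gi i m * q m b * G.Γ b i j := by
    simp_rw [G.palatini_dΓ q hq]
    simp only [hv, Fin.sum_univ_three, G.gi_symm 1 0, G.gi_symm 2 0, G.gi_symm 2 1]
    ring
  have hU : ∑ i, ∑ j, G.up (G.hess α) i j * q i j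
      = ∑ i, ∑ a, ∑ b, ∑ c, G.gi i a * q a b * G.gi b c * G.hess α i c := by
    simp only [up, Fin.sum_univ_three, G.gi_symm 1 0, G.gi_symm 2 0, G.gi_symm 2 1, hq 1 0, hq 2 0,
      hq 2 1]
    ring
  have hW : ∑ i, ∑ j, (G.up (G.hess α) i j - G.tr (G.hess α) * G.gi i j) * q i j
      = ∑ i, ∑ a, ∑ b, ∑ c, G.gi i a * q a b * G.gi b c * G.hess α i c
        - G.tr (G.hess α) * G.tr q := by
    rw [← hU]; simp only [tr, Finset.mul_sum, ← Finset.sum_sub_distrib]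
    exact Finset.sum_congr rfl fun i _ => Finset.sum_congr rfl fun j _ => by ring
  rw [hT, hW]
  simp_rw [hY]
  -- From here on the raised gradient v enters only through its derivative `hDv`.
  clear_value v
  simp only [Derivation.leibniz, map_sum, map_sub, smul_eq_mul, G.D_gi, G.D_s_eq, hDv, tr]
  simp only [Fin.sum_univ_three, G.gi_symm 1 0, G.gi_symm 2 0, G.gi_symm 2 1, hq 1 0, hq 2 0,
      hq 2 1, G.Γ_symm _ 1 0, G.Γ_symm _ 2 0, G.Γ_symm _ 2 1]
  ring

end Geom

end

/-! ### First variations of the constraints and of the Hamiltonian density -/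

section

namespace Geom

variable {A : Type*} [CommRing A] [Algebra ℝ A] (G : Geom A)

theorem deriv_s (δ : Derivation ℝ A A) (h : 2 * δ G.s = G.s * G.tr fun i j => δ (G.g i j)) :
    δ G.si = -(half A * G.si * G.tr fun i j => δ (G.g i j)) := by
  have := congrArg δ G.s_si
  simp only [Derivation.leibniz, smul_eq_mul, Derivation.map_one_eq_zero] at this
  apply two_cancel
  have h2 := two_mul_half (A := A)
  have h3 := G.s_si
  linear_combination 2 * G.si * this - G.si * G.si * h - 2 * δ G.si * h3
    + G.si * (G.tr fun i j => δ (G.g i j)) * (h2 - h3)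

theorem deriv_ric (δ : Derivation ℝ A A) (hδ : ∀ i a, δ (G.D i a) = G.D i (δ a)) (i j : Fin 3) :
    δ (G.ric i j) = G.dRic (G.dΓ fun i j => δ (G.g i j)) i j := by
  unfold ric dRic
  simp only [Derivation.leibniz, map_sum, map_sub, map_add, smul_eq_mul, hδ, G.deriv_Γ δ hδ]
  congr 1
  exact Finset.sum_congr rfl fun k _ => Finset.sum_congr rfl fun l _ => by ring

/-- The linearized scalar curvature. -/
def dR (q : Fin 3 → Fin 3 → A) : A :=
  ∑ i, ∑ j, (G.gi i j * G.dRic (G.dΓ q) i j - G.up q i j * G.ric i j)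

theorem deriv_R (δ : Derivation ℝ A A) (hδ : ∀ i a, δ (G.D i a) = G.D i (δ a)) :
    δ G.R = G.dR fun i j => δ (G.g i j) := by
  unfold R dR up
  simp only [Derivation.leibniz, map_sum, smul_eq_mul, G.deriv_ric δ hδ, G.deriv_gi]
  refine Finset.sum_congr rfl fun i _ => Finset.sum_congr rfl fun j _ => by ring

variable (p : Fin 3 → Fin 3 → A)

/-- `π_i^j`. -/
def mix (i j : Fin 3) : A := ∑ k, G.g i k * p k j

/-- The trace of the momentum. -/
def trP : A := ∑ i, G.mix p i i

/-- `π_{mn} π^{mn} - π²/2`. -/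
def kin : A := ∑ i, ∑ j, G.mix p i j * G.mix p j i - half A * G.trP p ^ 2

/-- `π_{ij}`. -/
def pLow (i j : Fin 3) : A := ∑ a, ∑ b, G.g i a * p a b * G.g b j

/-- `π^{im} π_m^j`. -/
def pp (i j : Fin 3) : A := ∑ a, ∑ b, p i a * G.g a b * p b j

/-- The linearization of `kin`. -/
def dKin (q w : Fin 3 → Fin 3 → A) : A :=
  2 * ∑ i, ∑ j, ((G.pLow p i j - half A * G.trP p * G.g i j) * w i j
    + (G.pp p i j - half A * G.trP p * p i j) * q i j)

theorem deriv_kin (δ : Derivation ℝ A A) (hp : ∀ i j, p i j = p j i) :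
    δ (G.kin p) = G.dKin p (fun i j => δ (G.g i j)) (fun i j => δ (p i j)) := by
  have h : δ (G.kin p) = ∑ i, ∑ j, (2 * δ (G.mix p i j) * G.mix p j i) -
      2 * half A * G.trP p * ∑ i, δ (G.mix p i i) := by
    unfold kin
    simp only [Derivation.leibniz, Derivation.leibniz_pow, map_sum, map_sub, smul_eq_mul,
      deriv_half]
    have : ∑ i, ∑ j, (G.mix p i j * δ (G.mix p j i) + G.mix p j i * δ (G.mix p i j))
       = ∑ i, ∑ j, (2 * δ (G.mix p i j) * G.mix p j i) := by
      simp only [Fin.sum_univ_three]; ring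
    rw [this, trP, map_sum]; simp; ring
  have hm (i j : Fin 3) : δ (G.mix p i j) = ∑ k, (δ (G.g i k) * p k j + G.g i k * δ (p k j)) := by
    simp only [mix, map_sum, Derivation.leibniz, smul_eq_mul]
    exact Finset.sum_congr rfl fun k _ => by ring
  rw [h]
  simp only [hm]
  unfold dKin
  generalize G.trP p = t
  simp only [mix, pLow, pp]
  simp only [Fin.sum_univ_three, G.g_symm 1 0, G.g_symm 2 0, G.g_symm 2 1, hp 1 0, hp 2 0, hp 2 1]
  ring

/-- The Hamiltonian constraint. -/
def C : A := G.kin p * G.si - G.s * G.R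

/-- The linearized Hamiltonian constraint. -/
def dC (q w : Fin 3 → Fin 3 → A) : A :=
  G.dKin p q w * G.si - half A * G.kin p * G.si * G.tr q
    - half A * G.s * G.tr q * G.R - G.s * G.dR q

theorem deriv_C (δ : Derivation ℝ A A) (hδ : ∀ i a, δ (G.D i a) = G.D i (δ a))
    (h : 2 * δ G.s = G.s * G.tr fun i j => δ (G.g i j)) (hp : ∀ i j, p i j = p j i) :
    δ (G.C p) = G.dC p (fun i j => δ (G.g i j)) (fun i j => δ (p i j)) := by
  unfold C dC
  have h' : δ G.s = half A * (G.s * G.tr fun i j => δ (G.g i j)) := by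
    rw [← h]; linear_combination (-δ G.s) * two_mul_half (A := A)
  simp only [Derivation.leibniz, map_sub, smul_eq_mul, G.deriv_s δ h, G.deriv_R δ hδ,
    G.deriv_kin p δ hp, h']
  ring

/-- Coefficient of the momentum variation in `α δC`. -/
def GA (α : A) (i j : Fin 3) : A :=
  2 * α * G.si * (G.pLow p i j - half A * G.trP p * G.g i j)

/-- Minus the coefficient of the metric variation in `α δC`. -/
def FA (α : A) (i j : Fin 3) : A :=
  -(α * G.s * (G.up G.ric i j - half A * G.R * G.gi i j))
    + half A * α * G.si * G.kin p * G.gi i j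
    - 2 * α * G.si * (G.pp p i j - half A * G.trP p * p i j)
    + G.s * (G.up (G.hess α) i j - G.tr (G.hess α) * G.gi i j)

/-- The boundary flux in `α δC`. -/
def VA (α : A) (q : Fin 3 → Fin 3 → A) (k : Fin 3) : A :=
  G.gradFlux α q k - G.s * α * G.palatini (G.dΓ q) k

theorem dΓ_symm (q : Fin 3 → Fin 3 → A) (hq : ∀ i j, q i j = q j i) (k i j : Fin 3) :
    G.dΓ q k i j = G.dΓ q k j i := by
  unfold dΓ
  refine Finset.sum_congr rfl fun m _ => ?_
  rw [hq i j, Finset.sum_congr rfl fun b _ => by rw [G.Γ_symm b i j]]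
  ring

theorem up_mul (q T : Fin 3 → Fin 3 → A) :
    ∑ i, ∑ j, G.up q i j * T i j = ∑ i, ∑ j, G.up T i j * q i j := by
  unfold up
  simp only [Fin.sum_univ_three, G.gi_symm 1 0, G.gi_symm 2 0, G.gi_symm 2 1]
  ring

/-- The adjoint of the linearized constraint. The second derivatives of q form a divergence by
`palatini_identity`; one Leibniz rule and `palatini_by_parts` then carry both derivatives over to α,
and the two total divergences make up `VA`. -/
theorem mul_dC (α : A) (q w : Fin 3 → Fin 3 → A) (hq : ∀ i j, q i j = q j i) :
    α * G.dC p q w = ∑ i, ∑ j, (G.GA p α i j * w i j - G.FA p α i j * q i j)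
      + ∑ k, G.D k (G.VA α q k) := by
  have hV : ∑ k, G.D k (G.VA α q k) = ∑ k, G.D k (G.gradFlux α q k)
      - G.s * ∑ k, G.D k α * G.palatini (G.dΓ q) k
      - α * (G.s * ∑ i, ∑ j, G.gi i j * G.dRic (G.dΓ q) i j) := by
    rw [G.palatini_identity _ (G.dΓ_symm q hq)]
    simp only [VA, map_sub, Finset.sum_sub_distrib, Finset.mul_sum, Derivation.leibniz,
      smul_eq_mul, sub_sub]
    rw [← Finset.sum_add_distrib]
    congr 1
    exact Finset.sum_congr rfl fun k _ => by ring
  rw [hV, G.palatini_by_parts α q hq]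
  have hd : G.dR q = ∑ i, ∑ j, G.gi i j * G.dRic (G.dΓ q) i j
      - ∑ i, ∑ j, G.up G.ric i j * q i j := by
    rw [← G.up_mul]; simp only [dR, Finset.sum_sub_distrib]
  have h1 : ∑ i, ∑ j, (G.GA p α i j * w i j - G.FA p α i j * q i j)
      = α * G.si * G.dKin p q w + α * G.s * ∑ i, ∑ j, G.up G.ric i j * q i j
        - half A * α * (G.s * G.R + G.si * G.kin p) * G.tr q
        - G.s * ∑ i, ∑ j, (G.up (G.hess α) i j - G.tr (G.hess α) * G.gi i j) * q i j := by
    simp only [GA, FA, dKin, tr, Finset.mul_sum, ← Finset.sum_add_distrib,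
      ← Finset.sum_sub_distrib]
    exact Finset.sum_congr rfl fun i _ => Finset.sum_congr rfl fun j _ => by ring
  rw [h1, dC, hd]
  ring

/-- The vector constraint. -/
def Cv (j : Fin 3) : A :=
  -2 * ∑ k, G.g j k * (∑ i, G.D i (p i k) + ∑ i, ∑ l, G.Γ k i l * p i l)

/-- In this form neither Γ nor the inverse metric appears and the constraint is bilinear in metric
and momentum. Its variation and its expansion at infinity both start from here. -/
theorem Cv_eq (hp : ∀ i j, p i j = p j i) (j : Fin 3) :
    G.Cv p j = -2 * ∑ i, G.D i (∑ k, p i k * G.g k j) + ∑ a, ∑ b, p a b * G.D j (G.g a b) := by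
  have h : ∑ k, G.g j k * ∑ i, ∑ l, G.Γ k i l * p i l
      = half A * ∑ i, ∑ l, p i l * (G.D i (G.g l j) + G.D l (G.g i j) - G.D j (G.g i l)) := by
    have : ∀ i l, ∑ k, G.g j k * G.Γ k i l
      = half A * (G.D i (G.g l j) + G.D l (G.g i j) - G.D j (G.g i l)) := fun i l => by
        rw [← G.low]; linear_combination
          (-∑ k, G.g j k * G.Γ k i l) * two_mul_half (A := A)
    have e : ∑ k, G.g j k * ∑ i, ∑ l, G.Γ k i l * p i l
      = ∑ i, ∑ l, p i l * ∑ k, G.g j k * G.Γ k i l := by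
      simp only [Fin.sum_univ_three]; ring
    rw [e]; simp only [this, Finset.mul_sum]
    exact Finset.sum_congr rfl fun i _ => Finset.sum_congr rfl fun l _ => by ring
  unfold Cv
  simp only [mul_add, Finset.sum_add_distrib]
  rw [h]
  simp only [map_sum, Derivation.leibniz, smul_eq_mul]
  simp only [Fin.sum_univ_three, hp 1 0, hp 2 0, hp 2 1, G.g_symm j]
  linear_combination (-(p 0 0 * (2 * G.D 0 (G.g 0 j) - G.D j (G.g 0 0))
    + p 1 1 * (2 * G.D 1 (G.g 1 j) - G.D j (G.g 1 1))
    + p 2 2 * (2 * G.D 2 (G.g 2 j) - G.D j (G.g 2 2))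
    + p 0 1 * (2 * G.D 0 (G.g 1 j) + 2 * G.D 1 (G.g 0 j) - G.D j (G.g 0 1) - G.D j (G.g 1 0))
    + p 0 2 * (2 * G.D 0 (G.g 2 j) + 2 * G.D 2 (G.g 0 j) - G.D j (G.g 0 2) - G.D j (G.g 2 0))
    + p 1 2 * (2 * G.D 1 (G.g 2 j) + 2 * G.D 2 (G.g 1 j) - G.D j (G.g 1 2) - G.D j (G.g 2 1))))
    * two_mul_half (A := A)

/-- The linearized vector constraint. -/
def dCv (q w : Fin 3 → Fin 3 → A) (j : Fin 3) : A :=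
  -2 * ∑ i, G.D i (∑ k, (w i k * G.g k j + p i k * q k j))
    + ∑ a, ∑ b, (w a b * G.D j (G.g a b) + p a b * G.D j (q a b))

theorem deriv_Cv (δ : Derivation ℝ A A) (hδ : ∀ i a, δ (G.D i a) = G.D i (δ a))
    (hp : ∀ i j, p i j = p j i) (j : Fin 3) :
    δ (G.Cv p j) = G.dCv p (fun i j => δ (G.g i j)) (fun i j => δ (p i j)) j := by
  rw [G.Cv_eq p hp, dCv]
  have h2 : δ (-2 : A) = 0 := by rw [map_neg, deriv_two, neg_zero]
  simp only [map_add, Derivation.leibniz δ (-2 : A), h2, map_sum, hδ, Derivation.leibniz δ (p _ _),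
    smul_eq_mul, mul_zero, add_zero]
  congr 1
  · congr 1
    exact Finset.sum_congr rfl fun i _ => Finset.sum_congr rfl fun k _ => by
      rw [add_comm, mul_comm (δ _)]
  · exact Finset.sum_congr rfl fun i _ => Finset.sum_congr rfl fun k _ => by ring

/-- Lie derivative of the metric. -/
def lieG (u : Fin 3 → A) (i j : Fin 3) : A :=
  ∑ k, (u k * G.D k (G.g i j) + G.g k j * G.D i (u k) + G.g i k * G.D j (u k))

/-- Lie derivative of the momentum density. -/
def lieP (u : Fin 3 → A) (i j : Fin 3) : A :=
  ∑ k, (G.D k (u k * p i j) - p k j * G.D k (u i) - p i k * G.D k (u j))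

/-- The boundary flux in `u^j δC_j`. -/
def VM (u : Fin 3 → A) (q w : Fin 3 → Fin 3 → A) (k : Fin 3) : A :=
  -2 * ∑ i, u i * ∑ l, (w k l * G.g l i + p k l * q l i) + u k * ∑ i, ∑ j, p i j * q i j

/-- The adjoint of the linearized vector constraint: moving the derivatives onto u by the Leibniz
rule reproduces the Lie derivatives of g and π. -/
theorem mul_dCv (u : Fin 3 → A) (q w : Fin 3 → Fin 3 → A) (hq : ∀ i j, q i j = q j i)
    (hw : ∀ i j, w i j = w j i) (hp : ∀ i j, p i j = p j i) :
    ∑ j, u j * G.dCv p q w j = ∑ i, ∑ j, (G.lieG u i j * w i j - G.lieP p u i j * q i j)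
      + ∑ k, G.D k (G.VM p u q w k) := by
  have h2 (i : Fin 3) : G.D i (-2 : A) = 0 := by rw [map_neg, deriv_two, neg_zero]
  simp only [dCv, lieG, lieP, VM, map_add, map_sum, Derivation.leibniz, smul_eq_mul, h2]
  simp only [Fin.sum_univ_three, hp 1 0, hp 2 0, hp 2 1, G.g_symm 1 0, G.g_symm 2 0, G.g_symm 2 1,
    hq 1 0, hq 2 0, hq 2 1, hw 1 0, hw 2 0, hw 2 1]
  ring

/-- `H² = C² - g^{ij} C_i C_j` with `H` invertible. -/
structure IsHam (H Hi : A) : Prop where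
  sq : H * H = G.C p ^ 2 - ∑ i, ∑ j, G.gi i j * G.Cv p i * G.Cv p j
  inv : H * Hi = 1

/-- The lapse. -/
def N (Hi : A) : A := G.C p * Hi

/-- The shift. -/
def Nv (Hi : A) (i : Fin 3) : A := -(∑ j, G.gi i j * G.Cv p j) * Hi

variable {p} {H Hi : A}

/-- Differentiate H² = C² − g^{ij}C_iC_j and divide by 2H. Lapse and shift appear as the
coefficients of δC and δC_j, and the variation of the inverse metric gives the quadratic term in the
shift. -/
theorem deriv_H (hH : G.IsHam p H Hi) (δ : Derivation ℝ A A) :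
    δ H = G.N p Hi * δ (G.C p) + ∑ j, G.Nv p Hi j * δ (G.Cv p j)
      + half A * H * ∑ i, ∑ j, G.Nv p Hi i * G.Nv p Hi j * δ (G.g i j) := by
  have e := congrArg δ hH.sq
  simp only [Derivation.leibniz, Derivation.leibniz_pow, map_sum, map_sub, smul_eq_mul,
    G.deriv_gi] at e
  have h0 : H * Hi = 1 := hH.inv
  have hN : H * G.N p Hi = G.C p := by rw [N]; linear_combination (G.C p) * h0
  have hNv (i : Fin 3) : H * G.Nv p Hi i = -∑ j, G.gi i j * G.Cv p j := by
    rw [Nv]; linear_combination (-∑ j, G.gi i j * G.Cv p j) * h0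
  have hK : 2 * H * δ H = 2 * H * (G.N p Hi * δ (G.C p) + ∑ j, G.Nv p Hi j * δ (G.Cv p j)
      + half A * H * ∑ i, ∑ j, G.Nv p Hi i * G.Nv p Hi j * δ (G.g i j)) := by
    have r : 2 * H * (G.N p Hi * δ (G.C p) + ∑ j, G.Nv p Hi j * δ (G.Cv p j)
      + half A * H * ∑ i, ∑ j, G.Nv p Hi i * G.Nv p Hi j * δ (G.g i j))
      = 2 * (H * G.N p Hi) * δ (G.C p) + 2 * ∑ j, (H * G.Nv p Hi j) * δ (G.Cv p j)
       + (2 * half A) * ∑ i, ∑ j, (H * G.Nv p Hi i) * (H * G.Nv p Hi j) * δ (G.g i j) := by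
      simp only [Fin.sum_univ_three]; ring
    rw [r, hN, two_mul_half]
    simp only [hNv]
    have l : 2 * H * δ H = H * δ H + H * δ H := by ring
    rw [l, e]
    simp only [Fin.sum_univ_three, G.gi_symm 1 0, G.gi_symm 2 0, G.gi_symm 2 1]
    ring
  have hK2 : H * δ H = H * (G.N p Hi * δ (G.C p) + ∑ j, G.Nv p Hi j * δ (G.Cv p j)
      + half A * H * ∑ i, ∑ j, G.Nv p Hi i * G.Nv p Hi j * δ (G.g i j)) :=
    two_cancel (by linear_combination hK)
  linear_combination Hi * hK2 + (-(δ H) + (G.N p Hi * δ (G.C p) + ∑ j, G.Nv p Hi j * δ (G.Cv p j)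
      + half A * H * ∑ i, ∑ j, G.Nv p Hi i * G.Nv p Hi j * δ (G.g i j))) * h0

/-- The coefficient of the momentum variation in the variation of the charge density. -/
def bulkGA (p : Fin 3 → Fin 3 → A) (Hi ξ : A) (ξv : Fin 3 → A) (i j : Fin 3) : A :=
  G.GA p (ξ * G.N p Hi) i j + G.lieG ξv i j + G.lieG (fun i => ξ * G.Nv p Hi i) i j

/-- Minus the coefficient of the metric variation in the variation of the charge density. -/
def bulkFA (p : Fin 3 → Fin 3 → A) (H Hi ξ : A) (ξv : Fin 3 → A) (i j : Fin 3) : A :=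
  G.FA p (ξ * G.N p Hi) i j + G.lieP p ξv i j + G.lieP p (fun i => ξ * G.Nv p Hi i) i j
    - half A * ξ * H * (G.Nv p Hi i * G.Nv p Hi j)

/-- The boundary flux in the variation of the charge density. -/
def flux (p : Fin 3 → Fin 3 → A) (Hi ξ : A) (ξv : Fin 3 → A) (q w : Fin 3 → Fin 3 → A)
    (k : Fin 3) : A :=
  G.VM p (fun i => ξv i + ξ * G.Nv p Hi i) q w k + G.VA (ξ * G.N p Hi) q k

theorem lieG_add (u v : Fin 3 → A) (i j : Fin 3) :
    G.lieG (fun i => u i + v i) i j = G.lieG u i j + G.lieG v i j := by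
  simp only [lieG, map_add, ← Finset.sum_add_distrib]
  exact Finset.sum_congr rfl fun k _ => by ring

theorem lieP_add (u v : Fin 3 → A) (i j : Fin 3) :
    G.lieP p (fun i => u i + v i) i j = G.lieP p u i j + G.lieP p v i j := by
  simp only [lieP, map_add, ← Finset.sum_add_distrib, add_mul]
  exact Finset.sum_congr rfl fun k _ => by ring

/-- By `deriv_H`, δC is multiplied by ξN and δC_j by ξ^j + ξN^j, so `mul_dC` and `mul_dCv` apply
with these as lapse and shift. The quadratic term needs no integration by parts and goes into
`bulkFA`. -/
theorem deriv_density (hH : G.IsHam p H Hi) (hp : ∀ i j, p i j = p j i) (δ : Derivation ℝ A A)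
    (hδ : ∀ i a, δ (G.D i a) = G.D i (δ a))
    (h : 2 * δ G.s = G.s * G.tr fun i j => δ (G.g i j)) (ξ : A) (ξv : Fin 3 → A)
    (hξ : δ ξ = 0) (hξv : ∀ i, δ (ξv i) = 0) :
    δ (ξ * H + ∑ i, ξv i * G.Cv p i)
      = ∑ i, ∑ j, (-G.bulkFA p H Hi ξ ξv i j * δ (G.g i j) + G.bulkGA p Hi ξ ξv i j * δ (p i j))
        + ∑ k, G.D k (G.flux p Hi ξ ξv (fun i j => δ (G.g i j)) (fun i j => δ (p i j)) k) := by
  set q : Fin 3 → Fin 3 → A := fun i j => δ (G.g i j) with hq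
  set w : Fin 3 → Fin 3 → A := fun i j => δ (p i j) with hw
  have hqs : ∀ i j, q i j = q j i := fun i j => by simp only [hq, G.g_symm i j]
  have hws : ∀ i j, w i j = w j i := fun i j => by simp only [hw, hp i j]
  have e : δ (ξ * H + ∑ i, ξv i * G.Cv p i) = (ξ * G.N p Hi) * G.dC p q w
      + ∑ j, (ξv j + ξ * G.Nv p Hi j) * G.dCv p q w j
      + half A * ξ * H * ∑ i, ∑ j, G.Nv p Hi i * G.Nv p Hi j * q i j := by
    simp only [map_add, map_sum, Derivation.leibniz, smul_eq_mul, hξ, hξv, mul_zero, add_zero]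
    rw [G.deriv_H hH, G.deriv_C p δ hδ h hp]
    simp only [G.deriv_Cv p δ hδ hp]
    simp only [add_mul, Finset.sum_add_distrib, mul_assoc, ← Finset.mul_sum]
    ring
  rw [e, G.mul_dC p _ q w hqs, G.mul_dCv p _ q w hqs hws hp]
  have hf : ∑ k, G.D k (G.flux p Hi ξ ξv q w k)
      = ∑ k, G.D k (G.VM p (fun i => ξv i + ξ * G.Nv p Hi i) q w k)
        + ∑ k, G.D k (G.VA (ξ * G.N p Hi) q k) := by
    simp only [flux, map_add, Finset.sum_add_distrib]
  have : ∑ i, ∑ j, (-G.bulkFA p H Hi ξ ξv i j * q i j + G.bulkGA p Hi ξ ξv i j * w i j)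
     = ∑ i, ∑ j, (G.GA p (ξ * G.N p Hi) i j * w i j - G.FA p (ξ * G.N p Hi) i j * q i j)
      + ∑ i, ∑ j, (G.lieG (fun i => ξv i + ξ * G.Nv p Hi i) i j * w i j
        - G.lieP p (fun i => ξv i + ξ * G.Nv p Hi i) i j * q i j)
      + half A * ξ * H * ∑ i, ∑ j, G.Nv p Hi i * G.Nv p Hi j * q i j := by
    simp only [Finset.mul_sum, ← Finset.sum_add_distrib]
    refine Finset.sum_congr rfl fun i _ => Finset.sum_congr rfl fun j _ => ?_
    rw [lieG_add, lieP_add, bulkFA, bulkGA]; ring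
  refine Eq.trans ?_ (congrArg₂ (· + ·) this hf).symm
  ring

end Geom

end

/-! ### Covariance under diffeomorphisms and the bracket identity -/

section

namespace Geom

variable {A : Type*} [CommRing A] [Algebra ℝ A] (G : Geom A)

/-- The Lie derivative of a covariant two-tensor. -/
def lieT (u : Fin 3 → A) (T : Fin 3 → Fin 3 → A) (i j : Fin 3) : A :=
  ∑ k, (u k * G.D k (T i j) + T k j * G.D i (u k) + T i k * G.D j (u k))

theorem lieG_symm (u : Fin 3 → A) (i j : Fin 3) : G.lieG u i j = G.lieG u j i := by
  unfold lieG
  exact Finset.sum_congr rfl fun k _ => by rw [G.g_symm i j, G.g_symm k j, G.g_symm k i]; ring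

/-- The Lie derivative of the Christoffel symbols. -/
def lieΓ (β : Fin 3 → A) (k i j : Fin 3) : A :=
  ∑ m, (β m * G.D m (G.Γ k i j) + G.D i (β m) * G.Γ k m j + G.D j (β m) * G.Γ k i m
    - G.D m (β k) * G.Γ m i j) + G.D i (G.D j (β k))

/-- Naturality of the Levi-Civita connection under the flow of β. By `dΓ_unique` it is enough to
compare the lowered forms, where only derivatives of `low` are needed. -/
theorem dΓ_lieG (β : Fin 3 → A) (k i j : Fin 3) :
    G.dΓ (G.lieG β) k i j = G.lieΓ β k i j := by
  refine (G.dΓ_unique (X := fun k => G.lieΓ β k i j) (fun m => ?_) k).symm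
  have hlow (n : Fin 3) : 2 * ∑ l, G.g m l * G.D n (G.Γ l i j)
      = G.D n (G.D i (G.g j m)) + G.D n (G.D j (G.g i m)) - G.D n (G.D m (G.g i j))
        - 2 * ∑ l, G.D n (G.g m l) * G.Γ l i j := by
    have := congrArg (G.D n) (G.low m i j)
    simp only [Derivation.leibniz, map_sum, map_sub, map_add, smul_eq_mul, deriv_two] at this
    rw [← this, Finset.sum_add_distrib,
      Finset.sum_congr rfl fun b _ => mul_comm (G.D n (G.g m b)) _]
    ring
  have hX : 2 * ∑ l, G.g m l * G.lieΓ β l i j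
      = ∑ n, (β n * (2 * ∑ l, G.g m l * G.D n (G.Γ l i j))
          + G.D i (β n) * (2 * ∑ l, G.g m l * G.Γ l n j)
          + G.D j (β n) * (2 * ∑ l, G.g m l * G.Γ l i n))
        - 2 * ∑ n, ∑ l, G.g m l * G.D n (β l) * G.Γ n i j
        + 2 * ∑ l, G.g m l * G.D i (G.D j (β l)) := by
    simp only [lieΓ, Fin.sum_univ_three]; ring
  have hQ : 2 * ∑ b, G.lieG β m b * G.Γ b i j
      = ∑ k, (β k * (2 * ∑ b, G.D k (G.g m b) * G.Γ b i j)
          + G.D m (β k) * (2 * ∑ b, G.g k b * G.Γ b i j))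
        + 2 * ∑ b, ∑ k, G.g m k * G.D b (β k) * G.Γ b i j := by
    simp only [lieG, Fin.sum_univ_three]; ring
  rw [hX, hQ]
  simp only [hlow, G.low, lieG, map_sum, map_add, Derivation.leibniz, smul_eq_mul]
  simp only [Fin.sum_univ_three, G.comm i 0, G.comm i 1, G.comm i 2, G.comm j 0, G.comm j 1,
    G.comm j 2, G.comm m 0, G.comm m 1, G.comm m 2, G.comm j i, G.comm m i, G.comm m j,
    G.g_symm i 0, G.g_symm i 1, G.g_symm i 2, G.g_symm j 0, G.g_symm j 1, G.g_symm j 2,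
    G.g_symm m 0, G.g_symm m 1, G.g_symm m 2]
  ring

-- Naturality of the Ricci tensor as a function of the connection. The third derivatives of β cancel
-- between the two derivative terms, and only the symmetry of Γ and commuting derivatives are used.
set_option maxRecDepth 20000 in
set_option maxHeartbeats 2000000 in
theorem dRic_lieΓ (β : Fin 3 → A) (i j : Fin 3) :
    G.dRic (G.lieΓ β) i j
      = ∑ m, (β m * G.D m (G.ric i j) + G.D i (β m) * G.ric m j + G.D j (β m) * G.ric i m) := by
  have h1 (k : Fin 3) : G.D k (G.lieΓ β k i j)
      = ∑ m, (β m * G.D m (G.D k (G.Γ k i j)) + G.D k (β m) * G.D m (G.Γ k i j)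
        + G.D i (G.D k (β m)) * G.Γ k m j + G.D i (β m) * G.D k (G.Γ k m j)
        + G.D j (G.D k (β m)) * G.Γ k i m + G.D j (β m) * G.D k (G.Γ k i m)
        - G.D k (G.D m (β k)) * G.Γ m i j - G.D m (β k) * G.D k (G.Γ m i j))
        + G.D i (G.D j (G.D k (β k))) := by
    rw [lieΓ, map_add, map_sum, G.comm k i, G.comm k j]
    congr 1
    refine Finset.sum_congr rfl fun m _ => ?_
    simp only [map_add, map_sub, Derivation.leibniz, smul_eq_mul]
    rw [G.comm k m, G.comm k i, G.comm k j]; ring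
  have h2 (k : Fin 3) : G.D j (G.lieΓ β k i k)
      = ∑ m, (β m * G.D m (G.D j (G.Γ k i k)) + G.D j (β m) * G.D m (G.Γ k i k)
        + G.D i (G.D j (β m)) * G.Γ k m k + G.D i (β m) * G.D j (G.Γ k m k)
        + G.D j (G.D k (β m)) * G.Γ k i m + G.D k (β m) * G.D j (G.Γ k i m)
        - G.D j (G.D m (β k)) * G.Γ m i k - G.D m (β k) * G.D j (G.Γ m i k))
        + G.D i (G.D j (G.D k (β k))) := by
    rw [lieΓ, map_add, map_sum, G.comm j i]
    congr 1
    refine Finset.sum_congr rfl fun m _ => ?_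
    simp only [map_add, map_sub, Derivation.leibniz, smul_eq_mul]
    rw [G.comm j m, G.comm j i]; ring
  have h3 (m i j : Fin 3) : G.D m (G.ric i j) = ∑ k, G.D m (G.D k (G.Γ k i j))
      - ∑ k, G.D m (G.D j (G.Γ k i k))
      + ∑ k, ∑ l, (G.D m (G.Γ k k l) * G.Γ l i j + G.Γ k k l * G.D m (G.Γ l i j)
        - G.D m (G.Γ k j l) * G.Γ l i k - G.Γ k j l * G.D m (G.Γ l i k)) := by
    simp only [ric, map_add, map_sub, map_sum, Derivation.leibniz, smul_eq_mul]
    congr 1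
    exact Finset.sum_congr rfl fun k _ => Finset.sum_congr rfl fun l _ => by ring
  simp only [h3]
  simp only [dRic, h1, h2, ric]
  unfold lieΓ
  simp only [Fin.sum_univ_three, G.Γ_symm _ 0 j,
    G.Γ_symm _ 1 j, G.Γ_symm _ 2 j, G.Γ_symm _ 1 0, G.Γ_symm _ 2 0, G.Γ_symm _ 2 1]
  ring

theorem dR_lieG (β : Fin 3 → A) : G.dR (G.lieG β) = ∑ m, β m * G.D m G.R := by
  have hX : G.dΓ (G.lieG β) = G.lieΓ β := by
    funext k i j; exact G.dΓ_lieG β k i j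
  have hq (i j : Fin 3) : G.up (G.lieG β) i j = -∑ m, β m * G.D m (G.gi i j)
      + ∑ a, (G.gi i a * G.D a (β j) + G.D a (β i) * G.gi a j) := by
    have h1 (a : Fin 3) := G.gi_g_sum (fun b => G.D a (β b)) i
    have h2 (a : Fin 3) := G.gi_g_sum (fun b => G.D a (β b)) j
    have e : ∑ a, (G.gi i a * G.D a (β j) + G.D a (β i) * G.gi a j) =
      ∑ a, ∑ b, G.gi i a * (∑ k, (G.g k b * G.D a (β k) + G.g a k * G.D b (β k))) * G.gi b j := by
      simp only [← h1, ← h2]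
      simp only [Fin.sum_univ_three, G.gi_symm j, G.g_symm 1 0, G.g_symm 2 0, G.g_symm 2 1]
      ring
    rw [e]
    simp only [G.deriv_gi, up, lieG, Fin.sum_univ_three]; ring
  unfold dR
  simp only [hX, dRic_lieΓ, hq, R, map_sum, Derivation.leibniz, smul_eq_mul]
  simp only [Fin.sum_univ_three, G.gi_symm 1 0, G.gi_symm 2 0, G.gi_symm 2 1, G.ric_symm 1 0,
    G.ric_symm 2 0, G.ric_symm 2 1]
  ring

theorem tr_lieG (β : Fin 3 → A) : G.tr (G.lieG β)
    = ∑ m, (β m * G.tr (fun i j => G.D m (G.g i j)) + 2 * G.D m (β m)) := by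
  have h (m : Fin 3) := G.gi_g_sum (fun b => G.D m (β b)) m
  simp only [← h, tr, lieG]
  simp only [Fin.sum_univ_three, G.gi_symm 1 0, G.gi_symm 2 0, G.gi_symm 2 1, G.g_symm 1 0,
    G.g_symm 2 0, G.g_symm 2 1]
  ring

variable (p : Fin 3 → Fin 3 → A)

/-- The kinetic expression is quadratic in a density of weight one, hence transforms as a scalar
density of weight two; this accounts for the factor 2 before the divergence of β. -/
theorem dKin_lie (hp : ∀ i j, p i j = p j i) (β : Fin 3 → A) :
    G.dKin p (G.lieG β) (G.lieP p β)
      = ∑ m, (β m * G.D m (G.kin p) + 2 * G.D m (β m) * G.kin p) := by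
  simp only [G.deriv_kin p _ hp]
  unfold dKin kin
  have htr : G.trP p = ∑ i, ∑ k, G.g i k * p k i := rfl
  have hL : ∑ i, ∑ j, G.pLow p i j * (∑ k, (p i j * G.D k (β k) - p k j * G.D k (β i)
      - p i k * G.D k (β j))) + ∑ i, ∑ j, G.pp p i j * (∑ k, (G.g k j * G.D i (β k)
      + G.g i k * G.D j (β k))) = (∑ k, G.D k (β k)) * ∑ i, ∑ j, G.mix p i j * G.mix p j i := by
    simp only [pLow, pp, mix, Fin.sum_univ_three, G.g_symm 1 0, G.g_symm 2 0, G.g_symm 2 1,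
      hp 1 0, hp 2 0, hp 2 1]
    ring
  have hT : ∑ i, ∑ j, G.g i j * (∑ k, (p i j * G.D k (β k) - p k j * G.D k (β i)
      - p i k * G.D k (β j))) + ∑ i, ∑ j, p i j * (∑ k, (G.g k j * G.D i (β k)
      + G.g i k * G.D j (β k))) = (∑ k, G.D k (β k)) * G.trP p := by
    rw [htr]
    simp only [Fin.sum_univ_three, G.g_symm 1 0, G.g_symm 2 0, G.g_symm 2 1,
      hp 1 0, hp 2 0, hp 2 1]
    ring
  have hg (i j : Fin 3) : G.lieG β i j = ∑ m, β m * G.D m (G.g i j)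
      + ∑ k, (G.g k j * G.D i (β k) + G.g i k * G.D j (β k)) := by
    rw [← Finset.sum_add_distrib]; exact Finset.sum_congr rfl fun k _ => by ring
  have hP (i j : Fin 3) : G.lieP p β i j = ∑ m, β m * G.D m (p i j)
      + ∑ k, (p i j * G.D k (β k) - p k j * G.D k (β i) - p i k * G.D k (β j)) := by
    rw [← Finset.sum_add_distrib]
    exact Finset.sum_congr rfl fun k _ => by rw [Derivation.leibniz, smul_eq_mul, smul_eq_mul]; ring
  simp only [hg, hP]
  generalize G.trP p = t at *
  have e : 2 * ∑ i, ∑ j, ((G.pLow p i j - half A * t * G.g i j) * (∑ m, β m * G.D m (p i j)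
      + ∑ k, (p i j * G.D k (β k) - p k j * G.D k (β i) - p i k * G.D k (β j)))
      + (G.pp p i j - half A * t * p i j) * (∑ m, β m * G.D m (G.g i j)
      + ∑ k, (G.g k j * G.D i (β k) + G.g i k * G.D j (β k))))
    = ∑ m, β m * (2 * ∑ i, ∑ j, ((G.pLow p i j - half A * t * G.g i j) * G.D m (p i j)
      + (G.pp p i j - half A * t * p i j) * G.D m (G.g i j)))
      + 2 * (∑ i, ∑ j, G.pLow p i j * (∑ k, (p i j * G.D k (β k) - p k j * G.D k (β i)
      - p i k * G.D k (β j))) + ∑ i, ∑ j, G.pp p i j * (∑ k, (G.g k j * G.D i (β k)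
      + G.g i k * G.D j (β k))))
      - 2 * half A * t * (∑ i, ∑ j, G.g i j * (∑ k, (p i j * G.D k (β k) - p k j * G.D k (β i)
      - p i k * G.D k (β j))) + ∑ i, ∑ j, p i j * (∑ k, (G.g k j * G.D i (β k)
      + G.g i k * G.D j (β k)))) := by
    simp only [Fin.sum_univ_three]; ring
  rw [e, hL, hT]
  simp only [Finset.sum_add_distrib, ← Finset.sum_mul, ← Finset.mul_sum]
  ring

theorem D_s_tr (m : Fin 3) :
    G.D m G.s = half A * G.s * G.tr fun i j => G.D m (G.g i j) := by
  have := G.D_s m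
  have h : G.D m G.s = half A * (2 * G.D m G.s) := by
    linear_combination (-G.D m G.s) * two_mul_half (A := A)
  rw [h, this, tr]; ring

/-- C is a scalar density of weight one: `kin` has weight two, `si` weight minus one, and `s` times
the scalar curvature weight one. Its Lie derivative is therefore a total divergence. -/
theorem dC_lie (hp : ∀ i j, p i j = p j i) (β : Fin 3 → A) :
    G.dC p (G.lieG β) (G.lieP p β) = ∑ k, G.D k (β k * G.C p) := by
  have hs (m : Fin 3) := G.D_s_tr m
  have hsi (m : Fin 3) := G.deriv_s (G.D m) (G.D_s m)
  rw [dC, G.dKin_lie p hp, G.dR_lieG, G.tr_lieG]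
  simp only [C, Derivation.leibniz, map_sub, smul_eq_mul, hs, hsi]
  simp only [Fin.sum_univ_three]
  linear_combination (-(G.D 0 (β 0) + G.D 1 (β 1) + G.D 2 (β 2)) *
    (G.kin p * G.si + G.s * G.R)) * two_mul_half (A := A)

/-- `C^j`. -/
def Cu (j : Fin 3) : A := ∑ k, G.gi j k * G.Cv p k

theorem Cu_eq (j : Fin 3) :
    G.Cu p j = -2 * (∑ i, G.D i (p i j) + ∑ i, ∑ l, G.Γ j i l * p i l) := by
  have := G.gi_g_sum (fun k => -2 * (∑ i, G.D i (p i k) + ∑ i, ∑ l, G.Γ k i l * p i l)) j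
  rw [← this, Cu]
  refine Finset.sum_congr rfl fun k _ => ?_
  rw [Cv, Finset.mul_sum]
  congr 1
  exact Finset.sum_congr rfl fun k _ => by ring

/-- In dimension three the two trace modifications undo each other: the coefficient of tr T · π is
−1/2 − 1 + 3/2 = 0. -/
theorem hess_pairing (T : Fin 3 → Fin 3 → A) (hp : ∀ i j, p i j = p j i) :
    ∑ i, ∑ j, (G.up T i j - G.tr T * G.gi i j) * (G.pLow p i j - half A * G.trP p * G.g i j)
      = ∑ i, ∑ j, p i j * T i j := by
  have h3 : ∑ i, ∑ j, G.gi i j * G.g i j = 3 := by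
    have := fun i => G.gi_g i i
    simp only [if_true] at this
    calc _ = ∑ i, ∑ k, G.gi i k * G.g k i := by
          exact Finset.sum_congr rfl fun i _ => Finset.sum_congr rfl fun j _ => by
            rw [G.g_symm i j]
      _ = 3 := by simp only [this, Fin.sum_univ_three]; norm_num
  have h1 : ∑ i, ∑ j, G.up T i j * G.pLow p i j = ∑ i, ∑ j, p i j * T i j := by
    have e (a b : Fin 3) : ∑ i, ∑ j, G.gi i a * G.gi b j * G.pLow p i j = p a b := by
      have h1 (c : Fin 3) := G.gi_g_sum (fun d => p d c) a
      have h2 := G.gi_g_sum (fun c => p a c) b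
      rw [← h2]
      simp only [← h1]
      simp only [pLow, Fin.sum_univ_three, G.gi_symm _ a, G.g_symm 1 0,
        G.g_symm 2 0, G.g_symm 2 1]
      simp only [G.gi_symm a, G.gi_symm b]
      ring
    simp only [← e, up]
    simp only [Fin.sum_univ_three]; ring
  have h2 : ∑ i, ∑ j, G.up T i j * G.g i j = G.tr T := by
    rw [G.up_mul]
    have e (i j : Fin 3) : G.up G.g i j = G.gi i j := by
      have h1 (b : Fin 3) : ∑ a, G.gi i a * G.g a b = if i = b then 1 else 0 := G.gi_g i b
      have : G.up G.g i j = ∑ b, (∑ a, G.gi i a * G.g a b) * G.gi b j := by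
        unfold up; rw [Finset.sum_comm]; simp only [Finset.sum_mul]
      rw [this]; simp [h1]
    simp only [e, tr]
  have h4 : ∑ i, ∑ j, G.gi i j * G.pLow p i j = G.trP p := by
    have h2 (i k : Fin 3) := G.gi_g_sum (fun c => p c k) i
    have : G.trP p = ∑ i, ∑ k, G.g i k * ∑ l, G.gi k l * ∑ n, G.g l n * p n i := by
      simp only [h2]; rfl
    rw [this]
    simp only [pLow, Fin.sum_univ_three, G.gi_symm 1 0, G.gi_symm 2 0, G.gi_symm 2 1, G.g_symm 1 0,
      G.g_symm 2 0, G.g_symm 2 1, hp 1 0, hp 2 0, hp 2 1]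
    ring
  have e : ∑ i, ∑ j, (G.up T i j - G.tr T * G.gi i j) * (G.pLow p i j - half A * G.trP p * G.g i j)
      = ∑ i, ∑ j, G.up T i j * G.pLow p i j
        - half A * G.trP p * ∑ i, ∑ j, G.up T i j * G.g i j
        - G.tr T * ∑ i, ∑ j, G.gi i j * G.pLow p i j
        + half A * G.trP p * G.tr T * ∑ i, ∑ j, G.gi i j * G.g i j := by
    simp only [Finset.mul_sum, ← Finset.sum_add_distrib, ← Finset.sum_sub_distrib]
    exact Finset.sum_congr rfl fun i _ => Finset.sum_congr rfl fun j _ => by ring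
  rw [e, h1, h2, h3, h4]
  linear_combination (G.trP p * G.tr T) * two_mul_half (A := A)

/-- Terms of `FA` without derivatives of the lapse carry the product αα' and cancel by antisymmetry.
Only the Hessians survive; integrating them by parts against the momentum leaves its divergence,
that is `Cu`. -/
theorem pairing_lapse_lapse (hp : ∀ i j, p i j = p j i) (α α' : A) :
    ∑ i, ∑ j, (-G.FA p α i j * G.GA p α' i j + G.GA p α i j * G.FA p α' i j)
      = ∑ k, G.D k (2 * ∑ j, p k j * (α * G.D j α' - α' * G.D j α))
        + ∑ j, G.Cu p j * (α * G.D j α' - α' * G.D j α) := by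
  have e : ∑ i, ∑ j, (-G.FA p α i j * G.GA p α' i j + G.GA p α i j * G.FA p α' i j)
      = 2 * (α * ∑ i, ∑ j, p i j * G.hess α' i j - α' * ∑ i, ∑ j, p i j * G.hess α i j) := by
    rw [← G.hess_pairing p (G.hess α') hp, ← G.hess_pairing p (G.hess α) hp]
    simp only [Finset.mul_sum, ← Finset.sum_sub_distrib]
    refine Finset.sum_congr rfl fun i _ => Finset.sum_congr rfl fun j _ => ?_
    unfold FA GA
    linear_combination (2 * (G.pLow p i j - half A * G.trP p * G.g i j) *
      (α * (G.up (G.hess α') i j - G.tr (G.hess α') * G.gi i j)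
       - α' * (G.up (G.hess α) i j - G.tr (G.hess α) * G.gi i j))) * G.s_si
  rw [e]
  simp only [Cu_eq, hess, map_sum, map_sub, Derivation.leibniz, smul_eq_mul, deriv_two]
  simp only [Fin.sum_univ_three, G.Γ_symm _ 1 0, G.Γ_symm _ 2 0, G.Γ_symm _ 2 1, hp 1 0, hp 2 0,
    hp 2 1]
  ring

/-- The Lie bracket of vector fields. -/
def brk (β β' : Fin 3 → A) (j : Fin 3) : A := ∑ m, (β m * G.D m (β' j) - β' m * G.D m (β j))

theorem p_lieG (hp : ∀ i j, p i j = p j i) (u : Fin 3 → A) :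
    ∑ i, ∑ j, p i j * G.lieG u i j = ∑ j, G.Cv p j * u j
      + ∑ k, G.D k (2 * ∑ j, p k j * ∑ i, G.g j i * u i) := by
  simp only [G.Cv_eq p hp, lieG, map_sum, Derivation.leibniz, smul_eq_mul, deriv_two]
  simp only [Fin.sum_univ_three, hp 1 0, hp 2 0, hp 2 1, G.g_symm 1 0, G.g_symm 2 0, G.g_symm 2 1]
  ring

/-- Up to a divergence, the Lie derivative on momentum densities is minus the adjoint of the one on
covariant tensors. -/
theorem mul_lieP (T : Fin 3 → Fin 3 → A) (u : Fin 3 → A) :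
    ∑ i, ∑ j, T i j * G.lieP p u i j = ∑ k, G.D k (u k * ∑ i, ∑ j, p i j * T i j)
      - ∑ i, ∑ j, p i j * G.lieT u T i j := by
  simp only [lieP, lieT, map_sum, Derivation.leibniz, smul_eq_mul]
  simp only [Fin.sum_univ_three]
  ring

theorem lieT_comm (T : Fin 3 → Fin 3 → A) (β β' : Fin 3 → A) (i j : Fin 3) :
    G.lieT β (G.lieT β' T) i j - G.lieT β' (G.lieT β T) i j = G.lieT (G.brk β β') T i j := by
  simp only [lieT, brk, map_sum, map_add, map_sub, Derivation.leibniz, smul_eq_mul]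
  simp only [Fin.sum_univ_three, G.comm i 0, G.comm i 1, G.comm i 2, G.comm j 0, G.comm j 1,
    G.comm j 2, G.comm 1 0, G.comm 2 0, G.comm 2 1]
  ring

/-- Move both Lie derivatives onto the metric. Their commutator is the Lie derivative along the
bracket of the two fields, and `p_lieG` turns its pairing with the momentum into the vector
constraint. -/
theorem pairing_shift_shift (hp : ∀ i j, p i j = p j i) (β β' : Fin 3 → A) :
    ∑ i, ∑ j, (-G.lieP p β i j * G.lieG β' i j + G.lieG β i j * G.lieP p β' i j)
      = ∑ k, G.D k (β' k * (∑ i, ∑ j, p i j * G.lieG β i j)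
          - β k * (∑ i, ∑ j, p i j * G.lieG β' i j)
          + 2 * ∑ j, p k j * ∑ i, G.g j i * G.brk β β' i)
        + ∑ j, G.Cv p j * G.brk β β' j := by
  have h1 := G.mul_lieP p (G.lieG β) β'
  have h2 := G.mul_lieP p (G.lieG β') β
  have h3 := G.p_lieG p hp (G.brk β β')
  have h4 (i j : Fin 3) : G.lieT β (G.lieG β') i j - G.lieT β' (G.lieG β) i j
    = G.lieG (G.brk β β') i j := G.lieT_comm G.g β β' i j
  simp only [← h4, mul_sub, Finset.sum_sub_distrib] at h3
  simp only [map_add, map_sub, Finset.sum_add_distrib, Finset.sum_sub_distrib, neg_mul,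
    Finset.sum_neg_distrib]
  rw [h1, Finset.sum_congr rfl fun i _ => Finset.sum_congr rfl fun j _ =>
    mul_comm (G.lieP p β i j) _, h2]
  linear_combination h3

theorem lieG_mul (a : A) (u : Fin 3 → A) (i j : Fin 3) :
    G.lieG (fun k => a * u k) i j
      = a * G.lieG u i j + ∑ k, (G.g k j * u k * G.D i a + G.g i k * u k * G.D j a) := by
  simp only [lieG, Derivation.leibniz, smul_eq_mul, Finset.mul_sum, ← Finset.sum_add_distrib]
  exact Finset.sum_congr rfl fun k _ => by ring

variable {p} {H Hi : A}

/-- The flux in the bracket of a charge with the physical Hamiltonian. -/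
def bracketFlux (p : Fin 3 → Fin 3 → A) (Hi ξ : A) (ξv : Fin 3 → A) (k : Fin 3) : A :=
  let α := ξ * G.N p Hi
  let β : Fin 3 → A := fun i => ξv i + ξ * G.Nv p Hi i
  let α' := G.N p Hi
  let β' := G.Nv p Hi
  2 * ∑ j, p k j * (α * G.D j α' - α' * G.D j α)
    + (β' k * (∑ i, ∑ j, p i j * G.lieG β i j) - β k * (∑ i, ∑ j, p i j * G.lieG β' i j)
      + 2 * ∑ j, p k j * ∑ i, G.g j i * G.brk β β' i)
    + (G.VA α' (G.lieG β) k - α' * (β k * G.C p) - (G.VA α (G.lieG β') k - α * (β' k * G.C p)))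

theorem bracketFlux_eq {p : Fin 3 → Fin 3 → A} {Hi ξ α α' : A} {ξv β β' : Fin 3 → A}
    (hα : α = ξ * G.N p Hi) (hβ : ∀ i, β i = ξv i + ξ * G.Nv p Hi i) (hα' : α' = G.N p Hi)
    (hβ' : β' = G.Nv p Hi) (k : Fin 3) : G.bracketFlux p Hi ξ ξv k
      = 2 * ∑ j, p k j * (α * G.D j α' - α' * G.D j α)
    + (β' k * (∑ i, ∑ j, p i j * G.lieG β i j) - β k * (∑ i, ∑ j, p i j * G.lieG β' i j)
      + 2 * ∑ j, p k j * ∑ i, G.g j i * G.brk β β' i)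
    + (G.VA α' (G.lieG β) k - α' * (β k * G.C p) - (G.VA α (G.lieG β') k
      - α * (β' k * G.C p))) := by
  obtain rfl : β = fun i => ξv i + ξ * G.Nv p Hi i := funext hβ
  subst hα hα' hβ'
  rfl

/-- The definition of H² divided by H². Lapse and shift thus form a unit timelike vector, and the
derivative of this relation is what closes `bracket_identity`. -/
theorem norm_shift (hH : G.IsHam p H Hi) :
    G.N p Hi * G.N p Hi = 1 + ∑ i, ∑ j, G.g i j * G.Nv p Hi i * G.Nv p Hi j := by
  have h0 := hH.inv
  have hC (i : Fin 3) : ∑ j, G.g i j * G.Nv p Hi j = - G.Cv p i * Hi := by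
    have := G.g_gi_sum (G.Cv p) i
    rw [← this]; unfold Nv; simp only [Fin.sum_univ_three]; ring
  have : ∑ i, ∑ j, G.g i j * G.Nv p Hi i * G.Nv p Hi j
      = Hi * Hi * ∑ i, ∑ j, G.gi i j * G.Cv p i * G.Cv p j := by
    have e : ∑ i, ∑ j, G.g i j * G.Nv p Hi i * G.Nv p Hi j
      = ∑ i, G.Nv p Hi i * ∑ j, G.g i j * G.Nv p Hi j := by
      simp only [Finset.mul_sum]
      exact Finset.sum_congr rfl fun i _ => Finset.sum_congr rfl fun j _ => by ring
    rw [e]; simp only [hC]; unfold Nv; simp only [Fin.sum_univ_three]; ring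
  rw [this, N]
  linear_combination (-Hi * Hi) * hH.sq + (H * Hi + 1) * h0

/-- Lapse-lapse and shift-shift pairings are given by the two lemmas above; the mixed pairings are
`mul_dC` applied to Lie-dragged fields, where `dC_lie` makes the left side a divergence. All
divergences are collected in `bracketFlux`, and the remaining multiples of the constraints have to
cancel. -/
theorem bracket_identity (hH : G.IsHam p H Hi) (hp : ∀ i j, p i j = p j i) (ξ : A)
    (ξv : Fin 3 → A) :
    ∑ i, ∑ j, (-G.bulkFA p H Hi ξ ξv i j * G.bulkGA p Hi 1 0 i j
        + G.bulkGA p Hi ξ ξv i j * G.bulkFA p H Hi 1 0 i j)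
      = ∑ k, G.D k (G.bracketFlux p Hi ξ ξv k) := by
  set N := G.N p Hi with hN
  set Nv := G.Nv p Hi with hNv
  set α := ξ * N with hα
  set β : Fin 3 → A := fun i => ξv i + ξ * Nv i with hβ
  have h0 := hH.inv
  have hC : G.C p = H * N := by rw [hN, Geom.N]; linear_combination (-G.C p) * h0
  have hCu (i : Fin 3) : G.Cu p i = - H * Nv i := by
    rw [hNv, Geom.Nv, Cu]; linear_combination (-∑ j, G.gi i j * G.Cv p j) * h0
  have hCv (i : Fin 3) : G.Cv p i = - H * ∑ j, G.g i j * Nv j := by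
    have := G.g_gi_sum (G.Cv p) i
    rw [← this, Finset.mul_sum, Finset.sum_congr rfl]
    intro j _; rw [← Cu, hCu]; ring
  have hF (i j : Fin 3) : G.bulkFA p H Hi ξ ξv i j
      = G.FA p α i j + G.lieP p β i j - half A * ξ * H * (Nv i * Nv j) := by
    rw [hβ, lieP_add, bulkFA]; ring
  have hG (i j : Fin 3) : G.bulkGA p Hi ξ ξv i j = G.GA p α i j + G.lieG β i j := by
    rw [hβ, lieG_add, bulkGA]; ring
  have hF' (i j : Fin 3) : G.bulkFA p H Hi 1 0 i j
      = G.FA p N i j + G.lieP p Nv i j - half A * H * (Nv i * Nv j) := by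
    simp [bulkFA, lieP, hN, hNv]
  have hG' (i j : Fin 3) : G.bulkGA p Hi 1 0 i j = G.GA p N i j + G.lieG Nv i j := by
    simp [bulkGA, lieG, hN, hNv]
  have h1 := G.pairing_lapse_lapse p hp α N
  have h2 := G.pairing_shift_shift p hp β Nv
  have h3 := G.mul_dC p N (G.lieG β) (G.lieP p β) (G.lieG_symm β)
  have h4 := G.mul_dC p α (G.lieG Nv) (G.lieP p Nv) (G.lieG_symm Nv)
  rw [G.dC_lie p hp] at h3 h4
  have hGA (i j : Fin 3) : G.GA p α i j = ξ * G.GA p N i j := by rw [hα, GA, GA]; ring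
  have hlie (i j : Fin 3) : G.lieG β i j = G.lieG ξv i j + ξ * G.lieG Nv i j
      + ∑ k, (G.g k j * Nv k * G.D i ξ + G.g i k * Nv k * G.D j ξ) := by
    rw [hβ, lieG_add, lieG_mul]; ring
  -- `K` is the Lie derivative of g along β minus ξ times the one along the shift. In the terms
  -- quadratic in the shift, the contributions proportional to ξ cancel between the two charges, so
  -- only `K` remains.
  set K : Fin 3 → Fin 3 → A := fun i j => G.lieG ξv i j
    + ∑ k, (G.g k j * Nv k * G.D i ξ + G.g i k * Nv k * G.D j ξ) with hK
  have e : ∑ i, ∑ j, (-G.bulkFA p H Hi ξ ξv i j * G.bulkGA p Hi 1 0 i j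
        + G.bulkGA p Hi ξ ξv i j * G.bulkFA p H Hi 1 0 i j)
     = ∑ i, ∑ j, (-G.FA p α i j * G.GA p N i j + G.GA p α i j * G.FA p N i j)
      + ∑ i, ∑ j, (-G.lieP p β i j * G.lieG Nv i j + G.lieG β i j * G.lieP p Nv i j)
      - ∑ i, ∑ j, (G.GA p N i j * G.lieP p β i j - G.FA p N i j * G.lieG β i j)
      + ∑ i, ∑ j, (G.GA p α i j * G.lieP p Nv i j - G.FA p α i j * G.lieG Nv i j)
      - half A * H * ∑ i, ∑ j, Nv i * Nv j * K i j := by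
    have hlie' (i j : Fin 3) : G.lieG β i j = ξ * G.lieG Nv i j + K i j := by
      rw [hlie]; simp only [hK]; ring
    clear_value K β α
    simp only [hF, hG, hF', hG', Finset.mul_sum, ← Finset.sum_add_distrib,
      ← Finset.sum_sub_distrib]
    refine Finset.sum_congr rfl fun i _ => Finset.sum_congr rfl fun j _ => ?_
    linear_combination (-(half A * H * (Nv i * Nv j))) * (hGA i j + hlie' i j)
  have hflux : ∑ k, G.D k (G.bracketFlux p Hi ξ ξv k)
      = ∑ k, G.D k (2 * ∑ j, p k j * (α * G.D j N - N * G.D j α))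
        + ∑ k, G.D k (Nv k * (∑ i, ∑ j, p i j * G.lieG β i j)
          - β k * (∑ i, ∑ j, p i j * G.lieG Nv i j)
          + 2 * ∑ j, p k j * ∑ i, G.g j i * G.brk β Nv i)
        + ∑ k, G.D k (G.VA N (G.lieG β) k) - ∑ k, G.D k (G.VA α (G.lieG Nv) k)
        - N * ∑ k, G.D k (β k * G.C p) - (∑ k, β k * G.D k N) * G.C p
        + α * ∑ k, G.D k (Nv k * G.C p) + (∑ k, Nv k * G.D k α) * G.C p := by
    unfold bracketFlux
    simp only [map_add, map_sub, Finset.sum_add_distrib, Finset.sum_sub_distrib]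
    have r (a : A) (u : Fin 3 → A) : ∑ k, G.D k (a * (u k * G.C p))
       = a * ∑ k, G.D k (u k * G.C p) + (∑ k, u k * G.D k a) * G.C p := by
      simp only [Derivation.leibniz (G.D _) a, smul_eq_mul, Finset.sum_add_distrib,
        Finset.mul_sum, Finset.sum_mul]
      congr 1; exact Finset.sum_congr rfl fun k _ => by ring
    rw [r, r]; ring
  have hn := fun k => congrArg (G.D k) (G.norm_shift hH)
  simp only [← hN, ← hNv, Derivation.leibniz, map_add, map_sum, smul_eq_mul,
    Derivation.map_one_eq_zero] at hn
  rw [e, hflux, h1, h2]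
  -- With C = HN and C_i = −H g_ijN^j, the remainder is H times the derivative along ξ^i of N² − 1 −
  -- g_ijN^iN^j, which vanishes.
  have key : ∑ j, G.Cu p j * (α * G.D j N - N * G.D j α) + ∑ j, G.Cv p j * G.brk β Nv j
      + (∑ k, β k * G.D k N) * G.C p - (∑ k, Nv k * G.D k α) * G.C p
      - half A * H * ∑ i, ∑ j, Nv i * Nv j * K i j = 0 := by
    simp only [hC, hCu, hCv]
    apply two_cancel
    have n0 := hn 0
    have n1 := hn 1
    have n2 := hn 2
    have r (X E : A) : 2 * (X - half A * H * E) = 2 * X - H * E := by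
      linear_combination (-H * E) * two_mul_half (A := A)
    rw [r]
    simp only [hK, hβ, hα, brk, lieG, Derivation.leibniz, map_add, smul_eq_mul]
    simp only [Fin.sum_univ_three, G.g_symm 1 0, G.g_symm 2 0, G.g_symm 2 1] at n0 n1 n2 ⊢
    linear_combination H * (ξv 0 * n0 + ξv 1 * n1 + ξv 2 * n2)
  linear_combination key + h3 - h4

end Geom

end

section

/-! ### Directional derivatives on parameter times space -/

/-- Parameter times space. -/
abbrev PSpace := ℝ × Space

/-- The direction of the `i`-th spatial coordinate. -/
def ex (i : Fin 3) : PSpace := (0, EuclideanSpace.single i 1)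

/-- The direction of the parameter. -/
def es : PSpace := (1, 0)

/-- Derivative of `F` in the direction `v`. -/
def dirD (v : PSpace) (F : PSpace → ℝ) (q : PSpace) : ℝ := fderiv ℝ F q v

theorem dirD_comm {F : PSpace → ℝ} {q : PSpace} (hF : ContDiffAt ℝ ∞ F q) (v w : PSpace) :
    dirD v (dirD w F) q = dirD w (dirD v F) q := by
  have h2 : ContDiffAt ℝ 2 F q := hF.of_le (by norm_cast)
  have hd : DifferentiableAt ℝ (fderiv ℝ F) q :=
    (h2.fderiv_right (m := 1) (by norm_num)).differentiableAt (by norm_num)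
  have e (v w : PSpace) : dirD v (dirD w F) q = fderiv ℝ (fderiv ℝ F) q v w := by
    unfold dirD
    rw [fderiv_clm_apply hd (differentiableAt_const w)]
    simp
  rw [e, e]
  exact (h2.isSymmSndFDerivAt (by simp)).eq v w

theorem contDiffAt_dirD {F : PSpace → ℝ} {q : PSpace} (hF : ContDiffAt ℝ ∞ F q) (v : PSpace) :
    ContDiffAt ℝ ∞ (dirD v F) q :=
  (hF.fderiv_right (m := ∞) (by simp)).clm_apply contDiffAt_const

theorem pd_eq_dirD {F : PSpace → ℝ} {s : ℝ} {x : Space} (hF : DifferentiableAt ℝ F (s, x))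
    (i : Fin 3) : pd i (fun y => F (s, y)) x = dirD (ex i) F (s, x) := by
  have h : HasFDerivAt (fun y : Space => (s, y))
      (ContinuousLinearMap.inr ℝ ℝ Space) x := hasFDerivAt_prodMk_right s x
  have := (hF.hasFDerivAt.comp x h).fderiv
  unfold pd dirD ex
  change fderiv ℝ (F ∘ fun y => (s, y)) x _ = _
  rw [this]; simp

theorem deriv_eq_dirD {F : PSpace → ℝ} {s : ℝ} {x : Space} (hF : DifferentiableAt ℝ F (s, x)) :
    HasDerivAt (fun t => F (t, x)) (dirD es F (s, x)) s := by
  have h : HasFDerivAt (fun t : ℝ => (t, x))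
      (ContinuousLinearMap.inl ℝ ℝ Space) s := hasFDerivAt_prodMk_left s x
  have := (hF.hasFDerivAt.comp s h).hasDerivAt
  simpa [dirD, es, Function.comp_def] using this

/-! ### The algebra of smooth functions -/

/-- The algebra of smooth functions on parameter times space. -/
def smoothSubalgebra : Subalgebra ℝ (PSpace → ℝ) where
  carrier := {F | ContDiff ℝ ∞ F}
  mul_mem' {a b} ha hb := by
    simp only [Set.mem_ofPred_eq] at *; exact ha.mul hb
  add_mem' {a b} ha hb := by
    simp only [Set.mem_ofPred_eq] at *; exact ha.add hb
  algebraMap_mem' r := by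
    change ContDiff ℝ ∞ (fun _ => r); exact contDiff_const

/-- Smooth functions on parameter times space. -/
abbrev SmoothFn : Type := smoothSubalgebra

theorem smooth_contDiff (F : SmoothFn) : ContDiff ℝ ∞ F.1 := F.2

theorem smooth_contDiffAt (F : SmoothFn) (q : PSpace) : ContDiffAt ℝ ∞ F.1 q :=
  (smooth_contDiff F).contDiffAt

theorem smooth_differentiableAt (F : SmoothFn) (q : PSpace) : DifferentiableAt ℝ F.1 q :=
  (smooth_contDiffAt F q).differentiableAt (by simp)

/-- Evaluation at a point. -/
def ev (q : PSpace) : SmoothFn →ₐ[ℝ] ℝ := (Pi.evalAlgHom ℝ (fun _ : PSpace => ℝ) q).comp smoothSubalgebra.val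

theorem ev_apply (q : PSpace) (F : SmoothFn) : ev q F = F.1 q := rfl

/-- Directional derivatives as derivations of the algebra of smooth functions. -/
def smD (v : PSpace) : Derivation ℝ SmoothFn SmoothFn :=
  Derivation.mk'
    { toFun := fun F => ⟨dirD v F.1, contDiff_iff_contDiffAt.2 fun q =>
        contDiffAt_dirD (smooth_contDiffAt F q) v⟩
      map_add' := fun F G => Subtype.ext <| funext fun q => by
        change fderiv ℝ (F.1 + G.1) q v = _
        rw [fderiv_add (smooth_differentiableAt F q) (smooth_differentiableAt G q)]; rfl
      map_smul' := fun r F => Subtype.ext <| funext fun q => by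
        change fderiv ℝ (r • F.1) q v = _
        rw [fderiv_const_smul (smooth_differentiableAt F q)]; rfl }
    (fun F G => Subtype.ext <| funext fun q => by
      change fderiv ℝ (F.1 * G.1) q v = _
      rw [fderiv_mul (smooth_differentiableAt F q) (smooth_differentiableAt G q)]; rfl)

/-- Besides the commuting coordinate derivatives, this contains the fact that the variation ∂_s
commutes with them, which the abstract variation formulas require. -/
theorem smD_comm (v w : PSpace) (F : SmoothFn) : smD v (smD w F) = smD w (smD v F) :=
  Subtype.ext <| funext fun q => dirD_comm (smooth_contDiffAt F q) v w

theorem pd_ev (i : Fin 3) (F : SmoothFn) (s : ℝ) (x : Space) :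
    pd i (fun y => ev (s, y) F) x = ev (s, x) (smD (ex i) F) :=
  pd_eq_dirD (smooth_differentiableAt F _) i

theorem hasDerivAt_ev (F : SmoothFn) (s : ℝ) (x : Space) :
    HasDerivAt (fun t => ev (t, x) F) (ev (s, x) (smD es F)) s :=
  deriv_eq_dirD (smooth_differentiableAt F _)

theorem ev_ext {F G : SmoothFn} (h : ∀ q, ev q F = ev q G) : F = G :=
  Subtype.ext (funext h)

/-- A smooth function of space, seen as a function independent of the parameter. -/
def pullback (f : Space → ℝ) (hf : ContDiff ℝ ∞ f) : SmoothFn := ⟨fun q => f q.2, hf.comp contDiff_snd⟩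

theorem smD_es_pullback (f : Space → ℝ) (hf : ContDiff ℝ ∞ f) : smD es (pullback f hf) = 0 := by
  refine ev_ext fun ⟨s, x⟩ => ?_
  have := hasDerivAt_ev (pullback f hf) s x
  exact this.unique (hasDerivAt_const s (f x))

/-! ### The geometry of a variation -/

theorem contDiff_det {M : PSpace → Mat} (h : ∀ i j, ContDiff ℝ ∞ fun q => M q i j) :
    ContDiff ℝ ∞ fun q => (M q).det := by
  simp only [Matrix.det_fin_three]
  fun_prop

theorem contDiff_inv_apply {M : PSpace → Mat} (h : ∀ i j, ContDiff ℝ ∞ fun q => M q i j)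
    (h0 : ∀ q, (M q).det ≠ 0) (i j : Fin 3) : ContDiff ℝ ∞ fun q => (M q)⁻¹ i j := by
  simp only [Matrix.inv_def, Ring.inverse_eq_inv', Matrix.smul_apply, smul_eq_mul,
    Matrix.adjugate_apply]
  refine ((contDiff_det h).inv h0).mul (contDiff_det fun a b => ?_)
  simp only [Matrix.updateRow_apply]
  split_ifs
  · exact contDiff_const
  · exact h _ _

variable {ε : ℝ} {c : ℝ → Fields}

namespace IsVariation

theorem det_pos (hc : IsVariation ε c) (q : PSpace) : 0 < ((c q.1).g q.2).det :=
  ((hc.mem q.1).posDef_g q.2).det_pos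

theorem g_symm (hc : IsVariation ε c) (s : ℝ) (x : Space) (i j : Fin 3) :
    (c s).g x i j = (c s).g x j i := by
  have := ((hc.mem s).posDef_g x).1
  simpa using (this.apply i j).symm

theorem p_symm (hc : IsVariation ε c) (s : ℝ) (x : Space) (i j : Fin 3) :
    (c s).p x i j = (c s).p x j i := (((hc.mem s).symm_p x).apply i j).symm

/-- The metric components as smooth functions. -/
def gA (hc : IsVariation ε c) (i j : Fin 3) : SmoothFn :=
  ⟨fun q => (c q.1).g q.2 i j, hc.smooth_g i j⟩

/-- The momentum components as smooth functions. -/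
def pA (hc : IsVariation ε c) (i j : Fin 3) : SmoothFn :=
  ⟨fun q => (c q.1).p q.2 i j, hc.smooth_p i j⟩

/-- The inverse metric components as smooth functions. -/
def giA (hc : IsVariation ε c) (i j : Fin 3) : SmoothFn :=
  ⟨fun q => ((c q.1).g q.2)⁻¹ i j,
    contDiff_inv_apply (M := fun q => (c q.1).g q.2) hc.smooth_g (fun q => (hc.det_pos q).ne') i j⟩

/-- The square root of the determinant as a smooth function. -/
def sA (hc : IsVariation ε c) : SmoothFn :=
  ⟨fun q => sqrtDet (c q.1).g q.2,
    (contDiff_det (M := fun q => (c q.1).g q.2) hc.smooth_g).sqrt fun q => (hc.det_pos q).ne'⟩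

/-- The inverse of `sA`. -/
def siA (hc : IsVariation ε c) : SmoothFn :=
  ⟨fun q => (sqrtDet (c q.1).g q.2)⁻¹,
    (smooth_contDiff hc.sA).inv fun q => (Real.sqrt_pos.2 (hc.det_pos q)).ne'⟩

/-- Jacobi's formula: the derivative of det g is its contraction with the cofactors, which are det g
times the inverse metric. The statement follows by differentiating s² = det g and multiplying by the
inverse of s. -/
theorem deriv_sA (hc : IsVariation ε c) (δ : Derivation ℝ SmoothFn SmoothFn) :
    2 * δ hc.sA = hc.sA * ∑ i, ∑ j, hc.giA i j * δ (hc.gA i j) := by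
  set g := hc.gA with hg
  set d : SmoothFn := g 0 0 * g 1 1 * g 2 2 - g 0 0 * g 1 2 * g 2 1 - g 0 1 * g 1 0 * g 2 2
    + g 0 1 * g 1 2 * g 2 0 + g 0 2 * g 1 0 * g 2 1 - g 0 2 * g 1 1 * g 2 0 with hd
  have hdet (q : PSpace) : ev q d = ((c q.1).g q.2).det := by
    rw [Matrix.det_fin_three]
    simp only [hd, map_add, map_sub, map_mul]; rfl
  have hss : hc.sA * hc.sA = d := ev_ext fun q => by
    rw [map_mul, hdet]; exact Real.mul_self_sqrt (hc.det_pos q).le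
  have hadj (i j : Fin 3) : ∀ q, ev q (d * hc.giA i j) = ((c q.1).g q.2).adjugate i j := by
    intro q
    rw [map_mul, hdet]
    change _ * ((c q.1).g q.2)⁻¹ i j = _
    rw [Matrix.inv_def, Ring.inverse_eq_inv', Matrix.smul_apply, smul_eq_mul,
      mul_inv_cancel_left₀ (hc.det_pos q).ne']
  have hsi : hc.sA * hc.siA = 1 := ev_ext fun q => by
    rw [map_mul, map_one]
    exact mul_inv_cancel₀ (Real.sqrt_pos.2 (hc.det_pos q)).ne'
  have e00 : d * hc.giA 0 0 = g 1 1 * g 2 2 - g 1 2 * g 2 1 := ev_ext fun q => by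
    rw [hadj, Matrix.adjugate_fin_three]; simp [hg]; rfl
  have e01 : d * hc.giA 0 1 = -(g 0 1 * g 2 2) + g 0 2 * g 2 1 := ev_ext fun q => by
    rw [hadj, Matrix.adjugate_fin_three]; simp [hg]; rfl
  have e02 : d * hc.giA 0 2 = g 0 1 * g 1 2 - g 0 2 * g 1 1 := ev_ext fun q => by
    rw [hadj, Matrix.adjugate_fin_three]; simp [hg]; rfl
  have e10 : d * hc.giA 1 0 = -(g 1 0 * g 2 2) + g 1 2 * g 2 0 := ev_ext fun q => by
    rw [hadj, Matrix.adjugate_fin_three]; simp [hg]; rfl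
  have e11 : d * hc.giA 1 1 = g 0 0 * g 2 2 - g 0 2 * g 2 0 := ev_ext fun q => by
    rw [hadj, Matrix.adjugate_fin_three]; simp [hg]; rfl
  have e12 : d * hc.giA 1 2 = -(g 0 0 * g 1 2) + g 0 2 * g 1 0 := ev_ext fun q => by
    rw [hadj, Matrix.adjugate_fin_three]; simp [hg]; rfl
  have e20 : d * hc.giA 2 0 = g 1 0 * g 2 1 - g 1 1 * g 2 0 := ev_ext fun q => by
    rw [hadj, Matrix.adjugate_fin_three]; simp [hg]; rfl
  have e21 : d * hc.giA 2 1 = -(g 0 0 * g 2 1) + g 0 1 * g 2 0 := ev_ext fun q => by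
    rw [hadj, Matrix.adjugate_fin_three]; simp [hg]; rfl
  have e22 : d * hc.giA 2 2 = g 0 0 * g 1 1 - g 0 1 * g 1 0 := ev_ext fun q => by
    rw [hadj, Matrix.adjugate_fin_three]; simp [hg]; rfl
  have gs (i j : Fin 3) : g i j = g j i := ev_ext fun q => hc.g_symm q.1 q.2 i j
  have hδd : δ d = d * ∑ i, ∑ j, hc.giA i j * δ (g i j) := by
    have : d * ∑ i, ∑ j, hc.giA i j * δ (g i j)
        = ∑ i, ∑ j, (d * hc.giA i j) * δ (g i j) := by
      simp only [Finset.mul_sum, mul_assoc]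
    rw [this]
    simp only [Fin.sum_univ_three, e00, e01, e02, e10, e11, e12, e20, e21, e22]
    simp only [hd, map_add, map_sub, Derivation.leibniz, smul_eq_mul, gs 1 0, gs 2 0, gs 2 1]
    ring
  have h2 := congrArg δ hss
  simp only [Derivation.leibniz, smul_eq_mul] at h2
  rw [hδd] at h2
  linear_combination hc.siA * h2 - hc.siA * (∑ i, ∑ j, hc.giA i j * δ (g i j)) * hss
    + (hc.sA * (∑ i, ∑ j, hc.giA i j * δ (g i j)) - 2 * δ hc.sA) * hsi

/-- The geometry along a variation. -/
def geom (hc : IsVariation ε c) : Geom SmoothFn where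
  D i := smD (ex i)
  comm i j a := smD_comm _ _ a
  g := hc.gA
  gi := hc.giA
  s := hc.sA
  si := hc.siA
  g_symm i j := ev_ext fun q => hc.g_symm q.1 q.2 i j
  gi_symm i j := ev_ext fun q => by
    have h : (((c q.1).g q.2)⁻¹).IsHermitian := ((hc.mem q.1).posDef_g q.2).1.inv
    have h2 : ((c q.1).g q.2)⁻¹ i j = ((c q.1).g q.2)⁻¹ j i := by simpa using (h.apply i j).symm
    exact h2
  gi_g i j := ev_ext fun q => by
    have h : ((c q.1).g q.2)⁻¹ * (c q.1).g q.2 = 1 :=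
      Matrix.nonsing_inv_mul _ (hc.det_pos q).ne'.isUnit
    have h2 := congrFun (congrFun h i) j
    rw [Matrix.mul_apply, Matrix.one_apply] at h2
    rw [map_sum, apply_ite (ev q), map_one, map_zero, ← h2]
    rfl
  s_si := ev_ext fun q => by
    rw [map_mul, map_one]
    exact mul_inv_cancel₀ (Real.sqrt_pos.2 (hc.det_pos q)).ne'
  D_s k := hc.deriv_sA _

theorem pA_symm (hc : IsVariation ε c) (i j : Fin 3) : hc.pA i j = hc.pA j i :=
  ev_ext fun q => hc.p_symm q.1 q.2 i j

end IsVariation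

end

section

/-! ### Geometric quantities of a variation as smooth functions -/

variable {ε : ℝ} {c : ℝ → Fields} {χ : Smearing}

theorem ev_half (q : PSpace) : ev q (Geom.half SmoothFn) = 1 / 2 :=
  (ev q).commutes _

namespace IsVariation

variable (hc : IsVariation ε c) (s : ℝ) (x : Space)

theorem ev_g (i j : Fin 3) : ev (s, x) (hc.geom.g i j) = (c s).g x i j := rfl

theorem ev_gi (i j : Fin 3) : ev (s, x) (hc.geom.gi i j) = ((c s).g x)⁻¹ i j := rfl

theorem ev_s : ev (s, x) hc.geom.s = sqrtDet (c s).g x := rfl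

theorem ev_si : ev (s, x) hc.geom.si = (sqrtDet (c s).g x)⁻¹ := rfl

theorem ev_p (i j : Fin 3) : ev (s, x) (hc.pA i j) = (c s).p x i j := rfl

theorem ev_D (i : Fin 3) (F : SmoothFn) :
    ev (s, x) (hc.geom.D i F) = pd i (fun y => ev (s, y) F) x := (pd_ev i F s x).symm

theorem christoffel_eq (k i j : Fin 3) :
    christoffel (c s).g k i j x = ev (s, x) (hc.geom.Γ k i j) := by
  simp only [Geom.Γ, map_mul, map_sum, map_add, map_sub, ev_half, ev_D, ev_g, ev_gi, christoffel]

theorem ricci_eq (i j : Fin 3) : ricci (c s).g x i j = ev (s, x) (hc.geom.ric i j) := by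
  simp only [Geom.ric, map_mul, map_sum, map_add, map_sub, ev_D, ricci, ← christoffel_eq]

theorem scalarCurv_eq : scalarCurv (c s).g x = ev (s, x) hc.geom.R := by
  simp only [Geom.R, map_mul, map_sum, ev_gi, ← ricci_eq, scalarCurv, Matrix.trace,
    Matrix.diag_apply, Matrix.mul_apply]
  refine Finset.sum_congr rfl fun i _ => Finset.sum_congr rfl fun j _ => ?_
  rw [hc.ricci_eq, hc.ricci_eq, hc.geom.ric_symm]

theorem up_eq (T : Fin 3 → Fin 3 → SmoothFn) (M : Mat) (hM : ∀ i j, M i j = ev (s, x) (T i j))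
    (i j : Fin 3) : (((c s).g x)⁻¹ * M * ((c s).g x)⁻¹) i j = ev (s, x) (hc.geom.up T i j) := by
  simp only [Geom.up, map_mul, map_sum, ev_gi, ← hM, Matrix.mul_apply, Finset.sum_mul]
  rw [Finset.sum_comm]

theorem ricciUp_eq (i j : Fin 3) :
    ricciUp (c s).g x i j = ev (s, x) (hc.geom.up hc.geom.ric i j) :=
  hc.up_eq s x _ _ (hc.ricci_eq s x) i j

theorem hess_eq (α : SmoothFn) (φ : Space → ℝ) (hφ : ∀ y, φ y = ev (s, y) α) (i j : Fin 3) :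
    hess (c s).g φ x i j = ev (s, x) (hc.geom.hess α i j) := by
  have h : φ = fun y => ev (s, y) α := funext hφ
  have h2 (j : Fin 3) : pd j φ = fun y => ev (s, y) (hc.geom.D j α) := by
    funext y; rw [hc.ev_D, ← h]
  simp only [Geom.hess, map_sub, map_sum, map_mul, ← christoffel_eq, hess, h2]
  rw [hc.ev_D s x i]

theorem laplace_eq (α : SmoothFn) (φ : Space → ℝ) (hφ : ∀ y, φ y = ev (s, y) α) :
    laplace (c s).g φ x = ev (s, x) (hc.geom.tr (hc.geom.hess α)) := by
  have hs (i j : Fin 3) : hc.geom.hess α i j = hc.geom.hess α j i := by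
    unfold Geom.hess
    rw [hc.geom.comm i j, Finset.sum_congr rfl fun m _ => by rw [hc.geom.Γ_symm m i j]]
  simp only [laplace, Matrix.trace, Matrix.diag_apply, Matrix.mul_apply, Geom.tr, map_sum,
    map_mul, ev_gi]
  refine Finset.sum_congr rfl fun i _ => Finset.sum_congr rfl fun j _ => ?_
  rw [hc.hess_eq s x α φ hφ, hs]

theorem hessUp_eq (α : SmoothFn) (φ : Space → ℝ) (hφ : ∀ y, φ y = ev (s, y) α) (i j : Fin 3) :
    hessUp (c s).g φ x i j = ev (s, x) (hc.geom.up (hc.geom.hess α) i j) :=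
  hc.up_eq s x _ _ (hc.hess_eq s x α φ hφ) i j

theorem mix_eq (i j : Fin 3) :
    ((c s).g x * (c s).p x) i j = ev (s, x) (hc.geom.mix hc.pA i j) := by
  simp only [Geom.mix, map_sum, map_mul, ev_g, ev_p, Matrix.mul_apply]

theorem trMom_eq : trMom (c s).g (c s).p x = ev (s, x) (hc.geom.trP hc.pA) := by
  simp only [trMom, Geom.trP, map_sum, ← mix_eq, Matrix.trace, Matrix.diag_apply]

theorem kin_eq : sqMom (c s).g (c s).p x - 1 / 2 * trMom (c s).g (c s).p x ^ 2
    = ev (s, x) (hc.geom.kin hc.pA) := by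
  simp only [Geom.kin, map_sub, map_sum, map_mul, map_pow, ev_half, trMom_eq hc]
  congr 1

theorem constraintC_eq : constraintC (c s).g (c s).p x = ev (s, x) (hc.geom.C hc.pA) := by
  rw [constraintC, hc.kin_eq, hc.scalarCurv_eq, Geom.C, map_sub, map_mul, map_mul, ev_si, ev_s,
    div_eq_mul_inv]

theorem constraintV_eq (j : Fin 3) :
    constraintV (c s).g (c s).p x j = ev (s, x) (hc.geom.Cv hc.pA j) := by
  simp only [constraintV, Geom.Cv, map_mul, map_neg, map_sum, map_add, map_ofNat, ev_g, ev_D,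
    ev_p, hc.christoffel_eq]

/-- The squared Hamiltonian density as a smooth function. -/
def hamSqA : SmoothFn := hc.geom.C hc.pA ^ 2
    - ∑ i, ∑ j, hc.geom.gi i j * hc.geom.Cv hc.pA i * hc.geom.Cv hc.pA j

theorem hamSq_eq : hamSq (c s).g (c s).p x = ev (s, x) hc.hamSqA := by
  simp only [hamSq, hamSqA, hc.constraintC_eq, hc.constraintV_eq, map_sub, map_pow, map_sum,
    map_mul, ev_gi]

theorem contDiff_hamSq (hc : IsVariation ε c) :
    ContDiff ℝ ∞ fun q : PSpace => hamSq (c q.1).g (c q.1).p q.2 := by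
  have h : (fun q : PSpace => hamSq (c q.1).g (c q.1).p q.2) = hc.hamSqA.1 := by
    funext ⟨s, x⟩
    exact (hc.hamSq_eq s x).trans (ev_apply (s, x) hc.hamSqA)
  exact (congrArg (ContDiff ℝ ∞) h).mpr (smooth_contDiff hc.hamSqA)

/-- The physical Hamiltonian density as a smooth function. -/
def hamA : SmoothFn := ⟨fun q => hamDensity (c q.1).g (c q.1).p q.2,
  hc.contDiff_hamSq.sqrt fun q => ((hc.mem q.1).dust_ham q.2).ne'⟩

theorem ham_pos (hc : IsVariation ε c) (q : PSpace) : 0 < hamDensity (c q.1).g (c q.1).p q.2 :=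
  Real.sqrt_pos.2 ((hc.mem q.1).dust_ham q.2)

/-- The inverse of the physical Hamiltonian density. -/
def hamInvA : SmoothFn := ⟨fun q => (hamDensity (c q.1).g (c q.1).p q.2)⁻¹,
  (smooth_contDiff hc.hamA).inv fun q => (hc.ham_pos q).ne'⟩

theorem ev_ham : ev (s, x) hc.hamA = hamDensity (c s).g (c s).p x := rfl

theorem isHam : hc.geom.IsHam hc.pA hc.hamA hc.hamInvA where
  sq := ev_ext fun ⟨s, x⟩ => by
    change _ = ev (s, x) hc.hamSqA
    rw [map_mul, ← hc.hamSq_eq]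
    exact Real.mul_self_sqrt ((hc.mem s).dust_ham x).le
  inv := ev_ext fun q => by
    rw [map_mul, map_one]; exact mul_inv_cancel₀ (hc.ham_pos q).ne'

/-- The lapse as a smooth function. -/
abbrev NA : SmoothFn := hc.geom.N hc.pA hc.hamInvA

/-- The shift as smooth functions. -/
abbrev NvA : Fin 3 → SmoothFn := hc.geom.Nv hc.pA hc.hamInvA

theorem lapse_eq : lapse (c s).g (c s).p x = ev (s, x) hc.NA := by
  rw [lapse, NA, Geom.N, map_mul, hc.constraintC_eq, div_eq_mul_inv]; rfl

theorem shift_eq (i : Fin 3) : shift (c s).g (c s).p x i = ev (s, x) (hc.NvA i) := by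
  rw [shift, NvA, Geom.Nv, map_mul, map_neg, map_sum, div_eq_mul_inv]
  simp only [hc.constraintV_eq, map_mul, ev_gi]; rfl

end IsVariation

namespace Smearing.IsAdmissible

/-- The smearing function as a smooth function. -/
def ξA (hχ : χ.IsAdmissible) : SmoothFn := pullback χ.ξ hχ.smooth_ξ

/-- The smearing vector as smooth functions. -/
def ξvA (hχ : χ.IsAdmissible) (i : Fin 3) : SmoothFn := pullback (fun x => χ.ξv x i) (hχ.smooth_ξv i)

theorem ev_ξ (hχ : χ.IsAdmissible) (s : ℝ) (x : Space) : ev (s, x) hχ.ξA = χ.ξ x := rfl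

theorem ev_ξv (hχ : χ.IsAdmissible) (s : ℝ) (x : Space) (i : Fin 3) :
    ev (s, x) (hχ.ξvA i) = χ.ξv x i := rfl

end Smearing.IsAdmissible

namespace IsVariation

variable (hc : IsVariation ε c) (hχ : χ.IsAdmissible) (s : ℝ) (x : Space)

theorem tildeξ_eq : tildeξ χ (c s).g (c s).p x = ev (s, x) (hχ.ξA * hc.NA) := by
  rw [tildeξ, hc.lapse_eq, map_mul]; rfl

theorem tildeξv_eq (i : Fin 3) :
    tildeξv χ (c s).g (c s).p x i = ev (s, x) (hχ.ξA * hc.NvA i) := by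
  rw [tildeξv, hc.shift_eq, map_mul]; rfl

/-- The charge density as a smooth function. -/
def chargeA : SmoothFn := hχ.ξA * hc.hamA + ∑ i, hχ.ξvA i * hc.geom.Cv hc.pA i

theorem chargeDensity_eq : chargeDensity χ (c s) x = ev (s, x) (hc.chargeA hχ) := by
  simp only [chargeDensity, chargeA, map_add, map_mul, map_sum, hc.constraintV_eq, hχ.ev_ξ,
    hχ.ev_ξv, hc.ev_ham]

theorem lieMetric_eq (u : Space → Fin 3 → ℝ) (uA : Fin 3 → SmoothFn)
    (hu : ∀ y i, u y i = ev (s, y) (uA i)) (i j : Fin 3) :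
    lieMetric u (c s).g x i j = ev (s, x) (hc.geom.lieG uA i j) := by
  simp only [lieMetric, Geom.lieG, map_sum, map_add, map_mul, ev_D, ev_g, hu]

theorem lieMom_eq (u : Space → Fin 3 → ℝ) (uA : Fin 3 → SmoothFn)
    (hu : ∀ y i, u y i = ev (s, y) (uA i)) (i j : Fin 3) :
    lieMom u (c s).p x i j = ev (s, x) (hc.geom.lieP hc.pA uA i j) := by
  simp only [lieMom, Geom.lieP, map_sum, map_sub, map_mul, ev_D, ev_p, hu]

theorem bulkG_eq (i j : Fin 3) : bulkG χ (c s).g (c s).p x i j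
    = ev (s, x) (hc.geom.bulkGA hc.pA hc.hamInvA hχ.ξA hχ.ξvA i j) := by
  simp only [bulkG, Matrix.add_apply, Matrix.smul_apply, smul_eq_mul, Matrix.sub_apply,
    hc.lieMetric_eq s x χ.ξv hχ.ξvA fun _ _ => rfl,
    hc.lieMetric_eq s x _ _ fun y => hc.tildeξv_eq hχ s y,
    Geom.bulkGA, map_add, Geom.GA, map_mul, map_sub, ev_half, ev_si, ev_g, map_ofNat,
    ← hc.trMom_eq, hc.tildeξ_eq hχ]
  have : ((c s).g x * (c s).p x * (c s).g x) i j = ev (s, x) (hc.geom.pLow hc.pA i j) := by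
    simp only [Geom.pLow, map_sum, map_mul, ev_g, ev_p, Matrix.mul_apply, Finset.sum_mul]
    rw [Finset.sum_comm]
  rw [this]; ring

theorem bulkF_eq (i j : Fin 3) : bulkF χ (c s).g (c s).p x i j
    = ev (s, x) (hc.geom.bulkFA hc.pA hc.hamA hc.hamInvA hχ.ξA hχ.ξvA i j) := by
  have h1 : ((c s).p x * (c s).g x * (c s).p x) i j = ev (s, x) (hc.geom.pp hc.pA i j) := by
    simp only [Geom.pp, map_sum, map_mul, ev_g, ev_p, Matrix.mul_apply, Finset.sum_mul]
    rw [Finset.sum_comm]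
  simp only [bulkF, Matrix.add_apply, Matrix.smul_apply, smul_eq_mul, Matrix.sub_apply,
    Matrix.neg_apply, Matrix.vecMulVec_apply,
    h1]
  rw [hc.kin_eq]
  simp only [hc.lieMom_eq s x χ.ξv hχ.ξvA fun _ _ => rfl,
    hc.lieMom_eq s x _ _ fun y => hc.tildeξv_eq hχ s y,
    hc.hessUp_eq s x _ _ fun y => hc.tildeξ_eq hχ s y,
    hc.laplace_eq s x _ _ fun y => hc.tildeξ_eq hχ s y,
    hc.ricciUp_eq, hc.scalarCurv_eq, hc.trMom_eq, hc.tildeξ_eq hχ, hc.shift_eq]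
  simp only [Geom.bulkFA, map_add, Geom.FA, map_mul, map_sub, map_neg, ev_half, ev_si, ev_s,
    map_ofNat, ev_gi, ev_p, hχ.ev_ξ, hc.ev_ham]
  ring

/-- The variation of the metric as smooth functions. -/
def varGA (i j : Fin 3) : SmoothFn := smD es (hc.gA i j)

/-- The variation of the momentum as smooth functions. -/
def varPA (i j : Fin 3) : SmoothFn := smD es (hc.pA i j)

theorem varG_eq (i j : Fin 3) : varG c x i j = ev (0, x) (hc.varGA i j) :=
  (hasDerivAt_ev (hc.gA i j) 0 x).deriv

theorem varP_eq (i j : Fin 3) : varP c x i j = ev (0, x) (hc.varPA i j) :=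
  (hasDerivAt_ev (hc.pA i j) 0 x).deriv

theorem varGamma_eq (k i j : Fin 3) :
    varGamma c k i j x = ev (0, x) (hc.geom.dΓ hc.varGA k i j) := by
  have h := (hasDerivAt_ev (hc.geom.Γ k i j) 0 x).deriv
  simp only [← hc.christoffel_eq] at h
  rw [varGamma, h, hc.geom.deriv_Γ (smD es) (fun _ _ => smD_comm _ _ _)]
  rfl

theorem varMixed_eq (i : Fin 3) : varMixed c i x = ∑ j, radialVec x j *
    ev (0, x) (∑ k, (hc.varPA j k * hc.gA k i + hc.pA j k * hc.varGA k i)) := by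
  have h : HasDerivAt (fun s => ∑ j, ∑ k, radialVec x j * (c s).p x j k * (c s).g x i k)
      (∑ j, ∑ k, (radialVec x j * ev (0, x) (hc.varPA j k) * (c 0).g x i k
        + radialVec x j * (c 0).p x j k * ev (0, x) (hc.varGA i k))) 0 := by
    refine HasDerivAt.fun_sum fun j _ => HasDerivAt.fun_sum fun k _ => ?_
    exact ((hasDerivAt_ev (hc.pA j k) 0 x).const_mul _).mul (hasDerivAt_ev (hc.gA i k) 0 x)
  rw [varMixed, h.deriv]
  refine Finset.sum_congr rfl fun j _ => ?_
  rw [map_sum, Finset.mul_sum]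
  refine Finset.sum_congr rfl fun k _ => ?_
  have e : hc.varGA i k = hc.varGA k i := by
    unfold varGA; rw [show hc.gA i k = hc.gA k i from hc.geom.g_symm i k]
  rw [map_add, map_mul, map_mul, e, hc.g_symm 0 x i k]
  change _ = _ * (_ * (c 0).g x k i + (c 0).p x j k * _)
  ring

theorem gradPairing_eq : gradPairing (fun x => -bulkF χ (c 0).g (c 0).p x)
    (bulkG χ (c 0).g (c 0).p) c x
    = ev (0, x) (∑ i, ∑ j, (-hc.geom.bulkFA hc.pA hc.hamA hc.hamInvA hχ.ξA hχ.ξvA i j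
        * hc.varGA i j
        + hc.geom.bulkGA hc.pA hc.hamInvA hχ.ξA hχ.ξvA i j * hc.varPA i j)) := by
  simp only [gradPairing, Matrix.neg_apply, hc.bulkF_eq hχ, hc.bulkG_eq hχ, hc.varG_eq, hc.varP_eq,
    map_sum, map_add, map_mul, map_neg]

/-- The boundary flux of the variation of the charge density. -/
def fluxA (k : Fin 3) : SmoothFn :=
  hc.geom.flux hc.pA hc.hamInvA hχ.ξA hχ.ξvA hc.varGA hc.varPA k

/-- The integrand of 𝒦_R is the radial component of the algebraic flux. Hence the divergence theorem
applies to it. -/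
theorem boundaryDensity_eq :
    boundaryDensity χ c x = ∑ k, radialVec x k * ev (0, x) (hc.fluxA hχ k) := by
  have hD (a : Fin 3) : pd a (tildeξ χ (c 0).g (c 0).p) x
      = ev (0, x) (hc.geom.D a (hχ.ξA * hc.NA)) := by
    rw [hc.ev_D]; congr 1; funext y; exact hc.tildeξ_eq hχ 0 y
  have hg (a b : Fin 3) : ((c 0).g x)⁻¹ a b = ((c 0).g x)⁻¹ b a := by
    rw [← hc.ev_gi, ← hc.ev_gi, hc.geom.gi_symm]
  have hq (a b : Fin 3) : ev (0, x) (hc.varGA a b) = ev (0, x) (hc.varGA b a) := by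
    unfold varGA; rw [show hc.gA a b = hc.gA b a from hc.geom.g_symm a b]
  simp only [boundaryDensity, hD, hc.varMixed_eq, hc.varG_eq, hc.varGamma_eq, hc.tildeξ_eq hχ,
    hc.tildeξv_eq hχ, fluxA, Geom.flux, Geom.VM, Geom.VA, Geom.gradFlux, Geom.palatini, Geom.up,
    Geom.tr, map_add, map_sub, map_mul, map_sum, map_neg, map_ofNat, ev_gi, ev_s, ev_p]
  simp only [Fin.sum_univ_three, hg 1 0, hg 2 0, hg 2 1, hq 1 0, hq 2 0, hq 2 1]
  simp only [show ∀ i, χ.ξv x i = ev (0, x) (hχ.ξvA i) from fun _ => rfl,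
    show ∀ i j, hc.geom.g i j = hc.gA i j from fun _ _ => rfl]
  ring

/-- The variation of the charge density is the bulk integrand plus a divergence. -/
theorem deriv_chargeA : smD es (hc.chargeA hχ)
    = ∑ i, ∑ j, (-hc.geom.bulkFA hc.pA hc.hamA hc.hamInvA hχ.ξA hχ.ξvA i j * hc.varGA i j
        + hc.geom.bulkGA hc.pA hc.hamInvA hχ.ξA hχ.ξvA i j * hc.varPA i j)
      + ∑ k, smD (ex k) (hc.fluxA hχ k) :=
  hc.geom.deriv_density hc.isHam hc.pA_symm (smD es) (fun _ _ => smD_comm _ _ _)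
    (hc.deriv_sA _) hχ.ξA hχ.ξvA (smD_es_pullback _ _) (fun _ => smD_es_pullback _ _)

end IsVariation

end

section

/-! ### Polar coordinates -/

open Metric Set in
theorem integral_eq_polar {F : Space → ℝ} (hF : Integrable F) :
    ∫ x, F x = ∫ r in Ioi (0 : ℝ), r ^ 2 * sphereInt (fun n => F (r • n)) := by
  set μ : Measure Space := volume
  have hdim : Module.finrank ℝ Space - 1 = 2 := by simp
  have hm : MeasurableSet ({0}ᶜ : Set Space) := (measurableSet_singleton _).compl
  set G : sphere (0 : Space) 1 × Ioi (0 : ℝ) → ℝ := fun p => F (p.2.1 • p.1.1) with hG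
  have hGF (x : ({0}ᶜ : Set Space)) : G (homeomorphUnitSphereProd Space x) = F x := by
    simp only [hG]
    rw [← homeomorphUnitSphereProd_symm_apply_coe, Homeomorph.symm_apply_apply]
  have hmp := μ.measurePreserving_homeomorphUnitSphereProd
  rw [hdim] at hmp
  have hint : Integrable G (μ.toSphere.prod (.volumeIoiPow 2)) := by
    rw [← hmp.integrable_comp_emb (Homeomorph.measurableEmbedding _)]
    have : G ∘ homeomorphUnitSphereProd Space = F ∘ Subtype.val := funext hGF
    rw [this, ← integrableOn_iff_comap_subtypeVal hm]
    exact hF.integrableOn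
  calc
    ∫ x, F x = ∫ x : ({0}ᶜ : Set Space), F x ∂(μ.comap (↑)) := by
      rw [integral_subtype_comap hm F, restrict_compl_singleton]
    _ = ∫ p, G p ∂μ.toSphere.prod (.volumeIoiPow 2) := by
      rw [← hmp.integral_comp (Homeomorph.measurableEmbedding _) G]
      exact integral_congr_ae (.of_forall fun x => (hGF x).symm)
    _ = ∫ r : Ioi (0 : ℝ), sphereInt (fun n => F (r.1 • n)) ∂.volumeIoiPow 2 :=
      integral_prod_symm _ hint
    _ = _ := by
      simp only [Measure.volumeIoiPow, ENNReal.ofReal]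
      rw [integral_withDensity_eq_integral_smul,
        integral_subtype_comap measurableSet_Ioi fun a =>
          Real.toNNReal (a ^ 2) • sphereInt (fun n => F (a • n)),
        setIntegral_congr_fun measurableSet_Ioi fun x hx ↦ ?_]
      · simp only [NNReal.smul_def, smul_eq_mul]
        rw [Real.coe_toNNReal _ (pow_nonneg (mem_Ioi.1 hx).le _)]
      · exact (measurable_subtype_coe.pow_const _).real_toNNReal

/-! ### Calculus on the sphere -/

instance : CompactSpace (Metric.sphere (0 : Space) 1) :=
  isCompact_iff_compactSpace.1 (isCompact_sphere _ _)

theorem sphere_ne_zero (n : Metric.sphere (0 : Space) 1) : (n : Space) ≠ 0 :=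
  ne_zero_of_mem_unit_sphere n

theorem sphere_norm (n : Metric.sphere (0 : Space) 1) : ‖(n : Space)‖ = 1 := by simp

theorem sphereIntegrable_of_continuousOn {F : Space → ℝ} (hF : ContinuousOn F {0}ᶜ) :
    SphereIntegrable F := by
  have : Continuous fun n : Metric.sphere (0 : Space) 1 => F n :=
    hF.comp_continuous continuous_subtype_val fun n => sphere_ne_zero n
  exact this.integrable_of_hasCompactSupport (HasCompactSupport.of_compactSpace _)

theorem sphereInt_add {F G : Space → ℝ} (hF : SphereIntegrable F) (hG : SphereIntegrable G) :
    sphereInt (fun n => F n + G n) = sphereInt F + sphereInt G := integral_add hF hG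

theorem SphereIntegrable.const_mul {F : Space → ℝ} (hF : SphereIntegrable F) (a : ℝ) :
    SphereIntegrable (fun n => a * F n) := Integrable.const_mul hF a

theorem sphereInt_const_mul (a : ℝ) (F : Space → ℝ) :
    sphereInt (fun n => a * F n) = a * sphereInt F := integral_const_mul a _

theorem sphereInt_congr {F G : Space → ℝ} (h : ∀ n, ‖n‖ = 1 → F n = G n) :
    sphereInt F = sphereInt G :=
  integral_congr_ae (.of_forall fun n => h n (sphere_norm n))

theorem fderiv_eq_sum_pd (φ : Space → ℝ) (x v : Space) :
    fderiv ℝ φ x v = ∑ i, v i * pd i φ x := by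
  conv_lhs => rw [← (EuclideanSpace.basisFun (Fin 3) ℝ).sum_repr v]
  simp [pd]

theorem pd_mul {φ ψ : Space → ℝ} {x : Space} (hφ : DifferentiableAt ℝ φ x)
    (hψ : DifferentiableAt ℝ ψ x) (i : Fin 3) :
    pd i (fun y => φ y * ψ y) x = pd i φ x * ψ x + φ x * pd i ψ x := by
  unfold pd
  rw [fderiv_fun_mul hφ hψ]
  simp; ring

theorem hasFDerivAt_norm {x : Space} (hx : x ≠ 0) :
    HasFDerivAt (fun y : Space => ‖y‖) (‖x‖⁻¹ • innerSL ℝ x) x := by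
  have hn : ‖x‖ ≠ 0 := norm_ne_zero_iff.2 hx
  have h := ((hasStrictFDerivAt_norm_sq x).hasFDerivAt).sqrt (by positivity)
  have e : (fun y : Space => √(‖y‖ ^ 2)) = fun y => ‖y‖ := by
    funext y; exact Real.sqrt_sq (norm_nonneg y)
  rw [e, Real.sqrt_sq (norm_nonneg x)] at h
  refine h.congr_fderiv ?_
  ext v
  simp
  field_simp

theorem pd_norm {x : Space} (hx : x ≠ 0) (i : Fin 3) :
    pd i (fun y => ‖y‖) x = x i / ‖x‖ := by
  unfold pd
  rw [(hasFDerivAt_norm hx).fderiv]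
  simp [EuclideanSpace.inner_single_right]
  field_simp

theorem norm_sq_eq_sum (x : Space) : ∑ i, x i * x i = ‖x‖ ^ 2 := by
  rw [EuclideanSpace.norm_sq_eq]
  simp [pow_two]

theorem norm_mul_radialVec {x : Space} (hx : x ≠ 0) (i : Fin 3) : ‖x‖ * radialVec x i = x i := by
  have : ‖x‖ ≠ 0 := norm_ne_zero_iff.2 hx
  unfold radialVec; field_simp

theorem sum_radialVec_sq {x : Space} (hx : x ≠ 0) : ∑ i, radialVec x i * radialVec x i = 1 := by
  have h : ‖x‖ ^ 2 ≠ 0 := pow_ne_zero _ (norm_ne_zero_iff.2 hx)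
  have e : ∑ i, radialVec x i * radialVec x i = (∑ i, x i * x i) / ‖x‖ ^ 2 := by
    rw [Finset.sum_div]
    exact Finset.sum_congr rfl fun i _ => by rw [radialVec]; ring
  rw [e, norm_sq_eq_sum, div_self h]

theorem radialVec_of_norm_one {x : Space} (hx : ‖x‖ = 1) (i : Fin 3) : radialVec x i = x i := by
  simp [radialVec, hx]

theorem radialVec_smul {t : ℝ} (ht : 0 < t) (x : Space) : radialVec (t • x) = radialVec x := by
  funext i
  have : ‖t • x‖ = t * ‖x‖ := by rw [norm_smul, Real.norm_of_nonneg ht.le]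
  simp only [radialVec, this, PiLp.smul_apply, smul_eq_mul]
  exact mul_div_mul_left _ _ ht.ne'

/-- Radial projection to the unit sphere. -/
def unitVec (x : Space) : Space := ‖x‖⁻¹ • x

theorem unitVec_apply (x : Space) (i : Fin 3) : unitVec x i = radialVec x i := by
  simp [unitVec, radialVec, div_eq_inv_mul]

theorem unitVec_ne_zero {x : Space} (hx : x ≠ 0) : unitVec x ≠ 0 :=
  smul_ne_zero (inv_ne_zero (norm_ne_zero_iff.2 hx)) hx

theorem norm_unitVec {x : Space} (hx : x ≠ 0) : ‖unitVec x‖ = 1 := norm_smul_inv_norm (𝕜 := ℝ) hx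

theorem unitVec_smul {t : ℝ} (ht : 0 < t) (x : Space) : unitVec (t • x) = unitVec x := by
  ext i; rw [unitVec_apply, unitVec_apply, radialVec_smul ht]

theorem contDiffAt_unitVec {x : Space} (hx : x ≠ 0) : ContDiffAt ℝ ∞ unitVec x :=
  ((contDiffAt_norm ℝ hx).inv (norm_ne_zero_iff.2 hx)).smul contDiffAt_id

theorem isSphereFun_radialVec (i : Fin 3) : IsSphereFun (fun x => radialVec x i) := by
  refine ⟨fun x hx => ContDiffAt.contDiffWithinAt ?_, fun t ht x => congrFun (radialVec_smul ht x) i⟩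
  have : ContDiffAt ℝ ∞ (fun y => unitVec y i) x :=
    contDiffAt_euclidean.1 (contDiffAt_unitVec hx) i
  simpa only [unitVec_apply] using this

theorem contDiffAt_of_off {φ : Space → ℝ} (hφ : ContDiffOn ℝ ∞ φ {0}ᶜ) {x : Space} (hx : x ≠ 0) :
    ContDiffAt ℝ ∞ φ x := hφ.contDiffAt (isOpen_compl_singleton.mem_nhds hx)

theorem differentiableAt_of_off {φ : Space → ℝ} (hφ : ContDiffOn ℝ ∞ φ {0}ᶜ) {x : Space}
    (hx : x ≠ 0) : DifferentiableAt ℝ φ x := (contDiffAt_of_off hφ hx).differentiableAt (by simp)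

theorem contDiffOn_pd {φ : Space → ℝ} (hφ : ContDiffOn ℝ ∞ φ {0}ᶜ) (i : Fin 3) :
    ContDiffOn ℝ ∞ (pd i φ) {0}ᶜ := fun _ hx =>
  ContDiffAt.contDiffWithinAt <|
    ((contDiffAt_of_off hφ hx).fderiv_right (m := ∞) (by simp)).clm_apply contDiffAt_const

namespace IsSphereFun

variable {φ : Space → ℝ}

theorem pd_smul (hφ : IsSphereFun φ) (i : Fin 3) {t : ℝ} (ht : 0 < t) (x : Space) :
    pd i φ (t • x) = t⁻¹ * pd i φ x := by
  have h := fderiv_comp_smul (f := φ) (x := x) t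
  have e : (fun x => φ (t • x)) = φ := funext fun x => hφ.2 t ht x
  rw [e] at h
  unfold pd
  rw [h]; simp [ht.ne']

theorem euler (hφ : IsSphereFun φ) {x : Space} (hx : x ≠ 0) : ∑ i, x i * pd i φ x = 0 := by
  rw [← fderiv_eq_sum_pd]
  have h1 : HasDerivAt (fun t : ℝ => t • x) x 1 := by
    simpa using (hasDerivAt_id (1 : ℝ)).smul_const x
  have h2 : HasFDerivAt φ (fderiv ℝ φ x) ((1 : ℝ) • x) := by
    rw [one_smul]; exact (differentiableAt_of_off hφ.1 hx).hasFDerivAt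
  have h3 := h2.comp_hasDerivAt 1 h1
  have h4 : HasDerivAt (φ ∘ fun t : ℝ => t • x) 0 1 := by
    refine (hasDerivAt_const 1 (φ x)).congr_of_eventuallyEq ?_
    filter_upwards [lt_mem_nhds (zero_lt_one (α := ℝ))] with t ht using hφ.2 t ht x
  exact h3.unique h4

end IsSphereFun

theorem integral_pd_eq_zero {φ : Space → ℝ} (h : ContDiff ℝ 1 φ) (hs : HasCompactSupport φ)
    (i : Fin 3) : ∫ x, pd i φ x = 0 := by
  have hc : Continuous (fun x => fderiv ℝ φ x (EuclideanSpace.single i 1)) :=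
    (h.continuous_fderiv one_ne_zero).clm_apply continuous_const
  have hi : Integrable (fun x => fderiv ℝ φ x (EuclideanSpace.single i 1)) :=
    hc.integrable_of_hasCompactSupport (hs.fderiv_apply ℝ _)
  have := integral_mul_fderiv_eq_neg_fderiv_mul_of_integrable (μ := (volume : Measure Space))
    (f := fun _ => (1 : ℝ)) (g := φ) (v := EuclideanSpace.single i 1) (by simp)
    (by simpa using hi) (by simpa using h.continuous.integrable_of_hasCompactSupport hs)
    (fun _ _ => differentiableAt_const _) (fun _ _ => h.differentiable one_ne_zero _)
  simpa [pd] using this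

-- Apply ∫ div = 0 to the compactly supported field ψ(r)V. In polar coordinates this reads a ∫ r²ψ'
-- + b ∫ rψ = 0, with a the flux and b the integrated divergence. Since ∫ r²ψ' = −2 ∫ rψ and ∫ rψ >
-- 0, it follows that b = 2a.
open Set in
theorem sphere_divergence_of_isSphereFun {V : Fin 3 → Space → ℝ} (hV : ∀ i, IsSphereFun (V i)) :
    sphereInt (fun n => ∑ i, pd i (V i) n) = 2 * sphereInt (fun n => ∑ i, n i * V i n) := by
  -- The cut-off lives on 1 < r < 3, away from the origin, where V need not be continuous.
  let ψ : ContDiffBump (2 : ℝ) := ⟨1 / 2, 1, by norm_num, by norm_num⟩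
  have hψ : ContDiff ℝ ∞ ψ := ψ.contDiff
  have hψ0 : ∀ r : ℝ, r ≤ 1 → ψ r = 0 := fun r hr => by
    refine ψ.zero_of_le_dist ?_
    rw [Real.dist_eq, abs_of_nonpos (by linarith)]
    change (1 : ℝ) ≤ _; linarith
  set G : Fin 3 → Space → ℝ := fun i x => ψ ‖x‖ * V i x with hG
  have hψn {x : Space} (hx : x ≠ 0) : ContDiffAt ℝ ∞ (fun y : Space => ψ ‖y‖) x :=
    hψ.contDiffAt.comp x (contDiffAt_norm ℝ hx)
  have hGc (i) : ContDiff ℝ 1 (G i) := by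
    refine contDiff_iff_contDiffAt.2 fun x => ?_
    by_cases hx : x = 0
    · refine (contDiffAt_const (c := (0 : ℝ))).congr_of_eventuallyEq ?_
      filter_upwards [Metric.ball_mem_nhds x one_pos] with y hy
      rw [hx, mem_ball_zero_iff] at hy
      simp [hG, hψ0 _ hy.le]
    · exact ((hψn hx).mul (contDiffAt_of_off (hV i).1 hx)).of_le (by norm_cast)
  have hGs (i) : HasCompactSupport (G i) := by
    refine HasCompactSupport.intro (isCompact_closedBall (0 : Space) 3) fun x hx => ?_
    have hx' : 3 < ‖x‖ := by simpa using hx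
    have : ψ ‖x‖ = 0 := ψ.zero_of_le_dist (by
      rw [Real.dist_eq, abs_of_nonneg (by linarith)]; change (1 : ℝ) ≤ _; linarith)
    simp [hG, this]
  have hpd {x : Space} (hx : x ≠ 0) (i : Fin 3) :
      pd i (G i) x = deriv ψ ‖x‖ * (radialVec x i * V i x) + ψ ‖x‖ * pd i (V i) x := by
    have h1 := pd_mul (i := i) ((hψn hx).differentiableAt (by simp))
      (differentiableAt_of_off (hV i).1 hx)
    have h2 : pd i (fun y : Space => ψ ‖y‖) x = deriv ψ ‖x‖ * (x i / ‖x‖) := by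
      have hd : HasDerivAt ψ (deriv ψ ‖x‖) ‖x‖ :=
        (hψ.differentiable (by simp) _).hasDerivAt
      have := (hd.comp_hasFDerivAt x (hasFDerivAt_norm hx)).fderiv
      rw [← pd_norm hx]
      unfold pd
      rw [show (fun y : Space => ψ ‖y‖) = ψ ∘ fun y => ‖y‖ from rfl, this,
        (hasFDerivAt_norm hx).fderiv]
      simp
    rw [hG, h1, h2, radialVec]; ring
  have hdiv : ∑ i, ∫ x, pd i (G i) x = 0 :=
    Finset.sum_eq_zero fun i _ => integral_pd_eq_zero (hGc i) (hGs i) i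
  have hi (i) : Integrable (pd i (G i)) :=
    Continuous.integrable_of_hasCompactSupport
      (((hGc i).continuous_fderiv one_ne_zero).clm_apply continuous_const)
      ((hGs i).fderiv_apply ℝ _)
  rw [← integral_finsetSum _ fun i _ => hi i,
    integral_eq_polar (integrable_finsetSum _ fun i _ => hi i)] at hdiv
  set a := sphereInt (fun n => ∑ i, n i * V i n)
  set b := sphereInt (fun n => ∑ i, pd i (V i) n)
  have hia : SphereIntegrable (fun n => ∑ i, n i * V i n) :=
    sphereIntegrable_of_continuousOn (continuousOn_finsetSum _ fun i _ =>
      (by fun_prop : Continuous fun n : Space => n i).continuousOn.mul (hV i).1.continuousOn)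
  have hib : SphereIntegrable (fun n => ∑ i, pd i (V i) n) :=
    sphereIntegrable_of_continuousOn (continuousOn_finsetSum _ fun i _ =>
      (contDiffOn_pd (hV i).1 i).continuousOn)
  have hr {r : ℝ} (hr : r ∈ Ioi (0 : ℝ)) :
      r ^ 2 * sphereInt (fun n => ∑ i, pd i (G i) (r • n))
        = r ^ 2 * deriv ψ r * a + r * ψ r * b := by
    have h1 : sphereInt (fun n => ∑ i, pd i (G i) (r • n))
        = sphereInt (fun n => deriv ψ r * (∑ i, n i * V i n)
          + ψ r * r⁻¹ * ∑ i, pd i (V i) n) := by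
      refine sphereInt_congr fun n hn => ?_
      have hn0 : n ≠ 0 := by rintro rfl; simp at hn
      have hrn : ‖r • n‖ = r := by rw [norm_smul, hn, Real.norm_of_nonneg (le_of_lt hr), mul_one]
      rw [Finset.mul_sum, Finset.mul_sum, ← Finset.sum_add_distrib]
      refine Finset.sum_congr rfl fun i _ => ?_
      rw [hpd (smul_ne_zero (ne_of_gt hr) hn0), hrn, radialVec_smul hr, radialVec_of_norm_one hn,
        (hV i).2 r hr, (hV i).pd_smul i hr]
      ring
    rw [h1, sphereInt_add (hia.const_mul _) (hib.const_mul _), sphereInt_const_mul,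
      sphereInt_const_mul]
    have : r ≠ 0 := ne_of_gt hr
    change r ^ 2 * (deriv ψ r * a + ψ r * r⁻¹ * b) = _
    field_simp
  rw [setIntegral_congr_fun measurableSet_Ioi fun r h => hr h] at hdiv
  have hψs : HasCompactSupport ψ := ψ.hasCompactSupport
  have hcd : Continuous (deriv ψ) := hψ.continuous_deriv (by simp)
  have I1 : Integrable (fun r : ℝ => r ^ 2 * deriv ψ r) :=
    (by fun_prop : Continuous fun r : ℝ => r ^ 2 * deriv ψ r).integrable_of_hasCompactSupport
      hψs.deriv.mul_left
  have I2 : Integrable (fun r : ℝ => r * ψ r) :=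
    ((by fun_prop : Continuous fun r : ℝ => r).mul ψ.continuous).integrable_of_hasCompactSupport
      hψs.mul_left
  -- The integral of the derivative of r²ψ, which has compact support and vanishes at r = 0.
  have hz : ∫ r in Ioi (0 : ℝ), (2 * (r * ψ r) + r ^ 2 * deriv ψ r) = 0 := by
    have h := HasCompactSupport.integral_Ioi_deriv_eq (f := fun r : ℝ => r ^ 2 * ψ r)
      (((by fun_prop : ContDiff ℝ 1 fun r : ℝ => r ^ 2)).mul ψ.contDiff) hψs.mul_left 0
    rw [zero_pow two_ne_zero, zero_mul, neg_zero] at h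
    refine Eq.trans ?_ h
    refine integral_congr_ae (.of_forall fun r => ?_)
    have hd : HasDerivAt ψ (deriv ψ r) r := (hψ.differentiable (by simp) r).hasDerivAt
    have := (((hasDerivAt_id r).pow 2).mul hd).deriv
    simp only [Pi.mul_def, Pi.pow_apply, id] at this
    rw [this]; simp; ring
  rw [integral_add ((I2.const_mul 2).integrableOn) I1.integrableOn, integral_const_mul] at hz
  rw [integral_add ((I1.mul_const a).integrableOn) ((I2.mul_const b).integrableOn),
    integral_mul_const, integral_mul_const] at hdiv
  have hpos : 0 < ∫ r in Ioi (0 : ℝ), r * ψ r := by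
    rw [integral_pos_iff_support_of_nonneg_ae ((ae_restrict_mem measurableSet_Ioi).mono
      fun r hr => mul_nonneg (le_of_lt hr) ψ.nonneg) I2.integrableOn]
    refine lt_of_lt_of_le ?_ (measure_mono (s := Ioo (1 : ℝ) 3) fun r hr => ?_)
    · rw [Measure.restrict_apply measurableSet_Ioo, inter_eq_left.2 fun r hr => ?_]
      · simp
      · exact lt_trans one_pos hr.1
    · refine mul_ne_zero (lt_trans one_pos hr.1).ne' (ψ.pos_of_mem_ball ?_).ne'
      rw [Metric.mem_ball, Real.dist_eq, abs_lt]
      change -(1 : ℝ) < _ ∧ _ < (1 : ℝ)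
      constructor <;> linarith [hr.1, hr.2]
  have : (∫ r in Ioi (0 : ℝ), r * ψ r) * (b - 2 * a) = 0 := by
    linear_combination hdiv - a * hz
  rcases mul_eq_zero.1 this with h | h
  · exact absurd h hpos.ne'
  · linarith

end

/-! ### Radial projection, and the divergence theorem for fields that are not homogeneous -/

theorem pd_radialVec {x : Space} (hx : x ≠ 0) (i k : Fin 3) :
    pd i (fun y => radialVec y k) x
      = ((if i = k then 1 else 0) - radialVec x i * radialVec x k) / ‖x‖ := by
  have hn : ‖x‖ ≠ 0 := norm_ne_zero_iff.2 hx
  have h := pd_mul (φ := fun y => ‖y‖) (ψ := fun y => radialVec y k) (i := i)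
    (hasFDerivAt_norm hx).differentiableAt (differentiableAt_of_off (isSphereFun_radialVec k).1 hx)
  have e : pd i (fun y => ‖y‖ * radialVec y k) x = if i = k then 1 else 0 := by
    have h1 : (fun y : Space => ‖y‖ * radialVec y k) =ᶠ[𝓝 x]
        (EuclideanSpace.proj k : Space →L[ℝ] ℝ) := by
      filter_upwards [isOpen_compl_singleton.mem_nhds hx] with y hy
      exact norm_mul_radialVec hy k
    unfold pd
    rw [h1.fderiv_eq, ContinuousLinearMap.fderiv]
    simp [eq_comm]
  rw [e, pd_norm hx] at h
  rw [h]
  simp only [radialVec]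
  field_simp
  ring

theorem ContDiffOn.comp_unitVec {φ : Space → ℝ} (hφ : ContDiffOn ℝ ∞ φ {0}ᶜ) :
    IsSphereFun (fun x => φ (unitVec x)) :=
  ⟨fun _ hx => ((contDiffAt_of_off hφ (unitVec_ne_zero hx)).comp _
    (contDiffAt_unitVec hx)).contDiffWithinAt, fun t ht x => by simp only [unitVec_smul ht]⟩

theorem unitVec_of_norm_one {n : Space} (hn : ‖n‖ = 1) : unitVec n = n := by simp [unitVec, hn]

/-- The degree-zero extension of the restriction to the sphere has as gradient the tangential part
of the original gradient. This reduces the divergence theorem for a general field to the homogeneous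
case. -/
theorem pd_comp_unitVec {φ : Space → ℝ} (hφ : ContDiffOn ℝ ∞ φ {0}ᶜ) {n : Space} (hn : ‖n‖ = 1)
    (i : Fin 3) :
    pd i (fun x => φ (unitVec x)) n = pd i φ n - n i * ∑ k, n k * pd k φ n := by
  have hn0 : n ≠ 0 := by rintro rfl; simp at hn
  have hu : DifferentiableAt ℝ unitVec n := (contDiffAt_unitVec hn0).differentiableAt (by simp)
  have h1 : HasFDerivAt φ (fderiv ℝ φ n) (unitVec n) := by
    rw [unitVec_of_norm_one hn]; exact (differentiableAt_of_off hφ hn0).hasFDerivAt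
  have h2 := (h1.comp n hu.hasFDerivAt).fderiv
  have h3 (k : Fin 3) : (fderiv ℝ unitVec n (EuclideanSpace.single i 1)) k
      = (if i = k then 1 else 0) - n i * n k := by
    have h4 := pd_radialVec hn0 i k
    rw [hn, div_one, radialVec_of_norm_one hn, radialVec_of_norm_one hn] at h4
    rw [← h4]
    have h5 := ((EuclideanSpace.proj k : Space →L[ℝ] ℝ).hasFDerivAt.comp n hu.hasFDerivAt).fderiv
    have e : (⇑(EuclideanSpace.proj k : Space →L[ℝ] ℝ) ∘ unitVec) = fun y => radialVec y k :=
      funext fun y => unitVec_apply y k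
    rw [e] at h5
    unfold pd
    rw [h5]; rfl
  change fderiv ℝ (φ ∘ unitVec) n _ = _
  rw [h2, ContinuousLinearMap.comp_apply, fderiv_eq_sum_pd]
  simp only [h3]
  fin_cases i <;> simp [Fin.sum_univ_three] <;> ring

/-- The divergence theorem on the unit sphere. -/
theorem sphere_divergence {V : Fin 3 → Space → ℝ} (hV : ∀ i, ContDiffOn ℝ ∞ (V i) {0}ᶜ) :
    sphereInt (fun n => ∑ i, (pd i (V i) n - n i * ∑ k, n k * pd k (V i) n))
      = 2 * sphereInt (fun n => ∑ i, n i * V i n) := by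
  have h := sphere_divergence_of_isSphereFun fun i => ContDiffOn.comp_unitVec (hV i)
  rw [sphereInt_congr (G := fun n => ∑ i, (pd i (V i) n - n i * ∑ k, n k * pd k (V i) n))
    fun n hn => Finset.sum_congr rfl fun i _ => pd_comp_unitVec (hV i) hn i] at h
  rw [h]
  congr 1
  exact sphereInt_congr fun n hn => by simp only [unitVec_of_norm_one hn]

/-! ### Differentiation under the integral sign -/

/-- Points of parameter times space off the spatial origin. -/
def offZ : Set PSpace := Set.univ ×ˢ {(0 : Space)}ᶜ

theorem mem_offZ {q : PSpace} : q ∈ offZ ↔ q.2 ≠ 0 := by simp [offZ]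

theorem isOpen_offZ : IsOpen offZ := isOpen_univ.prod isOpen_compl_singleton

-- Joint smoothness near the compact set K bounds the parameter derivative uniformly for |t − s| ≤
-- 1, and a constant is a dominating function for a finite measure. The sphere and the balls are the
-- two instances.
open Set in
theorem hasDerivAt_integral_of_compact {X : Type*} [MeasurableSpace X] {μ : Measure X}
    [IsFiniteMeasure μ] {φ : X → Space} (hφ : Measurable φ) {K U : Set Space} (hK : IsCompact K)
    (hU : IsOpen U) (hKU : K ⊆ U) (hφK : ∀ᵐ x ∂μ, φ x ∈ K) {F : PSpace → ℝ}
    (hF : ContDiffOn ℝ ∞ F (univ ×ˢ U)) (s : ℝ) :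
    HasDerivAt (fun t => ∫ x, F (t, φ x) ∂μ) (∫ x, dirD es F (s, φ x) ∂μ) s := by
  have hat {t : ℝ} {y : Space} (hy : y ∈ K) : ContDiffAt ℝ ∞ F (t, y) :=
    hF.contDiffAt ((isOpen_univ.prod hU).mem_nhds ⟨trivial, hKU hy⟩)
  have hmeas {G : PSpace → ℝ} (hG : ∀ t, ∀ y ∈ K, ContinuousAt G (t, y)) (t : ℝ) :
      AEStronglyMeasurable (fun x => G (t, φ x)) μ := by
    have h1 : ContinuousOn (fun y => G (t, y)) K := fun y hy =>
      ((hG t y hy).comp (f := fun y : Space => (t, y)) (by fun_prop)).continuousWithinAt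
    have h2 : AEStronglyMeasurable (fun y => G (t, y)) ((μ.map φ).restrict K) :=
      h1.aestronglyMeasurable hK.measurableSet
    rw [Measure.restrict_eq_self_of_ae_mem] at h2
    · exact h2.comp_measurable hφ
    · exact (ae_map_iff (p := fun y => y ∈ K) hφ.aemeasurable hK.measurableSet).2 hφK
  have hbd {G : PSpace → ℝ} (hG : ∀ t, ∀ y ∈ K, ContinuousAt G (t, y)) :
      ∃ M, ∀ t ∈ Metric.closedBall s 1, ∀ y ∈ K, ‖G (t, y)‖ ≤ M := by
    obtain ⟨M, hM⟩ := ((isCompact_closedBall s 1).prod hK).exists_bound_of_continuousOn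
      (f := G) fun q hq => (hG q.1 q.2 hq.2).continuousWithinAt
    exact ⟨M, fun t ht y hy => hM (t, y) ⟨ht, hy⟩⟩
  have hF0 : ∀ t, ∀ y ∈ K, ContinuousAt F (t, y) := fun t y hy => (hat hy).continuousAt
  have hF1 : ∀ t, ∀ y ∈ K, ContinuousAt (dirD es F) (t, y) := fun t y hy =>
    (contDiffAt_dirD (hat hy) es).continuousAt
  obtain ⟨M, hM⟩ := hbd hF0
  obtain ⟨M', hM'⟩ := hbd hF1
  refine (hasDerivAt_integral_of_dominated_loc_of_deriv_le (F := fun t x => F (t, φ x))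
    (F' := fun t x => dirD es F (t, φ x)) (Metric.closedBall_mem_nhds s one_pos)
    (.of_forall fun t => hmeas hF0 t) ?_ (hmeas hF1 s) (bound := fun _ => M') ?_
    (integrable_const _) ?_).2
  · exact Integrable.of_bound (hmeas hF0 s) M
      (hφK.mono fun x hx => hM s (Metric.mem_closedBall_self zero_le_one) _ hx)
  · exact hφK.mono fun x hx t ht => hM' t ht _ hx
  · exact hφK.mono fun x hx t _ => deriv_eq_dirD ((hat hx).differentiableAt (by simp))

theorem hasDerivAt_sphereInt {F : PSpace → ℝ} (hF : ContDiffOn ℝ ∞ F offZ) (s : ℝ) :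
    HasDerivAt (fun t => sphereInt (fun n => F (t, n))) (sphereInt fun n => dirD es F (s, n)) s :=
  hasDerivAt_integral_of_compact measurable_subtype_coe (isCompact_sphere (0 : Space) 1)
    isOpen_compl_singleton (fun n hn => ne_zero_of_mem_unit_sphere ⟨n, hn⟩)
    (.of_forall fun n => n.2) hF s

theorem hasDerivAt_ballInt (F : SmoothFn) (R s : ℝ) :
    HasDerivAt (fun t => ballInt (fun x => ev (t, x) F) R)
      (ballInt (fun x => ev (s, x) (smD es F)) R) s := by
  have : IsFiniteMeasure ((volume : Measure Space).restrict (Metric.ball 0 R)) :=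
    isFiniteMeasure_restrict.2 Metric.isBounded_ball.measure_lt_top.ne
  exact hasDerivAt_integral_of_compact (μ := volume.restrict (Metric.ball (0 : Space) R))
    measurable_id (isCompact_closedBall (0 : Space) R) isOpen_univ
    (Set.subset_univ _) ((ae_restrict_mem measurableSet_ball).mono
      fun x hx => Metric.ball_subset_closedBall hx) (smooth_contDiff F).contDiffOn s

theorem integrableOn_ball {V : Space → ℝ} (hV : Continuous V) (R : ℝ) :
    IntegrableOn V (Metric.ball 0 R) :=
  (hV.continuousOn.integrableOn_compact (isCompact_closedBall 0 R)).mono_set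
    Metric.ball_subset_closedBall

open Set in
/-- The divergence theorem on balls. -/
theorem ball_divergence {V : Fin 3 → Space → ℝ} (hV : ∀ i, ContDiff ℝ ∞ (V i)) {R : ℝ}
    (hR : 0 < R) : ballInt (fun x => ∑ i, pd i (V i) x) R
      = R ^ 2 * sphereInt (fun n => ∑ i, n i * V i (R • n)) := by
  have hpd (i k) : ContDiff ℝ ∞ (pd k (V i)) :=
    ((hV i).fderiv_right (m := ∞) (by simp)).clm_apply contDiff_const
  have hdc : Continuous (fun x => ∑ i, pd i (V i) x) :=
    continuous_finsetSum _ fun i _ => (hpd i i).continuous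
  -- The radius plays the role of the parameter, so that the flux through spheres can be
  -- differentiated in it under the integral.
  set G : PSpace → ℝ := fun q => q.1 ^ 2 * ∑ i, q.2 i * V i (q.1 • q.2) with hG
  have hGs : ContDiff ℝ ∞ G := by
    refine ((contDiff_fst).pow 2).mul (ContDiff.sum fun i _ => ContDiff.mul ?_ ?_)
    · exact (EuclideanSpace.proj i : Space →L[ℝ] ℝ).contDiff.comp contDiff_snd
    · exact (hV i).comp (contDiff_fst.smul contDiff_snd)
  have hdG (r : ℝ) (n : Space) : dirD es G (r, n) = 2 * r * (∑ i, n i * V i (r • n))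
      + r ^ 2 * ∑ i, n i * ∑ k, n k * pd k (V i) (r • n) := by
    have h1 := deriv_eq_dirD (s := r) (x := n) ((hGs.differentiable (by simp)) (r, n))
    have h2 (i) : HasDerivAt (fun t : ℝ => V i (t • n)) (∑ k, n k * pd k (V i) (r • n)) r := by
      rw [← fderiv_eq_sum_pd]
      have h3 : HasDerivAt (fun t : ℝ => t • n) n r := by
        simpa using (hasDerivAt_id r).smul_const n
      exact ((hV i).differentiable (by simp) (r • n)).hasFDerivAt.comp_hasDerivAt r h3
    have h4 := ((hasDerivAt_id r).pow 2).fun_mul (HasDerivAt.fun_sum (u := Finset.univ)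
      fun i _ => (h2 i).const_mul (n i))
    rw [h1.unique h4]
    simp
  have hA (r : ℝ) : HasDerivAt (fun r => r ^ 2 * sphereInt (fun n => ∑ i, n i * V i (r • n)))
      (sphereInt fun n => dirD es G (r, n)) r := by
    have := hasDerivAt_sphereInt (hGs.contDiffOn (s := offZ)) r
    simp only [hG, sphereInt_const_mul] at this
    exact this
  -- The radial derivative of the flux has a term from r² and a term with normal derivatives. The
  -- sphere divergence theorem converts the former into the tangential part of the divergence, which
  -- the latter completes.
  have hA' (r : ℝ) (hr : 0 < r) : (sphereInt fun n => dirD es G (r, n))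
      = r ^ 2 * sphereInt (fun n => ∑ i, pd i (V i) (r • n)) := by
    have hW (i) : ContDiff ℝ ∞ (fun x => V i (r • x)) := (hV i).comp (contDiff_const_smul r)
    have hp (i k) (x : Space) : pd k (fun x => V i (r • x)) x = r * pd k (V i) (r • x) := by
      unfold pd; rw [fderiv_comp_smul]; rfl
    have h := sphere_divergence fun i => (hW i).contDiffOn (s := {0}ᶜ)
    have i1 : SphereIntegrable (fun n => ∑ i, n i * V i (r • n)) :=
      sphereIntegrable_of_continuousOn (Continuous.continuousOn <| continuous_finsetSum _
        fun i _ => (by fun_prop : Continuous fun n : Space => n i).mul (hW i).continuous)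
    have i2 : SphereIntegrable
        (fun n => ∑ i, (r * pd i (V i) (r • n) - n i * ∑ k, n k * (r * pd k (V i) (r • n)))) := by
      refine sphereIntegrable_of_continuousOn (Continuous.continuousOn ?_)
      have (i k : Fin 3) : Continuous fun x : Space => pd k (V i) (r • x) :=
        (hpd i k).continuous.comp (continuous_const_smul r)
      fun_prop
    have i3 : SphereIntegrable (fun n => ∑ i, n i * ∑ k, n k * pd k (V i) (r • n)) := by
      refine sphereIntegrable_of_continuousOn (Continuous.continuousOn ?_)
      have (i k : Fin 3) : Continuous fun x : Space => pd k (V i) (r • x) :=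
        (hpd i k).continuous.comp (continuous_const_smul r)
      fun_prop
    simp only [hp] at h
    rw [sphereInt_congr fun n _ => hdG r n, sphereInt_add (i1.const_mul _) (i3.const_mul _),
      sphereInt_const_mul]
    have h5 : 2 * r * sphereInt (fun n => ∑ i, n i * V i (r • n))
        = r * (2 * sphereInt (fun n => ∑ i, n i * V i (r • n))) := by ring
    rw [h5, ← h, ← sphereInt_const_mul, ← sphereInt_add (i2.const_mul _) (i3.const_mul _),
      ← sphereInt_const_mul]
    refine sphereInt_congr fun n _ => ?_
    simp only [Fin.sum_univ_three]
    ring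
  have hcont : Continuous fun r => sphereInt fun n => dirD es G (r, n) := by
    refine continuous_iff_continuousAt.2 fun r => ?_
    have hd : ContDiff ℝ ∞ (dirD es G) := contDiff_iff_contDiffAt.2 fun q =>
      contDiffAt_dirD hGs.contDiffAt es
    exact (hasDerivAt_sphereInt (hd.contDiffOn (s := offZ)) r).continuousAt
  have hball : ballInt (fun x => ∑ i, pd i (V i) x) R
      = ∫ r in (0 : ℝ)..R, sphereInt fun n => dirD es G (r, n) := by
    rw [ballInt, ← integral_indicator measurableSet_ball,
      integral_eq_polar ((integrable_indicator_iff measurableSet_ball).2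
        (integrableOn_ball hdc R)),
      intervalIntegral.integral_of_le hR.le, integral_Ioc_eq_integral_Ioo,
      ← integral_indicator measurableSet_Ioo, ← integral_indicator measurableSet_Ioi]
    refine integral_congr_ae (.of_forall fun r => ?_)
    simp only [indicator, mem_Ioi, mem_Ioo]
    by_cases hr : 0 < r
    · have hn (n : Space) (h : ‖n‖ = 1) : r • n ∈ Metric.ball (0 : Space) R ↔ r < R := by
        rw [mem_ball_zero_iff, norm_smul, h, Real.norm_of_nonneg hr.le, mul_one]
      by_cases hrR : r < R
      · simp only [hr, hrR, and_self, if_true]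
        rw [hA' r hr]
        congr 1
        exact sphereInt_congr fun n h => by rw [if_pos ((hn n h).2 hrR)]
      · simp only [hr, hrR, and_false, if_true, if_false]
        rw [sphereInt_congr (G := fun _ => 0) fun n h => by rw [if_neg (mt (hn n h).1 hrR)]]
        simp [sphereInt]
    · simp [hr]
  rw [hball, intervalIntegral.integral_eq_sub_of_hasDerivAt (fun r _ => hA r)
    (hcont.intervalIntegrable _ _)]
  simp

section

/-! ### Smooth functions off the spatial origin -/

open Classical in
/-- Extension by zero of a function off the spatial origin. -/
def extZ (F : offZ → ℝ) (q : PSpace) : ℝ := if h : q ∈ offZ then F ⟨q, h⟩ else 0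

theorem extZ_apply {F : offZ → ℝ} {q : PSpace} (h : q ∈ offZ) : extZ F q = F ⟨q, h⟩ := dif_pos h

theorem extZ_add (F G : offZ → ℝ) : extZ (F + G) = fun q => extZ F q + extZ G q := by
  funext q; unfold extZ; split_ifs <;> simp

theorem extZ_mul (F G : offZ → ℝ) : extZ (F * G) = fun q => extZ F q * extZ G q := by
  funext q; unfold extZ; split_ifs <;> simp

theorem extZ_smul (a : ℝ) (F : offZ → ℝ) : extZ (a • F) = fun q => a * extZ F q := by
  funext q; unfold extZ; split_ifs <;> simp

/-- The algebra of smooth functions off the spatial origin. -/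
def offSubalgebra : Subalgebra ℝ (offZ → ℝ) where
  carrier := {F | ContDiffOn ℝ ∞ (extZ F) offZ}
  mul_mem' {a b} ha hb := by
    simp only [Set.mem_ofPred_eq] at *; rw [extZ_mul]; exact ha.mul hb
  add_mem' {a b} ha hb := by
    simp only [Set.mem_ofPred_eq] at *; rw [extZ_add]; exact ha.add hb
  algebraMap_mem' r := by
    simp only [Set.mem_ofPred_eq]
    exact (contDiffOn_const (c := r)).congr fun q hq => extZ_apply hq

/-- Smooth functions off the spatial origin. -/
abbrev OffFn : Type := offSubalgebra

/-- The underlying function on parameter times space, zero at the spatial origin. -/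
def evo (F : OffFn) (q : PSpace) : ℝ := extZ F.1 q

theorem contDiffOn_evo (F : OffFn) : ContDiffOn ℝ ∞ (evo F) offZ := F.2

theorem contDiffAt_evo (F : OffFn) {q : PSpace} (hq : q ∈ offZ) : ContDiffAt ℝ ∞ (evo F) q :=
  (contDiffOn_evo F).contDiffAt (isOpen_offZ.mem_nhds hq)

theorem differentiableAt_evo (F : OffFn) {q : PSpace} (hq : q ∈ offZ) :
    DifferentiableAt ℝ (evo F) q := (contDiffAt_evo F hq).differentiableAt (by simp)

theorem evo_add (F G : OffFn) : evo (F + G) = fun q => evo F q + evo G q := extZ_add _ _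

theorem evo_mul (F G : OffFn) : evo (F * G) = fun q => evo F q * evo G q := extZ_mul _ _

theorem evo_smul (a : ℝ) (F : OffFn) : evo (a • F) = fun q => a * evo F q := extZ_smul _ _

/-- Evaluation at a point off the origin. -/
def evoHom (q : PSpace) (hq : q ∈ offZ) : OffFn →ₐ[ℝ] ℝ :=
  (Pi.evalAlgHom ℝ (fun _ : offZ => ℝ) ⟨q, hq⟩).comp offSubalgebra.val

theorem evoHom_apply {q : PSpace} (hq : q ∈ offZ) (F : OffFn) : evoHom q hq F = evo F q :=
  (extZ_apply hq).symm

theorem evo_ext {F G : OffFn} (h : ∀ q ∈ offZ, evo F q = evo G q) : F = G := by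
  refine Subtype.ext (funext fun ⟨q, hq⟩ => ?_)
  have := h q hq
  unfold evo at this
  rwa [extZ_apply hq, extZ_apply hq] at this

/-- Restriction of a function to the complement of the spatial origin. -/
def mkOff (f : PSpace → ℝ) (hf : ContDiffOn ℝ ∞ f offZ) : OffFn :=
  ⟨fun q => f q, hf.congr fun _ hq => extZ_apply hq⟩

theorem evo_mkOff (f : PSpace → ℝ) (hf : ContDiffOn ℝ ∞ f offZ) {q : PSpace} (hq : q ∈ offZ) :
    evo (mkOff f hf) q = f q := extZ_apply hq

theorem contDiffOn_dirD_evo (v : PSpace) (F : OffFn) : ContDiffOn ℝ ∞ (dirD v (evo F)) offZ :=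
  fun _ hq => (contDiffAt_dirD (contDiffAt_evo F hq) v).contDiffWithinAt

/-- Directional derivatives as derivations of the algebra of smooth functions off the origin. -/
def offD (v : PSpace) : Derivation ℝ OffFn OffFn :=
  Derivation.mk'
    { toFun := fun F => mkOff (dirD v (evo F)) (contDiffOn_dirD_evo v F)
      map_add' := fun F G => evo_ext fun q hq => by
        rw [evo_mkOff _ _ hq]
        simp only [evo_add]
        rw [evo_mkOff _ _ hq, evo_mkOff _ _ hq]
        simp only [dirD]
        rw [fderiv_fun_add (differentiableAt_evo F hq) (differentiableAt_evo G hq)]; rfl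
      map_smul' := fun r F => evo_ext fun q hq => by
        rw [evo_mkOff _ _ hq, RingHom.id_apply]
        simp only [evo_smul]
        rw [evo_mkOff _ _ hq]
        simp only [dirD]
        rw [fderiv_const_mul (differentiableAt_evo F hq)]; rfl }
    (fun F G => evo_ext fun q hq => by
      simp only [LinearMap.coe_mk, AddHom.coe_mk, smul_eq_mul]
      rw [evo_mkOff _ _ hq]
      simp only [evo_add, evo_mul]
      rw [evo_mkOff _ _ hq, evo_mkOff _ _ hq]
      simp only [dirD]
      rw [fderiv_fun_mul (differentiableAt_evo F hq) (differentiableAt_evo G hq)]; simp)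

theorem evo_offD (v : PSpace) (F : OffFn) {q : PSpace} (hq : q ∈ offZ) :
    evo (offD v F) q = dirD v (evo F) q :=
  evo_mkOff _ (contDiffOn_dirD_evo v F) hq

theorem dirD_congr {F G : PSpace → ℝ} (h : Set.EqOn F G offZ) (v : PSpace) {q : PSpace}
    (hq : q ∈ offZ) : dirD v F q = dirD v G q := by
  unfold dirD
  rw [(h.eventuallyEq_of_mem (isOpen_offZ.mem_nhds hq)).fderiv_eq]

theorem offD_comm (v w : PSpace) (F : OffFn) : offD v (offD w F) = offD w (offD v F) :=
  evo_ext fun q hq => by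
    rw [evo_offD v _ hq, evo_offD w _ hq, dirD_congr (fun q hq => evo_offD w F hq) v hq,
      dirD_congr (fun q hq => evo_offD v F hq) w hq]
    exact dirD_comm (contDiffAt_evo F hq) v w

/-- Restriction of smooth functions to the complement of the origin. -/
def toOff : SmoothFn →ₐ[ℝ] OffFn where
  toFun F := mkOff F.1 (smooth_contDiff F).contDiffOn
  map_one' := rfl
  map_mul' _ _ := rfl
  map_zero' := rfl
  map_add' _ _ := rfl
  commutes' _ := rfl

theorem evo_toOff (F : SmoothFn) {q : PSpace} (hq : q ∈ offZ) : evo (toOff F) q = ev q F :=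
  evo_mkOff _ (smooth_contDiff F).contDiffOn hq

theorem toOff_smD (v : PSpace) (F : SmoothFn) : toOff (smD v F) = offD v (toOff F) :=
  evo_ext fun q hq => by
    rw [evo_toOff _ hq, evo_offD v _ hq, dirD_congr (fun q hq => evo_toOff F hq) v hq]; rfl

theorem evo_const (a : ℝ) {q : PSpace} (hq : q ∈ offZ) : evo (algebraMap ℝ OffFn a) q = a := by
  rw [← evoHom_apply hq, AlgHom.commutes]; rfl

/-! ### Symbols -/

/-- Spatial infinity, locally uniformly in the parameter near zero. -/
def farL : Filter PSpace := 𝓝 (0 : ℝ) ×ˢ Bornology.cobounded Space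

theorem tendsto_norm_farL : Tendsto (fun q : PSpace => ‖q.2‖) farL atTop :=
  tendsto_norm_cobounded_atTop.comp tendsto_snd

theorem eventually_one_le : ∀ᶠ q in farL, 1 ≤ ‖q.2‖ :=
  tendsto_norm_farL.eventually_ge_atTop 1

theorem mem_offZ_of_one_le {q : PSpace} (h : 1 ≤ ‖q.2‖) : q ∈ offZ :=
  mem_offZ.2 (norm_pos_iff.1 (by linarith))

theorem eventually_offZ : ∀ᶠ q in farL, q ∈ offZ :=
  eventually_one_le.mono fun _ => mem_offZ_of_one_le

theorem eventually_abs_lt {δ : ℝ} (hδ : 0 < δ) : ∀ᶠ q in farL, |q.1| < δ := by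
  have : ∀ᶠ s in 𝓝 (0 : ℝ), |s| < δ := by
    filter_upwards [Metric.ball_mem_nhds (0 : ℝ) hδ] with s hs
    simpa [Real.dist_eq] using hs
  exact tendsto_fst.eventually this

theorem isBigO_rpow_mono {a b : ℝ} (h : a ≤ b) :
    (fun q : PSpace => ‖q.2‖ ^ a) =O[farL] fun q => ‖q.2‖ ^ b := by
  refine IsBigO.of_bound 1 (eventually_one_le.mono fun q hq => ?_)
  rw [one_mul, Real.norm_of_nonneg (by positivity), Real.norm_of_nonneg (by positivity)]
  exact Real.rpow_le_rpow_of_exponent_le hq h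

theorem isBigO_rpow_mul (a b : ℝ) :
    (fun q : PSpace => ‖q.2‖ ^ a * ‖q.2‖ ^ b) =O[farL] fun q => ‖q.2‖ ^ (a + b) := by
  refine IsBigO.of_bound 1 (eventually_one_le.mono fun q hq => ?_)
  rw [one_mul, Real.rpow_add (by linarith)]

/-- The first `k` spatial derivatives are bounded, each gaining one power of the radius. -/
def BdO : ℕ → ℝ → OffFn → Prop
  | 0, a, F => evo F =O[farL] fun q => ‖q.2‖ ^ a
  | k + 1, a, F => (evo F =O[farL] fun q => ‖q.2‖ ^ a) ∧
      ∀ i, BdO k (a - 1) (offD (ex i) F)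

namespace BdO

variable {k : ℕ} {a b : ℝ} {F G : OffFn}

theorem isBigO (h : BdO k a F) : evo F =O[farL] fun q => ‖q.2‖ ^ a := by
  cases k
  · exact h
  · exact h.1

theorem pred : ∀ {k : ℕ} {a : ℝ} {F : OffFn}, BdO (k + 1) a F → BdO k a F
  | 0, _, _, h => h.1
  | _ + 1, _, _, h => ⟨h.1, fun i => (h.2 i).pred⟩

theorem mono : ∀ {k : ℕ} {a b : ℝ} {F : OffFn}, BdO k a F → a ≤ b → BdO k b F
  | 0, _, _, _, h, hab => IsBigO.trans h (isBigO_rpow_mono hab)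
  | _ + 1, _, _, _, h, hab =>
    ⟨h.1.trans (isBigO_rpow_mono hab), fun i => (h.2 i).mono (by linarith)⟩

theorem add : ∀ {k : ℕ} {a : ℝ} {F G : OffFn}, BdO k a F → BdO k a G → BdO k a (F + G)
  | 0, _, _, _, hF, hG => by unfold BdO; rw [evo_add]; exact IsBigO.add hF hG
  | _ + 1, _, _, _, hF, hG => ⟨by rw [evo_add]; exact hF.1.add hG.1,
      fun i => by rw [map_add]; exact (hF.2 i).add (hG.2 i)⟩

theorem smul (r : ℝ) : ∀ {k : ℕ} {a : ℝ} {F : OffFn}, BdO k a F → BdO k a (r • F)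
  | 0, _, _, hF => by unfold BdO; rw [evo_smul]; exact IsBigO.const_mul_left hF r
  | _ + 1, _, _, hF => ⟨by rw [evo_smul]; exact hF.1.const_mul_left r,
      fun i => by rw [Derivation.map_smul]; exact (hF.2 i).smul r⟩

theorem zero : ∀ {k : ℕ} {a : ℝ}, BdO k a 0
  | 0, a => by
    have : evo 0 = fun _ => 0 := by funext q; simp [evo, extZ]
    unfold BdO; rw [this]; exact isBigO_zero _ _
  | k + 1, a => ⟨(zero (k := 0)), fun i => by rw [map_zero]; exact zero⟩

theorem mul : ∀ {k : ℕ} {a b : ℝ} {F G : OffFn}, BdO k a F → BdO k b G → BdO k (a + b) (F * G)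
  | 0, a, b, _, _, hF, hG => by
    unfold BdO; rw [evo_mul]; exact (IsBigO.mul hF hG).trans (isBigO_rpow_mul a b)
  | _ + 1, a, b, _, _, hF, hG => by
    refine ⟨?_, fun i => ?_⟩
    · rw [evo_mul]; exact (hF.1.mul hG.1).trans (isBigO_rpow_mul a b)
    · rw [Derivation.leibniz, smul_eq_mul, smul_eq_mul]
      refine (hF.pred.mul (hG.2 i)).mono (by linarith) |>.add ?_
      exact (hG.pred.mul (hF.2 i)).mono (by linarith)

theorem one : ∀ {k : ℕ}, BdO k 0 1
  | 0 => by
    refine IsBigO.of_bound 1 (eventually_offZ.mono fun q hq => ?_)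
    have : evo 1 q = 1 := by rw [← evoHom_apply hq, map_one]
    simp [this]
  | k + 1 => ⟨one (k := 0), fun i => by rw [Derivation.map_one_eq_zero]; exact zero⟩

/-- Division by a function bounded below. -/
theorem of_mul_eq {X : OffFn} {c : ℝ} (hc : 0 < c) (hX : ∀ᶠ q in farL, c ≤ |evo X q|) :
    ∀ {k : ℕ} {a : ℝ} {U Y : OffFn}, BdO k 0 X → BdO k a Y → U * X = Y → BdO k a U
  | k, a, U, Y, hXk, hY, h => by
    have h0 : evo U =O[farL] fun q => ‖q.2‖ ^ a := by
      refine IsBigO.trans (IsBigO.of_bound c⁻¹ (hX.mono fun q hq => ?_)) hY.isBigO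
      have : evo Y q = evo U q * evo X q := by rw [← h, evo_mul]
      rw [this, norm_mul, Real.norm_eq_abs (evo X q), inv_mul_eq_div, le_div_iff₀ hc]
      exact mul_le_mul_of_nonneg_left hq (norm_nonneg _)
    cases k with
    | zero => exact h0
    | succ k =>
      have hU : BdO k a U := of_mul_eq hc hX hXk.pred hY.pred h
      refine ⟨h0, fun i => ?_⟩
      -- Differentiating UX = Y gives (∂U)X = ∂Y − U∂X, an equation of the same kind for ∂U with one
      -- derivative fewer to control.
      refine of_mul_eq hc hX (Y := offD (ex i) Y + (-1 : ℝ) • (U * offD (ex i) X)) hXk.pred ?_ ?_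
      · exact (hY.2 i).add (((hU.mul (hXk.2 i)).mono (by linarith)).smul _)
      · rw [← h, Derivation.leibniz, smul_eq_mul, smul_eq_mul, neg_one_smul]; ring

/-- Square roots of functions bounded below. -/
theorem of_mul_self_eq {X : OffFn} {c : ℝ} (hc : 0 < c) (hX : ∀ᶠ q in farL, c ≤ |evo X q|) :
    ∀ {k : ℕ} {Y : OffFn}, BdO k 0 Y → X * X = Y → BdO k 0 X
  | k, Y, hY, h => by
    have h0 : evo X =O[farL] fun q => ‖q.2‖ ^ (0 : ℝ) := by
      refine IsBigO.trans (IsBigO.of_bound c⁻¹ (hX.mono fun q hq => ?_)) hY.isBigO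
      have : evo Y q = evo X q * evo X q := by rw [← h, evo_mul]
      rw [this, norm_mul, inv_mul_eq_div, le_div_iff₀ hc]
      exact mul_le_mul_of_nonneg_left hq (norm_nonneg _)
    cases k with
    | zero => exact h0
    | succ k =>
      have hXk : BdO k 0 X := of_mul_self_eq hc hX hY.pred h
      refine ⟨h0, fun i => ?_⟩
      -- Differentiating X² = Y gives (∂X)X = ½∂Y, so the division lemma applies.
      refine of_mul_eq hc hX (Y := (1 / 2 : ℝ) • offD (ex i) Y) hXk ((hY.2 i).smul _) ?_
      rw [← h, Derivation.leibniz, smul_eq_mul, ← two_smul ℝ, smul_smul]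
      norm_num [mul_comm]

end BdO

/-- Symbols: all spatial derivatives bounded, each gaining one power of the radius; if `b` holds,
then also those of the parameter derivative. -/
def Sy (b : Bool) (a : ℝ) : Submodule ℝ OffFn where
  carrier := {F | ∀ k, BdO k a F ∧ (b = true → BdO k a (offD es F))}
  add_mem' hF hG k := ⟨(hF k).1.add (hG k).1, fun hb => by
    rw [map_add]; exact ((hF k).2 hb).add ((hG k).2 hb)⟩
  zero_mem' _ := ⟨BdO.zero, fun _ => by rw [map_zero]; exact BdO.zero⟩
  smul_mem' r _ hF k := ⟨(hF k).1.smul r, fun hb => by rw [Derivation.map_smul]; exact ((hF k).2 hb).smul r⟩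

namespace Sy

variable {b : Bool} {a a' : ℝ} {F G : OffFn}

theorem isBigO (h : F ∈ Sy b a) : evo F =O[farL] fun q => ‖q.2‖ ^ a := (h 0).1

theorem mono (h : F ∈ Sy b a) (ha : a ≤ a') : F ∈ Sy b a' := fun k =>
  ⟨(h k).1.mono ha, fun hb => ((h k).2 hb).mono ha⟩

theorem mul (hF : F ∈ Sy b a) (hG : G ∈ Sy b a') : F * G ∈ Sy b (a + a') := fun k =>
  ⟨(hF k).1.mul (hG k).1, fun hb => by
    rw [Derivation.leibniz, smul_eq_mul, smul_eq_mul]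
    exact ((hF k).1.mul ((hG k).2 hb)).add
      (((hG k).1.mul ((hF k).2 hb)).mono (by linarith))⟩

theorem mul_le (hF : F ∈ Sy b a) (hG : G ∈ Sy b a') {a'' : ℝ} (h : a + a' ≤ a'') :
    F * G ∈ Sy b a'' := mono (mul hF hG) h

theorem offD_mem (hF : F ∈ Sy b a) (i : Fin 3) : offD (ex i) F ∈ Sy b (a - 1) := fun k =>
  ⟨(hF (k + 1)).1.2 i, fun hb => by rw [offD_comm]; exact ((hF (k + 1)).2 hb).2 i⟩

theorem offD_le (hF : F ∈ Sy b a) (i : Fin 3) (h : a - 1 ≤ a') : offD (ex i) F ∈ Sy b a' :=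
  mono (offD_mem hF i) h

theorem of_true (hF : F ∈ Sy true a) : F ∈ Sy b a := fun k => ⟨(hF k).1, fun _ => (hF k).2 rfl⟩

theorem offD_es (hF : F ∈ Sy true a) : offD es F ∈ Sy false a := fun k =>
  ⟨(hF k).2 rfl, fun h => by simp at h⟩

theorem of_offD_es_eq_zero (hF : F ∈ Sy false a) (h : offD es F = 0) : F ∈ Sy b a := fun k =>
  ⟨(hF k).1, fun _ => by rw [h]; exact BdO.zero⟩

theorem one_mem : (1 : OffFn) ∈ Sy b 0 := fun _ =>
  ⟨BdO.one, fun _ => by rw [Derivation.map_one_eq_zero]; exact BdO.zero⟩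

theorem const_mem (r : ℝ) : algebraMap ℝ OffFn r ∈ Sy b 0 := by
  rw [Algebra.algebraMap_eq_smul_one]; exact Submodule.smul_mem _ _ one_mem

theorem of_mul_eq {X U Y : OffFn} {c : ℝ} (hc : 0 < c) (hb : ∀ᶠ q in farL, c ≤ |evo X q|)
    (hX : X ∈ Sy b 0) (hY : Y ∈ Sy b a) (h : U * X = Y) : U ∈ Sy b a := fun k => by
  have hU : BdO k a U := BdO.of_mul_eq hc hb (hX k).1 (hY k).1 h
  refine ⟨hU, fun ht => ?_⟩
  refine BdO.of_mul_eq hc hb (Y := offD es Y + (-1 : ℝ) • (U * offD es X)) (hX k).1 ?_ ?_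
  · exact ((hY k).2 ht).add (((hU.mul ((hX k).2 ht)).mono (by linarith)).smul _)
  · rw [← h, Derivation.leibniz, smul_eq_mul, smul_eq_mul, neg_one_smul]; ring

theorem of_mul_self_eq {X Y : OffFn} {c : ℝ} (hc : 0 < c) (hb : ∀ᶠ q in farL, c ≤ |evo X q|)
    (hY : Y ∈ Sy b 0) (h : X * X = Y) : X ∈ Sy b 0 := fun k => by
  have hX : BdO k 0 X := BdO.of_mul_self_eq hc hb (hY k).1 h
  refine ⟨hX, fun ht => ?_⟩
  refine BdO.of_mul_eq hc hb (Y := (1 / 2 : ℝ) • offD es Y) hX (((hY k).2 ht).smul _) ?_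
  rw [← h, Derivation.leibniz, smul_eq_mul, ← two_smul ℝ, smul_smul]
  norm_num [mul_comm]

theorem tendsto_zero (hF : F ∈ Sy b a) (ha : a < 0) : Tendsto (evo F) farL (𝓝 0) := by
  refine (isBigO hF).trans_tendsto ?_
  have := (tendsto_rpow_neg_atTop (y := -a) (by linarith)).comp tendsto_norm_farL
  simpa [Function.comp_def] using this

end Sy

end

section

/-! ### Radial functions -/

/-- A function of space off the origin, independent of the parameter. -/
def offX (f : Space → ℝ) (hf : ContDiffOn ℝ ∞ f {0}ᶜ) : OffFn :=
  mkOff (fun q => f q.2) (hf.comp contDiffOn_snd fun _ hq => hq.2)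

theorem evo_offX (f : Space → ℝ) (hf : ContDiffOn ℝ ∞ f {0}ᶜ) {q : PSpace} (hq : q ∈ offZ) :
    evo (offX f hf) q = f q.2 := evo_mkOff (fun q => f q.2) _ hq

theorem pd_evo (F : OffFn) {s : ℝ} {x : Space} (hx : x ≠ 0) (i : Fin 3) :
    pd i (fun y => evo F (s, y)) x = evo (offD (ex i) F) (s, x) := by
  have hq : (s, x) ∈ offZ := mem_offZ.2 hx
  rw [pd_eq_dirD (differentiableAt_evo F hq), evo_offD _ _ hq]

theorem hasDerivAt_evo (F : OffFn) {s : ℝ} {x : Space} (hx : x ≠ 0) :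
    HasDerivAt (fun t => evo F (t, x)) (evo (offD es F) (s, x)) s := by
  have hq : (s, x) ∈ offZ := mem_offZ.2 hx
  rw [evo_offD _ _ hq]
  exact deriv_eq_dirD (differentiableAt_evo F hq)

theorem pd_congr_off {f g : Space → ℝ} (h : ∀ x ≠ 0, f x = g x) {x : Space} (hx : x ≠ 0)
    (i : Fin 3) : pd i f x = pd i g x := by
  unfold pd
  rw [Filter.EventuallyEq.fderiv_eq (f := g)]
  filter_upwards [isOpen_compl_singleton.mem_nhds hx] with y hy using h y hy

theorem evo_offD_offX (f : Space → ℝ) (hf : ContDiffOn ℝ ∞ f {0}ᶜ) {q : PSpace} (hq : q ∈ offZ)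
    (i : Fin 3) : evo (offD (ex i) (offX f hf)) q = pd i f q.2 := by
  obtain ⟨s, x⟩ := q
  have hx := mem_offZ.1 hq
  rw [← pd_evo _ hx]
  exact pd_congr_off (fun y hy => evo_offX f hf (q := (s, y)) (mem_offZ.2 hy)) hx i

theorem offD_es_offX (f : Space → ℝ) (hf : ContDiffOn ℝ ∞ f {0}ᶜ) :
    offD es (offX f hf) = 0 := evo_ext fun ⟨s, x⟩ hq => by
  have h := hasDerivAt_evo (s := s) (offX f hf) (mem_offZ.1 hq)
  have e : (fun t => evo (offX f hf) (t, x)) = fun _ => f x :=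
    funext fun t => evo_offX f hf (q := (t, x)) hq
  rw [e] at h
  rw [h.unique (hasDerivAt_const s (f x)), ← evoHom_apply hq, map_zero]

theorem contDiffOn_norm_off : ContDiffOn ℝ ∞ (fun x : Space => ‖x‖) {0}ᶜ :=
  fun _ hx => (contDiffAt_norm ℝ hx).contDiffWithinAt

/-- The radius. -/
def rho : OffFn := offX (fun x => ‖x‖) contDiffOn_norm_off

/-- The inverse radius. -/
def rhoI : OffFn := offX (fun x => ‖x‖⁻¹) (contDiffOn_norm_off.inv fun _ hx => norm_ne_zero_iff.2 hx)

/-- The logarithm of the radius. -/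
def lg : OffFn := offX (fun x => Real.log ‖x‖)
  (contDiffOn_norm_off.log fun _ hx => norm_ne_zero_iff.2 hx)

/-- The components of the unit radial vector. -/
def nu (i : Fin 3) : OffFn := offX (fun x => radialVec x i) (isSphereFun_radialVec i).1

theorem evo_rho {q : PSpace} (hq : q ∈ offZ) : evo rho q = ‖q.2‖ := evo_offX _ _ hq

theorem evo_rhoI {q : PSpace} (hq : q ∈ offZ) : evo rhoI q = ‖q.2‖⁻¹ :=
  evo_offX (fun x => ‖x‖⁻¹) _ hq

theorem evo_lg {q : PSpace} (hq : q ∈ offZ) : evo lg q = Real.log ‖q.2‖ :=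
  evo_offX (fun x => Real.log ‖x‖) _ hq

theorem evo_nu (i : Fin 3) {q : PSpace} (hq : q ∈ offZ) : evo (nu i) q = radialVec q.2 i :=
  evo_offX (fun x => radialVec x i) _ hq

theorem norm_ne_zero_of_mem {q : PSpace} (hq : q ∈ offZ) : ‖q.2‖ ≠ 0 :=
  norm_ne_zero_iff.2 (mem_offZ.1 hq)

theorem rho_rhoI : rho * rhoI = 1 := evo_ext fun q hq => by
  rw [← evoHom_apply hq, ← evoHom_apply hq, map_mul, map_one, evoHom_apply, evoHom_apply,
    evo_rho hq, evo_rhoI hq, mul_inv_cancel₀ (norm_ne_zero_of_mem hq)]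

theorem sum_nu_sq : ∑ i, nu i * nu i = 1 := evo_ext fun q hq => by
  rw [← evoHom_apply hq, ← evoHom_apply hq, map_sum, map_one]
  simp only [map_mul, evoHom_apply, evo_nu _ hq]
  exact sum_radialVec_sq (mem_offZ.1 hq)

@[simp] theorem offD_es_rho : offD es rho = 0 := offD_es_offX _ _

@[simp] theorem offD_es_rhoI : offD es rhoI = 0 := offD_es_offX _ _

@[simp] theorem offD_es_lg : offD es lg = 0 := offD_es_offX _ _

@[simp] theorem offD_es_nu (i : Fin 3) : offD es (nu i) = 0 := offD_es_offX _ _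

theorem offD_rho (i : Fin 3) : offD (ex i) rho = nu i := evo_ext fun q hq => by
  rw [rho, evo_offD_offX _ _ hq, evo_nu i hq, pd_norm (mem_offZ.1 hq)]; rfl

theorem offD_rhoI (i : Fin 3) : offD (ex i) rhoI = -(rhoI * rhoI * nu i) := by
  have h := congrArg (offD (ex i)) rho_rhoI
  rw [Derivation.leibniz, Derivation.map_one_eq_zero, offD_rho, smul_eq_mul, smul_eq_mul] at h
  linear_combination rhoI * h - offD (ex i) rhoI * rho_rhoI

theorem offD_nu (i k : Fin 3) :
    offD (ex i) (nu k) = rhoI * ((if i = k then 1 else 0) - nu i * nu k) := by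
  refine evo_ext fun q hq => ?_
  rw [nu, evo_offD_offX _ _ hq, pd_radialVec (mem_offZ.1 hq), ← evoHom_apply hq, map_mul, map_sub,
    map_mul, apply_ite (evoHom q hq), map_one, map_zero]
  simp only [evoHom_apply, evo_nu _ hq, evo_rhoI hq]
  change _ = _ * (_ - _ * evo (nu k) q)
  rw [evo_nu _ hq, div_eq_inv_mul]

theorem offD_lg (i : Fin 3) : offD (ex i) lg = rhoI * nu i := by
  refine evo_ext fun q hq => ?_
  have hx := mem_offZ.1 hq
  have h := ((Real.hasDerivAt_log (norm_ne_zero_iff.2 hx)).comp_hasFDerivAt q.2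
    (hasFDerivAt_norm hx)).fderiv
  have h2 := pd_norm hx i
  simp only [evo_mul]
  rw [lg, evo_offD_offX _ _ hq, evo_nu i hq, evo_rhoI hq, radialVec, ← h2]
  unfold pd
  rw [show (fun x : Space => Real.log ‖x‖) = Real.log ∘ fun x => ‖x‖ from rfl, h,
    (hasFDerivAt_norm hx).fderiv]
  simp

/-! ### Homogeneous functions of degree zero -/

/-- Homogeneity of degree zero in space. -/
def HomZ (F : OffFn) : Prop :=
  ∀ (s t : ℝ) (x : Space), 0 < t → x ≠ 0 → evo F (s, t • x) = evo F (s, x)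

theorem smul_mem_offZ {s t : ℝ} {x : Space} (ht : 0 < t) (hx : x ≠ 0) : (s, t • x) ∈ offZ :=
  mem_offZ.2 (smul_ne_zero ht.ne' hx)

namespace HomZ

variable {F G : OffFn}

theorem isSphereFun (hF : HomZ F) (s : ℝ) : IsSphereFun (fun x => evo F (s, x)) := by
  refine ⟨(contDiffOn_evo F).comp (by fun_prop) fun x hx => ⟨trivial, hx⟩, fun t ht x => ?_⟩
  by_cases hx : x = 0
  · rw [hx, smul_zero]
  · exact hF s t x ht hx

theorem offX {f : Space → ℝ} (hf : IsSphereFun f) : HomZ (offX f hf.1) := fun s t x ht hx => by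
  rw [evo_offX _ _ (smul_mem_offZ ht hx), evo_offX _ _ (mem_offZ.2 hx), hf.2 t ht]

theorem nu (i : Fin 3) : HomZ (nu i) := offX (isSphereFun_radialVec i)

theorem mul (hF : HomZ F) (hG : HomZ G) : HomZ (F * G) := fun s t x ht hx => by
  rw [evo_mul]; simp only [hF s t x ht hx, hG s t x ht hx]

theorem add (hF : HomZ F) (hG : HomZ G) : HomZ (F + G) := fun s t x ht hx => by
  rw [evo_add]; simp only [hF s t x ht hx, hG s t x ht hx]

theorem smul (a : ℝ) (hF : HomZ F) : HomZ (a • F) := fun s t x ht hx => by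
  rw [evo_smul]; simp only [hF s t x ht hx]

theorem neg (hF : HomZ F) : HomZ (-F) := by simpa using hF.smul (-1)

theorem sub (hF : HomZ F) (hG : HomZ G) : HomZ (F - G) := by
  rw [sub_eq_add_neg]; exact hF.add hG.neg

theorem const (a : ℝ) : HomZ (algebraMap ℝ OffFn a) := fun s t x ht hx => by
  rw [evo_const _ (smul_mem_offZ ht hx), evo_const _ (mem_offZ.2 hx)]

theorem zero : HomZ 0 := by simpa using const 0

theorem ofNat (n : ℕ) [n.AtLeastTwo] : HomZ (OfNat.ofNat n : OffFn) := by
  have := const (OfNat.ofNat n)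
  rwa [map_ofNat] at this

theorem sum {ι : Type*} {u : Finset ι} {F : ι → OffFn} (h : ∀ i ∈ u, HomZ (F i)) :
    HomZ (∑ i ∈ u, F i) := by
  induction u using Finset.cons_induction with
  | empty => simpa using zero
  | cons a u ha ih =>
    rw [Finset.sum_cons]
    exact (h a (by simp)).add (ih fun i hi => h i (by simp [hi]))

theorem offD_es (hF : HomZ F) : HomZ (offD es F) := fun s t x ht hx => by
  have h1 := hasDerivAt_evo (s := s) F (x := t • x) (smul_ne_zero ht.ne' hx)
  simp only [fun s => hF s t x ht hx] at h1
  exact h1.unique (hasDerivAt_evo F hx)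

theorem rho_mul_offD (hF : HomZ F) (i : Fin 3) : HomZ (rho * offD (ex i) F) :=
  fun s t x ht hx => by
  simp only [evo_mul]
  rw [← pd_evo F (smul_ne_zero ht.ne' hx), ← pd_evo F hx, (hF.isSphereFun s).pd_smul i ht,
    evo_rho (smul_mem_offZ ht hx), evo_rho (mem_offZ.2 hx), norm_smul, Real.norm_of_nonneg ht.le]
  simp only
  field_simp

theorem offD_eq (F : OffFn) (i : Fin 3) :
    offD (ex i) F = rhoI * (rho * offD (ex i) F) := by
  rw [← mul_assoc, mul_comm rhoI, rho_rhoI, one_mul]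

theorem euler (hF : HomZ F) : ∑ i, DustCharge.nu i * offD (ex i) F = 0 := by
  refine evo_ext fun q hq => ?_
  obtain ⟨s, x⟩ := q
  have hx := mem_offZ.1 hq
  have h := (hF.isSphereFun s).euler hx
  rw [← evoHom_apply hq, ← evoHom_apply hq, map_zero, map_sum]
  simp only [map_mul, evoHom_apply, evo_nu _ hq, ← pd_evo F hx, radialVec]
  have : ‖x‖⁻¹ * ∑ i, x i * pd i (fun y => evo F (s, y)) x = 0 := by rw [h, mul_zero]
  rw [← this, Finset.mul_sum]
  exact Finset.sum_congr rfl fun i _ => by ring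

theorem isBigO (hF : HomZ F) : evo F =O[farL] fun q => ‖q.2‖ ^ (0 : ℝ) := by
  have hK : IsCompact (Metric.closedBall (0 : ℝ) 1 ×ˢ Metric.sphere (0 : Space) 1) :=
    (isCompact_closedBall _ _).prod (isCompact_sphere _ _)
  obtain ⟨M, hM⟩ := hK.exists_bound_of_continuousOn (f := evo F) fun q hq =>
    (contDiffAt_evo F (mem_offZ.2 (ne_zero_of_mem_unit_sphere ⟨q.2, hq.2⟩))).continuousAt.continuousWithinAt
  refine IsBigO.of_bound M ?_
  filter_upwards [eventually_offZ, eventually_abs_lt one_pos] with q hq hs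
  have hx := mem_offZ.1 hq
  have h := hM (q.1, unitVec q.2) ⟨by simpa using hs.le, by simpa using norm_unitVec hx⟩
  rw [unitVec, hF q.1 _ q.2 (by positivity) hx] at h
  simpa using h

end HomZ

/-- The two estimates need each other: the derivative of a homogeneous function is `rhoI` times a
homogeneous one, and the derivative of `rhoI` contains the homogeneous ν. Hence one simultaneous
induction. -/
theorem bdO_hom_rhoI (k : ℕ) : (∀ F, HomZ F → BdO k 0 F) ∧ BdO k (-1) rhoI := by
  have hr : evo rhoI =O[farL] fun q => ‖q.2‖ ^ (-1 : ℝ) :=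
    IsBigO.of_bound 1 (eventually_offZ.mono fun q hq => by
      rw [evo_rhoI hq, Real.rpow_neg_one, one_mul])
  induction k with
  | zero => exact ⟨fun F hF => hF.isBigO, hr⟩
  | succ k ih =>
    refine ⟨fun F hF => ⟨hF.isBigO, fun i => ?_⟩, hr, fun i => ?_⟩
    · rw [HomZ.offD_eq]
      exact (ih.2.mul (ih.1 _ (hF.rho_mul_offD i))).mono (by norm_num)
    · rw [show offD (ex i) rhoI = (-1 : ℝ) • (rhoI * rhoI * nu i) by rw [offD_rhoI, neg_one_smul]]
      exact (((ih.2.mul ih.2).mul (ih.1 _ (HomZ.nu i))).mono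
        (by norm_num : (-1 + -1 + 0 : ℝ) ≤ -1 - 1)).smul _

namespace Sy

variable {b : Bool}

theorem hom {F : OffFn} (hF : HomZ F) : F ∈ Sy b 0 := fun k =>
  ⟨(bdO_hom_rhoI k).1 F hF, fun _ => (bdO_hom_rhoI k).1 _ hF.offD_es⟩

theorem rhoI : rhoI ∈ Sy b (-1) := of_offD_es_eq_zero
  (fun k => ⟨(bdO_hom_rhoI k).2, fun h => by simp at h⟩) offD_es_rhoI

theorem of_derivs {F : OffFn} {a : ℝ} (h : evo F =O[farL] fun q => ‖q.2‖ ^ a)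
    (hD : ∀ i, offD (ex i) F ∈ Sy b (a - 1)) (hs : offD es F = 0) : F ∈ Sy b a := fun k => by
  refine ⟨?_, fun _ => by rw [hs]; exact BdO.zero⟩
  cases k with
  | zero => exact h
  | succ k => exact ⟨h, fun i => (hD i k).1⟩

theorem rho : rho ∈ Sy b 1 := by
  refine of_derivs (IsBigO.of_bound 1 (eventually_offZ.mono fun q hq => ?_)) (fun i => ?_)
    offD_es_rho
  · rw [evo_rho hq, Real.rpow_one, one_mul]
  · rw [offD_rho, sub_self]; exact hom (HomZ.nu i)

/-- The order δ is any positive number. This is how logarithmic terms are absorbed into the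
half-integer orders used for remainders. -/
theorem lg {δ : ℝ} (hδ : 0 < δ) : lg ∈ Sy b δ := by
  refine of_derivs ?_ (fun i => ?_) offD_es_lg
  · have h := (isLittleO_log_rpow_atTop hδ).isBigO.comp_tendsto tendsto_norm_farL
    refine h.congr' (eventually_offZ.mono fun q hq => ?_) (.of_forall fun q => rfl)
    rw [evo_lg hq]; rfl
  · rw [offD_lg]; exact mul_le rhoI (hom (HomZ.nu i)) (by linarith)

theorem pow {F : OffFn} {a : ℝ} (hF : F ∈ Sy b a) (n : ℕ) : F ^ n ∈ Sy b (n * a) := by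
  induction n with
  | zero => simpa using one_mem
  | succ n ih => rw [pow_succ]; refine mul_le ih hF ?_; push_cast; linarith

theorem pow_le {F : OffFn} {a : ℝ} (hF : F ∈ Sy b a) (n : ℕ) {a' : ℝ} (h : n * a ≤ a') :
    F ^ n ∈ Sy b a' := mono (pow hF n) h

end Sy

/-- The inverse of `1 + (log r)²`. -/
def la : OffFn := offX (fun x => (1 + Real.log ‖x‖ ^ 2)⁻¹)
  ((contDiffOn_const.add ((contDiffOn_norm_off.log fun _ hx => norm_ne_zero_iff.2 hx).pow 2)).inv
    fun _ _ => by positivity)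

theorem evo_la {q : PSpace} (hq : q ∈ offZ) : evo la q = (1 + Real.log ‖q.2‖ ^ 2)⁻¹ :=
  evo_offX (fun x => (1 + Real.log ‖x‖ ^ 2)⁻¹) _ hq

theorem la_mul : la * (1 + lg * lg) = 1 := evo_ext fun q hq => by
  rw [← evoHom_apply hq, ← evoHom_apply hq]
  simp only [map_mul, map_add, map_one, evoHom_apply, evo_la hq, evo_lg hq]
  rw [← pow_two]
  exact inv_mul_cancel₀ (by positivity)

/-- The function `log r / (1 + (log r)²)`. -/
def lb : OffFn := la * lg

theorem evo_lb {q : PSpace} (hq : q ∈ offZ) :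
    evo lb q = (1 + Real.log ‖q.2‖ ^ 2)⁻¹ * Real.log ‖q.2‖ := by
  simp only [lb, evo_mul, evo_la hq, evo_lg hq]

/-- `lb` replaces 1/log r: it is smooth also at r = 1, it is a symbol of order zero, and the error
`la` tends to zero. Multiplying C by r⁴ `lb` then produces a symbol of order zero with a nonzero
limit. -/
theorem lb_mul_lg : lb * lg = 1 - la := by
  rw [lb]; linear_combination la_mul

@[simp] theorem offD_es_la : offD es la = 0 := offD_es_offX _ _

@[simp] theorem offD_es_lb : offD es lb = 0 := by simp [lb]

theorem offD_la (i : Fin 3) : offD (ex i) la = -(2 : ℝ) • (la * lb * (rhoI * nu i)) := by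
  have h := congrArg (offD (ex i)) la_mul
  simp only [Derivation.leibniz, map_add, Derivation.map_one_eq_zero, offD_lg, smul_eq_mul] at h
  rw [neg_smul, ← algebraMap_smul OffFn (2 : ℝ), smul_eq_mul, map_ofNat, lb]
  linear_combination la * h - offD (ex i) la * la_mul

theorem offD_lb (i : Fin 3) :
    offD (ex i) lb = la * (rhoI * nu i) + -(2 : ℝ) • (lb * lb * (rhoI * nu i)) := by
  rw [lb, Derivation.leibniz, offD_la, offD_lg, smul_eq_mul, smul_eq_mul, neg_smul, neg_smul,
    ← algebraMap_smul OffFn (2 : ℝ), ← algebraMap_smul OffFn (2 : ℝ), smul_eq_mul, smul_eq_mul,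
    map_ofNat, lb]
  ring

/-- Derivatives of `la` and `lb` are polynomials in `la` and `lb` times ν/r, so the pair is closed
under differentiation and can be treated in one induction. -/
theorem bdO_la_lb (k : ℕ) : BdO k 0 la ∧ BdO k 0 lb := by
  have ha : evo la =O[farL] fun q => ‖q.2‖ ^ (0 : ℝ) :=
    IsBigO.of_bound 1 (eventually_offZ.mono fun q hq => by
      rw [evo_la hq, Real.rpow_zero, norm_one, one_mul, Real.norm_of_nonneg (by positivity)]
      exact inv_le_one_of_one_le₀ (by nlinarith [sq_nonneg (Real.log ‖q.2‖)]))
  have hb : evo lb =O[farL] fun q => ‖q.2‖ ^ (0 : ℝ) :=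
    IsBigO.of_bound 1 (eventually_offZ.mono fun q hq => by
      rw [evo_lb hq, Real.rpow_zero, norm_one, one_mul, norm_mul, Real.norm_of_nonneg (by positivity),
        inv_mul_eq_div, div_le_one (by positivity), Real.norm_eq_abs]
      nlinarith [sq_abs (Real.log ‖q.2‖), sq_nonneg (|Real.log ‖q.2‖| - 1)])
  induction k with
  | zero => exact ⟨ha, hb⟩
  | succ k ih =>
    have hv (i : Fin 3) : BdO k (-1) (rhoI * nu i) :=
      ((bdO_hom_rhoI k).2.mul ((bdO_hom_rhoI k).1 _ (HomZ.nu i))).mono (by norm_num)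
    refine ⟨⟨ha, fun i => ?_⟩, hb, fun i => ?_⟩
    · rw [offD_la]
      exact (((ih.1.mul ih.2).mul (hv i)).mono (by norm_num)).smul _
    · rw [offD_lb]
      exact ((ih.1.mul (hv i)).mono (by norm_num)).add
        ((((ih.2.mul ih.2).mul (hv i)).mono (by norm_num)).smul _)

theorem Sy.la {b : Bool} : la ∈ Sy b 0 := Sy.of_offD_es_eq_zero
  (fun k => ⟨(bdO_la_lb k).1, fun h => by simp at h⟩) offD_es_la

theorem Sy.lb {b : Bool} : lb ∈ Sy b 0 := Sy.of_offD_es_eq_zero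
  (fun k => ⟨(bdO_la_lb k).2, fun h => by simp at h⟩) offD_es_lb

theorem tendsto_lb : Tendsto (evo lb) farL (𝓝 0) := by
  have h1 : Tendsto (fun t : ℝ => (1 + t ^ 2)⁻¹ * t) atTop (𝓝 0) := by
    refine squeeze_zero' (eventually_ge_atTop 0 |>.mono fun t ht => by positivity)
      (g := fun t => t⁻¹) ((eventually_gt_atTop 0).mono fun t ht => ?_) tendsto_inv_atTop_zero
    rw [inv_mul_eq_div, div_le_iff₀ (by positivity), inv_mul_eq_div, le_div_iff₀ ht]
    nlinarith
  have h2 := h1.comp (Real.tendsto_log_atTop.comp tendsto_norm_farL)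
  refine h2.congr' (eventually_offZ.mono fun q hq => ?_)
  rw [evo_lb hq]; rfl

theorem tendsto_la : Tendsto (evo la) farL (𝓝 0) := by
  have h1 : Tendsto (fun t : ℝ => (1 + t ^ 2)⁻¹) atTop (𝓝 0) :=
    tendsto_inv_atTop_zero.comp (tendsto_atTop_add_const_left _ _ (tendsto_pow_atTop two_ne_zero))
  have h2 := h1.comp (Real.tendsto_log_atTop.comp tendsto_norm_farL)
  refine h2.congr' (eventually_offZ.mono fun q hq => ?_)
  rw [evo_la hq]; rfl

/-! ### Functions vanishing for small parameters -/

/-- Vanishing for all small values of the parameter. -/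
def VanN (F : OffFn) : Prop := ∀ᶠ s in 𝓝 (0 : ℝ), ∀ x ≠ 0, evo F (s, x) = 0

theorem VanN.offD {F : OffFn} (h : VanN F) (v : PSpace) : VanN (offD v F) := by
  refine (eventually_eventually_nhds.2 h).mono fun s hs x hx => ?_
  have hq : (s, x) ∈ offZ := mem_offZ.2 hx
  have : evo F =ᶠ[𝓝 (s, x)] fun _ => 0 := by
    filter_upwards [(continuous_fst.tendsto (s, x)).eventually hs, isOpen_offZ.mem_nhds hq]
      with q h1 h2 using h1 _ (mem_offZ.1 h2)
  rw [evo_offD _ _ hq, dirD, this.fderiv_eq]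
  simp

theorem VanN.bdO : ∀ {k : ℕ} {a : ℝ} {F : OffFn}, VanN F → BdO k a F := by
  have h0 {a : ℝ} {F : OffFn} (h : VanN F) : evo F =O[farL] fun q => ‖q.2‖ ^ a := by
    refine IsBigO.of_bound 0 ?_
    filter_upwards [eventually_offZ, tendsto_fst.eventually h] with q hq h1
    simp [h1 q.2 (mem_offZ.1 hq)]
  intro k
  induction k with
  | zero => exact fun h => h0 h
  | succ k ih => exact fun h => ⟨h0 h, fun i => ih (h.offD _)⟩

theorem VanN.mem {F : OffFn} (h : VanN F) (b : Bool) (a : ℝ) : F ∈ Sy b a := fun _ =>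
  ⟨h.bdO, fun _ => (h.offD _).bdO⟩

theorem tendsto_smul_cobounded {n : Space} (hn : ‖n‖ = 1) :
    Tendsto (fun r : ℝ => r • n) atTop (Bornology.cobounded Space) := by
  rw [← tendsto_norm_atTop_iff_cobounded]
  simp only [norm_smul, hn, mul_one]
  exact tendsto_norm_atTop_atTop

/-- The leading coefficient of an expansion is a limit. -/
theorem HomZ.eq_of_tendsto {F X : OffFn} (hF : HomZ F) {w φ : ℝ → ℝ}
    (hφ : Tendsto φ atTop (𝓝 0))
    (h : (fun q : PSpace => w ‖q.2‖ * evo X q - evo F q) =O[farL] fun q => φ ‖q.2‖) :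
    ∀ᶠ s in 𝓝 (0 : ℝ), ∀ n : Space, ‖n‖ = 1 → ∀ l : ℝ,
      Tendsto (fun r : ℝ => w r * evo X (s, r • n)) atTop (𝓝 l) → evo F (s, n) = l := by
  obtain ⟨M, hM⟩ := h.bound
  -- One constant M serves all parameters near zero; at each fixed parameter the limit along a ray
  -- can then be taken.
  refine hM.curry.mono fun s hs n hn l hl => ?_
  have hn0 : n ≠ 0 := by rintro rfl; simp at hn
  have h1 : Tendsto (fun r : ℝ => w r * evo X (s, r • n) - evo F (s, n)) atTop (𝓝 0) := by
    refine squeeze_zero_norm' (a := fun r => M * ‖φ r‖) ?_ (by simpa using hφ.norm.const_mul M)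
    filter_upwards [(tendsto_smul_cobounded hn).eventually hs, eventually_gt_atTop 0] with r h2 hr
    have : ‖r • n‖ = r := by rw [norm_smul, hn, Real.norm_of_nonneg hr.le, mul_one]
    simpa only [this, hF s r n hr hn0] using h2
  have h2 := (hl.sub_const (evo F (s, n)))
  have := tendsto_nhds_unique h1 h2
  linarith

theorem HomZ.evo_unitVec {F : OffFn} (hF : HomZ F) (s : ℝ) {x : Space} (hx : x ≠ 0) :
    evo F (s, x) = evo F (s, unitVec x) :=
  (hF s _ x (inv_pos.2 (norm_pos_iff.2 hx)) hx).symm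

theorem HomZ.vanN {F : OffFn} (hF : HomZ F)
    (h : ∀ᶠ s in 𝓝 (0 : ℝ), ∀ n : Space, ‖n‖ = 1 → evo F (s, n) = 0) : VanN F :=
  h.mono fun s hs x hx => by rw [hF.evo_unitVec s hx, hs _ (norm_unitVec hx)]

end

/-! ### From estimates on iterated derivatives to symbols -/

section

theorem contDiffAt_evo_slice (F : OffFn) (s : ℝ) {x : Space} (hx : x ≠ 0) :
    ContDiffAt ℝ ∞ (fun y => evo F (s, y)) x :=
  (contDiffAt_evo F (q := (s, x)) (mem_offZ.2 hx)).comp x (by fun_prop)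

theorem norm_iteratedFDeriv_offD_le (F : OffFn) (i : Fin 3) (k : ℕ) {q : PSpace} (hq : q ∈ offZ) :
    ‖iteratedFDeriv ℝ k (fun x => evo (offD (ex i) F) (q.1, x)) q.2‖
      ≤ ‖iteratedFDeriv ℝ (k + 1) (fun x => evo F (q.1, x)) q.2‖ := by
  obtain ⟨s, x⟩ := q
  have hx := mem_offZ.1 hq
  set f : Space → ℝ := fun y => evo F (s, y)
  set T : (Space →L[ℝ] ℝ) →L[ℝ] ℝ :=
    ContinuousLinearMap.apply ℝ ℝ (EuclideanSpace.single i (1 : ℝ))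
  have e : (fun y => evo (offD (ex i) F) (s, y)) =ᶠ[𝓝 x] T ∘ fderiv ℝ f := by
    filter_upwards [isOpen_compl_singleton.mem_nhds hx] with y hy
    rw [← pd_evo F hy]; rfl
  have hT : ‖T‖ ≤ 1 := by
    refine ContinuousLinearMap.opNorm_le_bound _ zero_le_one fun L => ?_
    have := L.le_opNorm (EuclideanSpace.single i (1 : ℝ))
    simpa [T] using this
  have h1 := T.norm_iteratedFDeriv_comp_left (N := ∞) (n := k)
    (((contDiffAt_evo_slice F s hx).fderiv_right (m := ∞) (by simp))) (by exact_mod_cast le_top)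
  rw [(e.iteratedFDeriv ℝ k).self_of_nhds, ← norm_iteratedFDeriv_fderiv]
  exact h1.trans (mul_le_of_le_one_left (norm_nonneg _) hT)

theorem bdO_of_iteratedFDeriv : ∀ {k : ℕ} {a : ℤ} {F : OffFn},
    (∀ m : ℕ, (fun q : PSpace => iteratedFDeriv ℝ m (fun x => evo F (q.1, x)) q.2)
      =O[farL] fun q => ‖q.2‖ ^ (a - m : ℤ)) → BdO k a F := by
  have h0 {a : ℤ} {F : OffFn}
      (h : ∀ m : ℕ, (fun q : PSpace => iteratedFDeriv ℝ m (fun x => evo F (q.1, x)) q.2)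
      =O[farL] fun q => ‖q.2‖ ^ (a - m : ℤ)) : evo F =O[farL] fun q => ‖q.2‖ ^ (a : ℝ) := by
    have h1 := (h 0).norm_left
    simp only [norm_iteratedFDeriv_zero, Nat.cast_zero, sub_zero] at h1
    simpa only [Real.rpow_intCast] using h1.of_norm_left
  intro k
  induction k with
  | zero => exact fun h => h0 h
  | succ k ih =>
    intro a F h
    refine ⟨h0 h, fun i => ?_⟩
    have := ih (a := a - 1) (F := offD (ex i) F) fun m => ?_
    · simpa using this
    · refine IsBigO.trans (IsBigO.of_bound 1 (eventually_offZ.mono fun q hq => ?_)) (h (m + 1)) |>.trans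
        (IsBigO.of_bound 1 (.of_forall fun q => ?_))
      · rw [one_mul]; exact norm_iteratedFDeriv_offD_le F i m hq
      · rw [one_mul]; push_cast; rw [sub_sub, add_comm (1 : ℤ)]

theorem iteratedFDeriv_congr_off {f g : Space → ℝ} (h : ∀ x ≠ 0, f x = g x) {x : Space}
    (hx : x ≠ 0) (k : ℕ) : iteratedFDeriv ℝ k f x = iteratedFDeriv ℝ k g x := by
  have e : f =ᶠ[𝓝 x] g := by
    filter_upwards [isOpen_compl_singleton.mem_nhds hx] with y hy using h y hy
  exact (e.iteratedFDeriv ℝ k).self_of_nhds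

theorem Sy.of_family {F : OffFn} {a : ℤ} {ρ : ℝ → Space → ℝ}
    (hF : ∀ s, ∀ x ≠ 0, evo F (s, x) = ρ s x) (h : IsSmallSymbolFamily a ρ) : F ∈ Sy true a := by
  refine fun k => ⟨bdO_of_iteratedFDeriv fun m => ?_, fun _ => bdO_of_iteratedFDeriv fun m => ?_⟩
  · refine (h m 0 zero_le_one).isBigO.congr' (eventually_offZ.mono fun q hq => ?_) .rfl
    simp only [iteratedDeriv_zero]
    exact iteratedFDeriv_congr_off (fun x hx => (hF q.1 x hx).symm) (mem_offZ.1 hq) m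
  · refine (h m 1 le_rfl).isBigO.congr' (eventually_offZ.mono fun q hq => ?_) .rfl
    refine iteratedFDeriv_congr_off (fun x hx => ?_) (mem_offZ.1 hq) m
    rw [iteratedDeriv_one, ← (hasDerivAt_evo F hx).deriv]
    simp only [fun t => hF t x hx]

theorem Sy.of_isBigSymbol {b : Bool} {F : OffFn} {a : ℤ} {ρ : Space → ℝ}
    (hF : ∀ s, ∀ x ≠ 0, evo F (s, x) = ρ x) (h : IsBigSymbol a ρ) : F ∈ Sy b a := by
  refine Sy.of_offD_es_eq_zero (fun k => ⟨bdO_of_iteratedFDeriv fun m => ?_, fun h => by simp at h⟩)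
    (evo_ext fun ⟨s, x⟩ hq => ?_)
  · refine ((h m).comp_tendsto (tendsto_snd (f := 𝓝 (0 : ℝ)))).congr'
      (eventually_offZ.mono fun q hq => ?_) .rfl
    exact iteratedFDeriv_congr_off (fun x hx => (hF q.1 x hx).symm) (mem_offZ.1 hq) m
  · have hx := mem_offZ.1 hq
    have h1 := hasDerivAt_evo (s := s) F hx
    simp only [fun t => hF t x hx] at h1
    rw [h1.unique (hasDerivAt_const s _), ← evoHom_apply hq, map_zero]

/-! ### Constant variations -/

variable {ε : ℝ} {c : ℝ → Fields} {z : Fields}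

theorem isSmallSymbolFamily_const {a : ℤ} {ρ : Space → ℝ} (h : IsSmallSymbol a ρ) :
    IsSmallSymbolFamily a fun _ => ρ := by
  intro k m hm
  interval_cases m
  · simp only [iteratedDeriv_zero]
    exact (h k).comp_tendsto (tendsto_snd (f := 𝓝 (0 : ℝ)))
  · have : (fun q : ℝ × Space => iteratedFDeriv ℝ k
        (fun x => iteratedDeriv 1 (fun _ : ℝ => ρ x) q.1) q.2) = fun _ => 0 := by
      funext q
      simp only [iteratedDeriv_one, deriv_const]
      exact congrFun (iteratedFDeriv_fun_zero (𝕜 := ℝ) (n := k)) q.2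
    rw [this]
    exact isLittleO_zero _ _

/-- A point is treated as a constant curve. Statements about points of 𝒫 become special cases of
statements about variations, and only the latter need an asymptotic analysis. -/
theorem InPhaseSpace.isVariation (hz : InPhaseSpace ε z) : IsVariation ε fun _ => z where
  mem _ := hz
  smooth_g i j := (hz.smooth_g i j).comp contDiff_snd
  smooth_p i j := (hz.smooth_p i j).comp contDiff_snd
  smooth_hBar i j := (hz.hBar_sphere i j).1.comp contDiffOn_snd fun _ hq => hq.2
  smooth_hLog i j := (hz.hLog_sphere i j).1.comp contDiffOn_snd fun _ hq => hq.2
  smooth_h2 i j := (hz.h2_sphere i j).1.comp contDiffOn_snd fun _ hq => hq.2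
  smooth_pBar i j := (hz.pBar_sphere i j).1.comp contDiffOn_snd fun _ hq => hq.2
  smooth_pLog i j := (hz.pLog_sphere i j).1.comp contDiffOn_snd fun _ hq => hq.2
  smooth_p2 i j := (hz.p2_sphere i j).1.comp contDiffOn_snd fun _ hq => hq.2
  smooth_pLL i j := (hz.pLL_sphere i j).1.comp contDiffOn_snd fun _ hq => hq.2
  smooth_p3 i j := (hz.p3_sphere i j).1.comp contDiffOn_snd fun _ hq => hq.2
  falloff_g i j := isSmallSymbolFamily_const (hz.falloff_g i j)
  falloff_p i j := isSmallSymbolFamily_const (hz.falloff_p i j)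

/-! ### Asymptotics of the fields -/

namespace IsVariation

/-- `h̄_{ij}`. -/
def hB (hc : IsVariation ε c) (i j : Fin 3) : OffFn :=
  mkOff (fun q => (c q.1).hBar q.2 i j) (hc.smooth_hBar i j)

/-- `π̄^{ij}`. -/
def pB (hc : IsVariation ε c) (i j : Fin 3) : OffFn :=
  mkOff (fun q => (c q.1).pBar q.2 i j) (hc.smooth_pBar i j)

/-- `π^{(log)ij}`. -/
def pL (hc : IsVariation ε c) (i j : Fin 3) : OffFn :=
  mkOff (fun q => (c q.1).pLog q.2 i j) (hc.smooth_pLog i j)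

/-- `π^{(2)ij}`. -/
def pT (hc : IsVariation ε c) (i j : Fin 3) : OffFn :=
  mkOff (fun q => (c q.1).p2 q.2 i j) (hc.smooth_p2 i j)

variable (hc : IsVariation ε c) (i j : Fin 3)

theorem evo_hB {s : ℝ} {x : Space} (hx : x ≠ 0) : evo (hc.hB i j) (s, x) = (c s).hBar x i j :=
  evo_mkOff _ (hc.smooth_hBar i j) (mem_offZ.2 hx)

theorem evo_pB {s : ℝ} {x : Space} (hx : x ≠ 0) : evo (hc.pB i j) (s, x) = (c s).pBar x i j :=
  evo_mkOff _ (hc.smooth_pBar i j) (mem_offZ.2 hx)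

theorem evo_pL {s : ℝ} {x : Space} (hx : x ≠ 0) : evo (hc.pL i j) (s, x) = (c s).pLog x i j :=
  evo_mkOff _ (hc.smooth_pLog i j) (mem_offZ.2 hx)

theorem evo_pT {s : ℝ} {x : Space} (hx : x ≠ 0) : evo (hc.pT i j) (s, x) = (c s).p2 x i j :=
  evo_mkOff _ (hc.smooth_p2 i j) (mem_offZ.2 hx)

theorem homZ_mkOff {f : ℝ → Space → ℝ} (hf : ContDiffOn ℝ ∞ (fun q : PSpace => f q.1 q.2) offZ)
    (h : ∀ s, IsSphereFun (f s)) : HomZ (mkOff (fun q => f q.1 q.2) hf) := fun s t x ht hx => by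
  rw [evo_mkOff _ hf (smul_mem_offZ ht hx), evo_mkOff _ hf (mem_offZ.2 hx)]
  exact (h s).2 t ht x

theorem homZ_hB : HomZ (hc.hB i j) :=
  homZ_mkOff (f := fun s x => (c s).hBar x i j) _ fun s => (hc.mem s).hBar_sphere i j

theorem homZ_pB : HomZ (hc.pB i j) :=
  homZ_mkOff (f := fun s x => (c s).pBar x i j) _ fun s => (hc.mem s).pBar_sphere i j

theorem homZ_pL : HomZ (hc.pL i j) :=
  homZ_mkOff (f := fun s x => (c s).pLog x i j) _ fun s => (hc.mem s).pLog_sphere i j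

theorem homZ_pT : HomZ (hc.pT i j) :=
  homZ_mkOff (f := fun s x => (c s).p2 x i j) _ fun s => (hc.mem s).p2_sphere i j

/-- `g_{ij}` off the origin. -/
abbrev gO : OffFn := toOff (hc.gA i j)

/-- `π^{ij}` off the origin. -/
abbrev pO : OffFn := toOff (hc.pA i j)

variable {b : Bool}

theorem mem_logTerm {F : OffFn} (hF : HomZ F) (n : ℕ) {a : ℝ} (ha : -n < a) :
    lg * rhoI ^ n * F ∈ Sy b a :=
  Sy.mul_le (Sy.mul (Sy.lg (δ := a + n) (by linarith)) (Sy.pow Sy.rhoI n)) (Sy.hom hF)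
    (by linarith)

theorem mem_powTerm {F : OffFn} (hF : HomZ F) (n : ℕ) {a : ℝ} (ha : -n ≤ a) :
    rhoI ^ n * F ∈ Sy b a :=
  Sy.mul_le (Sy.pow Sy.rhoI n) (Sy.hom hF) (by linarith)

/-- `h^{(log)}_{ij}`. -/
def hL (hc : IsVariation ε c) (i j : Fin 3) : OffFn :=
  mkOff (fun q => (c q.1).hLog q.2 i j) (hc.smooth_hLog i j)

theorem homZ_hL : HomZ (hc.hL i j) :=
  homZ_mkOff (f := fun s x => (c s).hLog x i j) _ fun s => (hc.mem s).hLog_sphere i j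

theorem metric_expansion_log : hc.gO i j - ((if i = j then 1 else 0) + rhoI ^ 1 * hc.hB i j
    + lg * rhoI ^ 2 * hc.hL i j) ∈ Sy b (-2) := by
  set H2 : OffFn := mkOff (fun q => (c q.1).h2 q.2 i j) (hc.smooth_h2 i j)
  have z2 : HomZ H2 := homZ_mkOff (f := fun s x => (c s).h2 x i j) _
    fun s => (hc.mem s).h2_sphere i j
  have hr : hc.gO i j - ((if i = j then 1 else 0) + rhoI ^ 1 * hc.hB i j
      + lg * rhoI ^ 2 * hc.hL i j + rhoI ^ 2 * H2) ∈ Sy true ((-2 : ℤ) : ℝ) := by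
    refine Sy.of_family (fun s x hx => ?_) (hc.falloff_g i j)
    have hq : (s, x) ∈ offZ := mem_offZ.2 hx
    rw [← evoHom_apply hq]
    simp only [map_sub, map_add, map_mul, map_pow, apply_ite (evoHom (s, x) hq), map_one, map_zero]
    simp only [evoHom_apply, evo_toOff _ hq, evo_rhoI hq, evo_lg hq, hc.evo_hB i j hx, metricRem]
    rw [hL, evo_mkOff _ (hc.smooth_hLog i j) hq, evo_mkOff _ (hc.smooth_h2 i j) hq,
      Matrix.one_apply]
    change (c s).g x i j - _ = _
    simp only
    ring
  have h1 : hc.gO i j - ((if i = j then 1 else 0) + rhoI ^ 1 * hc.hB i j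
      + lg * rhoI ^ 2 * hc.hL i j + rhoI ^ 2 * H2) ∈ Sy b (-2) :=
    Sy.mono (Sy.of_true hr) (by norm_num)
  have h3 : rhoI ^ 2 * H2 ∈ Sy b (-2) := mem_powTerm z2 2 (by norm_num)
  convert add_mem h1 h3 using 1
  ring

/-- The order −3/2 comes from log r/r², which is smaller than r^{-3/2}. Only h̄ is needed for the
surface terms; the logarithmic coefficient matters only for C. -/
theorem metric_expansion : hc.gO i j - ((if i = j then 1 else 0) + rhoI ^ 1 * hc.hB i j)
    ∈ Sy b (-3 / 2) := by
  have h1 : hc.gO i j - ((if i = j then 1 else 0) + rhoI ^ 1 * hc.hB i j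
      + lg * rhoI ^ 2 * hc.hL i j) ∈ Sy b (-3 / 2) :=
    Sy.mono (hc.metric_expansion_log i j) (by norm_num)
  have h2 : lg * rhoI ^ 2 * hc.hL i j ∈ Sy b (-3 / 2) := mem_logTerm (hc.homZ_hL i j) 2 (by norm_num)
  convert add_mem h1 h2 using 1
  ring

theorem momentum_expansion : hc.pO i j - (rhoI ^ 2 * hc.pB i j + lg * rhoI ^ 3 * hc.pL i j
    + rhoI ^ 3 * hc.pT i j) ∈ Sy b (-7 / 2) := by
  set H1 : OffFn := mkOff (fun q => (c q.1).pLL q.2 i j) (hc.smooth_pLL i j)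
  set H2 : OffFn := mkOff (fun q => (c q.1).p3 q.2 i j) (hc.smooth_p3 i j)
  have z1 : HomZ H1 := homZ_mkOff (f := fun s x => (c s).pLL x i j) _
    fun s => (hc.mem s).pLL_sphere i j
  have z2 : HomZ H2 := homZ_mkOff (f := fun s x => (c s).p3 x i j) _
    fun s => (hc.mem s).p3_sphere i j
  have hr : hc.pO i j - (rhoI ^ 2 * hc.pB i j + lg * rhoI ^ 3 * hc.pL i j
      + rhoI ^ 3 * hc.pT i j + lg * rhoI ^ 4 * H1 + rhoI ^ 4 * H2) ∈ Sy true ((-4 : ℤ) : ℝ) := by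
    refine Sy.of_family (fun s x hx => ?_) (hc.falloff_p i j)
    have hq : (s, x) ∈ offZ := mem_offZ.2 hx
    rw [← evoHom_apply hq]
    simp only [map_sub, map_add, map_mul, map_pow]
    simp only [evoHom_apply, evo_toOff _ hq, evo_rhoI hq, evo_lg hq, hc.evo_pB i j hx,
      hc.evo_pL i j hx, hc.evo_pT i j hx, momRem]
    rw [evo_mkOff _ (hc.smooth_pLL i j) hq, evo_mkOff _ (hc.smooth_p3 i j) hq]
    change (c s).p x i j - _ = _
    simp only
    ring
  have h1 : hc.pO i j - (rhoI ^ 2 * hc.pB i j + lg * rhoI ^ 3 * hc.pL i j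
      + rhoI ^ 3 * hc.pT i j + lg * rhoI ^ 4 * H1 + rhoI ^ 4 * H2) ∈ Sy b (-7 / 2) :=
    Sy.mono (Sy.of_true hr) (by norm_num)
  have h2 : lg * rhoI ^ 4 * H1 ∈ Sy b (-7 / 2) := mem_logTerm z1 4 (by norm_num)
  have h3 : rhoI ^ 4 * H2 ∈ Sy b (-7 / 2) := mem_powTerm z2 4 (by norm_num)
  convert add_mem h1 (add_mem h2 h3) using 1
  ring

end IsVariation

end

section

/-! ### Polyhomogeneous functions -/

theorem offD_rhoI_pow (n : ℕ) (i : Fin 3) :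
    offD (ex i) (rhoI ^ n) = rhoI ^ (n + 1) * (-(n : OffFn) * nu i) := by
  induction n with
  | zero => simp
  | succ n ih =>
    rw [pow_succ, Derivation.leibniz, ih, offD_rhoI, smul_eq_mul, smul_eq_mul]
    push_cast
    ring

theorem HomZ.natCast (n : ℕ) : HomZ (n : OffFn) := by
  have := HomZ.const (n : ℝ)
  rwa [map_natCast] at this

/-- Homogeneous functions of degree `-n`. -/
def HomS (n : ℕ) : Submodule ℝ OffFn where
  carrier := {F | ∃ G, HomZ G ∧ F = rhoI ^ n * G}
  add_mem' := by
    rintro _ _ ⟨G, hG, rfl⟩ ⟨G', hG', rfl⟩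
    exact ⟨G + G', hG.add hG', by ring⟩
  zero_mem' := ⟨0, HomZ.zero, by simp⟩
  smul_mem' := by
    rintro a _ ⟨G, hG, rfl⟩
    exact ⟨a • G, hG.smul a, by rw [mul_smul_comm]⟩

/-- Sums of a homogeneous function of degree `-n` and one multiplied by the logarithm. -/
def LogS (n : ℕ) : Submodule ℝ OffFn where
  carrier := {F | ∃ G G', HomZ G ∧ HomZ G' ∧ F = lg * rhoI ^ n * G + rhoI ^ n * G'}
  add_mem' := by
    rintro _ _ ⟨G, G', hG, hG', rfl⟩ ⟨H, H', hH, hH', rfl⟩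
    exact ⟨G + H, G' + H', hG.add hH, hG'.add hH', by ring⟩
  zero_mem' := ⟨0, 0, HomZ.zero, HomZ.zero, by simp⟩
  smul_mem' := by
    rintro a _ ⟨G, G', hG, hG', rfl⟩
    exact ⟨a • G, a • G', hG.smul a, hG'.smul a, by rw [mul_smul_comm, mul_smul_comm, smul_add]⟩

theorem mem_HomS {n : ℕ} {G : OffFn} (hG : HomZ G) : rhoI ^ n * G ∈ HomS n := ⟨G, hG, rfl⟩

theorem mem_LogS {n : ℕ} {G : OffFn} (hG : HomZ G) : lg * rhoI ^ n * G ∈ LogS n :=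
  ⟨G, 0, hG, HomZ.zero, by simp⟩

theorem HomS_le_LogS {n : ℕ} : HomS n ≤ LogS n := by
  rintro _ ⟨G, hG, rfl⟩
  exact ⟨0, G, HomZ.zero, hG, by simp⟩

theorem HomS_le_Sy {b : Bool} {n : ℕ} {a : ℝ} (ha : -n ≤ a) : HomS n ≤ Sy b a := by
  rintro _ ⟨G, hG, rfl⟩
  exact IsVariation.mem_powTerm hG n ha

theorem HomS_mul {m n : ℕ} {F G : OffFn} (hF : F ∈ HomS m) (hG : G ∈ HomS n) :
    F * G ∈ HomS (m + n) := by
  obtain ⟨F, h, rfl⟩ := hF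
  obtain ⟨G, h', rfl⟩ := hG
  exact ⟨F * G, h.mul h', by ring⟩

theorem HomS_offD {n : ℕ} {F : OffFn} (hF : F ∈ HomS n) (i : Fin 3) :
    offD (ex i) F ∈ HomS (n + 1) := by
  obtain ⟨F, h, rfl⟩ := hF
  refine ⟨rho * offD (ex i) F + -(n : OffFn) * nu i * F, (h.rho_mul_offD i).add
    (((HomZ.natCast n).neg.mul (HomZ.nu i)).mul h), ?_⟩
  rw [Derivation.leibniz, offD_rhoI_pow, smul_eq_mul, smul_eq_mul]
  linear_combination -rhoI ^ n * offD (ex i) F * rho_rhoI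

theorem LogS_offD {n : ℕ} {F : OffFn} (hF : F ∈ LogS n) (i : Fin 3) :
    offD (ex i) F ∈ LogS (n + 1) := by
  obtain ⟨F, F', h, h', rfl⟩ := hF
  have h1 := HomS_offD (mem_HomS (n := n) h) i
  obtain ⟨G, hG, e⟩ := h1
  have e2 : offD (ex i) (lg * rhoI ^ n * F) = lg * rhoI ^ (n + 1) * G
      + rhoI ^ (n + 1) * (nu i * F) := by
    rw [mul_assoc, Derivation.leibniz, e, offD_lg, smul_eq_mul, smul_eq_mul]
    ring
  rw [map_add, e2]
  exact add_mem (add_mem (mem_LogS hG) (HomS_le_LogS (mem_HomS ((HomZ.nu i).mul h))))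
    (HomS_le_LogS (HomS_offD (mem_HomS h') i))

theorem sup_mul {b : Bool} {m n k : ℕ} {a a' a'' : ℝ} {F G : OffFn} (hF : F ∈ HomS m ⊔ Sy b a)
    (hG : G ∈ HomS n ⊔ Sy b a') (hk : m + n = k) (h1 : a + a' ≤ a'') (h2 : -m + a' ≤ a'')
    (h3 : a + -n ≤ a'') : F * G ∈ HomS k ⊔ Sy b a'' := by
  obtain ⟨F1, hF1, F2, hF2, rfl⟩ := Submodule.mem_sup.1 hF
  obtain ⟨G1, hG1, G2, hG2, rfl⟩ := Submodule.mem_sup.1 hG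
  have e : (F1 + F2) * (G1 + G2) = F1 * G1 + (F1 * G2 + F2 * G1 + F2 * G2) := by ring
  rw [e]
  subst hk
  refine add_mem (Submodule.mem_sup_left (HomS_mul hF1 hG1)) (Submodule.mem_sup_right ?_)
  refine add_mem (add_mem ?_ ?_) (Sy.mul_le hF2 hG2 h1)
  · exact Sy.mul_le (HomS_le_Sy le_rfl hF1) hG2 h2
  · exact Sy.mul_le hF2 (HomS_le_Sy le_rfl hG1) h3

/-! ### Functions asymptotic to constants -/

/-- `F = a + O(1/r)` in the sense of symbols. -/
def Near (b : Bool) (F : OffFn) (a : ℝ) : Prop := F - algebraMap ℝ OffFn a ∈ Sy b (-1)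

namespace Near

variable {b : Bool} {F G : OffFn} {u v : ℝ}

theorem const (u : ℝ) : Near b (algebraMap ℝ OffFn u) u := by
  unfold Near; rw [sub_self]; exact zero_mem _

theorem of_mem (h : F ∈ Sy b (-1)) : Near b F 0 := by unfold Near; simpa using h

theorem mem (h : Near b F u) : F ∈ Sy b 0 := by
  have := add_mem (Sy.mono h (by norm_num : (-1 : ℝ) ≤ 0)) (Sy.const_mem (b := b) u)
  simpa using this

theorem add (hF : Near b F u) (hG : Near b G v) : Near b (F + G) (u + v) := by
  have := add_mem hF hG
  unfold Near; rw [map_add]; convert this using 1; ring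

theorem sub (hF : Near b F u) (hG : Near b G v) : Near b (F - G) (u - v) := by
  have := sub_mem hF hG
  unfold Near; rw [map_sub]; convert this using 1; ring

theorem mul (hF : Near b F u) (hG : Near b G v) : Near b (F * G) (u * v) := by
  have h1 : (F - algebraMap ℝ OffFn u) * G ∈ Sy b (-1) := Sy.mul_le hF hG.mem (by norm_num)
  have h2 : algebraMap ℝ OffFn u * (G - algebraMap ℝ OffFn v) ∈ Sy b (-1) :=
    Sy.mul_le (Sy.const_mem u) hG (by norm_num)
  have := add_mem h1 h2
  unfold Near; rw [map_mul]; convert this using 1; ring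

theorem tendsto (h : Near b F u) : Tendsto (evo F) farL (𝓝 u) := by
  have h1 := (Sy.tendsto_zero h (by norm_num)).add_const u
  rw [zero_add] at h1
  refine h1.congr' (eventually_offZ.mono fun q hq => ?_)
  rw [← evoHom_apply hq, map_sub, evoHom_apply, evoHom_apply, evo_const _ hq]; ring

theorem eventually_half_le (h : Near b F 1) : ∀ᶠ q in farL, (1 / 2 : ℝ) ≤ |evo F q| := by
  filter_upwards [h.tendsto.eventually (lt_mem_nhds (by norm_num : (1 / 2 : ℝ) < 1))] with q hq
  exact hq.le.trans (le_abs_self _)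

/-- Division by a function asymptotic to one. -/
theorem div (hG : Near b G 1) (hF : Near b F u) {U : OffFn} (h : U * G = F) : Near b U u := by
  refine Sy.of_mul_eq (X := G) (Y := F - algebraMap ℝ OffFn u * G) (c := 1 / 2) (by norm_num)
    hG.eventually_half_le hG.mem ?_ (by rw [← h]; ring)
  have := hF.sub ((const (b := b) u).mul hG)
  unfold Near at this
  simpa using this

/-- Factor U² − 1 = (U − 1)(U + 1). Positivity gives U + 1 ≥ 1, so U − 1 decays as fast as G − 1. -/
theorem of_mul_self (hG : Near b G 1) {U : OffFn} (h : U * U = G) (h0 : ∀ q ∈ offZ, 0 < evo U q) :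
    Near b U 1 := by
  have hU : U ∈ Sy b 0 := by
    refine Sy.of_mul_self_eq (c := 1 / 2) (by norm_num) ?_ hG.mem h
    filter_upwards [eventually_offZ, hG.tendsto.eventually
      (lt_mem_nhds (by norm_num : (1 / 2 : ℝ) < 1))] with q hq h1
    have h2 : evo U q * evo U q = evo G q := by rw [← h, evo_mul]
    have h3 := h0 q hq
    rw [abs_of_pos h3]
    nlinarith
  unfold Near
  rw [map_one]
  refine Sy.of_mul_eq (X := U + 1) (Y := G - 1) (c := 1) (by norm_num) ?_
    (add_mem hU Sy.one_mem) (by simpa [Near] using hG) (by rw [← h]; ring)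
  filter_upwards [eventually_offZ] with q hq
  have h3 := h0 q hq
  have : evo (U + 1) q = evo U q + 1 := by
    rw [← evoHom_apply hq, map_add, map_one, evoHom_apply]
  rw [this, abs_of_pos (by linarith)]
  linarith

end Near

/-! ### Asymptotics of the metric -/

namespace IsVariation

variable {ε : ℝ} {c : ℝ → Fields} (hc : IsVariation ε c) {b : Bool}

/-- The inverse metric off the origin. -/
abbrev giO (i j : Fin 3) : OffFn := toOff (hc.giA i j)

theorem toOff_D (i : Fin 3) (F : SmoothFn) : toOff (hc.geom.D i F) = offD (ex i) (toOff F) :=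
  toOff_smD _ F

theorem deltaC (i j : Fin 3) : (if i = j then 1 else 0 : OffFn)
    = algebraMap ℝ OffFn (if i = j then 1 else 0) := by split_ifs <;> simp

theorem near_g (i j : Fin 3) : Near b (hc.gO i j) (if i = j then 1 else 0) := by
  have h1 := Sy.mono (hc.metric_expansion (b := b) i j) (by norm_num : (-3 / 2 : ℝ) ≤ -1)
  have h2 : rhoI ^ 1 * hc.hB i j ∈ Sy b (-1) := mem_powTerm (hc.homZ_hB i j) 1 (by norm_num)
  unfold Near
  rw [← deltaC]
  convert add_mem h1 h2 using 1
  ring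

/-- The determinant of the metric. -/
def detA : SmoothFn := hc.gA 0 0 * (hc.gA 1 1 * hc.gA 2 2 - hc.gA 1 2 * hc.gA 2 1)
  - hc.gA 0 1 * (hc.gA 1 0 * hc.gA 2 2 - hc.gA 1 2 * hc.gA 2 0)
  + hc.gA 0 2 * (hc.gA 1 0 * hc.gA 2 1 - hc.gA 1 1 * hc.gA 2 0)

theorem ev_detA (q : PSpace) : ev q hc.detA = ((c q.1).g q.2).det := by
  rw [Matrix.det_fin_three]
  simp only [detA, map_add, map_sub, map_mul]
  change (c q.1).g q.2 0 0 * ((c q.1).g q.2 1 1 * (c q.1).g q.2 2 2 - _ * _) - _ * (_ * _ - _ * _)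
    + _ * (_ * _ - _ * _) = _
  change _ - (c q.1).g q.2 0 1 * ((c q.1).g q.2 1 0 * (c q.1).g q.2 2 2 - (c q.1).g q.2 1 2
    * (c q.1).g q.2 2 0) + (c q.1).g q.2 0 2 * ((c q.1).g q.2 1 0 * (c q.1).g q.2 2 1
    - (c q.1).g q.2 1 1 * (c q.1).g q.2 2 0) = _
  change (c q.1).g q.2 0 0 * ((c q.1).g q.2 1 1 * (c q.1).g q.2 2 2
    - (c q.1).g q.2 1 2 * (c q.1).g q.2 2 1) - _ + _ = _
  ring

theorem sA_mul_sA : hc.sA * hc.sA = hc.detA := ev_ext fun q => by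
  rw [map_mul, ev_detA]; exact Real.mul_self_sqrt (hc.det_pos q).le

/-- Cramer's rule. With indices taken cyclically modulo 3 the cofactors carry no extra sign. -/
theorem giA_mul_detA (i j : Fin 3) : hc.giA i j * hc.detA
    = hc.gA (j + 1) (i + 1) * hc.gA (j + 2) (i + 2)
      - hc.gA (j + 1) (i + 2) * hc.gA (j + 2) (i + 1) := ev_ext fun q => by
  rw [map_mul, ev_detA, map_sub, map_mul, map_mul]
  change ((c q.1).g q.2)⁻¹ i j * _ = (c q.1).g q.2 (j + 1) (i + 1) * (c q.1).g q.2 (j + 2) (i + 2)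
    - (c q.1).g q.2 (j + 1) (i + 2) * (c q.1).g q.2 (j + 2) (i + 1)
  rw [Matrix.inv_def, Ring.inverse_eq_inv', Matrix.smul_apply, smul_eq_mul, mul_comm,
    mul_inv_cancel_left₀ (hc.det_pos q).ne', Matrix.adjugate_fin_three]
  fin_cases i <;> fin_cases j <;> simp <;> ring

theorem near_det : Near b (toOff hc.detA) 1 := by
  have h (i j : Fin 3) := hc.near_g (b := b) i j
  have := (((h 0 0).mul (((h 1 1).mul (h 2 2)).sub ((h 1 2).mul (h 2 1)))).sub
    ((h 0 1).mul (((h 1 0).mul (h 2 2)).sub ((h 1 2).mul (h 2 0))))).add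
    ((h 0 2).mul (((h 1 0).mul (h 2 1)).sub ((h 1 1).mul (h 2 0))))
  simpa [detA] using this

theorem near_gi (i j : Fin 3) : Near b (hc.giO i j) (if i = j then 1 else 0) := by
  have h (i j : Fin 3) := hc.near_g (b := b) i j
  refine hc.near_det.div ?_ (by rw [← map_mul])
  rw [giA_mul_detA]
  have := ((h (j + 1) (i + 1)).mul (h (j + 2) (i + 2))).sub
    ((h (j + 1) (i + 2)).mul (h (j + 2) (i + 1)))
  simp only [map_sub, map_mul]
  convert this using 1
  fin_cases i <;> fin_cases j <;> simp

theorem near_s : Near b (toOff hc.sA) 1 := by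
  refine hc.near_det.of_mul_self (by rw [← map_mul, sA_mul_sA]) fun q hq => ?_
  rw [evo_toOff _ hq]
  exact Real.sqrt_pos.2 (hc.det_pos q)

theorem near_si : Near b (toOff hc.siA) 1 := by
  refine hc.near_s.div (F := 1) (by simpa using Near.const (b := b) 1) ?_
  rw [← map_mul, mul_comm, show hc.sA * hc.siA = 1 from hc.geom.s_si, map_one]

theorem gO_mem (i j : Fin 3) : hc.gO i j ∈ Sy b 0 := (hc.near_g i j).mem

theorem giO_mem (i j : Fin 3) : hc.giO i j ∈ Sy b 0 := (hc.near_gi i j).mem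

theorem offD_eq_of_near {F : OffFn} {u : ℝ} (v : PSpace) :
    offD v F = offD v (F - algebraMap ℝ OffFn u) := by
  rw [map_sub, Derivation.map_algebraMap, sub_zero]

theorem offD_mem_of_near {F : OffFn} {u : ℝ} (h : Near b F u) (i : Fin 3) :
    offD (ex i) F ∈ Sy b (-2) := by
  rw [offD_eq_of_near (u := u)]
  exact Sy.offD_le h i (by norm_num)

theorem offD_g_mem (i j k : Fin 3) : offD (ex k) (hc.gO i j) ∈ Sy b (-2) :=
  offD_mem_of_near (hc.near_g i j) k

theorem half_mem : toOff (Geom.half SmoothFn) ∈ Sy b 0 := by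
  have : toOff (Geom.half SmoothFn) = algebraMap ℝ OffFn (1 / 2) := toOff.commutes _
  rw [this]; exact Sy.const_mem _

theorem christoffel_mem (k i j : Fin 3) : toOff (hc.geom.Γ k i j) ∈ Sy b (-2) := by
  simp only [Geom.Γ, map_mul, map_sum, map_add, map_sub, hc.toOff_D]
  refine Sy.mul_le half_mem (a' := -2) (sum_mem fun l _ => Sy.mul_le (hc.giO_mem k l) (a' := -2)
    ?_ (by norm_num)) (by norm_num)
  exact sub_mem (add_mem (hc.offD_g_mem _ _ _) (hc.offD_g_mem _ _ _)) (hc.offD_g_mem _ _ _)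

end IsVariation

end

section

/-! ### Asymptotics of the constraints -/

theorem toOff_half : toOff (Geom.half SmoothFn) = Geom.half OffFn := toOff.commutes _

theorem Sy.half {b : Bool} : Geom.half OffFn ∈ Sy b 0 := Sy.const_mem _

theorem Sy.half_mul {b : Bool} {a : ℝ} {F : OffFn} (h : F ∈ Sy b a) : Geom.half OffFn * F ∈ Sy b a :=
  Sy.mul_le Sy.half h (by linarith)

theorem Sy.ofNat_mul {b : Bool} {a : ℝ} {F : OffFn} (n : ℕ) [n.AtLeastTwo] (h : F ∈ Sy b a) :
    (OfNat.ofNat n : OffFn) * F ∈ Sy b a := by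
  have h1 := Sy.const_mem (b := b) (OfNat.ofNat n : ℝ)
  rw [map_ofNat] at h1
  exact Sy.mul_le h1 h (by linarith)

/-- The flat linearized Christoffel symbols. -/
def linΓ (q : Fin 3 → Fin 3 → OffFn) (k i j : Fin 3) : OffFn :=
  Geom.half OffFn * (offD (ex i) (q j k) + offD (ex j) (q i k) - offD (ex k) (q i j))

theorem linΓ_mem {b : Bool} {a : ℝ} {q : Fin 3 → Fin 3 → OffFn} (hq : ∀ i j, q i j ∈ Sy b a)
    (k i j : Fin 3) : linΓ q k i j ∈ Sy b (a - 1) :=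
  Sy.half_mul (sub_mem (add_mem (Sy.offD_mem (hq _ _) _) (Sy.offD_mem (hq _ _) _))
    (Sy.offD_mem (hq _ _) _))

/-- The flat operator `∂_i ∂_j q_{ij} - Δ q_{ii}`. -/
def linR (q : Fin 3 → Fin 3 → OffFn) : OffFn :=
  ∑ i, ∑ k, (offD (ex k) (offD (ex i) (q i k)) - offD (ex k) (offD (ex k) (q i i)))

theorem near_mul_sub {b : Bool} {a : ℝ} {F G : OffFn} {u : ℝ} (hF : Near b F u) (hG : G ∈ Sy b a) :
    F * G - algebraMap ℝ OffFn u * G ∈ Sy b (a - 1) := by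
  have := Sy.mul_le hF hG (by linarith : -1 + a ≤ a - 1)
  convert this using 1
  ring

/-- Contraction with coefficients asymptotic to the identity. -/
theorem contract_sub {b : Bool} {a : ℝ} {M : Fin 3 → OffFn} {G : Fin 3 → OffFn} {k : Fin 3}
    (hM : ∀ l, Near b (M l) (if k = l then 1 else 0)) (hG : ∀ l, G l ∈ Sy b a) :
    ∑ l, M l * G l - G k ∈ Sy b (a - 1) := by
  have h : ∑ l, (M l * G l - algebraMap ℝ OffFn (if k = l then 1 else 0) * G l) ∈ Sy b (a - 1) :=
    sum_mem fun l _ => near_mul_sub (hM l) (hG l)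
  rw [Finset.sum_sub_distrib] at h
  convert h using 2
  simp [apply_ite (algebraMap ℝ OffFn)]

theorem near_add_mem {b : Bool} {a a' : ℝ} {F G : OffFn} (h : F - G ∈ Sy b a) (hG : G ∈ Sy b a')
    (ha : a ≤ a') : F ∈ Sy b a' := by
  have := add_mem (Sy.mono h ha) hG
  rwa [sub_add_cancel] at this

namespace IsVariation

variable {ε : ℝ} {c : ℝ → Fields} (hc : IsVariation ε c) {b : Bool}

theorem near_gi_row (k l : Fin 3) : Near b (hc.giO k l) (if k = l then 1 else 0) := hc.near_gi k l

theorem christoffel_sub (k i j : Fin 3) :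
    toOff (hc.geom.Γ k i j) - linΓ hc.gO k i j ∈ Sy b (-3) := by
  have h := contract_sub (b := b) (a := -2) (hc.near_gi_row k) (G := fun l => linΓ hc.gO l i j)
    fun l => Sy.half_mul (sub_mem (add_mem (hc.offD_g_mem _ _ _) (hc.offD_g_mem _ _ _))
      (hc.offD_g_mem _ _ _))
  have e : toOff (hc.geom.Γ k i j) = ∑ l, hc.giO k l * linΓ hc.gO l i j := by
    simp only [Geom.Γ, map_mul, map_sum, map_add, map_sub, hc.toOff_D, toOff_half, Finset.mul_sum,
      linΓ]
    refine Finset.sum_congr rfl fun l _ => ?_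
    change _ * (toOff (hc.giA k l) * (offD (ex i) (toOff (hc.gA j l))
      + offD (ex j) (toOff (hc.gA i l)) - offD (ex l) (toOff (hc.gA i j)))) = _
    ring
  rw [e]
  exact Sy.mono h (by norm_num)

/-- The flat linearized Ricci tensor. -/
def linRic (q : Fin 3 → Fin 3 → OffFn) (i j : Fin 3) : OffFn :=
  ∑ k, offD (ex k) (linΓ q k i j) - ∑ k, offD (ex j) (linΓ q k i k)

/-- The products of two Christoffel symbols are O(r⁻⁴), and replacing the inverse metric by the
identity inside Γ costs O(r⁻³) before the derivative. Only the flat linearization is therefore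
visible above order r⁻⁴. -/
theorem ricci_sub (i j : Fin 3) : toOff (hc.geom.ric i j) - linRic hc.gO i j ∈ Sy b (-4) := by
  have hG (k i j l : Fin 3) : offD (ex l) (toOff (hc.geom.Γ k i j))
      - offD (ex l) (linΓ hc.gO k i j) ∈ Sy b (-4) := by
    rw [← map_sub]; exact Sy.offD_le (hc.christoffel_sub k i j) l (by norm_num)
  have hq : ∑ k, ∑ l, (toOff (hc.geom.Γ k k l) * toOff (hc.geom.Γ l i j)
      - toOff (hc.geom.Γ k j l) * toOff (hc.geom.Γ l i k)) ∈ Sy b (-4) :=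
    sum_mem fun k _ => sum_mem fun l _ => sub_mem
      (Sy.mul_le (hc.christoffel_mem _ _ _) (hc.christoffel_mem _ _ _) (by norm_num))
      (Sy.mul_le (hc.christoffel_mem _ _ _) (hc.christoffel_mem _ _ _) (by norm_num))
  have h1 := sum_mem (t := Finset.univ) fun k (_ : k ∈ Finset.univ) => hG k i j k
  have h2 := sum_mem (t := Finset.univ) fun k (_ : k ∈ Finset.univ) => hG k i k j
  rw [Finset.sum_sub_distrib] at h1 h2
  convert add_mem (sub_mem h1 h2) hq using 1
  simp only [Geom.ric, map_add, map_sub, map_sum, map_mul, hc.toOff_D, linRic]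
  ring

theorem linRic_mem (i j : Fin 3) : linRic hc.gO i j ∈ Sy b (-3) := by
  have h (k i j l : Fin 3) : offD (ex l) (linΓ hc.gO k i j) ∈ Sy b (-3) := by
    refine Sy.offD_le (a := -2) ?_ l (by norm_num)
    exact Sy.half_mul (sub_mem (add_mem (hc.offD_g_mem _ _ _) (hc.offD_g_mem _ _ _))
      (hc.offD_g_mem _ _ _))
  exact sub_mem (sum_mem fun k _ => h _ _ _ _) (sum_mem fun k _ => h _ _ _ _)

theorem ricci_mem (i j : Fin 3) : toOff (hc.geom.ric i j) ∈ Sy b (-3) :=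
  near_add_mem (hc.ricci_sub i j) (hc.linRic_mem i j) (by norm_num)

theorem scalar_sub : toOff hc.geom.R - linR hc.gO ∈ Sy b (-4) := by
  have h1 (i : Fin 3) := contract_sub (b := b) (a := -3) (k := i) (M := fun j => hc.giO i j)
    (fun l => hc.near_gi i l) (G := fun j => toOff (hc.geom.ric i j)) fun j => hc.ricci_mem i j
  have h2 := sum_mem (t := Finset.univ) fun i (_ : i ∈ Finset.univ) =>
    add_mem (Sy.mono (h1 i) (by norm_num : (-3 - 1 : ℝ) ≤ -4)) (hc.ricci_sub i i)
  convert h2 using 1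
  have e : linR hc.gO = ∑ i, linRic hc.gO i i := by
    have h3 : (2 : OffFn) * Geom.half OffFn = 1 := Geom.two_mul_half
    have hh (v : PSpace) (F : OffFn) :
        offD v (Geom.half OffFn * F) = Geom.half OffFn * offD v F := by
      rw [Derivation.leibniz, Geom.deriv_half, smul_zero, add_zero, smul_eq_mul]
    have hg (i j : Fin 3) : hc.gO i j = hc.gO j i := congrArg toOff (hc.geom.g_symm i j)
    simp only [linR, linRic, linΓ, Fin.sum_univ_three, map_add, map_sub, hh]
    simp only [hg 1 0, hg 2 0, hg 2 1, offD_comm (ex 1) (ex 0), offD_comm (ex 2) (ex 0),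
      offD_comm (ex 2) (ex 1)]
    linear_combination (-(2 * offD (ex 0) (offD (ex 1) (hc.gO 0 1))
      + 2 * offD (ex 0) (offD (ex 2) (hc.gO 0 2)) + 2 * offD (ex 1) (offD (ex 2) (hc.gO 1 2))
      - offD (ex 0) (offD (ex 0) (hc.gO 1 1)) - offD (ex 0) (offD (ex 0) (hc.gO 2 2))
      - offD (ex 1) (offD (ex 1) (hc.gO 0 0)) - offD (ex 1) (offD (ex 1) (hc.gO 2 2))
      - offD (ex 2) (offD (ex 2) (hc.gO 0 0)) - offD (ex 2) (offD (ex 2) (hc.gO 1 1)))) * h3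
  rw [e]
  simp only [Geom.R, map_sum, map_mul]
  change (∑ i, ∑ j, hc.giO i j * _) - _ = _
  simp only [Fin.sum_univ_three]
  ring

theorem linR_mem : linR hc.gO ∈ Sy b (-3) :=
  sum_mem fun _ _ => sum_mem fun _ _ => sub_mem
    (Sy.offD_le (hc.offD_g_mem _ _ _) _ (by norm_num))
    (Sy.offD_le (hc.offD_g_mem _ _ _) _ (by norm_num))

theorem scalar_mem : toOff hc.geom.R ∈ Sy b (-3) :=
  near_add_mem hc.scalar_sub hc.linR_mem (by norm_num)

theorem momentum_sub (i j : Fin 3) : hc.pO i j - rhoI ^ 2 * hc.pB i j ∈ Sy b (-5 / 2) := by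
  have h1 := Sy.mono (hc.momentum_expansion (b := b) i j) (by norm_num : (-7 / 2 : ℝ) ≤ -5 / 2)
  have h2 : lg * rhoI ^ 3 * hc.pL i j ∈ Sy b (-5 / 2) := mem_logTerm (hc.homZ_pL i j) 3 (by norm_num)
  have h3 : rhoI ^ 3 * hc.pT i j ∈ Sy b (-5 / 2) := mem_powTerm (hc.homZ_pT i j) 3 (by norm_num)
  convert add_mem h1 (add_mem h2 h3) using 1
  ring

theorem p_mem (i j : Fin 3) : hc.pO i j ∈ Sy b (-2) :=
  near_add_mem (hc.momentum_sub i j) (mem_powTerm (hc.homZ_pB i j) 2 (by norm_num))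
    (by norm_num)

theorem kin_mem : toOff (hc.geom.kin hc.pA) ∈ Sy b (-4) := by
  have hm (i j : Fin 3) : toOff (hc.geom.mix hc.pA i j) ∈ Sy b (-2) := by
    simp only [Geom.mix, map_sum, map_mul]
    exact sum_mem fun k _ => Sy.mul_le (hc.gO_mem i k) (hc.p_mem k j) (by norm_num)
  have ht : toOff (hc.geom.trP hc.pA) ∈ Sy b (-2) := by
    simp only [Geom.trP, map_sum]; exact sum_mem fun k _ => hm k k
  simp only [Geom.kin, map_sub, map_sum, map_mul, toOff_half, map_pow]
  exact sub_mem (sum_mem fun i _ => sum_mem fun j _ => Sy.mul_le (hm _ _) (hm _ _) (by norm_num))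
    (Sy.half_mul (Sy.pow_le ht 2 (by norm_num)))

theorem constraintC_sub : toOff (hc.geom.C hc.pA) + linR hc.gO ∈ Sy b (-4) := by
  have h1 : toOff (hc.geom.kin hc.pA) * toOff hc.siA ∈ Sy b (-4) :=
    Sy.mul_le hc.kin_mem hc.near_si.mem (by norm_num)
  have h2 := near_mul_sub (hc.near_s (b := b)) (hc.scalar_mem (b := b))
  have h3 := Sy.mono h2 (by norm_num : (-3 - 1 : ℝ) ≤ -4)
  convert sub_mem (sub_mem h1 h3) (hc.scalar_sub (b := b)) using 1
  rw [Geom.C, map_sub, map_mul, map_mul, map_one]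
  change _ * toOff hc.siA - toOff hc.sA * _ + _ = _
  ring

theorem offD_ite (v : PSpace) (i j : Fin 3) : offD v (if i = j then (1 : OffFn) else 0) = 0 := by
  split_ifs <;> simp

/-- The expansion of `C`. -/
theorem constraintC_expansion : ∃ c3 cl : OffFn, HomZ c3 ∧ HomZ cl ∧
    toOff (hc.geom.C hc.pA) - (rhoI ^ 3 * c3 + lg * rhoI ^ 4 * cl) ∈ Sy b (-4) := by
  -- Two derivatives send h̄/r to degree −3, the logarithmic metric term to degree −4 with and
  -- without a logarithm, and the O(r⁻²) remainder to O(r⁻⁴).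
  have hg (i j k l : Fin 3) : offD (ex k) (offD (ex l) (hc.gO i j)) ∈ HomS 3 ⊔ LogS 4 ⊔ Sy b (-4) := by
    have e : offD (ex k) (offD (ex l) (hc.gO i j)) = offD (ex k) (offD (ex l) (rhoI ^ 1 * hc.hB i j))
        + offD (ex k) (offD (ex l) (lg * rhoI ^ 2 * hc.hL i j))
        + offD (ex k) (offD (ex l) (hc.gO i j - ((if i = j then 1 else 0) + rhoI ^ 1 * hc.hB i j
          + lg * rhoI ^ 2 * hc.hL i j))) := by
      simp only [map_sub, map_add, offD_ite, map_zero]; ring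
    rw [e]
    refine add_mem (add_mem ?_ ?_) (Submodule.mem_sup_right ?_)
    · exact Submodule.mem_sup_left (Submodule.mem_sup_left
        (HomS_offD (HomS_offD (mem_HomS (hc.homZ_hB i j)) l) k))
    · exact Submodule.mem_sup_left (Submodule.mem_sup_right
        (LogS_offD (LogS_offD (mem_LogS (hc.homZ_hL i j)) l) k))
    · exact Sy.offD_le (Sy.offD_mem (hc.metric_expansion_log i j) l) k (by norm_num)
  have hR : linR hc.gO ∈ HomS 3 ⊔ LogS 4 ⊔ Sy b (-4) :=
    sum_mem fun i _ => sum_mem fun k _ => sub_mem (hg _ _ _ _) (hg _ _ _ _)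
  have hC : toOff (hc.geom.C hc.pA) ∈ HomS 3 ⊔ LogS 4 ⊔ Sy b (-4) := by
    have := sub_mem (Submodule.mem_sup_right (hc.constraintC_sub (b := b))) hR
    rwa [add_sub_cancel_right] at this
  obtain ⟨F1, hF1, F2, hF2, e⟩ := Submodule.mem_sup.1 hC
  obtain ⟨F3, ⟨c3, h3, rfl⟩, F4, hF4, rfl⟩ := Submodule.mem_sup.1 hF1
  obtain ⟨cl, c4, hl, h4, rfl⟩ := hF4
  refine ⟨c3, cl, h3, hl, ?_⟩
  rw [← e]
  -- The part of degree −4 without a logarithm is not tracked; it joins the remainder.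
  convert add_mem hF2 (mem_powTerm (b := b) h4 4 (by norm_num : (-(4 : ℕ) : ℝ) ≤ -4)) using 1
  ring

/-- The expansion of `C_j`, with its explicit leading term. -/
theorem constraintV_expansion (j : Fin 3) : ∃ vl v4 : OffFn, HomZ vl ∧ HomZ v4 ∧
    toOff (hc.geom.Cv hc.pA j) - (-2 * ∑ i, offD (ex i) (rhoI ^ 2 * hc.pB i j)
      + lg * rhoI ^ 4 * vl + rhoI ^ 4 * v4) ∈ Sy b (-9 / 2) := by
  have hp (i j : Fin 3) : hc.pO i j ∈ HomS 2 ⊔ Sy b (-5 / 2) := by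
    have := add_mem (Submodule.mem_sup_left (T := Sy b (-5 / 2)) (mem_HomS (n := 2) (hc.homZ_pB i j)))
      (Submodule.mem_sup_right (hc.momentum_sub (b := b) i j))
    rwa [add_sub_cancel] at this
  have hh (i j : Fin 3) : hc.gO i j - (if i = j then 1 else 0) ∈ HomS 1 ⊔ Sy b (-3 / 2) := by
    have := add_mem (Submodule.mem_sup_left (T := Sy b (-3 / 2)) (mem_HomS (n := 1) (hc.homZ_hB i j)))
      (Submodule.mem_sup_right (hc.metric_expansion (b := b) i j))
    convert this using 1; ring
  have hDg (i j k : Fin 3) : offD (ex k) (hc.gO i j) ∈ HomS 2 ⊔ Sy b (-5 / 2) := by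
    obtain ⟨F1, hF1, F2, hF2, e⟩ := Submodule.mem_sup.1 (hh i j)
    have e2 : offD (ex k) (hc.gO i j) = offD (ex k) F1 + offD (ex k) F2 := by
      rw [← map_add, e, map_sub, offD_ite, sub_zero]
    rw [e2]
    exact add_mem (Submodule.mem_sup_left (HomS_offD hF1 k))
      (Submodule.mem_sup_right (Sy.offD_le hF2 k (by norm_num)))
  -- Beyond π̄/r², the mixed momentum contains π^{(log)}, π^{(2)} and the product of π̄/r² with
  -- h̄/r. All of these have degree −3 up to one logarithm, with an error of order −7/2.
  have hP (i : Fin 3) : ∑ k, hc.pO i k * hc.gO k j - rhoI ^ 2 * hc.pB i j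
      ∈ LogS 3 ⊔ Sy b (-7 / 2) := by
    have h1 : ∑ k, hc.pO i k * (hc.gO k j - (if k = j then 1 else 0)) ∈ HomS 3 ⊔ Sy b (-7 / 2) :=
      sum_mem fun k _ => sup_mul (hp i k) (hh k j) rfl (by norm_num) (by norm_num) (by norm_num)
    have h2 : ∑ k, hc.pO i k * (hc.gO k j - (if k = j then 1 else 0)) ∈ LogS 3 ⊔ Sy b (-7 / 2) :=
      sup_le_sup_right HomS_le_LogS _ h1
    have h3 : hc.pO i j - rhoI ^ 2 * hc.pB i j ∈ LogS 3 ⊔ Sy b (-7 / 2) := by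
      have := add_mem (Submodule.mem_sup_right (S := LogS 3) (hc.momentum_expansion (b := b) i j))
        (add_mem (Submodule.mem_sup_left (mem_LogS (n := 3) (hc.homZ_pL i j)))
          (Submodule.mem_sup_left (HomS_le_LogS (mem_HomS (n := 3) (hc.homZ_pT i j)))))
      convert this using 1; ring
    convert add_mem h2 h3 using 1
    simp only [mul_sub, Finset.sum_sub_distrib]
    simp
  have hDP (i : Fin 3) : offD (ex i) (∑ k, hc.pO i k * hc.gO k j)
      - offD (ex i) (rhoI ^ 2 * hc.pB i j) ∈ LogS 4 ⊔ Sy b (-9 / 2) := by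
    rw [← map_sub]
    obtain ⟨F1, hF1, F2, hF2, e⟩ := Submodule.mem_sup.1 (hP i)
    rw [← e, map_add]
    exact add_mem (Submodule.mem_sup_left (LogS_offD hF1 i))
      (Submodule.mem_sup_right (Sy.offD_le hF2 i (by norm_num)))
  have hq : ∑ a, ∑ d, hc.pO a d * offD (ex j) (hc.gO a d) ∈ LogS 4 ⊔ Sy b (-9 / 2) :=
    sup_le_sup_right HomS_le_LogS _ (sum_mem fun a _ => sum_mem fun d _ =>
      sup_mul (hp a d) (hDg a d j) rfl (by norm_num) (by norm_num) (by norm_num))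
  have hV : toOff (hc.geom.Cv hc.pA j) - (-2 * ∑ i, offD (ex i) (rhoI ^ 2 * hc.pB i j))
      ∈ LogS 4 ⊔ Sy b (-9 / 2) := by
    have h1 := sum_mem (t := Finset.univ) fun i (_ : i ∈ Finset.univ) => hDP i
    convert add_mem (Submodule.smul_mem _ (-2 : ℝ) h1) hq using 1
    rw [hc.geom.Cv_eq hc.pA hc.pA_symm, map_add, map_mul, map_neg, map_ofNat, neg_smul,
      ← algebraMap_smul OffFn (2 : ℝ), smul_eq_mul, map_ofNat, Finset.sum_sub_distrib]
    simp only [map_sum, map_mul, hc.toOff_D]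
    simp only [show ∀ i j, hc.geom.g i j = hc.gA i j from fun _ _ => rfl]
    ring
  obtain ⟨F1, ⟨vl, v4, hl, h4, rfl⟩, F2, hF2, e⟩ := Submodule.mem_sup.1 hV
  refine ⟨vl, v4, hl, h4, ?_⟩
  convert hF2 using 1
  linear_combination -e

end IsVariation

end

section

/-! ### Leading coefficients and the boundary conditions -/

theorem HomZ.limit_pow {b : Bool} {F X : OffFn} (hF : HomZ F) (n : ℕ)
    (h : X - rhoI ^ n * F ∈ Sy b (-n - 1 / 2)) :
    ∀ᶠ s in 𝓝 (0 : ℝ), ∀ m : Space, ‖m‖ = 1 → ∀ l : ℝ,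
      Tendsto (fun r : ℝ => r ^ n * evo X (s, r • m)) atTop (𝓝 l) → evo F (s, m) = l := by
  refine hF.eq_of_tendsto (φ := fun r => r ^ (-(1 / 2) : ℝ))
    (tendsto_rpow_neg_atTop (by norm_num)) ?_
  obtain ⟨M, hM⟩ := (Sy.isBigO h).bound
  refine IsBigO.of_bound M ?_
  filter_upwards [hM, eventually_one_le] with q hq h1
  have hz := mem_offZ_of_one_le h1
  have hr : 0 < ‖q.2‖ := by linarith
  have e : ‖q.2‖ ^ n * evo X q - evo F q = ‖q.2‖ ^ n * evo (X - rhoI ^ n * F) q := by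
    rw [← evoHom_apply hz (X - _), map_sub, map_mul, map_pow]
    simp only [evoHom_apply, evo_rhoI hz, inv_pow]
    field_simp
  rw [e, norm_mul, norm_pow, norm_norm]
  calc ‖q.2‖ ^ n * ‖evo (X - rhoI ^ n * F) q‖
      ≤ ‖q.2‖ ^ n * (M * ‖‖q.2‖ ^ (-n - 1 / 2 : ℝ)‖) := by gcongr
    _ = M * ‖‖q.2‖ ^ (-(1 / 2) : ℝ)‖ := by
      rw [Real.norm_of_nonneg (by positivity), Real.norm_of_nonneg (by positivity),
        show (-n - 1 / 2 : ℝ) = -n + -(1 / 2) by ring, Real.rpow_add hr, Real.rpow_neg hr.le,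
        Real.rpow_natCast]
      field_simp

theorem HomZ.limit_log {b : Bool} {F X : OffFn} (hF : HomZ F) (n : ℕ)
    (h : X - lg * rhoI ^ n * F ∈ Sy b (-n)) :
    ∀ᶠ s in 𝓝 (0 : ℝ), ∀ m : Space, ‖m‖ = 1 → ∀ l : ℝ,
      Tendsto (fun r : ℝ => r ^ n / Real.log r * evo X (s, r • m)) atTop (𝓝 l) →
        evo F (s, m) = l := by
  refine hF.eq_of_tendsto (w := fun r => r ^ n / Real.log r) (φ := fun r => (Real.log r)⁻¹)
    (tendsto_inv_atTop_zero.comp Real.tendsto_log_atTop) ?_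
  obtain ⟨M, hM⟩ := (Sy.isBigO h).bound
  refine IsBigO.of_bound M ?_
  filter_upwards [hM, eventually_one_le, tendsto_norm_farL.eventually_gt_atTop 1] with q hq h1 h2
  have hz := mem_offZ_of_one_le h1
  have hr : 0 < ‖q.2‖ := by linarith
  have hl : 0 < Real.log ‖q.2‖ := Real.log_pos h2
  have e : ‖q.2‖ ^ n / Real.log ‖q.2‖ * evo X q - evo F q
      = (Real.log ‖q.2‖)⁻¹ * (‖q.2‖ ^ n * evo (X - lg * rhoI ^ n * F) q) := by
    rw [← evoHom_apply hz (X - _), map_sub, map_mul, map_mul, map_pow]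
    simp only [evoHom_apply, evo_rhoI hz, evo_lg hz, inv_pow]
    field_simp
  rw [e, norm_mul, norm_mul, norm_pow, norm_norm, mul_comm M]
  refine mul_le_mul_of_nonneg_left ?_ (norm_nonneg _)
  calc ‖q.2‖ ^ n * ‖evo (X - lg * rhoI ^ n * F) q‖
      ≤ ‖q.2‖ ^ n * (M * ‖‖q.2‖ ^ (-n : ℝ)‖) := by gcongr
    _ = M := by
      rw [Real.norm_of_nonneg (by positivity), Real.rpow_neg hr.le, Real.rpow_natCast]
      field_simp

/-- A coefficient that vanishes for all small parameters may be dropped from an expansion together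
with its derivatives. This allows the boundary conditions to be used one coefficient after another.
-/
theorem sub_mem_of_vanN {b : Bool} {a : ℝ} {F G H : OffFn} (h : F - (G * H) ∈ Sy b a)
    (hH : VanN H) : F ∈ Sy b a := by
  have hv : VanN (G * H) := hH.mono fun s hs x hx => by simp only [evo_mul, hs x hx, mul_zero]
  have := add_mem h (hv.mem b a)
  rwa [sub_add_cancel] at this

namespace IsVariation

variable {ε : ℝ} {c : ℝ → Fields} (hc : IsVariation ε c) {b : Bool}

/-- The function `C` off the origin. -/
abbrev CO : OffFn := toOff (hc.geom.C hc.pA)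

/-- The functions `C_j` off the origin. -/
abbrev CvO (j : Fin 3) : OffFn := toOff (hc.geom.Cv hc.pA j)

theorem evo_CO (s : ℝ) {x : Space} (hx : x ≠ 0) :
    evo hc.CO (s, x) = constraintC (c s).g (c s).p x := by
  rw [evo_toOff _ (mem_offZ.2 hx), hc.constraintC_eq]

theorem evo_CvO (j : Fin 3) (s : ℝ) {x : Space} (hx : x ≠ 0) :
    evo (hc.CvO j) (s, x) = constraintV (c s).g (c s).p x j := by
  rw [evo_toOff _ (mem_offZ.2 hx), hc.constraintV_eq]

theorem tendsto_congr_ray {f g : ℝ → Space → ℝ} (h : ∀ r, ∀ x ≠ 0, f r x = g r x) {m : Space}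
    (hm : ‖m‖ = 1) {l : ℝ} (hl : Tendsto (fun r : ℝ => f r (r • m)) atTop (𝓝 l)) :
    Tendsto (fun r : ℝ => g r (r • m)) atTop (𝓝 l) := by
  refine hl.congr' ((eventually_gt_atTop 0).mono fun r hr => h r _ (smul_ne_zero hr.ne' ?_))
  rintro rfl; simp at hm

/-- `C` has a leading term `r⁻⁴ log r`, with a nowhere vanishing coefficient. -/
theorem constraintC_leading : ∃ cl : OffFn, HomZ cl ∧ (∀ n : Space, ‖n‖ = 1 → evo cl (0, n) ≠ 0) ∧
    hc.CO - lg * rhoI ^ 4 * cl ∈ Sy b (-4) := by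
  obtain ⟨c3, cl, h3, hl, h0⟩ := hc.constraintC_expansion (b := b)
  have h : hc.CO - (rhoI ^ 3 * c3 + lg * rhoI ^ 4 * cl) ∈ Sy b (-4) := h0
  have hlog : lg * rhoI ^ 4 * cl ∈ Sy b (-7 / 2) := mem_logTerm hl 4 (by norm_num)
  have h1 : hc.CO - rhoI ^ 3 * c3 ∈ Sy b (-(3 : ℕ) - 1 / 2) := by
    have := add_mem (Sy.mono h (by norm_num : (-4 : ℝ) ≤ -7 / 2)) hlog
    rw [show (-(3 : ℕ) - 1 / 2 : ℝ) = -7 / 2 by norm_num]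
    convert this using 1; ring
  -- The condition C^{(1)} = 0 holds for every member of the curve, so the coefficient vanishes for
  -- all s near 0 and not merely at s = 0.
  have hv : VanN c3 := h3.vanN <| (h3.limit_pow 3 h1).mono fun s hs n hn => hs n hn 0 <|
    tendsto_congr_ray (f := fun r x => r ^ 3 * constraintC (c s).g (c s).p x)
      (g := fun r x => r ^ 3 * evo hc.CO (s, x)) (fun r x hx => by rw [hc.evo_CO s hx]) hn
      ((hc.mem s).c_one n hn)
  have h4 : hc.CO - lg * rhoI ^ 4 * cl ∈ Sy b (-4) := by
    refine sub_mem_of_vanN (G := rhoI ^ 3) (H := c3) ?_ hv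
    convert h using 1; ring
  refine ⟨cl, hl, fun n hn => ?_, h4⟩
  obtain ⟨l, hl0, hlim⟩ := (hc.mem 0).c_log n hn
  have h5 := (hl.limit_log 4 (X := hc.CO) (by exact_mod_cast h4)).self_of_nhds n hn l
  rw [h5]
  · exact hl0
  · exact tendsto_congr_ray
      (f := fun r x => r ^ 4 / Real.log r * constraintC (c 0).g (c 0).p x)
      (g := fun r x => r ^ 4 / Real.log r * evo hc.CO (0, x))
      (fun r x hx => by rw [hc.evo_CO 0 hx]) hn hlim

theorem CO_mem : hc.CO ∈ Sy b (-7 / 2) := by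
  obtain ⟨cl, hl, -, h⟩ := hc.constraintC_leading (b := b)
  exact near_add_mem h (mem_logTerm hl 4 (a := -7 / 2) (by norm_num)) (by norm_num)

/-- The leading coefficient of `C_j` vanishes. -/
theorem vanN_div_pB (j : Fin 3) : VanN (∑ i, offD (ex i) (rhoI ^ 2 * hc.pB i j)) ∧
    hc.CvO j ∈ Sy b (-9 / 2) := by
  obtain ⟨vl, v4, hl, h4, h⟩ := hc.constraintV_expansion (b := b) j
  obtain ⟨v3, h3, e3⟩ : -2 * ∑ i, offD (ex i) (rhoI ^ 2 * hc.pB i j) ∈ HomS 3 := by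
    have : ∑ i, offD (ex i) (rhoI ^ 2 * hc.pB i j) ∈ HomS 3 :=
      sum_mem fun i _ => HomS_offD (mem_HomS (hc.homZ_pB i j)) i
    have e : -2 * ∑ i, offD (ex i) (rhoI ^ 2 * hc.pB i j)
        = (-2 : ℝ) • ∑ i, offD (ex i) (rhoI ^ 2 * hc.pB i j) := by
      rw [neg_smul, ← algebraMap_smul OffFn (2 : ℝ), smul_eq_mul, map_ofNat]; ring
    rw [e]
    exact Submodule.smul_mem _ _ this
  rw [e3] at h
  change hc.CvO j - _ ∈ _ at h
  have hl1 : lg * rhoI ^ 4 * vl ∈ Sy b (-7 / 2) := mem_logTerm hl 4 (by norm_num)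
  have h41 : rhoI ^ 4 * v4 ∈ Sy b (-4) := mem_powTerm h4 4 (by norm_num)
  -- The coefficients of r⁻³, r⁻⁴ log r and r⁻⁴ are removed in this order. Each is identified as a
  -- limit only after the previous ones are known to vanish.
  have step1 : hc.CvO j - rhoI ^ 3 * v3 ∈ Sy b (-(3 : ℕ) - 1 / 2) := by
    have := add_mem (add_mem (Sy.mono h (by norm_num : (-9 / 2 : ℝ) ≤ -7 / 2)) hl1)
      (Sy.mono h41 (by norm_num : (-4 : ℝ) ≤ -7 / 2))
    rw [show (-(3 : ℕ) - 1 / 2 : ℝ) = -7 / 2 by norm_num]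
    convert this using 1; ring
  have hv3 : VanN v3 := h3.vanN <| (h3.limit_pow 3 step1).mono fun s hs n hn => hs n hn 0 <|
    tendsto_congr_ray (f := fun r x => r ^ 3 * constraintV (c s).g (c s).p x j)
      (g := fun r x => r ^ 3 * evo (hc.CvO j) (s, x)) (fun r x hx => by rw [hc.evo_CvO j s hx]) hn
      ((hc.mem s).v_one n hn j)
  have h' : hc.CvO j - (lg * rhoI ^ 4 * vl + rhoI ^ 4 * v4) ∈ Sy b (-9 / 2) := by
    refine sub_mem_of_vanN (G := rhoI ^ 3) (H := v3) ?_ hv3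
    convert h using 1; ring
  have step2 : hc.CvO j - lg * rhoI ^ 4 * vl ∈ Sy b (-(4 : ℕ)) := by
    have := add_mem (Sy.mono h' (by norm_num : (-9 / 2 : ℝ) ≤ -4)) h41
    rw [show (-(4 : ℕ) : ℝ) = -4 by norm_num]
    convert this using 1; ring
  have hvl : VanN vl := hl.vanN <| (hl.limit_log 4 step2).mono fun s hs n hn => hs n hn 0 <|
    tendsto_congr_ray (f := fun r x => r ^ 4 / Real.log r * constraintV (c s).g (c s).p x j)
      (g := fun r x => r ^ 4 / Real.log r * evo (hc.CvO j) (s, x))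
      (fun r x hx => by rw [hc.evo_CvO j s hx]) hn ((hc.mem s).v_log n hn j)
  have h'' : hc.CvO j - rhoI ^ 4 * v4 ∈ Sy b (-9 / 2) := by
    refine sub_mem_of_vanN (G := lg * rhoI ^ 4) (H := vl) ?_ hvl
    convert h' using 1; ring
  have hv4 : VanN v4 := h4.vanN <| (h4.limit_pow (b := b) 4
      (by norm_num at h'' ⊢; exact h'')).mono fun s hs n hn => hs n hn 0 <|
    tendsto_congr_ray (f := fun r x => r ^ 4 * constraintV (c s).g (c s).p x j)
      (g := fun r x => r ^ 4 * evo (hc.CvO j) (s, x))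
      (fun r x hx => by rw [hc.evo_CvO j s hx]) hn ((hc.mem s).v_two n hn j)
  refine ⟨hv3.mono fun s hs x hx => ?_, sub_mem_of_vanN (G := rhoI ^ 4) (H := v4) h'' hv4⟩
  have e4 := congrArg (fun F => evo F (s, x)) e3
  have hq : (s, x) ∈ offZ := mem_offZ.2 hx
  simp only [evo_mul, hs x hx, mul_zero] at e4
  have h2 : evo (-2 : OffFn) (s, x) = -2 := by
    rw [← evoHom_apply hq, map_neg, map_ofNat]
  rw [h2] at e4
  linarith

theorem CvO_mem (j : Fin 3) : hc.CvO j ∈ Sy b (-9 / 2) := (hc.vanN_div_pB j).2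

/-- The rescaling of `C` which is bounded below. -/
def CHat : OffFn := hc.CO * (rho ^ 4 * lb)

theorem scale_mem : rho ^ 4 * lb ∈ Sy b 4 :=
  Sy.mul_le (Sy.pow Sy.rho 4) Sy.lb (by norm_num)

theorem CHat_eq {cl : OffFn} : hc.CHat = cl - cl * la
    + (hc.CO - lg * rhoI ^ 4 * cl) * rho ^ 4 * lb := by
  have h : rho ^ 4 * rhoI ^ 4 = 1 := by rw [← mul_pow, rho_rhoI, one_pow]
  rw [CHat]
  linear_combination (lg * cl * lb) * h + cl * lb_mul_lg

/-- The rescaled C differs from its leading coefficient `cl` by terms tending to zero. At s = 0 this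
coefficient has a positive minimum of its modulus on the compact sphere; half of it remains for
nearby s, and a quarter after the error is subtracted. -/
theorem CHat_bounds : hc.CHat ∈ Sy b 0 ∧ ∃ m > 0, ∀ᶠ q in farL, m ≤ |evo hc.CHat q| := by
  obtain ⟨cl, hl, h0, h⟩ := hc.constraintC_leading (b := b)
  have hE : (hc.CO - lg * rhoI ^ 4 * cl) * rho ^ 4 ∈ Sy b 0 :=
    Sy.mul_le h (Sy.pow Sy.rho 4) (by norm_num)
  have hcl : cl ∈ Sy b 0 := Sy.hom hl
  refine ⟨?_, ?_⟩
  · rw [hc.CHat_eq (cl := cl)]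
    exact add_mem (sub_mem hcl (Sy.mul_le hcl Sy.la (by norm_num)))
      (Sy.mul_le hE Sy.lb (by norm_num))
  · have hcont {q : PSpace} (hq : q ∈ offZ) : ContinuousAt (evo cl) q :=
      (contDiffAt_evo cl hq).continuousAt
    have hS (n : Space) (hn : n ∈ Metric.sphere (0 : Space) 1) : ((0 : ℝ), n) ∈ offZ :=
      mem_offZ.2 (ne_zero_of_mem_unit_sphere ⟨n, hn⟩)
    obtain ⟨n0, hn0, hmin⟩ := (isCompact_sphere (0 : Space) 1).exists_isMinOn
      (NormedSpace.sphere_nonempty.2 zero_le_one) (f := fun n => |evo cl (0, n)|) fun n hn =>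
        (ContinuousAt.comp (f := fun y : Space => ((0 : ℝ), y)) (hcont (hS n hn))
          (by fun_prop)).abs.continuousWithinAt
    set m := |evo cl (0, n0)| with hm
    have hm0 : 0 < m := abs_pos.2 (h0 n0 (by simpa using hn0))
    have hs : ∀ᶠ s in 𝓝 (0 : ℝ), ∀ n ∈ Metric.sphere (0 : Space) 1, m / 2 < |evo cl (s, n)| := by
      refine (isCompact_sphere (0 : Space) 1).eventually_forall_of_forall_eventually
        fun n hn => ?_
      have : m / 2 < |evo cl (0, n)| := lt_of_lt_of_le (by linarith) (hmin hn)
      exact (hcont (hS n hn)).abs.eventually (lt_mem_nhds this)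
    have hlim : Tendsto (fun q => evo (hc.CHat - cl) q) farL (𝓝 0) := by
      have t1 : Tendsto (fun q => evo cl q * evo la q) farL (𝓝 0) := by
        have : (fun q => evo cl q * evo la q) =O[farL] evo la := by
          have := (hl.isBigO).mul (isBigO_refl (evo la) farL)
          simpa using this
        exact this.trans_tendsto tendsto_la
      have t2 : Tendsto (fun q => evo ((hc.CO - lg * rhoI ^ 4 * cl) * rho ^ 4) q * evo lb q)
          farL (𝓝 0) := by
        have : (fun q => evo ((hc.CO - lg * rhoI ^ 4 * cl) * rho ^ 4) q * evo lb q)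
            =O[farL] evo lb := by
          have := (Sy.isBigO hE).mul (isBigO_refl (evo lb) farL)
          simpa using this
        exact this.trans_tendsto tendsto_lb
      have t3 := t2.sub t1
      rw [sub_zero] at t3
      refine t3.congr' (eventually_offZ.mono fun q hq => ?_)
      have e : hc.CHat - cl = (hc.CO - lg * rhoI ^ 4 * cl) * rho ^ 4 * lb - cl * la := by
        rw [hc.CHat_eq (cl := cl)]; ring
      simp only [e]
      rw [← evoHom_apply hq (_ - _), map_sub, map_mul _ _ lb, map_mul _ cl la]
      simp only [evoHom_apply]
    refine ⟨m / 4, by positivity, ?_⟩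
    filter_upwards [tendsto_fst.eventually hs, eventually_offZ,
      hlim.eventually (Metric.ball_mem_nhds 0 (by positivity : 0 < m / 4))] with q h1 h2 h3
    have h4 := h1 (unitVec q.2) (by simpa using norm_unitVec (mem_offZ.1 h2))
    rw [← hl.evo_unitVec q.1 (mem_offZ.1 h2)] at h4
    have h5 : |evo (hc.CHat - cl) q| < m / 4 := by simpa [Real.dist_eq] using h3
    have e : evo (hc.CHat - cl) q = evo hc.CHat q - evo cl q := by
      rw [← evoHom_apply h2, map_sub, evoHom_apply, evoHom_apply]
    rw [e] at h5
    have := abs_sub_abs_le_abs_sub (evo cl q) (evo hc.CHat q)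
    rw [abs_sub_comm] at this
    change m / 2 < |evo cl q| at h4
    linarith

theorem constraintC_ne_zero (hc : IsVariation ε c) (s : ℝ) (x : Space) :
    constraintC (c s).g (c s).p x ≠ 0 := fun h => by
  have := (hc.mem s).dust_sign x
  rw [h, mul_zero] at this
  exact lt_irrefl _ this

/-- The inverse of `C`. -/
def CInvA : SmoothFn := ⟨fun q => (ev q (hc.geom.C hc.pA))⁻¹,
  (smooth_contDiff (hc.geom.C hc.pA)).inv fun ⟨s, x⟩ => by
    have := hc.constraintC_ne_zero s x
    rwa [hc.constraintC_eq] at this⟩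

theorem C_mul_CInv : hc.geom.C hc.pA * hc.CInvA = 1 := ev_ext fun ⟨s, x⟩ => by
  have := hc.constraintC_ne_zero s x
  rw [hc.constraintC_eq] at this
  rw [map_mul, map_one]
  exact mul_inv_cancel₀ this

/-- The quotient C_j/C solves U · `CHat` = C_j r⁴ `lb`, whose right side has order −9/2 + 4, and
`CHat` is bounded below. -/
theorem ratio_mem (j : Fin 3) : hc.CvO j * toOff hc.CInvA ∈ Sy b (-1 / 2) := by
  obtain ⟨h1, m, hm, h2⟩ := hc.CHat_bounds (b := b)
  refine Sy.of_mul_eq hm h2 h1 (Y := hc.CvO j * (rho ^ 4 * lb))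
    (Sy.mul_le (hc.CvO_mem j) scale_mem (by norm_num)) ?_
  have h3 : hc.CO * toOff hc.CInvA = 1 := by rw [← map_mul, C_mul_CInv, map_one]
  rw [CHat]
  linear_combination (hc.CvO j * (rho ^ 4 * lb)) * h3

/-- The lapse off the origin. -/
abbrev NO : OffFn := toOff hc.NA

/-- The shift off the origin. -/
abbrev NvO (i : Fin 3) : OffFn := toOff (hc.NvA i)

/-- The inverse lapse tends to the sign. -/
theorem near_inv_lapse (hε : ε = 1 ∨ ε = -1) :
    Near b (algebraMap ℝ OffFn ε * (toOff hc.hamA * toOff hc.CInvA)) 1 := by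
  have hee : ε * ε = 1 := by rcases hε with rfl | rfl <;> norm_num
  -- This is (H/C)². Two factors C_j/C of order −1/2 make it 1 + O(r⁻¹), and εH/C is its positive
  -- square root by the sign condition on C.
  have hG : Near b (1 - ∑ i, ∑ j, hc.giO i j * (hc.CvO i * toOff hc.CInvA)
      * (hc.CvO j * toOff hc.CInvA)) 1 := by
    have h : ∑ i, ∑ j, hc.giO i j * (hc.CvO i * toOff hc.CInvA) * (hc.CvO j * toOff hc.CInvA)
        ∈ Sy b (-1) := sum_mem fun i _ => sum_mem fun j _ => Sy.mul_le
      (Sy.mul (hc.giO_mem i j) (hc.ratio_mem i)) (hc.ratio_mem j) (by norm_num)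
    have h1 : Near b 1 1 := by simpa using Near.const (b := b) 1
    have := h1.sub (Near.of_mem h)
    rwa [sub_zero] at this
  refine hG.of_mul_self ?_ fun q hq => ?_
  · have h1 : hc.hamA * hc.hamA = hc.hamSqA := by
      have := hc.isHam.sq
      exact this
    have h2 : hc.CO * toOff hc.CInvA = 1 := by rw [← map_mul, C_mul_CInv, map_one]
    have h3 : algebraMap ℝ OffFn ε * algebraMap ℝ OffFn ε = 1 := by rw [← map_mul, hee, map_one]
    have h4 : toOff hc.hamA * toOff hc.hamA
        = hc.CO ^ 2 - ∑ i, ∑ j, hc.giO i j * hc.CvO i * hc.CvO j := by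
      rw [← map_mul, h1, hamSqA]
      simp only [map_sub, map_pow, map_sum, map_mul]
      rfl
    have h5 : ∑ i, ∑ j, hc.giO i j * (hc.CvO i * toOff hc.CInvA) * (hc.CvO j * toOff hc.CInvA)
        = toOff hc.CInvA ^ 2 * ∑ i, ∑ j, hc.giO i j * hc.CvO i * hc.CvO j := by
      simp only [Finset.mul_sum]
      exact Finset.sum_congr rfl fun i _ => Finset.sum_congr rfl fun j _ => by ring
    rw [h5]
    linear_combination (toOff hc.hamA * toOff hc.CInvA) ^ 2 * h3 + toOff hc.CInvA ^ 2 * h4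
      + (hc.CO * toOff hc.CInvA + 1) * h2
  · have h1 := (hc.mem q.1).dust_sign q.2
    have h2 := hc.ham_pos q
    rw [← evoHom_apply hq, map_mul, map_mul, AlgHom.commutes]
    simp only [evoHom_apply, evo_toOff _ hq]
    change 0 < ε * (hamDensity (c q.1).g (c q.1).p q.2 * (ev (q.1, q.2) (hc.geom.C hc.pA))⁻¹)
    rw [← hc.constraintC_eq]
    have h3 : 0 < ε * (constraintC (c q.1).g (c q.1).p q.2)⁻¹ := by
      rcases hε with rfl | rfl
      · simpa using h1
      · have : constraintC (c q.1).g (c q.1).p q.2 < 0 := by linarith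
        have := inv_lt_zero.2 this
        linarith
    calc 0 < hamDensity (c q.1).g (c q.1).p q.2 * (ε * (constraintC (c q.1).g (c q.1).p q.2)⁻¹) :=
          mul_pos h2 h3
      _ = _ := by ring

theorem near_lapse (hε : ε = 1 ∨ ε = -1) : Near b hc.NO ε := by
  have hee : ε * ε = 1 := by rcases hε with rfl | rfl <;> norm_num
  refine (hc.near_inv_lapse hε).div (Near.const ε) ?_
  have h2 : hc.CO * toOff hc.CInvA = 1 := by rw [← map_mul, C_mul_CInv, map_one]
  have h3 : toOff hc.hamA * toOff hc.hamInvA = 1 := by rw [← map_mul, hc.isHam.inv, map_one]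
  rw [NO, NA, Geom.N, map_mul]
  linear_combination (algebraMap ℝ OffFn ε * (toOff hc.hamA * toOff hc.hamInvA)) * h2
    + algebraMap ℝ OffFn ε * h3

/-- The shift is −g^{ij}(C_j/C) times the lapse, so it inherits the order of the quotient. -/
theorem shift_mem (hε : ε = 1 ∨ ε = -1) (i : Fin 3) : hc.NvO i ∈ Sy b (-1 / 2) := by
  have h2 : hc.CO * toOff hc.CInvA = 1 := by rw [← map_mul, C_mul_CInv, map_one]
  have e : hc.NvO i = -((∑ j, hc.giO i j * (hc.CvO j * toOff hc.CInvA)) * hc.NO) := by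
    rw [NvO, NvA, Geom.Nv, NO, NA, Geom.N]
    simp only [map_mul, map_neg, map_sum]
    change -(∑ j, hc.giO i j * hc.CvO j) * _ = -((∑ j, hc.giO i j * (hc.CvO j * _)) * _)
    have : ∑ j, hc.giO i j * (hc.CvO j * toOff hc.CInvA)
        = toOff hc.CInvA * ∑ j, hc.giO i j * hc.CvO j := by
      rw [Finset.mul_sum]; exact Finset.sum_congr rfl fun j _ => by ring
    rw [this]
    linear_combination (∑ j, hc.giO i j * hc.CvO j) * toOff hc.hamInvA * h2
  rw [e]
  exact neg_mem (Sy.mul_le (sum_mem fun j _ => Sy.mul_le (hc.giO_mem i j) (hc.ratio_mem j)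
    (by norm_num : (0 + -1 / 2 : ℝ) ≤ -1 / 2)) (hc.near_lapse hε).mem (by norm_num))

theorem ham_mem (hε : ε = 1 ∨ ε = -1) : toOff hc.hamA ∈ Sy b (-7 / 2) := by
  have hee : ε * ε = 1 := by rcases hε with rfl | rfl <;> norm_num
  have h2 : hc.CO * toOff hc.CInvA = 1 := by rw [← map_mul, C_mul_CInv, map_one]
  have h3 : algebraMap ℝ OffFn ε * algebraMap ℝ OffFn ε = 1 := by rw [← map_mul, hee, map_one]
  have e : toOff hc.hamA = (algebraMap ℝ OffFn ε * hc.CO)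
      * (algebraMap ℝ OffFn ε * (toOff hc.hamA * toOff hc.CInvA)) := by
    linear_combination (-(toOff hc.hamA) * hc.CO * toOff hc.CInvA) * h3 - toOff hc.hamA * h2
  rw [e]
  exact Sy.mul_le (Sy.mul (Sy.const_mem ε) hc.CO_mem) (hc.near_inv_lapse hε).mem (by norm_num)

end IsVariation

end

/-! ### Integrals over dust space -/

/-- The symbol estimate controls the exterior of a ball and continuity the compact rest. Together
they give a bound on all of space, uniform in small s, which dominates the integrals over space. -/
theorem exists_bound {F : SmoothFn} {b : Bool} {a : ℝ} (hF : toOff F ∈ Sy b a) (ha : a ≤ 0) :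
    ∃ δ > 0, ∃ K, ∀ s, |s| < δ → ∀ x : Space, |ev (s, x) F| ≤ K * (1 + ‖x‖) ^ a := by
  obtain ⟨K, hK⟩ := (Sy.isBigO hF).bound
  obtain ⟨P, hP, Q, hQ, h⟩ := Filter.eventually_prod_iff.1 (hK.and eventually_one_le)
  obtain ⟨δ, hδ, hδP⟩ := Metric.eventually_nhds_iff.1 hP
  obtain ⟨r, -, hr⟩ := (Metric.hasBasis_cobounded_compl_closedBall (0 : Space)).eventually_iff.1 hQ
  have hcomp : IsCompact (Metric.closedBall (0 : ℝ) δ ×ˢ Metric.closedBall (0 : Space) r) :=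
    (isCompact_closedBall _ _).prod (isCompact_closedBall _ _)
  obtain ⟨K', hK'⟩ := hcomp.exists_bound_of_continuousOn (f := fun q : PSpace => ev q F)
    (smooth_contDiff F).continuous.continuousOn
  refine ⟨δ, hδ, max (|K| * 2 ^ (-a)) (|K'| * (1 + |r|) ^ (-a)), fun s hs x => ?_⟩
  have h0 : 0 < 1 + ‖x‖ := by positivity
  by_cases hx : x ∈ Metric.closedBall (0 : Space) r
  · have h1 := hK' (s, x) ⟨by simpa [Real.dist_eq] using hs.le, hx⟩
    have h2 : ‖x‖ ≤ |r| := by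
      have : ‖x‖ ≤ r := by simpa using hx
      exact this.trans (le_abs_self r)
    have h3 : 1 ≤ (1 + |r|) ^ (-a) * (1 + ‖x‖) ^ a := by
      rw [Real.rpow_neg (by positivity), ← div_eq_inv_mul, one_le_div (by positivity)]
      exact Real.rpow_le_rpow_of_nonpos h0 (by linarith) ha
    calc |ev (s, x) F| ≤ |K'| * 1 := by rw [mul_one]; exact h1.trans (le_abs_self _)
      _ ≤ |K'| * ((1 + |r|) ^ (-a) * (1 + ‖x‖) ^ a) := by gcongr
      _ = |K'| * (1 + |r|) ^ (-a) * (1 + ‖x‖) ^ a := by ring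
      _ ≤ _ := by gcongr; exact le_max_right _ _
  · obtain ⟨h1, h2⟩ := h (hδP (y := s) (by simpa [Real.dist_eq] using hs)) (hr hx)
    change 1 ≤ ‖x‖ at h2
    rw [evo_toOff _ (mem_offZ_of_one_le (q := (s, x)) h2)] at h1
    have hx0 : 0 < ‖x‖ := by linarith
    have h3 : ‖x‖ ^ a ≤ 2 ^ (-a) * (1 + ‖x‖) ^ a := by
      rw [Real.rpow_neg (by norm_num), ← div_eq_inv_mul, ← Real.div_rpow h0.le (by norm_num)]
      exact Real.rpow_le_rpow_of_nonpos (by positivity) (by linarith) ha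
    rw [Real.norm_eq_abs, Real.norm_of_nonneg (by positivity)] at h1
    change |ev (s, x) F| ≤ K * ‖x‖ ^ a at h1
    calc |ev (s, x) F| ≤ |K| * ‖x‖ ^ a := h1.trans (by gcongr; exact le_abs_self _)
      _ ≤ |K| * (2 ^ (-a) * (1 + ‖x‖) ^ a) := by gcongr
      _ = |K| * 2 ^ (-a) * (1 + ‖x‖) ^ a := by ring
      _ ≤ _ := by gcongr; exact le_max_left _ _

theorem integrable_bound {a : ℝ} (ha : a < -3) (K : ℝ) :
    Integrable (fun x : Space => K * (1 + ‖x‖) ^ a) := by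
  have h := integrable_one_add_norm (E := Space) (μ := volume) (r := -a)
    (by rw [finrank_euclideanSpace_fin]; push_cast; linarith)
  rw [neg_neg] at h
  exact h.const_mul K

theorem continuous_ev (F : SmoothFn) (s : ℝ) : Continuous (fun x : Space => ev (s, x) F) :=
  (smooth_contDiff F).continuous.comp (by fun_prop : Continuous fun x : Space => (s, x))

theorem eventually_integrable {F : SmoothFn} {b : Bool} {a : ℝ} (hF : toOff F ∈ Sy b a)
    (ha : a < -3) : ∀ᶠ s in 𝓝 (0 : ℝ), Integrable (fun x : Space => ev (s, x) F) := by
  obtain ⟨δ, hδ, K, h⟩ := exists_bound hF (by linarith)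
  filter_upwards [Metric.ball_mem_nhds (0 : ℝ) hδ] with s hs
  exact (integrable_bound ha K).mono' (continuous_ev F s).aestronglyMeasurable
    (Eventually.of_forall fun x => h s (by simpa [Real.dist_eq] using hs) x)

theorem tendsto_ballInt_of_integrable {f : Space → ℝ} (hf : Integrable f) :
    Tendsto (ballInt f) atTop (𝓝 (∫ x, f x)) :=
  (aecover_ball (tendsto_id)).integral_tendsto_of_countably_generated hf

theorem bulkInt_of_integrable {f : Space → ℝ} (hf : Integrable f) : bulkInt f = ∫ x, f x :=
  (tendsto_ballInt_of_integrable hf).limUnder_eq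

/-- Differentiation of an integral over dust space. -/
theorem hasDerivAt_bulkInt {F : SmoothFn} {a : ℝ} (hF : toOff F ∈ Sy true a) (ha : a < -3) :
    HasDerivAt (fun s => bulkInt (fun x => ev (s, x) F)) (∫ x, ev (0, x) (smD es F)) 0 := by
  have hD : toOff (smD es F) ∈ Sy false a := by rw [toOff_smD]; exact Sy.offD_es hF
  obtain ⟨δ, hδ, K, h⟩ := exists_bound hD (by linarith)
  have hint := eventually_integrable hF ha
  have key := (hasDerivAt_integral_of_dominated_loc_of_deriv_le (μ := (volume : Measure Space))
    (F := fun s x => ev (s, x) F) (F' := fun s x => ev (s, x) (smD es F)) (x₀ := (0 : ℝ))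
    (bound := fun x => K * (1 + ‖x‖) ^ a) (Metric.ball_mem_nhds (0 : ℝ) hδ)
    (Eventually.of_forall fun s => (continuous_ev F s).aestronglyMeasurable)
    hint.self_of_nhds (continuous_ev _ 0).aestronglyMeasurable
    (Eventually.of_forall fun x s hs => h s (by simpa [Real.dist_eq] using hs) x)
    (integrable_bound ha K) (Eventually.of_forall fun x s _ => hasDerivAt_ev F s x)).2
  exact key.congr_of_eventuallyEq (hint.mono fun s hs => bulkInt_of_integrable hs)

open Pointwise in
/-- The antipodal map preserves the area of the sphere. -/
theorem sphereInt_comp_neg (F : Space → ℝ) : sphereInt (fun n => F (-n)) = sphereInt F := by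
  have h : MeasurePreserving (fun n : Metric.sphere (0 : Space) 1 => -n)
      (volume : Measure Space).toSphere (volume : Measure Space).toSphere := by
    refine ⟨continuous_neg.measurable, Measure.ext fun s hs => ?_⟩
    rw [Measure.map_apply continuous_neg.measurable hs, Measure.toSphere_apply' _ hs,
      Measure.toSphere_apply' _ (continuous_neg.measurable hs),
      ← Measure.measure_neg volume (Set.Ioo (0 : ℝ) 1 • ((↑) '' s : Set Space))]
    congr 2
    ext x
    simp only [Set.mem_smul, Set.mem_neg, Set.mem_image, Set.mem_preimage]
    constructor
    · rintro ⟨t, ht, _, ⟨n, hn, rfl⟩, rfl⟩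
      exact ⟨t, ht, _, ⟨-n, hn, rfl⟩, by simp⟩
    · rintro ⟨t, ht, _, ⟨n, hn, rfl⟩, e⟩
      exact ⟨t, ht, _, ⟨-n, by simpa using hn, rfl⟩, by simp [e]⟩
  exact h.integral_comp (Homeomorph.neg _).measurableEmbedding (fun n => F n)

theorem SphereIntegrable.add {F G : Space → ℝ} (hF : SphereIntegrable F)
    (hG : SphereIntegrable G) : SphereIntegrable (fun n => F n + G n) := Integrable.add hF hG

theorem sphereInt_eq_zero_of_odd {F : Space → ℝ} (h : ∀ n, ‖n‖ = 1 → F (-n) = -F n) :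
    sphereInt F = 0 := by
  have h1 := sphereInt_comp_neg F
  rw [sphereInt_congr (G := fun n => -1 * F n) fun n hn => by rw [h n hn]; ring,
    sphereInt_const_mul] at h1
  linarith

/-- The limit of the flux through large spheres. -/
theorem tendsto_sphere_flux {X A B D : OffFn} {b : Bool} (hA : HomZ A) (hB : HomZ B) (hD : HomZ D)
    (h : X - (rhoI * A + lg * rhoI ^ 2 * B + rhoI ^ 2 * D) ∈ Sy b (-5 / 2))
    (hA0 : sphereInt (fun n => evo A (0, n)) = 0) (hB0 : sphereInt (fun n => evo B (0, n)) = 0) :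
    Tendsto (fun R : ℝ => R ^ 2 * sphereInt (fun n => evo X (0, R • n))) atTop
      (𝓝 (sphereInt (fun n => evo D (0, n)))) := by
  set E := X - (rhoI * A + lg * rhoI ^ 2 * B + rhoI ^ 2 * D) with hE
  have hX : X = rhoI * A + lg * rhoI ^ 2 * B + rhoI ^ 2 * D + E := by rw [hE]; ring
  have hi (F : OffFn) {R : ℝ} (hR : 0 < R) : SphereIntegrable (fun n => evo F (0, R • n)) :=
    sphereIntegrable_of_continuousOn fun x hx =>
      (ContinuousAt.comp (f := fun y : Space => ((0 : ℝ), R • y))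
        (contDiffAt_evo F (smul_mem_offZ hR hx)).continuousAt (by fun_prop)).continuousWithinAt
  have hi1 (F : OffFn) : SphereIntegrable (fun n => evo F (0, n)) := by
    simpa using hi F one_pos
  obtain ⟨K, hK⟩ := (Sy.isBigO h).bound
  obtain ⟨P, hP, Q, hQ, hPQ⟩ := Filter.eventually_prod_iff.1 hK
  obtain ⟨r, -, hr⟩ := (Metric.hasBasis_cobounded_compl_closedBall (0 : Space)).eventually_iff.1 hQ
  -- The remainder contributes R² · R^{-5/2}, which tends to zero.
  have hlim : Tendsto (fun R : ℝ => R ^ 2 * sphereInt (fun n => evo E (0, R • n))) atTop (𝓝 0) := by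
    set V := (volume : Measure Space).toSphere.real Set.univ
    refine squeeze_zero_norm' (a := fun R : ℝ => K * V * R ^ (-(1 / 2) : ℝ)) ?_ ?_
    · filter_upwards [eventually_gt_atTop 0, eventually_gt_atTop r] with R hR hRr
      have hb : ‖sphereInt (fun n => evo E (0, R • n))‖ ≤ K * R ^ (-5 / 2 : ℝ) * V := by
        refine norm_integral_le_of_norm_le_const (Eventually.of_forall fun n => ?_)
        have hn : ‖R • (n : Space)‖ = R := by
          rw [norm_smul, sphere_norm, mul_one, Real.norm_of_nonneg hR.le]
        have := hPQ hP.self_of_nhds (hr (x := R • (n : Space)) (by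
          rw [Set.mem_compl_iff, mem_closedBall_zero_iff, hn]; exact not_le.2 hRr))
        change ‖evo E (0, R • (n : Space))‖ ≤ K * ‖‖R • (n : Space)‖ ^ (-5 / 2 : ℝ)‖ at this
        rwa [hn, Real.norm_of_nonneg (by positivity : 0 ≤ R ^ (-5 / 2 : ℝ))] at this
      rw [norm_mul, Real.norm_of_nonneg (by positivity)]
      calc R ^ 2 * ‖sphereInt (fun n => evo E (0, R • n))‖
          ≤ R ^ 2 * (K * R ^ (-5 / 2 : ℝ) * V) := by gcongr
        _ = K * V * (R ^ (2 : ℝ) * R ^ (-5 / 2 : ℝ)) := by rw [Real.rpow_two]; ring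
        _ = _ := by rw [← Real.rpow_add hR]; norm_num
    · simpa using (tendsto_rpow_neg_atTop (by norm_num : (0 : ℝ) < 1 / 2)).const_mul (K * V)
  have hlim' := hlim.const_add (sphereInt (fun n => evo D (0, n)))
  rw [add_zero] at hlim'
  refine hlim'.congr' ?_
  filter_upwards [eventually_gt_atTop 0] with R hR
  have hev (n : Space) (hn : ‖n‖ = 1) : evo X (0, R • n)
      = R⁻¹ * evo A (0, n) + (Real.log R * R⁻¹ ^ 2) * evo B (0, n) + R⁻¹ ^ 2 * evo D (0, n)
        + evo E (0, R • n) := by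
    have hn0 : n ≠ 0 := by rintro rfl; simp at hn
    have hq := smul_mem_offZ (s := 0) hR hn0
    have hnR : ‖R • n‖ = R := by rw [norm_smul, hn, mul_one, Real.norm_of_nonneg hR.le]
    rw [hX]
    simp only [evo_add, evo_mul, pow_two, evo_rhoI hq, evo_lg hq, hnR, hA 0 R n hR hn0,
      hB 0 R n hR hn0, hD 0 R n hR hn0]
  -- After multiplication by R² the first two coefficients carry the divergent factors R and log R.
  -- They disappear because their integrals are exactly zero.
  rw [sphereInt_congr hev, sphereInt_add ((((hi1 A).const_mul _).add ((hi1 B).const_mul _)).add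
    ((hi1 D).const_mul _)) (hi E hR), sphereInt_add (((hi1 A).const_mul _).add
    ((hi1 B).const_mul _)) ((hi1 D).const_mul _), sphereInt_add ((hi1 A).const_mul _)
    ((hi1 B).const_mul _), sphereInt_const_mul, sphereInt_const_mul, sphereInt_const_mul, hA0, hB0]
  field_simp
  ring

section

/-! ### Asymptotics of the smearing fields -/

namespace Smearing.IsAdmissible

variable {χ : Smearing} (hχ : χ.IsAdmissible) {b : Bool}

/-- The boundary value `f` off the origin. -/
def fO : OffFn := offX χ.f hχ.f_sphere.1

/-- The boundary value `W` off the origin. -/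
def WO : OffFn := offX χ.W hχ.W_sphere.1

/-- The boundary value `Y` off the origin. -/
def YO (i : Fin 3) : OffFn := offX (fun x => χ.Y x i) (hχ.Y_sphere i).1

/-- The boundary value `I` off the origin. -/
def IvO (i : Fin 3) : OffFn := offX (fun x => χ.I x i) (hχ.I_sphere i).1

theorem homZ_fO : HomZ hχ.fO := HomZ.offX hχ.f_sphere

theorem homZ_WO : HomZ hχ.WO := HomZ.offX hχ.W_sphere

theorem homZ_YO (i : Fin 3) : HomZ (hχ.YO i) := HomZ.offX (hχ.Y_sphere i)

theorem homZ_IvO (i : Fin 3) : HomZ (hχ.IvO i) := HomZ.offX (hχ.I_sphere i)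

@[simp] theorem offD_es_fO : offD es hχ.fO = 0 := offD_es_offX _ _

@[simp] theorem offD_es_WO : offD es hχ.WO = 0 := offD_es_offX _ _

@[simp] theorem offD_es_YO (i : Fin 3) : offD es (hχ.YO i) = 0 := offD_es_offX _ _

@[simp] theorem offD_es_IvO (i : Fin 3) : offD es (hχ.IvO i) = 0 := offD_es_offX _ _

theorem sum_nu_YO : ∑ i, nu i * hχ.YO i = 0 := evo_ext fun q hq => by
  rw [← evoHom_apply hq, ← evoHom_apply hq, map_sum, map_zero]
  simp only [map_mul, evoHom_apply, evo_nu _ hq, YO, evo_offX _ _ hq]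
  exact hχ.Y_tangent q.2 (mem_offZ.1 hq)

theorem sum_nu_IvO : ∑ i, nu i * hχ.IvO i = 0 := evo_ext fun q hq => by
  rw [← evoHom_apply hq, ← evoHom_apply hq, map_sum, map_zero]
  simp only [map_mul, evoHom_apply, evo_nu _ hq, IvO, evo_offX _ _ hq]
  exact hχ.I_tangent q.2 (mem_offZ.1 hq)

theorem ξ_expansion : toOff hχ.ξA - hχ.fO ∈ Sy b (-1) := by
  have := Sy.of_isBigSymbol (b := b) (F := toOff hχ.ξA - hχ.fO) (fun s x hx => by
    have hq : (s, x) ∈ offZ := mem_offZ.2 hx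
    rw [← evoHom_apply hq, map_sub, evoHom_apply, evoHom_apply, evo_toOff _ hq, fO,
      evo_offX _ _ hq, hχ.ev_ξ]) hχ.falloff_ξ
  simpa using this

theorem ξv_expansion (i : Fin 3) :
    toOff (hχ.ξvA i) - (rho * hχ.YO i + hχ.WO * nu i + hχ.IvO i) ∈ Sy b (-1) := by
  have := Sy.of_isBigSymbol (b := b)
    (F := toOff (hχ.ξvA i) - (rho * hχ.YO i + hχ.WO * nu i + hχ.IvO i)) (fun s x hx => by
    have hq : (s, x) ∈ offZ := mem_offZ.2 hx
    rw [← evoHom_apply hq]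
    simp only [map_sub, map_add, map_mul, evoHom_apply]
    rw [evo_toOff _ hq, hχ.ev_ξv, evo_rho hq, evo_nu _ hq, YO, WO, IvO, evo_offX _ _ hq,
      evo_offX _ _ hq, evo_offX _ _ hq]) (hχ.falloff_ξv i)
  simpa using this

theorem ξ_mem : toOff hχ.ξA ∈ Sy b 0 :=
  near_add_mem hχ.ξ_expansion (Sy.hom hχ.homZ_fO) (by norm_num)

theorem leading_mem (i : Fin 3) : rho * hχ.YO i + hχ.WO * nu i + hχ.IvO i ∈ Sy b 1 :=
  add_mem (add_mem (Sy.mul_le Sy.rho (Sy.hom (hχ.homZ_YO i)) (by norm_num))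
    (Sy.mono (Sy.hom (hχ.homZ_WO.mul (HomZ.nu i))) (by norm_num)))
    (Sy.mono (Sy.hom (hχ.homZ_IvO i)) (by norm_num))

theorem ξv_mem (i : Fin 3) : toOff (hχ.ξvA i) ∈ Sy b 1 :=
  near_add_mem (hχ.ξv_expansion i) (hχ.leading_mem i) (by norm_num)

/-! ### Killing fields of the sphere are infinitesimal rotations -/

theorem nu_offD_YO (j : Fin 3) : rho * ∑ i, nu i * offD (ex j) (hχ.YO i) = -hχ.YO j := by
  have h := congrArg (offD (ex j)) hχ.sum_nu_YO
  rw [map_sum, map_zero] at h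
  simp only [Derivation.leibniz, smul_eq_mul, offD_nu, Finset.sum_add_distrib] at h
  have h1 : ∑ i, hχ.YO i * (rhoI * ((if j = i then 1 else 0) - nu j * nu i)) = rhoI * hχ.YO j := by
    have : ∑ i, hχ.YO i * (rhoI * ((if j = i then 1 else 0) - nu j * nu i))
        = rhoI * ∑ i, (if j = i then hχ.YO i else 0) - rhoI * nu j * ∑ i, nu i * hχ.YO i := by
      simp only [Finset.mul_sum, ← Finset.sum_sub_distrib]
      refine Finset.sum_congr rfl fun i _ => ?_
      split_ifs <;> ring
    rw [this, hχ.sum_nu_YO]; simp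
  rw [h1] at h
  linear_combination rho * h - hχ.YO j * rho_rhoI

/-- The symmetrized derivative of `|x| Y`. -/
def killS (i j : Fin 3) : OffFn := offD (ex i) (rho * hχ.YO j) + offD (ex j) (rho * hχ.YO i)

theorem killS_eq (i j : Fin 3) : hχ.killS i j = nu i * hχ.YO j + nu j * hχ.YO i
    + rho * (offD (ex i) (hχ.YO j) + offD (ex j) (hχ.YO i)) := by
  simp only [killS, Derivation.leibniz, smul_eq_mul, offD_rho]; ring

theorem homZ_killS (i j : Fin 3) : HomZ (hχ.killS i j) := by
  rw [killS_eq, mul_add]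
  exact (((HomZ.nu i).mul (hχ.homZ_YO j)).add ((HomZ.nu j).mul (hχ.homZ_YO i))).add
    (((hχ.homZ_YO j).rho_mul_offD i).add ((hχ.homZ_YO i).rho_mul_offD j))

/-- Not a consequence of the Killing equation: it follows from the homogeneity of Y (Euler's
relation) and from differentiating ν · Y = 0. -/
theorem killS_radial (j : Fin 3) : ∑ i, nu i * hχ.killS i j = 0 := by
  have h1 := (hχ.homZ_YO j).euler
  have h2 := hχ.nu_offD_YO j
  have h3 := hχ.sum_nu_YO
  have h4 := sum_nu_sq
  simp only [killS_eq]
  simp only [Fin.sum_univ_three] at *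
  linear_combination rho * h1 + h2 + nu j * h3 + hχ.YO j * h4

/-- The field rY is a Killing field of flat space. The tangential components of the symmetrized
derivative vanish by the Killing equation on the sphere and the radial ones by `killS_radial`;
homogeneity extends this from the sphere to all radii. -/
theorem killS_eq_zero (i j : Fin 3) : hχ.killS i j = 0 := by
  have hsymm (i j : Fin 3) : hχ.killS i j = hχ.killS j i := add_comm _ _
  have h1 (x : Space) (hx : ‖x‖ = 1) : evo (hχ.killS i j) (0, x) = 0 := by
    have hx0 : x ≠ 0 := by rintro rfl; simp at hx
    have hq : ((0 : ℝ), x) ∈ offZ := mem_offZ.2 hx0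
    set n : Fin 3 → ℝ := radialVec x with hn
    have hnn : ∑ k, n k * n k = 1 := sum_radialVec_sq hx0
    set Y : Fin 3 → ℝ := χ.Y x with hY
    have hnY : ∑ k, n k * Y k = 0 := hχ.Y_tangent x hx0
    set T : Fin 3 → Fin 3 → ℝ := fun k l => pd k (fun y => χ.Y y l) x + pd l (fun y => χ.Y y k) x
      with hT
    have hS (k l : Fin 3) : evo (hχ.killS k l) (0, x) = n k * Y l + n l * Y k + T k l := by
      rw [killS_eq, ← evoHom_apply hq]
      simp only [map_add, map_mul, evoHom_apply, evo_rho hq, evo_nu _ hq, hx, YO, evo_offX _ _ hq,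
        evo_offD_offX _ _ hq]
      ring
    have hr (l : Fin 3) : ∑ k, n k * evo (hχ.killS k l) (0, x) = 0 := by
      have := congrArg (evoHom _ hq) (hχ.killS_radial l)
      rw [map_sum, map_zero] at this
      simpa only [map_mul, evoHom_apply, evo_nu _ hq] using this
    have hr' (k : Fin 3) : ∑ l, n l * evo (hχ.killS k l) (0, x) = 0 := by
      exact (Finset.sum_congr rfl fun l _ => by rw [hsymm]).trans (hr k)
    have ht (a : Fin 3) : ∑ k, n k * ((if k = a then 1 else 0) - n a * n k) = 0 := by
      simp only [Fin.sum_univ_three] at hnn ⊢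
      fin_cases a
      · simp; linear_combination (-n 0) * hnn
      · simp; linear_combination (-n 1) * hnn
      · simp; linear_combination (-n 2) * hnn
    -- The test vectors are the tangential projections of the basis vectors i and j.
    have hK := hχ.Y_killing x hx (fun k => (if k = i then 1 else 0) - n i * n k)
      (fun l => (if l = j then 1 else 0) - n j * n l) (ht i) (ht j)
    have hK2 : ∑ k, ∑ l, ((if k = i then 1 else 0) - n i * n k)
        * ((if l = j then 1 else 0) - n j * n l) * evo (hχ.killS k l) (0, x) = 0 := by
      have e : ∑ k, ∑ l, ((if k = i then 1 else 0) - n i * n k)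
          * ((if l = j then 1 else 0) - n j * n l) * (n k * Y l + n l * Y k + T k l)
          = (∑ k, n k * ((if k = i then 1 else 0) - n i * n k))
              * (∑ l, ((if l = j then 1 else 0) - n j * n l) * Y l)
            + (∑ k, ((if k = i then 1 else 0) - n i * n k) * Y k)
              * (∑ l, n l * ((if l = j then 1 else 0) - n j * n l))
            + ∑ k, ∑ l, ((if k = i then 1 else 0) - n i * n k)
              * ((if l = j then 1 else 0) - n j * n l) * T k l := by
        simp only [Finset.sum_mul_sum, ← Finset.sum_add_distrib]
        exact Finset.sum_congr rfl fun k _ => Finset.sum_congr rfl fun l _ => by ring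
      simp only [hS]
      rw [e, ht i, ht j, hK]; ring
    have e2 : ∑ k, ∑ l, ((if k = i then 1 else 0) - n i * n k)
        * ((if l = j then 1 else 0) - n j * n l) * evo (hχ.killS k l) (0, x)
        = evo (hχ.killS i j) (0, x) - n j * ∑ l, n l * evo (hχ.killS i l) (0, x)
          - n i * ∑ l, ((if l = j then 1 else 0) - n j * n l)
            * ∑ k, n k * evo (hχ.killS k l) (0, x) := by
      have e3 (k : Fin 3) : ∑ l, ((if k = i then 1 else 0) - n i * n k)
        * ((if l = j then 1 else 0) - n j * n l) * evo (hχ.killS k l) (0, x)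
        = (if k = i then evo (hχ.killS k j) (0, x)
            - n j * ∑ l, n l * evo (hχ.killS k l) (0, x) else 0)
          - n i * ∑ l, ((if l = j then 1 else 0) - n j * n l)
            * (n k * evo (hχ.killS k l) (0, x)) := by
        have : ∑ l, ((if l = j then 1 else 0) - n j * n l) * evo (hχ.killS k l) (0, x)
            = evo (hχ.killS k j) (0, x) - n j * ∑ l, n l * evo (hχ.killS k l) (0, x) := by
          simp only [sub_mul, Finset.sum_sub_distrib, ite_mul, one_mul, zero_mul,
            Finset.sum_ite_eq', Finset.mem_univ, if_true, mul_assoc, Finset.mul_sum]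
        rw [← this, Finset.mul_sum]
        split_ifs
        · rw [← Finset.sum_sub_distrib]; exact Finset.sum_congr rfl fun l _ => by ring
        · simp only [zero_sub, neg_mul, Finset.sum_neg_distrib]
          exact congrArg Neg.neg (Finset.sum_congr rfl fun l _ => by ring)
      simp only [e3, Finset.sum_sub_distrib, Finset.sum_ite_eq', Finset.mem_univ, if_true,
        ← Finset.mul_sum]
      congr 2
      rw [Finset.sum_comm]
      exact Finset.sum_congr rfl fun l _ => by rw [Finset.mul_sum]
    rw [hK2, hr' i] at e2
    simp only [hr, mul_zero, Finset.sum_const_zero, sub_zero] at e2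
    exact e2.symm
  have hs (s : ℝ) (x : Space) (hx : x ≠ 0) :
      evo (hχ.killS i j) (s, x) = evo (hχ.killS i j) (0, x) := by
    have hq (s : ℝ) : (s, x) ∈ offZ := mem_offZ.2 hx
    rw [killS_eq, ← evoHom_apply (hq s), ← evoHom_apply (hq 0)]
    simp only [map_add, map_mul, evoHom_apply, evo_rho (hq _), evo_nu _ (hq _), YO,
      evo_offX _ _ (hq _), evo_offD_offX _ _ (hq _)]
  refine evo_ext fun q hq => ?_
  obtain ⟨s, x⟩ := q
  have hx := mem_offZ.1 hq
  rw [← evoHom_apply hq 0, map_zero, hs s x hx, (hχ.homZ_killS i j).evo_unitVec 0 hx]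
  exact h1 _ (norm_unitVec hx)

/-- An array symmetric in its first two indices and antisymmetric in its last two is zero: permuting
cyclically three times returns the original with the opposite sign. -/
theorem offD_offD_YO (k i j : Fin 3) : offD (ex k) (offD (ex i) (rho * hχ.YO j)) = 0 := by
  have ha (k i j : Fin 3) : offD (ex k) (offD (ex i) (rho * hχ.YO j))
      = -offD (ex k) (offD (ex j) (rho * hχ.YO i)) := by
    have := congrArg (offD (ex k)) (hχ.killS_eq_zero i j)
    rw [killS, map_add, map_zero] at this
    linear_combination this
  have h1 := ha k i j
  have h2 := ha j k i
  have h3 := ha i j k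
  rw [offD_comm (ex k) (ex j)] at h1
  rw [offD_comm (ex j) (ex i)] at h2
  rw [offD_comm (ex i) (ex k)] at h3
  have h4 : (2 : OffFn) * offD (ex k) (offD (ex i) (rho * hχ.YO j)) = 0 := by
    linear_combination h1 - h2 + h3
  have h5 := Geom.two_mul_half (A := OffFn)
  linear_combination Geom.half OffFn * h4 - offD (ex k) (offD (ex i) (rho * hχ.YO j)) * h5

/-- `Y` is the restriction of an infinitesimal rotation. -/
theorem exists_rotation : ∃ m : Fin 3 → Fin 3 → ℝ, (∀ i j, m j i = -m i j) ∧
    ∀ i, hχ.YO i = ∑ j, algebraMap ℝ OffFn (m i j) * nu j := by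
  have hdiff (i : Fin 3) : ContDiffOn ℝ ∞ (fun x : Space => ‖x‖ * χ.Y x i) {0}ᶜ :=
    contDiffOn_norm_off.mul (hχ.Y_sphere i).1
  have hZ (i : Fin 3) : rho * hχ.YO i = offX (fun x : Space => ‖x‖ * χ.Y x i) (hdiff i) :=
    evo_ext fun q hq => by
      simp only [evo_mul, evo_offX _ _ hq, evo_rho hq, YO]
  -- Space without a point is connected, so the first derivatives of rY, whose derivatives vanish,
  -- are globally constant.
  have hconn : IsPreconnected ({0}ᶜ : Set Space) :=
    (isConnected_compl_singleton_of_one_lt_rank (by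
      rw [← Module.finrank_eq_rank, finrank_euclideanSpace_fin]; norm_num) 0).isPreconnected
  have hex (i j : Fin 3) : ∃ a : ℝ, offD (ex j) (rho * hχ.YO i) = algebraMap ℝ OffFn a := by
    obtain ⟨a, ha⟩ := isOpen_compl_singleton.exists_is_const_of_fderiv_eq_zero hconn
      (f := pd j fun x : Space => ‖x‖ * χ.Y x i)
      ((contDiffOn_pd (hdiff i) j).differentiableOn (by simp)) (fun x hx => by
        ext v
        rw [fderiv_eq_sum_pd]
        refine Finset.sum_eq_zero fun k _ => ?_
        have hq : ((0 : ℝ), x) ∈ offZ := mem_offZ.2 hx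
        have h0 : evo (offD (ex k) (offD (ex j) (rho * hχ.YO i))) (0, x) = evo 0 (0, x) := by
          rw [hχ.offD_offD_YO k j i]
        rw [← pd_evo _ hx, hZ, ← evoHom_apply hq 0, map_zero] at h0
        rw [pd_congr_off (g := fun y => evo (offD (ex j) (offX _ (hdiff i))) (0, y))
          (fun y hy => (evo_offD_offX _ (hdiff i) (mem_offZ.2 hy : ((0 : ℝ), y) ∈ offZ) j).symm) hx,
          h0, mul_zero])
    refine ⟨a, evo_ext fun q hq => ?_⟩
    rw [hZ, evo_offD_offX _ _ hq, evo_const a hq]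
    exact ha _ (mem_offZ.1 hq)
  choose m hm using hex
  have hinj : Function.Injective (algebraMap ℝ OffFn) := fun a a' h => by
    have hq : ((0 : ℝ), EuclideanSpace.single (0 : Fin 3) (1 : ℝ)) ∈ offZ := mem_offZ.2 (by simp)
    rw [← evo_const a hq, h, evo_const a' hq]
  refine ⟨m, fun i j => hinj ?_, fun i => ?_⟩
  · rw [map_neg, ← hm, ← hm]
    have := hχ.killS_eq_zero i j
    rw [killS] at this
    linear_combination this
  · have h1 := (hχ.homZ_YO i).euler
    have h2 := sum_nu_sq
    have e : ∑ j, algebraMap ℝ OffFn (m i j) * nu j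
        = rho * ∑ j, nu j * offD (ex j) (hχ.YO i) + hχ.YO i * ∑ j, nu j * nu j := by
      simp only [← hm, Derivation.leibniz, smul_eq_mul, offD_rho, Finset.mul_sum,
        ← Finset.sum_add_distrib]
      exact Finset.sum_congr rfl fun j _ => by ring
    rw [e, h1, h2]; ring

end Smearing.IsAdmissible

end

section

/-! ### Symmetry of the leading coefficients -/

theorem HomZ.eq_zero_of_mem {F : OffFn} (hF : HomZ F) (n : ℕ) {a : ℝ}
    (h : rhoI ^ n * F ∈ Sy false a) (ha : a ≤ -n - 1 / 2) {x : Space} (hx : x ≠ 0) :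
    evo F (0, x) = 0 := by
  have h1 : (0 : OffFn) - rhoI ^ n * F ∈ Sy false (-n - 1 / 2) := by
    rw [zero_sub]; exact neg_mem (Sy.mono h ha)
  rw [hF.evo_unitVec 0 hx]
  refine (hF.limit_pow n h1).self_of_nhds _ (norm_unitVec hx) 0 (tendsto_const_nhds.congr fun r => ?_)
  have : evo (0 : OffFn) = fun _ => 0 := by funext q; simp [evo, extZ]
  rw [this, mul_zero]

namespace IsVariation

variable {ε : ℝ} {c : ℝ → Fields} (hc : IsVariation ε c) {b : Bool}

/-- Symmetry of the coefficient is not assumed; it follows from that of the metric and the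
uniqueness of expansion coefficients. -/
theorem hBar_symm (hc : IsVariation ε c) (i j : Fin 3) {x : Space} (hx : x ≠ 0) :
    (c 0).hBar x i j = (c 0).hBar x j i := by
  have h1 := sub_mem (hc.metric_expansion (b := false) j i) (hc.metric_expansion (b := false) i j)
  have h2 : rhoI ^ 1 * (hc.hB i j - hc.hB j i) ∈ Sy false (-3 / 2) := by
    convert h1 using 1
    rw [show hc.gO j i = hc.gO i j from congrArg toOff (hc.geom.g_symm j i)]
    by_cases h : i = j
    · subst h; ring
    · simp only [h, Ne.symm h, if_false]; ring
  have h3 := ((hc.homZ_hB i j).sub (hc.homZ_hB j i)).eq_zero_of_mem 1 h2 (by norm_num) hx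
  rw [← evoHom_apply (mem_offZ.2 hx : ((0 : ℝ), x) ∈ offZ), map_sub] at h3
  simp only [evoHom_apply, hc.evo_hB _ _ hx] at h3
  linarith

theorem pBar_symm (hc : IsVariation ε c) (i j : Fin 3) {x : Space} (hx : x ≠ 0) :
    (c 0).pBar x i j = (c 0).pBar x j i := by
  have h1 := sub_mem (hc.momentum_sub (b := false) j i) (hc.momentum_sub (b := false) i j)
  have h2 : rhoI ^ 2 * (hc.pB i j - hc.pB j i) ∈ Sy false (-5 / 2) := by
    convert h1 using 1
    rw [show hc.pO j i = hc.pO i j from congrArg toOff (hc.pA_symm j i)]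
    ring
  have h3 := ((hc.homZ_pB i j).sub (hc.homZ_pB j i)).eq_zero_of_mem 2 h2 (by norm_num) hx
  rw [← evoHom_apply (mem_offZ.2 hx : ((0 : ℝ), x) ∈ offZ), map_sub] at h3
  simp only [evoHom_apply, hc.evo_pB _ _ hx] at h3
  linarith

theorem hB_symm (i j : Fin 3) : hc.hB i j = hc.hB j i := evo_ext fun ⟨s, x⟩ hq => by
  have hx := mem_offZ.1 hq
  rw [hc.evo_hB _ _ hx, hc.evo_hB _ _ hx]
  exact (hc.mem s).isVariation.hBar_symm i j hx

theorem pB_symm (i j : Fin 3) : hc.pB i j = hc.pB j i := evo_ext fun ⟨s, x⟩ hq => by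
  have hx := mem_offZ.1 hq
  rw [hc.evo_pB _ _ hx, hc.evo_pB _ _ hx]
  exact (hc.mem s).isVariation.pBar_symm i j hx

end IsVariation

/-! ### The flat part of the flux of `C` -/

/-- The flat form of the linearized Palatini vector. -/
def flatPal (q : Fin 3 → Fin 3 → OffFn) (k : Fin 3) : OffFn :=
  ∑ i, (offD (ex i) (q i k) - offD (ex k) (q i i))

/-- The flat form of the flux of `C`. -/
def flatVA (α : OffFn) (q : Fin 3 → Fin 3 → OffFn) (k : Fin 3) : OffFn :=
  ∑ i, q k i * offD (ex i) α - offD (ex k) α * ∑ i, q i i - α * flatPal q k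

theorem flatPal_eq {q : Fin 3 → Fin 3 → OffFn} (hq : ∀ i j, q i j = q j i) (k : Fin 3) :
    ∑ i, linΓ q k i i - ∑ i, linΓ q i i k = flatPal q k := by
  have h := Geom.two_mul_half (A := OffFn)
  simp only [linΓ, flatPal, ← Finset.sum_sub_distrib]
  refine Finset.sum_congr rfl fun i _ => ?_
  rw [hq i k]
  linear_combination (offD (ex i) (q k i) - offD (ex k) (q i i)) * h

theorem flatPal_mem {b : Bool} {a a' : ℝ} {q : Fin 3 → Fin 3 → OffFn} (hq : ∀ i j, q i j ∈ Sy b a)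
    (h : a - 1 ≤ a') (k : Fin 3) : flatPal q k ∈ Sy b a' :=
  sum_mem fun _ _ => sub_mem (Sy.offD_le (hq _ _) _ h) (Sy.offD_le (hq _ _) _ h)

namespace IsVariation

variable {ε : ℝ} {c : ℝ → Fields} (hc : IsVariation ε c) {b : Bool}

theorem geom_g (i j : Fin 3) : hc.geom.g i j = hc.gA i j := rfl

theorem geom_gi (i j : Fin 3) : hc.geom.gi i j = hc.giA i j := rfl

theorem geom_s : hc.geom.s = hc.sA := rfl

theorem dΓ_sub {q : Fin 3 → Fin 3 → SmoothFn} {a : ℝ} (hq : ∀ i j, toOff (q i j) ∈ Sy b a)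
    (k i j : Fin 3) : toOff (hc.geom.dΓ q k i j) - linΓ (fun i j => toOff (q i j)) k i j
      ∈ Sy b (a - 2) := by
  have h1 := contract_sub (b := b) (a := a - 1) (hc.near_gi_row k)
    (G := fun l => linΓ (fun i j => toOff (q i j)) l i j) fun l => linΓ_mem hq l i j
  have h2 : ∑ m, hc.giO k m * ∑ d, toOff (q m d) * toOff (hc.geom.Γ d i j) ∈ Sy b (a - 2) :=
    sum_mem fun m _ => Sy.mul_le (hc.giO_mem k m) (sum_mem fun d _ =>
      Sy.mul_le (hq m d) (hc.christoffel_mem d i j) (by linarith : a + -2 ≤ a - 2)) (by linarith)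
  convert sub_mem (Sy.mono h1 (by linarith : a - 1 - 1 ≤ a - 2)) h2 using 1
  simp only [Geom.dΓ, map_mul, map_sum, map_add, map_sub, hc.toOff_D, toOff_half, linΓ, mul_sub,
    Finset.sum_sub_distrib, hc.geom_gi]
  ring

theorem palatini_sub {q : Fin 3 → Fin 3 → SmoothFn} (hs : ∀ i j, q i j = q j i) {a : ℝ}
    (hq : ∀ i j, toOff (q i j) ∈ Sy b a) (k : Fin 3) :
    toOff (hc.geom.palatini (hc.geom.dΓ q) k) - flatPal (fun i j => toOff (q i j)) k
      ∈ Sy b (a - 2) := by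
  have hX (k i j : Fin 3) : toOff (hc.geom.dΓ q k i j) ∈ Sy b (a - 1) :=
    near_add_mem (hc.dΓ_sub hq k i j) (linΓ_mem hq k i j) (by linarith)
  have h1 := sum_mem (t := Finset.univ) fun i (_ : i ∈ Finset.univ) =>
    contract_sub (b := b) (a := a - 1) (hc.near_gi_row i) (G := fun j => toOff (hc.geom.dΓ q k i j))
      fun j => hX k i j
  have h2 := sum_mem (t := Finset.univ) fun i (_ : i ∈ Finset.univ) =>
    contract_sub (b := b) (a := a - 1) (hc.near_gi_row k) (G := fun j => toOff (hc.geom.dΓ q i i j))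
      fun j => hX i i j
  have h3 := sum_mem (t := Finset.univ) fun i (_ : i ∈ Finset.univ) => hc.dΓ_sub hq k i i
  have h4 := sum_mem (t := Finset.univ) fun i (_ : i ∈ Finset.univ) => hc.dΓ_sub hq i i k
  have h5 := add_mem (Sy.mono (sub_mem h1 h2) (by linarith : a - 1 - 1 ≤ a - 2)) (sub_mem h3 h4)
  convert h5 using 1
  rw [← flatPal_eq (fun i j => congrArg toOff (hs i j))]
  simp only [Geom.palatini, map_sum, map_sub, map_mul, Finset.sum_sub_distrib, hc.geom_gi]
  ring

/-- The asymptotic form of the flux of `C`. -/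
theorem VA_sub {q : Fin 3 → Fin 3 → SmoothFn} (hs : ∀ i j, q i j = q j i) {α : SmoothFn}
    {q0 : Fin 3 → Fin 3 → OffFn} {α0 : OffFn} (hq0 : ∀ i j, q0 i j ∈ Sy b (-1))
    (hq : ∀ i j, toOff (q i j) - q0 i j ∈ Sy b (-3 / 2)) (hα0 : α0 ∈ Sy b 0)
    (hα : toOff α - α0 ∈ Sy b (-1)) (k : Fin 3) :
    toOff (hc.geom.VA α q k) - flatVA α0 q0 k ∈ Sy b (-5 / 2) := by
  have hqm (i j : Fin 3) : toOff (q i j) ∈ Sy b (-1) :=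
    near_add_mem (hq i j) (hq0 i j) (by norm_num)
  have hαm : toOff α ∈ Sy b 0 := near_add_mem hα hα0 (by norm_num)
  have hdα (i : Fin 3) : offD (ex i) (toOff α) - offD (ex i) α0 ∈ Sy b (-2) := by
    rw [← map_sub]; exact Sy.offD_le hα i (by norm_num)
  have hdα0 (i : Fin 3) : offD (ex i) α0 ∈ Sy b (-1) := Sy.offD_le hα0 i (by norm_num)
  have hdαm (i : Fin 3) : offD (ex i) (toOff α) ∈ Sy b (-1) := Sy.offD_le hαm i (by norm_num)
  have hs1 : toOff hc.sA - 1 ∈ Sy b (-1) := by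
    have := hc.near_s (b := b); unfold Near at this; rwa [map_one] at this
  have hup (k i : Fin 3) : toOff (hc.geom.up q k i) - q0 k i ∈ Sy b (-3 / 2) := by
    have h1 : ∑ a, (hc.giO k a * ∑ d, hc.giO i d * toOff (q a d)) - ∑ d, hc.giO i d * toOff (q k d)
        ∈ Sy b (-2) := Sy.mono (contract_sub (hc.near_gi_row k) (a := -1)
        (G := fun a => ∑ d, hc.giO i d * toOff (q a d)) fun a => sum_mem fun d _ =>
          Sy.mul_le (hc.giO_mem i d) (hqm a d) (by norm_num)) (by norm_num)
    have h2 := contract_sub (hc.near_gi_row i) (G := fun d => toOff (q k d)) fun d => hqm k d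
    convert add_mem (add_mem (Sy.mono h1 (by norm_num : (-2 : ℝ) ≤ -3 / 2))
      (Sy.mono h2 (by norm_num : (-1 - 1 : ℝ) ≤ -3 / 2))) (hq k i) using 1
    simp only [Geom.up, map_sum, map_mul, Finset.mul_sum]
    have e : ∑ x, ∑ y, toOff (hc.geom.gi k x) * toOff (q x y) * toOff (hc.geom.gi y i)
        = ∑ x, ∑ y, hc.giO k x * (hc.giO i y * toOff (q x y)) :=
      Finset.sum_congr rfl fun x _ => Finset.sum_congr rfl fun y _ => by
        rw [hc.geom.gi_symm y i, hc.geom_gi, hc.geom_gi]; ring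
    rw [e]
    ring
  have htr : toOff (hc.geom.tr q) - ∑ i, q0 i i ∈ Sy b (-3 / 2) := by
    have h1 := sum_mem (t := Finset.univ) fun i (_ : i ∈ Finset.univ) =>
      contract_sub (b := b) (hc.near_gi_row i) (G := fun d => toOff (q i d)) fun d => hqm i d
    have h2 := sum_mem (t := Finset.univ) fun i (_ : i ∈ Finset.univ) => hq i i
    convert add_mem (Sy.mono h1 (by norm_num : (-1 - 1 : ℝ) ≤ -3 / 2)) h2 using 1
    simp only [Geom.tr, map_sum, map_mul, Finset.sum_sub_distrib, hc.geom_gi]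
    ring
  have hupm (k i : Fin 3) : toOff (hc.geom.up q k i) ∈ Sy b (-1) :=
    near_add_mem (hup k i) (hq0 k i) (by norm_num)
  have htrm : toOff (hc.geom.tr q) ∈ Sy b (-1) :=
    near_add_mem htr (sum_mem fun i _ => hq0 i i) (by norm_num)
  have hgr : ∑ d, hc.giO k d * offD (ex d) (toOff α) - offD (ex k) α0 ∈ Sy b (-2) := by
    have h1 := contract_sub (hc.near_gi_row k) (G := fun d => offD (ex d) (toOff α)) hdαm
    convert add_mem (Sy.mono h1 (by norm_num : (-1 - 1 : ℝ) ≤ -2)) (hdα k) using 1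
    ring
  have hgrm : ∑ d, hc.giO k d * offD (ex d) (toOff α) ∈ Sy b (-1) :=
    near_add_mem hgr (hdα0 k) (by norm_num)
  have hG1 : ∑ d, toOff (hc.geom.up q k d) * offD (ex d) (toOff α) - ∑ d, q0 k d * offD (ex d) α0
      ∈ Sy b (-5 / 2) := by
    rw [← Finset.sum_sub_distrib]
    refine sum_mem fun d _ => ?_
    have h1 := Sy.mul_le (hup k d) (hdαm d) (by norm_num : (-3 / 2 + -1 : ℝ) ≤ -5 / 2)
    have h2 := Sy.mul_le (hq0 k d) (hdα d) (by norm_num : (-1 + -2 : ℝ) ≤ -5 / 2)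
    convert add_mem h1 h2 using 1
    ring
  have hG2 : (∑ d, hc.giO k d * offD (ex d) (toOff α)) * toOff (hc.geom.tr q)
      - offD (ex k) α0 * ∑ i, q0 i i ∈ Sy b (-5 / 2) := by
    have h1 := Sy.mul_le hgr htrm (by norm_num : (-2 + -1 : ℝ) ≤ -5 / 2)
    have h2 := Sy.mul_le (hdα0 k) htr (by norm_num : (-1 + -3 / 2 : ℝ) ≤ -5 / 2)
    convert add_mem h1 h2 using 1
    ring
  have hP : toOff (hc.geom.palatini (hc.geom.dΓ q) k) - flatPal q0 k ∈ Sy b (-5 / 2) := by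
    have h1 := Sy.mono (hc.palatini_sub hs hqm k) (by norm_num : (-1 - 2 : ℝ) ≤ -5 / 2)
    have h2 := flatPal_mem (q := fun i j => toOff (q i j) - q0 i j) hq
      (by norm_num : (-3 / 2 - 1 : ℝ) ≤ -5 / 2) k
    convert add_mem h1 h2 using 1
    simp only [flatPal, map_sub, Finset.sum_sub_distrib]
    ring
  have hPm : toOff (hc.geom.palatini (hc.geom.dΓ q) k) ∈ Sy b (-2) :=
    near_add_mem hP (flatPal_mem hq0 (by norm_num) k) (by norm_num)
  have hP2 : toOff α * toOff (hc.geom.palatini (hc.geom.dΓ q) k) - α0 * flatPal q0 k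
      ∈ Sy b (-5 / 2) := by
    have h1 := Sy.mul_le hα hPm (by norm_num : (-1 + -2 : ℝ) ≤ -5 / 2)
    have h2 := Sy.mul_le hα0 hP (by norm_num : (0 + -5 / 2 : ℝ) ≤ -5 / 2)
    convert add_mem h1 h2 using 1
    ring
  set Z := ∑ d, toOff (hc.geom.up q k d) * offD (ex d) (toOff α)
    - (∑ d, hc.giO k d * offD (ex d) (toOff α)) * toOff (hc.geom.tr q)
    - toOff α * toOff (hc.geom.palatini (hc.geom.dΓ q) k) with hZ
  have hZm : Z ∈ Sy b (-2) := sub_mem (sub_mem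
    (sum_mem fun d _ => Sy.mul_le (hupm k d) (hdαm d) (by norm_num))
    (Sy.mul_le hgrm htrm (by norm_num))) (Sy.mul_le hαm hPm (by norm_num))
  -- Replacing √g by 1 costs O(r⁻¹) times the flux, which is O(r⁻²).
  have h1 := Sy.mul_le hs1 hZm (by norm_num : (-1 + -2 : ℝ) ≤ -5 / 2)
  convert add_mem h1 (sub_mem (sub_mem hG1 hG2) hP2) using 1
  simp only [Geom.VA, Geom.gradFlux, map_sub, map_mul, map_sum, hc.toOff_D, flatVA, hc.geom_s,
    hc.geom_gi]
  rw [hZ]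
  ring

/-- The momentum with one lowered index. -/
def mixA (k j : Fin 3) : SmoothFn := ∑ i, hc.pA k i * hc.gA i j

/-- Lowering the index with g adds the product h̄π̄ to π^{(2)} at order r⁻³. This product is the
origin of the quadratic terms in the rotational boundary charge. -/
theorem mix_expansion (k j : Fin 3) : toOff (hc.mixA k j) - (rhoI ^ 2 * hc.pB j k
    + lg * rhoI ^ 3 * hc.pL j k + rhoI ^ 3 * (hc.pT j k + ∑ i, hc.hB j i * hc.pB i k))
      ∈ Sy b (-7 / 2) := by
  have h1 : ∑ i, hc.pO i k * (hc.gO j i - ((if j = i then 1 else 0) + rhoI ^ 1 * hc.hB j i))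
      ∈ Sy b (-7 / 2) := sum_mem fun i _ =>
    Sy.mul_le (hc.p_mem i k) (hc.metric_expansion j i) (by norm_num)
  have h2 : ∑ i, (hc.pO i k - rhoI ^ 2 * hc.pB i k) * (rhoI ^ 1 * hc.hB j i) ∈ Sy b (-7 / 2) :=
    sum_mem fun i _ => Sy.mul_le (hc.momentum_sub i k) (mem_powTerm (hc.homZ_hB j i) 1 le_rfl)
      (by norm_num)
  convert add_mem (add_mem h1 h2) (hc.momentum_expansion (b := b) j k) using 1
  have e : toOff (hc.mixA k j) = ∑ i, hc.pO i k * hc.gO j i := by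
    simp only [mixA, map_sum, map_mul]
    refine Finset.sum_congr rfl fun i _ => ?_
    rw [show hc.pO i k = hc.pO k i from congrArg toOff (hc.pA_symm i k),
      show hc.gO j i = hc.gO i j from congrArg toOff (hc.geom.g_symm j i)]
  have e2 : ∑ i, hc.pO i k * (if j = i then (1 : OffFn) else 0) = hc.pO j k := by simp
  rw [e, ← e2]
  simp only [mul_add, mul_sub, sub_mul, Finset.sum_sub_distrib, Finset.sum_add_distrib,
    Finset.mul_sum]
  have e3 : ∑ i, rhoI ^ 2 * hc.pB i k * (rhoI ^ 1 * hc.hB j i)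
      = ∑ i, rhoI ^ 3 * (hc.hB j i * hc.pB i k) := Finset.sum_congr rfl fun i _ => by ring
  rw [e3]
  ring

end IsVariation

end

section

/-! ### Asymptotics of the flux of the charge -/

namespace Smearing.IsAdmissible

variable {χ : Smearing} (hχ : χ.IsAdmissible) {b : Bool}

/-- The rotational part of the momentum flux. -/
def rotFlux (pb : Fin 3 → Fin 3 → OffFn) : OffFn := ∑ j, hχ.YO j * ∑ k, pb j k * nu k

/-- The bounded part of the momentum flux. -/
def gaugeFlux (pb : Fin 3 → Fin 3 → OffFn) : OffFn :=
  ∑ j, (hχ.WO * nu j + hχ.IvO j) * ∑ k, pb j k * nu k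

/-- The metric part of the flux. -/
def metricFlux (ε : ℝ) (hb : Fin 3 → Fin 3 → OffFn) : OffFn :=
  algebraMap ℝ OffFn ε * (∑ i, rho * offD (ex i) hχ.fO * ∑ k, hb i k * nu k
    - hχ.fO * (∑ i, hb i i - ∑ i, nu i * ∑ k, hb i k * nu k
      + ∑ i, ∑ k, rho * offD (ex i) (hb i k) * nu k))

variable {pb : Fin 3 → Fin 3 → OffFn}

theorem homZ_rotFlux (h : ∀ i j, HomZ (pb i j)) : HomZ (hχ.rotFlux pb) :=
  HomZ.sum fun j _ => (hχ.homZ_YO j).mul (HomZ.sum fun k _ => (h j k).mul (HomZ.nu k))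

theorem homZ_gaugeFlux (h : ∀ i j, HomZ (pb i j)) : HomZ (hχ.gaugeFlux pb) :=
  HomZ.sum fun j _ => ((hχ.homZ_WO.mul (HomZ.nu j)).add (hχ.homZ_IvO j)).mul
    (HomZ.sum fun k _ => (h j k).mul (HomZ.nu k))

theorem homZ_metricFlux (ε : ℝ) (h : ∀ i j, HomZ (pb i j)) : HomZ (hχ.metricFlux ε pb) := by
  have hr (i : Fin 3) : HomZ (∑ k, pb i k * nu k) := HomZ.sum fun k _ => (h i k).mul (HomZ.nu k)
  exact (HomZ.const ε).mul ((HomZ.sum fun i _ => (hχ.homZ_fO.rho_mul_offD i).mul (hr i)).sub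
    (hχ.homZ_fO.mul (((HomZ.sum fun i _ => h i i).sub (HomZ.sum fun i _ => (HomZ.nu i).mul (hr i))).add
      (HomZ.sum fun i _ => HomZ.sum fun k _ => ((h i k).rho_mul_offD i).mul (HomZ.nu k)))))

theorem sum_nu_leading :
    ∑ k, nu k * (rho * hχ.YO k + hχ.WO * nu k + hχ.IvO k) = hχ.WO := by
  have h1 := hχ.sum_nu_YO
  have h2 := hχ.sum_nu_IvO
  have h3 := sum_nu_sq
  simp only [Fin.sum_univ_three] at *
  linear_combination rho * h1 + h2 + hχ.WO * h3

/-- The radial part of the flat flux of a homogeneous metric perturbation. -/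
theorem sum_nu_flatVA (ε : ℝ) {hb : Fin 3 → Fin 3 → OffFn} (hh : ∀ i j, HomZ (hb i j))
    (hs : ∀ i j, hb i j = hb j i) :
    ∑ k, nu k * flatVA (algebraMap ℝ OffFn ε * hχ.fO) (fun i j => rhoI * hb i j) k
      = rhoI ^ 2 * hχ.metricFlux ε hb := by
  have e0 (i : Fin 3) : offD (ex i) (algebraMap ℝ OffFn ε * hχ.fO)
      = algebraMap ℝ OffFn ε * offD (ex i) hχ.fO := by
    rw [Derivation.leibniz, Derivation.map_algebraMap, smul_zero, add_zero, smul_eq_mul]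
  have ef := hχ.homZ_fO.euler
  have e1 := (hh 0 0).euler
  have e2 := (hh 1 1).euler
  have e3 := (hh 2 2).euler
  have en := sum_nu_sq
  have er : rho * rhoI * (∑ i, offD (ex i) hχ.fO * ∑ k, hb i k * nu k
      - hχ.fO * ∑ i, ∑ k, offD (ex i) (hb i k) * nu k)
      = ∑ i, offD (ex i) hχ.fO * ∑ k, hb i k * nu k
        - hχ.fO * ∑ i, ∑ k, offD (ex i) (hb i k) * nu k := by rw [rho_rhoI, one_mul]
  simp only [flatVA, flatPal, metricFlux, e0, Derivation.leibniz, smul_eq_mul, offD_rhoI,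
    Fin.sum_univ_three, hs 1 0, hs 2 0, hs 2 1] at *
  generalize algebraMap ℝ OffFn ε = κ
  linear_combination (-κ * rhoI * (hb 0 0 + hb 1 1 + hb 2 2)) * ef
    + κ * hχ.fO * rhoI * (e1 + e2 + e3)
    - κ * hχ.fO * rhoI ^ 2 * (hb 0 0 + hb 1 1 + hb 2 2) * en
    - κ * rhoI * er

end Smearing.IsAdmissible

namespace IsVariation

variable {ε : ℝ} {c : ℝ → Fields} {χ : Smearing} (hc : IsVariation ε c) (hχ : χ.IsAdmissible)
  {b : Bool}

theorem chargeA_mem (hε : ε = 1 ∨ ε = -1) : toOff (hc.chargeA hχ) ∈ Sy b (-7 / 2) := by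
  simp only [chargeA, map_add, map_mul, map_sum]
  exact add_mem (Sy.mul_le hχ.ξ_mem (hc.ham_mem hε) (by norm_num))
    (sum_mem fun i _ => Sy.mul_le (hχ.ξv_mem i) (hc.CvO_mem i) (by norm_num))

/-- The lapse smeared with `ξ`. -/
def αA : SmoothFn := hχ.ξA * hc.NA

/-- The vector `u`. -/
def uA (i : Fin 3) : SmoothFn := hχ.ξvA i + hχ.ξA * hc.NvA i

theorem α_expansion (hε : ε = 1 ∨ ε = -1) :
    toOff (hc.αA hχ) - algebraMap ℝ OffFn ε * hχ.fO ∈ Sy b (-1) := by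
  have h1 := near_mul_sub (hc.near_lapse (b := b) hε) (hχ.ξ_mem (b := b))
  have h2 := Sy.mul_le (Sy.const_mem (b := b) ε) hχ.ξ_expansion (by norm_num : (0 + -1 : ℝ) ≤ -1)
  convert add_mem (Sy.mono h1 (by norm_num : (0 - 1 : ℝ) ≤ -1)) h2 using 1
  rw [αA, map_mul, NO]; ring

theorem u_expansion (hε : ε = 1 ∨ ε = -1) (i : Fin 3) :
    toOff (hc.uA hχ i) - (rho * hχ.YO i + hχ.WO * nu i + hχ.IvO i) ∈ Sy b (-1 / 2) := by
  have h1 := Sy.mul_le (hχ.ξ_mem (b := b)) (hc.shift_mem hε i) (by norm_num : (0 + -1 / 2 : ℝ) ≤ -1 / 2)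
  convert add_mem (Sy.mono (hχ.ξv_expansion i) (by norm_num : (-1 : ℝ) ≤ -1 / 2)) h1 using 1
  rw [uA, map_add, map_mul, NvO]; ring

theorem u_mem (hε : ε = 1 ∨ ε = -1) (i : Fin 3) : toOff (hc.uA hχ i) ∈ Sy b 1 :=
  near_add_mem (hc.u_expansion hχ hε i) (hχ.leading_mem i) (by norm_num)

/-- The linearly growing part of u is tangential, so its radial component is bounded. Therefore u^r
π^{ij}δg_ij is O(r⁻³) and does not reach the boundary. -/
theorem radial_u_mem (hε : ε = 1 ∨ ε = -1) : ∑ k, nu k * toOff (hc.uA hχ k) ∈ Sy b 0 := by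
  have h1 := sum_mem (t := Finset.univ) fun k (_ : k ∈ Finset.univ) =>
    Sy.mul_le (Sy.hom (b := b) (HomZ.nu k)) (hc.u_expansion hχ hε k)
      (by norm_num : (0 + -1 / 2 : ℝ) ≤ 0)
  simp only [mul_sub, Finset.sum_sub_distrib, hχ.sum_nu_leading] at h1
  exact near_add_mem h1 (Sy.hom hχ.homZ_WO) le_rfl

theorem varG_expansion (i j : Fin 3) :
    toOff (hc.varGA i j) - rhoI * offD es (hc.hB i j) ∈ Sy false (-3 / 2) := by
  have h := Sy.offD_es (hc.metric_expansion (b := true) i j)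
  rwa [map_sub, map_add, offD_ite, zero_add, pow_one, Derivation.leibniz, offD_es_rhoI, smul_zero,
    add_zero, smul_eq_mul, ← toOff_smD] at h

theorem varG_mem (i j : Fin 3) : toOff (hc.varGA i j) ∈ Sy false (-1) :=
  near_add_mem (hc.varG_expansion i j)
    (Sy.mul_le Sy.rhoI (Sy.hom (hc.homZ_hB i j).offD_es) (by norm_num)) (by norm_num)

theorem varGA_symm (i j : Fin 3) : hc.varGA i j = hc.varGA j i := by
  unfold varGA; rw [show hc.gA i j = hc.gA j i from hc.geom.g_symm i j]

/-- The variation of the momentum with one lowered index. -/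
theorem varMix_expansion (k j : Fin 3) : toOff (smD es (hc.mixA k j))
    - (rhoI ^ 2 * offD es (hc.pB j k) + lg * rhoI ^ 3 * offD es (hc.pL j k)
      + rhoI ^ 3 * offD es (hc.pT j k + ∑ i, hc.hB j i * hc.pB i k)) ∈ Sy false (-7 / 2) := by
  have h := Sy.offD_es (hc.mix_expansion (b := true) k j)
  rw [map_sub, ← toOff_smD] at h
  convert h using 2
  simp [map_add, Derivation.leibniz, Derivation.leibniz_pow]

/-- The expansion of the radial momentum flux. -/
theorem momentumFlux_expansion (hε : ε = 1 ∨ ε = -1) :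
    ∑ j, toOff (hc.uA hχ j) * ∑ k, toOff (smD es (hc.mixA k j)) * nu k
      - (rhoI * hχ.rotFlux (fun i j => offD es (hc.pB i j))
        + lg * rhoI ^ 2 * hχ.rotFlux (fun i j => offD es (hc.pL i j))
        + rhoI ^ 2 * (hχ.rotFlux (fun j k => offD es (hc.pT j k + ∑ i, hc.hB j i * hc.pB i k))
          + hχ.gaugeFlux (fun i j => offD es (hc.pB i j)))) ∈ Sy false (-5 / 2) := by
  set T : Fin 3 → Fin 3 → OffFn := fun j k => toOff (smD es (hc.mixA k j)) with hT
  set P2 : Fin 3 → Fin 3 → OffFn := fun j k => offD es (hc.pB j k)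
  set PL : Fin 3 → Fin 3 → OffFn := fun j k => offD es (hc.pL j k)
  set P3 : Fin 3 → Fin 3 → OffFn := fun j k => offD es (hc.pT j k + ∑ i, hc.hB j i * hc.pB i k)
  have h2 (j k) : HomZ (P2 j k) := (hc.homZ_pB j k).offD_es
  have hL (j k) : HomZ (PL j k) := (hc.homZ_pL j k).offD_es
  have h3 (j k) : HomZ (P3 j k) := ((hc.homZ_pT j k).add
    (HomZ.sum fun i _ => (hc.homZ_hB j i).mul (hc.homZ_pB i k))).offD_es
  have hexp (j k) : T j k - (rhoI ^ 2 * P2 j k + lg * rhoI ^ 3 * PL j k + rhoI ^ 3 * P3 j k)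
      ∈ Sy false (-7 / 2) := hc.varMix_expansion k j
  have hlow (j k) : lg * rhoI ^ 3 * PL j k + rhoI ^ 3 * P3 j k ∈ Sy false (-5 / 2) :=
    add_mem (mem_logTerm (hL j k) 3 (by norm_num)) (mem_powTerm (h3 j k) 3 (by norm_num))
  have hTm (j k) : T j k ∈ Sy false (-2) := by
    have h4 := add_mem (Sy.mono (hexp j k) (by norm_num : (-7 / 2 : ℝ) ≤ -2))
      (Sy.mono (hlow j k) (by norm_num : (-5 / 2 : ℝ) ≤ -2))
    refine near_add_mem (G := rhoI ^ 2 * P2 j k) (a := -2) ?_ (mem_powTerm (h2 j k) 2 (by norm_num))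
      le_rfl
    convert h4 using 1; ring
  set l : Fin 3 → OffFn := fun j => hχ.WO * nu j + hχ.IvO j with hl
  have hlm (j) : l j ∈ Sy false 0 := Sy.hom ((hχ.homZ_WO.mul (HomZ.nu j)).add (hχ.homZ_IvO j))
  have hn (k) : nu k ∈ Sy false 0 := Sy.hom (HomZ.nu k)
  -- Three errors: that of u times the full variation, the leading part of u times the error of the
  -- variation, and the bounded part of u times the terms below r⁻².
  have key : ∑ j, ∑ k, ((toOff (hc.uA hχ j) - (rho * hχ.YO j + l j)) * T j k * nu k
      + (rho * hχ.YO j + l j)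
        * (T j k - (rhoI ^ 2 * P2 j k + lg * rhoI ^ 3 * PL j k + rhoI ^ 3 * P3 j k)) * nu k
      + l j * (lg * rhoI ^ 3 * PL j k + rhoI ^ 3 * P3 j k) * nu k) ∈ Sy false (-5 / 2) := by
    refine sum_mem fun j _ => sum_mem fun k _ => add_mem (add_mem ?_ ?_) ?_
    · have := hc.u_expansion (b := false) hχ hε j
      rw [add_assoc] at this
      exact Sy.mul_le (Sy.mul this (hTm j k)) (hn k) (by norm_num)
    · have := hχ.leading_mem (b := false) j
      rw [add_assoc] at this
      exact Sy.mul_le (Sy.mul this (hexp j k)) (hn k) (by norm_num)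
    · exact Sy.mul_le (Sy.mul (hlm j) (hlow j k)) (hn k) (by norm_num)
  convert key using 1
  have hr := rho_rhoI
  simp only [Smearing.IsAdmissible.rotFlux, Smearing.IsAdmissible.gaugeFlux, Finset.mul_sum,
    mul_add, ← Finset.sum_add_distrib, ← Finset.sum_sub_distrib]
  refine Finset.sum_congr rfl fun j _ => Finset.sum_congr rfl fun k _ => ?_
  change _ * (T j k * nu k) - _ = _
  linear_combination (hχ.YO j * nu k * (rhoI * P2 j k + lg * rhoI ^ 2 * PL j k
    + rhoI ^ 2 * P3 j k)) * hr

/-- The expansion of the radial flux of the variation of the charge. -/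
theorem flux_expansion (hε : ε = 1 ∨ ε = -1) :
    ∑ k, nu k * toOff (hc.fluxA hχ k)
      - (rhoI * (-2 * hχ.rotFlux (fun i j => offD es (hc.pB i j)))
        + lg * rhoI ^ 2 * (-2 * hχ.rotFlux (fun i j => offD es (hc.pL i j)))
        + rhoI ^ 2 * (-2 * (hχ.rotFlux (fun j k => offD es (hc.pT j k + ∑ i, hc.hB j i * hc.pB i k))
          + hχ.gaugeFlux (fun i j => offD es (hc.pB i j)))
          + hχ.metricFlux ε (fun i j => offD es (hc.hB i j)))) ∈ Sy false (-5 / 2) := by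
  have h1 := hc.momentumFlux_expansion hχ hε
  have h2 : (∑ k, nu k * toOff (hc.uA hχ k)) * ∑ i, ∑ j, hc.pO i j * toOff (hc.varGA i j)
      ∈ Sy false (-5 / 2) := Sy.mul_le (hc.radial_u_mem hχ hε) (sum_mem fun i _ => sum_mem fun j _ =>
        Sy.mul (hc.p_mem i j) (hc.varG_mem i j)) (by norm_num)
  have h3 : ∑ k, nu k * (toOff (hc.geom.VA (hc.αA hχ) hc.varGA k)
      - flatVA (algebraMap ℝ OffFn ε * hχ.fO) (fun i j => rhoI * offD es (hc.hB i j)) k)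
      ∈ Sy false (-5 / 2) := sum_mem fun k _ => Sy.mul_le (Sy.hom (HomZ.nu k))
        (hc.VA_sub hc.varGA_symm (fun i j => Sy.mul_le Sy.rhoI (Sy.hom (hc.homZ_hB i j).offD_es)
          (by norm_num)) hc.varG_expansion
          (Sy.mul_le (Sy.const_mem ε) (Sy.hom hχ.homZ_fO) (by norm_num))
          (hc.α_expansion hχ hε) k) (by norm_num)
  simp only [mul_sub, Finset.sum_sub_distrib] at h3
  rw [hχ.sum_nu_flatVA ε (fun i j => (hc.homZ_hB i j).offD_es) fun i j => by
    rw [hc.hB_symm]] at h3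
  have h4 : (-2 : OffFn) * (∑ j, toOff (hc.uA hχ j) * ∑ k, toOff (smD es (hc.mixA k j)) * nu k
      - (rhoI * hχ.rotFlux (fun i j => offD es (hc.pB i j))
        + lg * rhoI ^ 2 * hχ.rotFlux (fun i j => offD es (hc.pL i j))
        + rhoI ^ 2 * (hχ.rotFlux (fun j k => offD es (hc.pT j k + ∑ i, hc.hB j i * hc.pB i k))
          + hχ.gaugeFlux (fun i j => offD es (hc.pB i j))))) ∈ Sy false (-5 / 2) := by
    convert neg_mem (Sy.ofNat_mul 2 h1) using 1
    ring
  convert add_mem (add_mem h4 h2) h3 using 1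
  have hmix (k i : Fin 3) : smD es (hc.mixA k i)
      = ∑ l, (hc.varPA k l * hc.gA l i + hc.pA k l * hc.varGA l i) := by
    simp only [mixA, map_sum, Derivation.leibniz, smul_eq_mul, varPA, varGA]
    exact Finset.sum_congr rfl fun l _ => by ring
  have hflux (k : Fin 3) : toOff (hc.fluxA hχ k)
      = -2 * ∑ j, toOff (hc.uA hχ j) * toOff (smD es (hc.mixA k j))
        + toOff (hc.uA hχ k) * (∑ i, ∑ j, hc.pO i j * toOff (hc.varGA i j))
        + toOff (hc.geom.VA (hc.αA hχ) hc.varGA k) := by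
    rw [fluxA, Geom.flux, Geom.VM, map_add, map_add, map_mul, map_mul]
    simp only [map_sum, map_mul, map_neg, map_ofNat, hmix]
    rfl
  have e : ∑ k, nu k * (-2 * ∑ j, toOff (hc.uA hχ j) * toOff (smD es (hc.mixA k j)))
      = -2 * ∑ j, toOff (hc.uA hχ j) * ∑ k, toOff (smD es (hc.mixA k j)) * nu k := by
    simp only [Finset.mul_sum]
    rw [Finset.sum_comm]
    exact Finset.sum_congr rfl fun j _ => Finset.sum_congr rfl fun k _ => by ring
  simp only [hflux, mul_add, Finset.sum_add_distrib, e]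
  rw [Finset.sum_mul]
  simp only [mul_assoc]
  ring

end IsVariation

end

section

/-! ### Integrals over the sphere at infinity -/

theorem sphereIntegrable_evo (F : OffFn) (s : ℝ) : SphereIntegrable (fun n => evo F (s, n)) :=
  sphereIntegrable_of_continuousOn fun x hx =>
    (ContinuousAt.comp (f := fun y : Space => (s, y))
      (contDiffAt_evo F (mem_offZ.2 hx : (s, x) ∈ offZ)).continuousAt
      (by fun_prop)).continuousWithinAt

/-- The integral over the sphere as a linear functional. -/
def sphO (s : ℝ) : OffFn →ₗ[ℝ] ℝ where
  toFun F := sphereInt (fun n => evo F (s, n))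
  map_add' F G := by
    simp only [evo_add]
    exact sphereInt_add (sphereIntegrable_evo F s) (sphereIntegrable_evo G s)
  map_smul' a F := by
    simp only [evo_smul]
    exact sphereInt_const_mul a _

theorem sphO_apply (s : ℝ) (F : OffFn) : sphO s F = sphereInt (fun n => evo F (s, n)) := rfl

theorem sphO_congr {s : ℝ} {F G : OffFn}
    (h : ∀ x : Space, ‖x‖ = 1 → evo F (s, x) = evo G (s, x)) : sphO s F = sphO s G :=
  sphereInt_congr h

theorem ne_zero_of_norm_one {x : Space} (hx : ‖x‖ = 1) : x ≠ 0 := by rintro rfl; simp at hx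

theorem sphO_rho_mul (s : ℝ) (F : OffFn) : sphO s (rho * F) = sphO s F := sphO_congr fun x hx => by
  have hq : (s, x) ∈ offZ := mem_offZ.2 (ne_zero_of_norm_one hx)
  simp only [evo_mul, evo_rho hq, hx, one_mul]

theorem sphO_two_mul (s : ℝ) (F : OffFn) : sphO s (2 * F) = 2 * sphO s F := by
  have : (2 : OffFn) * F = (2 : ℝ) • F := by
    rw [← algebraMap_smul OffFn (2 : ℝ), smul_eq_mul, map_ofNat]
  rw [this, map_smul, smul_eq_mul]

theorem sphO_neg_two_mul (s : ℝ) (F : OffFn) : sphO s (-2 * F) = -2 * sphO s F := by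
  have : (-2 : OffFn) * F = -(2 * F) := by ring
  rw [this, map_neg, sphO_two_mul]; ring

theorem hasDerivAt_sphO (F : OffFn) (s : ℝ) :
    HasDerivAt (fun t => sphO t F) (sphO s (offD es F)) s := by
  have h := hasDerivAt_sphereInt (contDiffOn_evo F) s
  have e : sphereInt (fun n => dirD es (evo F) (s, n)) = sphereInt (fun n => evo (offD es F) (s, n)) :=
    sphereInt_congr fun n hn => by
      have hq : (s, n) ∈ offZ := mem_offZ.2 (ne_zero_of_norm_one hn)
      rw [evo_offD es F hq]
  rw [e] at h
  simp only [sphO_apply]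
  exact h

theorem sphO_divergence {V : Fin 3 → OffFn} (hV : ∀ i, HomZ (V i)) (s : ℝ) :
    sphO s (rho * ∑ i, offD (ex i) (V i)) = sphO s (2 * ∑ i, nu i * V i) := by
  have h := sphere_divergence_of_isSphereFun fun i => (hV i).isSphereFun s
  have h1 : sphO s (∑ i, offD (ex i) (V i))
      = sphereInt (fun n => ∑ i, pd i (fun x => evo (V i) (s, x)) n) :=
    (sphO_apply _ _).trans <| sphereInt_congr fun n hn => by
      have hq : (s, n) ∈ offZ := mem_offZ.2 (ne_zero_of_norm_one hn)
      rw [← evoHom_apply hq, map_sum]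
      simp only [evoHom_apply, pd_evo _ (ne_zero_of_norm_one hn)]
  have h2 : sphO s (∑ i, nu i * V i) = sphereInt (fun n => ∑ i, n i * evo (V i) (s, n)) :=
    (sphO_apply _ _).trans <| sphereInt_congr fun n hn => by
      have hq : (s, n) ∈ offZ := mem_offZ.2 (ne_zero_of_norm_one hn)
      rw [← evoHom_apply hq, map_sum]
      simp only [map_mul, evoHom_apply, evo_nu _ hq, radialVec_of_norm_one hn]
  rw [sphO_rho_mul, sphO_two_mul, h1, h2]
  exact h

theorem sum_offD_nu : rho * ∑ i, offD (ex i) (nu i) = 2 := by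
  have h1 := sum_nu_sq
  simp only [offD_nu, if_true, Fin.sum_univ_three] at *
  linear_combination (3 - (nu 0 * nu 0 + nu 1 * nu 1 + nu 2 * nu 2)) * rho_rhoI - h1

theorem radialVec_dot {x : Space} (hx : x ≠ 0) : radialVec x ⬝ᵥ radialVec x = 1 :=
  sum_radialVec_sq hx

theorem tangProj_mulVec (x : Space) (w : Fin 3 → ℝ) :
    tangProj x *ᵥ w = w - (radialVec x ⬝ᵥ w) • radialVec x := by
  rw [tangProj, Matrix.sub_mulVec, Matrix.one_mulVec, Matrix.vecMulVec_mulVec]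
  simp

theorem dot_tangProj {x : Space} {v : Fin 3 → ℝ} (hv : radialVec x ⬝ᵥ v = 0) (w : Fin 3 → ℝ) :
    v ⬝ᵥ (tangProj x *ᵥ w) = v ⬝ᵥ w := by
  rw [tangProj_mulVec, dotProduct_sub, dotProduct_smul, dotProduct_comm v (radialVec x), hv]
  simp

theorem tangProj_tangProj {x : Space} (hx : x ≠ 0) (w : Fin 3 → ℝ) :
    tangProj x *ᵥ (tangProj x *ᵥ w) = tangProj x *ᵥ w := by
  rw [tangProj_mulVec x (tangProj x *ᵥ w), tangProj_mulVec, dotProduct_sub, dotProduct_smul,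
    radialVec_dot hx]
  simp

namespace Smearing.IsAdmissible

variable {χ : Smearing} (hχ : χ.IsAdmissible)

/-- By `exists_rotation`, Y is a linear function of the unit radial vector. -/
theorem YO_odd (hχ : χ.IsAdmissible) (i : Fin 3) {x : Space} (hx : x ≠ 0) : χ.Y (-x) i = -χ.Y x i := by
  obtain ⟨m, -, h⟩ := hχ.exists_rotation
  have e (y : Space) (hy : y ≠ 0) : χ.Y y i = ∑ j, m i j * radialVec y j := by
    have hq : ((0 : ℝ), y) ∈ offZ := mem_offZ.2 hy
    have h1 := congrArg (evoHom _ hq) (h i)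
    rw [map_sum] at h1
    simpa only [map_mul, evoHom_apply, evo_const _ hq, evo_nu _ hq, YO, evo_offX _ _ hq] using h1
  rw [e x hx, e (-x) (neg_ne_zero.2 hx), ← Finset.sum_neg_distrib]
  refine Finset.sum_congr rfl fun j _ => ?_
  simp [radialVec, neg_div]

/-- The function `2 λ̄ + D̄_A λ̄^A` of a metric perturbation. -/
def lamDiv (hb : Fin 3 → Fin 3 → OffFn) : OffFn :=
  rho * ∑ i, offD (ex i) (∑ k, hb i k * nu k) - ∑ i, nu i * ∑ k, hb i k * nu k

/-- An integration by parts on the sphere: the divergence theorem for f h̄·n takes the derivative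
off f. Together with the divergence of h̄·n this doubles the result, which explains the factor 2 in
ℬ(f). -/
theorem sphO_metricFlux (ε : ℝ) {hb : Fin 3 → Fin 3 → OffFn} (hh : ∀ i j, HomZ (hb i j)) (s : ℝ) :
    sphO s (hχ.metricFlux ε hb) = -sphO s (algebraMap ℝ OffFn ε * (2 * hχ.fO * lamDiv hb)) := by
  have hv (i : Fin 3) : HomZ (∑ k, hb i k * nu k) := HomZ.sum fun k _ => (hh i k).mul (HomZ.nu k)
  have hd := sphO_divergence (V := fun i => hχ.fO * ∑ k, hb i k * nu k)
    (fun i => hχ.homZ_fO.mul (hv i)) s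
  have hε (F : OffFn) : sphO s (algebraMap ℝ OffFn ε * F) = ε * sphO s F := by
    rw [← Algebra.smul_def, map_smul, smul_eq_mul]
  have hw : ∑ i, hb i i - ∑ i, nu i * ∑ k, hb i k * nu k
      + ∑ i, ∑ k, rho * offD (ex i) (hb i k) * nu k
      = rho * ∑ i, offD (ex i) (∑ k, hb i k * nu k) := by
    have e (i : Fin 3) : rho * offD (ex i) (∑ k, hb i k * nu k)
        = hb i i - nu i * ∑ k, hb i k * nu k + ∑ k, rho * offD (ex i) (hb i k) * nu k := by
      have e1 : ∑ k, hb i k * (if i = k then (1 : OffFn) else 0) = hb i i := by simp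
      rw [map_sum, ← e1]
      simp only [Derivation.leibniz, smul_eq_mul, offD_nu, Finset.mul_sum, ← Finset.sum_add_distrib,
        ← Finset.sum_sub_distrib]
      refine Finset.sum_congr rfl fun k _ => ?_
      linear_combination hb i k * ((if i = k then (1 : OffFn) else 0) - nu i * nu k) * rho_rhoI
    rw [Finset.mul_sum]
    simp only [e, Finset.sum_add_distrib, Finset.sum_sub_distrib]
  rw [metricFlux, hε, hε, hw]
  have e2 : (∑ i, rho * offD (ex i) hχ.fO * ∑ k, hb i k * nu k
      - hχ.fO * (rho * ∑ i, offD (ex i) (∑ k, hb i k * nu k)))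
      = rho * ∑ i, offD (ex i) (hχ.fO * ∑ k, hb i k * nu k)
        - 2 * ∑ i, nu i * (hχ.fO * ∑ k, hb i k * nu k) - 2 * hχ.fO * lamDiv hb := by
    simp only [lamDiv, Derivation.leibniz, smul_eq_mul, Finset.sum_add_distrib]
    have e3 : ∑ i, nu i * (hχ.fO * ∑ k, hb i k * nu k)
        = hχ.fO * ∑ i, nu i * ∑ k, hb i k * nu k := by
      rw [Finset.mul_sum]; exact Finset.sum_congr rfl fun i _ => by ring
    have e4 : ∑ i, (∑ k, hb i k * nu k) * offD (ex i) hχ.fO * rho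
        = ∑ i, rho * offD (ex i) hχ.fO * ∑ k, hb i k * nu k :=
      Finset.sum_congr rfl fun i _ => by ring
    rw [e3, ← e4, ← Finset.sum_mul, ← Finset.mul_sum]
    ring
  rw [e2, map_sub, map_sub, hd]
  ring

/-- The rotational flux of a divergence-free momentum vanishes. -/
theorem sphO_rotFlux {pb : Fin 3 → Fin 3 → OffFn} (hp : ∀ i j, HomZ (pb i j))
    (hs : ∀ i j, pb i j = pb j i) (h : ∀ j, VanN (∑ i, offD (ex i) (rhoI ^ 2 * pb i j))) :
    sphO 0 (hχ.rotFlux pb) = 0 := by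
  have hV (i : Fin 3) : HomZ (∑ j, hχ.YO j * pb i j) :=
    HomZ.sum fun j _ => (hχ.homZ_YO j).mul (hp i j)
  have hd := sphO_divergence hV 0
  -- The derivative of rY is antisymmetric and drops out against the symmetric pb. What remains is
  -- the flux itself and a term with the divergence of r⁻²pb.
  have e1 : rho * ∑ i, offD (ex i) (∑ j, hχ.YO j * pb i j)
      = hχ.rotFlux pb + rho ^ 3 * ∑ j, hχ.YO j * ∑ i, offD (ex i) (rhoI ^ 2 * pb i j) := by
    have hk (i j : Fin 3) : nu i * hχ.YO j + rho * offD (ex i) (hχ.YO j)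
        + (nu j * hχ.YO i + rho * offD (ex j) (hχ.YO i)) = 0 := by
      have := hχ.killS_eq_zero i j
      rw [killS_eq] at this
      linear_combination this
    have e2 (i j : Fin 3) : rho * offD (ex i) (hχ.YO j * pb i j)
        = (nu i * hχ.YO j + rho * offD (ex i) (hχ.YO j)) * pb i j + hχ.YO j * pb i j * nu i
          + rho ^ 3 * (hχ.YO j * offD (ex i) (rhoI ^ 2 * pb i j)) := by
      rw [Derivation.leibniz, Derivation.leibniz _ (rhoI ^ 2), offD_rhoI_pow]
      simp only [smul_eq_mul]
      push_cast
      have hr := rho_rhoI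
      linear_combination (-hχ.YO j * offD (ex i) (pb i j) * rho * (rho * rhoI + 1)
        + 2 * pb i j * nu i * hχ.YO j * ((rho * rhoI) ^ 2 + rho * rhoI + 1)) * hr
    have e3 : ∑ i, ∑ j, (nu i * hχ.YO j + rho * offD (ex i) (hχ.YO j)) * pb i j = 0 := by
      have e : ∑ i, ∑ j, (nu i * hχ.YO j + rho * offD (ex i) (hχ.YO j)) * pb i j
          = ∑ i, ∑ j, (nu j * hχ.YO i + rho * offD (ex j) (hχ.YO i)) * pb i j := by
        rw [Finset.sum_comm]
        exact Finset.sum_congr rfl fun i _ => Finset.sum_congr rfl fun j _ => by rw [hs]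
      have e' : ∑ i, ∑ j, (nu i * hχ.YO j + rho * offD (ex i) (hχ.YO j)) * pb i j
          + ∑ i, ∑ j, (nu j * hχ.YO i + rho * offD (ex j) (hχ.YO i)) * pb i j = 0 := by
        simp only [← Finset.sum_add_distrib, ← add_mul, hk, zero_mul, Finset.sum_const_zero]
      rw [← e] at e'
      linear_combination Geom.half OffFn * e' - (∑ i, ∑ j, (nu i * hχ.YO j
        + rho * offD (ex i) (hχ.YO j)) * pb i j) * Geom.two_mul_half (A := OffFn)
    have e4 : hχ.rotFlux pb = ∑ i, ∑ j, hχ.YO j * pb i j * nu i := by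
      rw [rotFlux, Finset.sum_comm]
      refine Finset.sum_congr rfl fun j _ => ?_
      rw [Finset.mul_sum]
      exact Finset.sum_congr rfl fun i _ => by rw [hs j i]; ring
    have e5 : ∑ j, hχ.YO j * ∑ i, offD (ex i) (rhoI ^ 2 * pb i j)
        = ∑ i, ∑ j, hχ.YO j * offD (ex i) (rhoI ^ 2 * pb i j) := by
      rw [Finset.sum_comm]
      exact Finset.sum_congr rfl fun j _ => by rw [Finset.mul_sum]
    rw [e4, e5, ← zero_add (∑ i, ∑ j, hχ.YO j * pb i j * nu i), ← e3]
    simp only [map_sum, Finset.mul_sum, e2, Finset.sum_add_distrib]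
  have e6 : ∑ i, nu i * ∑ j, hχ.YO j * pb i j = hχ.rotFlux pb := by
    simp only [rotFlux, Finset.mul_sum]
    rw [Finset.sum_comm]
    exact Finset.sum_congr rfl fun j _ => Finset.sum_congr rfl fun i _ => by rw [hs j i]; ring
  have e7 : sphO 0 (rho ^ 3 * ∑ j, hχ.YO j * ∑ i, offD (ex i) (rhoI ^ 2 * pb i j)) = 0 := by
    refine (sphO_congr (G := 0) fun x hx => ?_).trans (map_zero _)
    have hx0 := ne_zero_of_norm_one hx
    have hq : ((0 : ℝ), x) ∈ offZ := mem_offZ.2 hx0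
    rw [← evoHom_apply hq, ← evoHom_apply hq, map_mul, map_sum, map_zero]
    have h0 (j : Fin 3) := (h j).self_of_nhds x hx0
    simp only [map_mul, evoHom_apply, h0, mul_zero, Finset.sum_const_zero]
  -- For the flux Φ the divergence theorem now reads Φ = 2Φ.
  rw [e1, e6, map_add, e7, sphO_two_mul] at hd
  linarith

end Smearing.IsAdmissible

namespace IsVariation

variable {ε : ℝ} {c : ℝ → Fields} {χ : Smearing} (hc : IsVariation ε c) (hχ : χ.IsAdmissible)

/-- r⁻²π̄ is divergence free for every small s, hence so is its variation. -/
theorem sphO_rotFlux_pB : sphO 0 (hχ.rotFlux fun i j => offD es (hc.pB i j)) = 0 := by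
  refine hχ.sphO_rotFlux (fun i j => (hc.homZ_pB i j).offD_es) (fun i j => by rw [hc.pB_symm])
    fun j => ?_
  have := (hc.vanN_div_pB (b := false) j).1.offD es
  convert this using 1
  rw [map_sum]
  refine Finset.sum_congr rfl fun i _ => ?_
  rw [offD_comm es (ex i), Derivation.leibniz (offD es) (rhoI ^ 2), Derivation.leibniz_pow,
    offD_es_rhoI]
  simp

/-- The rotation field Y is odd and π^{(log)rA} is even by the parity condition, so the integrand is
odd under the antipodal map. -/
theorem sphO_rotFlux_pL (s : ℝ) : sphO s (hχ.rotFlux hc.pL) = 0 := by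
  have e (x : Space) (hx : x ≠ 0) :
      evo (hχ.rotFlux hc.pL) (s, x) = χ.Y x ⬝ᵥ compRT (c s).pLog x := by
    have hq : (s, x) ∈ offZ := mem_offZ.2 hx
    rw [compRT, dot_tangProj (hχ.Y_tangent x hx), Smearing.IsAdmissible.rotFlux,
      ← evoHom_apply hq, map_sum]
    simp only [map_mul, map_sum, evoHom_apply, evo_nu _ hq, hc.evo_pL _ _ hx,
      Smearing.IsAdmissible.YO, evo_offX _ _ hq]
    rfl
  refine (sphO_apply _ _).trans <| sphereInt_eq_zero_of_odd fun n hn => ?_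
  have hn0 := ne_zero_of_norm_one hn
  rw [e n hn0, e (-n) (neg_ne_zero.2 hn0), (hc.mem s).parity n hn0,
    show χ.Y (-n) = -χ.Y n from funext fun i => hχ.YO_odd i hn0, neg_dotProduct]

theorem offD_es_rotFlux (pb : Fin 3 → Fin 3 → OffFn) :
    offD es (hχ.rotFlux pb) = hχ.rotFlux fun i j => offD es (pb i j) := by
  simp only [Smearing.IsAdmissible.rotFlux, map_sum, Derivation.leibniz, smul_eq_mul,
    hχ.offD_es_YO, offD_es_nu, mul_zero, zero_add, add_zero]
  exact Finset.sum_congr rfl fun j _ => by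
    congr 1; exact Finset.sum_congr rfl fun k _ => by ring

theorem offD_es_gaugeFlux (pb : Fin 3 → Fin 3 → OffFn) :
    offD es (hχ.gaugeFlux pb) = hχ.gaugeFlux fun i j => offD es (pb i j) := by
  simp only [Smearing.IsAdmissible.gaugeFlux, map_sum, map_add, Derivation.leibniz, smul_eq_mul,
    hχ.offD_es_WO, hχ.offD_es_IvO, offD_es_nu, mul_zero, zero_add, add_zero]
  exact Finset.sum_congr rfl fun j _ => by
    congr 1; exact Finset.sum_congr rfl fun k _ => by ring

theorem offD_es_lamDiv (hb : Fin 3 → Fin 3 → OffFn) :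
    offD es (Smearing.IsAdmissible.lamDiv hb)
      = Smearing.IsAdmissible.lamDiv fun i j => offD es (hb i j) := by
  have e (i : Fin 3) : offD es (∑ k, hb i k * nu k) = ∑ k, offD es (hb i k) * nu k := by
    simp only [map_sum, Derivation.leibniz, smul_eq_mul, offD_es_nu, mul_zero, zero_add]
    exact Finset.sum_congr rfl fun k _ => by ring
  simp only [Smearing.IsAdmissible.lamDiv]
  rw [map_sub, Derivation.leibniz, offD_es_rho, smul_zero, add_zero, smul_eq_mul, map_sum, map_sum]
  congr 1
  · congr 1; exact Finset.sum_congr rfl fun i _ => by rw [offD_comm, e]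
  · refine Finset.sum_congr rfl fun i _ => ?_
    rw [Derivation.leibniz, offD_es_nu, smul_zero, add_zero, smul_eq_mul, e]

theorem sphO_rotFlux_pL_deriv : sphO 0 (hχ.rotFlux fun i j => offD es (hc.pL i j)) = 0 := by
  have h := hasDerivAt_sphO (hχ.rotFlux hc.pL) 0
  simp only [hc.sphO_rotFlux_pL hχ, offD_es_rotFlux] at h
  exact h.unique (hasDerivAt_const _ _)

end IsVariation

end

section

/-! ### The boundary charge -/

namespace IsVariation

open Smearing.IsAdmissible

variable {ε : ℝ} {c : ℝ → Fields} {χ : Smearing} (hc : IsVariation ε c) (hχ : χ.IsAdmissible)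
  {s : ℝ} {x : Space}

theorem evo_row (A : Space → Mat) (a : Fin 3 → Fin 3 → OffFn)
    (h : ∀ y ≠ 0, ∀ i j, evo (a i j) (s, y) = A y i j) (hx : x ≠ 0) (i : Fin 3) :
    evo (∑ k, a i k * nu k) (s, x) = (A x *ᵥ radialVec x) i := by
  have hq : (s, x) ∈ offZ := mem_offZ.2 hx
  rw [← evoHom_apply hq, map_sum]
  simp only [map_mul, evoHom_apply, evo_nu _ hq, h x hx]
  rfl

theorem evo_compRR (A : Space → Mat) (a : Fin 3 → Fin 3 → OffFn)
    (h : ∀ y ≠ 0, ∀ i j, evo (a i j) (s, y) = A y i j) (hx : x ≠ 0) :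
    evo (∑ i, nu i * ∑ k, a i k * nu k) (s, x) = compRR A x := by
  have hq : (s, x) ∈ offZ := mem_offZ.2 hx
  rw [← evoHom_apply hq, map_sum]
  simp only [map_mul, evoHom_apply, evo_nu _ hq, evo_row A a h hx]
  rfl

theorem lamVec_eq (hx : x ≠ 0) (i : Fin 3) : lamVec (c s) x i
    = evo (∑ k, hc.hB i k * nu k - (∑ i, nu i * ∑ k, hc.hB i k * nu k) * nu i) (s, x) := by
  have hq : (s, x) ∈ offZ := mem_offZ.2 hx
  have h (y : Space) (hy : y ≠ 0) (i j : Fin 3) : evo (hc.hB i j) (s, y) = (c s).hBar y i j :=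
    hc.evo_hB i j hy
  rw [← evoHom_apply hq, map_sub, map_mul, evoHom_apply, evoHom_apply, evoHom_apply, evo_nu _ hq,
    evo_row _ _ h hx, evo_compRR _ _ h hx, lamVec, compRT, tangProj_mulVec]
  rfl

theorem densf_eq (hx : ‖x‖ = 1) : densf ε χ (c s) x
    = evo (algebraMap ℝ OffFn ε * (2 * hχ.fO * lamDiv hc.hB)) (s, x) := by
  have hx0 := ne_zero_of_norm_one hx
  have hq : (s, x) ∈ offZ := mem_offZ.2 hx0
  have h (y : Space) (hy : y ≠ 0) (i j : Fin 3) : evo (hc.hB i j) (s, y) = (c s).hBar y i j :=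
    hc.evo_hB i j hy
  set hrr : OffFn := ∑ i, nu i * ∑ k, hc.hB i k * nu k with hrr_def
  have hhrr : HomZ hrr := HomZ.sum fun i _ => (HomZ.nu i).mul
    (HomZ.sum fun k _ => (hc.homZ_hB i k).mul (HomZ.nu k))
  -- Split h̄·n into its tangential part λ̄_A and h̄_rr n. By Euler's relation and r div n = 2, the
  -- radial part has rescaled divergence 2h̄_rr, of which one h̄_rr = 2λ̄ is left after the
  -- subtraction in `lamDiv`.
  have e1 : lamDiv hc.hB
      = rho * ∑ i, offD (ex i) (∑ k, hc.hB i k * nu k - hrr * nu i) + hrr := by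
    have h1 := hhrr.euler
    have h2 := sum_offD_nu
    have h3 : ∑ i, offD (ex i) (hrr * nu i)
        = hrr * ∑ i, offD (ex i) (nu i) + ∑ i, nu i * offD (ex i) hrr := by
      simp only [Derivation.leibniz, smul_eq_mul, Finset.sum_add_distrib, Finset.mul_sum]
    simp only [lamDiv, map_sub, Finset.sum_sub_distrib]
    rw [h3, h1, ← hrr_def]
    linear_combination hrr * h2
  have e2 : sphereDiv (lamVec (c s)) x
      = ∑ i, evo (offD (ex i) (∑ k, hc.hB i k * nu k - hrr * nu i)) (s, x) := by
    refine Finset.sum_congr rfl fun i _ => ?_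
    rw [pd_congr_off (fun y hy => hc.lamVec_eq hy i) hx0, pd_evo _ hx0]
  rw [e1, ← evoHom_apply hq]
  simp only [map_mul, map_add, map_sum, map_ofNat, evoHom_apply, evo_const _ hq, evo_rho hq, hx,
    fO, evo_offX _ _ hq]
  rw [← e2, hrr_def, evo_compRR _ _ h hx0, densf, lamBar]
  ring

/-- The angular traces cancel: p̄ + 2π̄^A_A = 2π̄^rr. -/
theorem densW_eq (hx : ‖x‖ = 1) : densW χ (c s) x
    = evo (2 * (hχ.WO * ∑ i, nu i * ∑ k, hc.pB i k * nu k)) (s, x) := by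
  have hx0 := ne_zero_of_norm_one hx
  have hq : (s, x) ∈ offZ := mem_offZ.2 hx0
  rw [← evoHom_apply hq, map_mul, map_mul, map_ofNat, evoHom_apply, evoHom_apply,
    evo_compRR (c s).pBar hc.pB (fun y hy i j => hc.evo_pB i j hy) hx0, WO, evo_offX _ _ hq, densW,
    pScalar]
  ring

theorem densI_eq (hx : ‖x‖ = 1) : densI χ (c s) x
    = evo (2 * ∑ i, hχ.IvO i * ∑ k, hc.pB i k * nu k) (s, x) := by
  have hx0 := ne_zero_of_norm_one hx
  have hq : (s, x) ∈ offZ := mem_offZ.2 hx0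
  rw [← evoHom_apply hq, map_mul, map_ofNat, map_sum]
  simp only [map_mul, evoHom_apply,
    evo_row (c s).pBar hc.pB (fun y hy i j => hc.evo_pB i j hy) hx0, IvO, evo_offX _ _ hq]
  rw [densI, compRT, dot_tangProj (hχ.I_tangent x hx0)]
  rfl

/-- Split π̄·n into tangential and radial parts before applying h̄. The tangential part gives the
term with k̃ − λ̄γ̄ = h̄_AB/2, the radial part gives λ̄_A times 2π̄^rr, and their sum is the
tangential projection of 2h̄π̄n. -/
theorem densY_eq (hx : ‖x‖ = 1) : densY χ (c s) x
    = evo (2 * hχ.rotFlux fun j k => hc.pT j k + ∑ i, hc.hB j i * hc.pB i k) (s, x) := by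
  have hx0 := ne_zero_of_norm_one hx
  have hq : (s, x) ∈ offZ := mem_offZ.2 hx0
  have h1 : evo (2 * hχ.rotFlux fun j k => hc.pT j k + ∑ i, hc.hB j i * hc.pB i k) (s, x)
      = 2 * (χ.Y x ⬝ᵥ ((c s).p2 x *ᵥ radialVec x)
        + χ.Y x ⬝ᵥ ((c s).hBar x *ᵥ ((c s).pBar x *ᵥ radialVec x))) := by
    rw [← evoHom_apply hq, map_mul, map_ofNat, rotFlux, map_sum]
    simp only [map_mul, map_sum, map_add, evoHom_apply, evo_nu _ hq, YO, evo_offX _ _ hq,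
      hc.evo_pT _ _ hx0, hc.evo_hB _ _ hx0, hc.evo_pB _ _ hx0]
    rw [Matrix.mulVec_mulVec, ← dotProduct_add, ← Matrix.add_mulVec]
    rfl
  have hY := hχ.Y_tangent x hx0
  rw [h1, densY]
  have hk : kTilde (c s) x - lamBar (c s) x • tangProj x
      = (1 / 2 : ℝ) • (tangProj x * (c s).hBar x * tangProj x) := by
    rw [kTilde, compTT, add_sub_cancel_right]
  have e1 : (4 : ℝ) • ((kTilde (c s) x - lamBar (c s) x • tangProj x) *ᵥ compRT (c s).pBar x)
      = (2 : ℝ) • (tangProj x *ᵥ ((c s).hBar x *ᵥ (tangProj x *ᵥ ((c s).pBar x *ᵥ radialVec x)))) := by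
    rw [hk, compRT, Matrix.smul_mulVec, smul_smul, ← Matrix.mulVec_mulVec, ← Matrix.mulVec_mulVec,
      tangProj_tangProj hx0]
    norm_num
  rw [e1, dotProduct_add, dotProduct_add, dotProduct_smul, dotProduct_smul, dotProduct_smul,
    dot_tangProj hY, lamVec, compRT, compRT, dot_tangProj hY, dot_tangProj hY, tangProj_mulVec,
    Matrix.mulVec_sub, Matrix.mulVec_smul, dotProduct_sub, dotProduct_smul, pScalar, compRR]
  simp only [smul_eq_mul]
  ring

/-- The integrand of the boundary charge. -/
def bdyO : OffFn := algebraMap ℝ OffFn ε * (2 * hχ.fO * lamDiv hc.hB)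
  + 2 * hχ.gaugeFlux hc.pB
  + 2 * hχ.rotFlux fun j k => hc.pT j k + ∑ i, hc.hB j i * hc.pB i k

theorem sphereIntegrable_of_evo {φ : Space → ℝ} {F : OffFn}
    (h : ∀ x : Space, ‖x‖ = 1 → φ x = evo F (s, x)) : SphereIntegrable φ :=
  (sphereIntegrable_evo F s).congr (Eventually.of_forall fun n => (h n (sphere_norm n)).symm)

theorem boundaryCharge_eq (s : ℝ) : boundaryCharge ε χ (c s) = sphO s (hc.bdyO hχ) := by
  have e : hc.bdyO hχ = algebraMap ℝ OffFn ε * (2 * hχ.fO * lamDiv hc.hB)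
      + 2 * (hχ.WO * ∑ i, nu i * ∑ k, hc.pB i k * nu k)
      + (2 * hχ.rotFlux fun j k => hc.pT j k + ∑ i, hc.hB j i * hc.pB i k)
      + 2 * ∑ i, hχ.IvO i * ∑ k, hc.pB i k * nu k := by
    have : hχ.gaugeFlux hc.pB = hχ.WO * ∑ i, nu i * ∑ k, hc.pB i k * nu k
        + ∑ i, hχ.IvO i * ∑ k, hc.pB i k * nu k := by
      rw [gaugeFlux, Finset.mul_sum, ← Finset.sum_add_distrib]
      exact Finset.sum_congr rfl fun i _ => by ring
    rw [bdyO, this]; ring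
  rw [e, map_add, map_add, map_add, boundaryCharge]
  simp only [sphO_apply]
  rw [sphereInt_congr fun n hn => hc.densf_eq (s := s) hχ hn,
    sphereInt_congr fun n hn => hc.densW_eq (s := s) hχ hn,
    sphereInt_congr fun n hn => hc.densY_eq (s := s) hχ hn,
    sphereInt_congr fun n hn => hc.densI_eq (s := s) hχ hn]

theorem hasDerivAt_boundaryCharge : HasDerivAt (fun s => boundaryCharge ε χ (c s))
    (sphO 0 (offD es (hc.bdyO hχ))) 0 := by
  have h := hasDerivAt_sphO (hc.bdyO hχ) 0
  simpa only [hc.boundaryCharge_eq hχ] using h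

/-- The boundary term of the variation tends to minus the variation of the boundary charge. -/
theorem tendsto_boundaryTerm (hε : ε = 1 ∨ ε = -1) :
    Tendsto (boundaryTerm χ c) atTop (𝓝 (-sphO 0 (offD es (hc.bdyO hχ)))) := by
  have hpB (i j) : HomZ (offD es (hc.pB i j)) := (hc.homZ_pB i j).offD_es
  have hX (j k) : HomZ (offD es (hc.pT j k + ∑ i, hc.hB j i * hc.pB i k)) :=
    ((hc.homZ_pT j k).add (HomZ.sum fun i _ => (hc.homZ_hB j i).mul (hc.homZ_pB i k))).offD_es
  have h2 : HomZ (-2 : OffFn) := (HomZ.ofNat 2).neg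
  have h := tendsto_sphere_flux
    (h2.mul (hχ.homZ_rotFlux hpB))
    (h2.mul (hχ.homZ_rotFlux fun i j => (hc.homZ_pL i j).offD_es))
    ((h2.mul ((hχ.homZ_rotFlux hX).add (hχ.homZ_gaugeFlux hpB))).add
      (hχ.homZ_metricFlux ε fun i j => (hc.homZ_hB i j).offD_es))
    (hc.flux_expansion hχ hε) ?_ ?_
  · simp only [← sphO_apply] at h
    rw [map_add, sphO_neg_two_mul, map_add, hχ.sphO_metricFlux ε
      fun i j => (hc.homZ_hB i j).offD_es] at h
    have e : sphO 0 (offD es (hc.bdyO hχ))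
        = sphO 0 (algebraMap ℝ OffFn ε * (2 * hχ.fO * lamDiv fun i j => offD es (hc.hB i j)))
          + 2 * sphO 0 (hχ.gaugeFlux fun i j => offD es (hc.pB i j))
          + 2 * sphO 0 (hχ.rotFlux fun j k => offD es (hc.pT j k + ∑ i, hc.hB j i * hc.pB i k)) := by
      rw [← sphO_two_mul, ← sphO_two_mul, ← map_add, ← map_add]
      congr 1
      have h2' : offD es (2 : OffFn) = 0 := Geom.deriv_two _
      rw [bdyO, map_add, map_add, ← offD_es_rotFlux, ← offD_es_gaugeFlux, ← offD_es_lamDiv]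
      simp only [Derivation.leibniz, Derivation.map_algebraMap, hχ.offD_es_fO, h2', smul_eq_mul]
      ring
    rw [e]
    refine (h.congr' ?_).trans (le_of_eq ?_)
    · filter_upwards [eventually_gt_atTop 0] with R hR
      rw [boundaryTerm]
      congr 1
      refine sphereInt_congr fun n hn => ?_
      have hq : ((0 : ℝ), R • n) ∈ offZ := smul_mem_offZ hR (ne_zero_of_norm_one hn)
      rw [hc.boundaryDensity_eq hχ, ← evoHom_apply hq, map_sum]
      refine Finset.sum_congr rfl fun k _ => ?_
      rw [map_mul, evoHom_apply, evoHom_apply, evo_nu _ hq, evo_toOff _ hq]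
    · congr 1; ring
  · exact (sphO_apply _ _).symm.trans (by rw [sphO_neg_two_mul, hc.sphO_rotFlux_pB, mul_zero])
  · exact (sphO_apply _ _).symm.trans (by rw [sphO_neg_two_mul, hc.sphO_rotFlux_pL_deriv, mul_zero])

/-! ### The variation of the bulk charge -/

/-- The variation on a ball. -/
theorem hasDerivAt_ball_charge {R : ℝ} (hR : 0 < R) :
    ballInt (fun x => ev (0, x) (smD es (hc.chargeA hχ))) R
      = ballInt (gradPairing (fun x => -bulkF χ (c 0).g (c 0).p x) (bulkG χ (c 0).g (c 0).p) c) R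
        + boundaryTerm χ c R := by
  obtain ⟨P, hP⟩ : ∃ P, P = ∑ i, ∑ j,
      (-hc.geom.bulkFA hc.pA hc.hamA hc.hamInvA hχ.ξA hχ.ξvA i j * hc.varGA i j
        + hc.geom.bulkGA hc.pA hc.hamInvA hχ.ξA hχ.ξvA i j * hc.varPA i j) := ⟨_, rfl⟩
  have e : (fun x => ev ((0 : ℝ), x) (smD es (hc.chargeA hχ)))
      = fun x => ev (0, x) P + ∑ k, pd k (fun y => ev (0, y) (hc.fluxA hχ k)) x := by
    funext x
    rw [hc.deriv_chargeA hχ, ← hP, map_add, map_sum (ev ((0 : ℝ), x)) _ Finset.univ]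
    simp only [pd_ev]
  have hV (k : Fin 3) : ContDiff ℝ ∞ (fun y : Space => ev ((0 : ℝ), y) (hc.fluxA hχ k)) :=
    ContDiff.comp (g := fun q : PSpace => ev q (hc.fluxA hχ k)) (smooth_contDiff (hc.fluxA hχ k))
      (by fun_prop : ContDiff ℝ ∞ fun y : Space => ((0 : ℝ), y))
  have hcont : Continuous fun x : Space => ∑ k, pd k (fun y => ev ((0 : ℝ), y) (hc.fluxA hχ k)) x := by
    simp only [pd_ev]
    exact continuous_finsetSum _ fun k _ => continuous_ev _ 0
  rw [e, ballInt, integral_add (integrableOn_ball (continuous_ev P 0) R)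
    (integrableOn_ball hcont R)]
  congr 1
  · refine congrArg (fun f => ballInt f R) (funext fun x => by rw [hP, hc.gradPairing_eq hχ x])
  · refine (ball_divergence hV hR).trans ?_
    rw [boundaryTerm]
    congr 1
    refine sphereInt_congr fun n hn => ?_
    rw [hc.boundaryDensity_eq hχ, radialVec_smul hR]
    exact Finset.sum_congr rfl fun k _ => by rw [radialVec_of_norm_one hn]

theorem hasDerivAt_ballInt_charge (hc : IsVariation ε c) (hχ : χ.IsAdmissible) {R : ℝ} (hR : 0 < R) :
    HasDerivAt (fun s => ballInt (chargeDensity χ (c s)) R)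
      (ballInt (gradPairing (fun x => -bulkF χ (c 0).g (c 0).p x) (bulkG χ (c 0).g (c 0).p) c) R
        + boundaryTerm χ c R) 0 := by
  rw [← hc.hasDerivAt_ball_charge hχ hR]
  have h := hasDerivAt_ballInt (hc.chargeA hχ) R 0
  simpa only [← hc.chargeDensity_eq hχ] using h

theorem hasDerivAt_bulkCharge (hε : ε = 1 ∨ ε = -1) :
    HasDerivAt (fun s => bulkCharge χ (c s)) (∫ x, ev (0, x) (smD es (hc.chargeA hχ))) 0 := by
  have h := hasDerivAt_bulkInt (hc.chargeA_mem hχ hε) (by norm_num)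
  simp only [← hc.chargeDensity_eq hχ] at h
  exact h

/-- No decay of the bulk integrand itself is used. On each ball it is the variation of the charge
minus the boundary term, and both of these have limits. -/
theorem tendsto_bulk (hε : ε = 1 ∨ ε = -1) : Tendsto (ballInt (gradPairing
    (fun x => -bulkF χ (c 0).g (c 0).p x) (bulkG χ (c 0).g (c 0).p) c)) atTop
    (𝓝 ((∫ x, ev (0, x) (smD es (hc.chargeA hχ))) + sphO 0 (offD es (hc.bdyO hχ)))) := by
  have hD : toOff (smD es (hc.chargeA hχ)) ∈ Sy false (-7 / 2) := by
    rw [toOff_smD]; exact Sy.offD_es (hc.chargeA_mem hχ hε)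
  have h1 := tendsto_ballInt_of_integrable (eventually_integrable hD (by norm_num)).self_of_nhds
  have h2 := h1.sub (hc.tendsto_boundaryTerm hχ hε)
  rw [sub_neg_eq_add] at h2
  refine h2.congr' ((eventually_gt_atTop 0).mono fun R hR => ?_)
  rw [hc.hasDerivAt_ball_charge hχ hR, add_sub_cancel_right]

theorem tendsto_charge (hc : IsVariation ε c) (hχ : χ.IsAdmissible)
    (hε : ε = 1 ∨ ε = -1) :
    Tendsto (ballInt (chargeDensity χ (c 0))) atTop (𝓝 (bulkCharge χ (c 0))) := by
  have h := (eventually_integrable (hc.chargeA_mem (b := false) hχ hε) (by norm_num)).self_of_nhds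
  simp only [← hc.chargeDensity_eq hχ] at h
  rw [bulkCharge, bulkInt_of_integrable h]
  exact tendsto_ballInt_of_integrable h

end IsVariation

end

section

/-! ### Symmetry of the functional derivatives -/

namespace Geom

variable {A : Type*} [CommRing A] [Algebra ℝ A] (G : Geom A) {p T : Fin 3 → Fin 3 → A}

theorem hess_symm (α : A) (i j : Fin 3) : G.hess α i j = G.hess α j i := by
  unfold hess
  rw [G.comm i j, Finset.sum_congr rfl fun m _ => by rw [G.Γ_symm m i j]]

theorem up_symm (hT : ∀ i j, T i j = T j i) (i j : Fin 3) : G.up T i j = G.up T j i := by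
  unfold up
  rw [Finset.sum_comm]
  refine Finset.sum_congr rfl fun a _ => Finset.sum_congr rfl fun b _ => ?_
  rw [hT b a, G.gi_symm i b, G.gi_symm a j]; ring

theorem pLow_symm (hp : ∀ i j, p i j = p j i) (i j : Fin 3) : G.pLow p i j = G.pLow p j i := by
  unfold pLow
  rw [Finset.sum_comm]
  refine Finset.sum_congr rfl fun a _ => Finset.sum_congr rfl fun b _ => ?_
  rw [hp b a, G.g_symm i b, G.g_symm a j]; ring

theorem pp_symm (hp : ∀ i j, p i j = p j i) (i j : Fin 3) : G.pp p i j = G.pp p j i := by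
  unfold pp
  rw [Finset.sum_comm]
  refine Finset.sum_congr rfl fun a _ => Finset.sum_congr rfl fun b _ => ?_
  rw [G.g_symm b a, hp i b, hp a j]; ring

theorem lieP_symm (hp : ∀ i j, p i j = p j i) (u : Fin 3 → A) (i j : Fin 3) :
    G.lieP p u i j = G.lieP p u j i := by
  unfold lieP
  refine Finset.sum_congr rfl fun k _ => ?_
  rw [hp i j, hp k j, hp i k]; ring

theorem bulkGA_symm (hp : ∀ i j, p i j = p j i) (Hi ξ : A) (ξv : Fin 3 → A) (i j : Fin 3) :
    G.bulkGA p Hi ξ ξv i j = G.bulkGA p Hi ξ ξv j i := by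
  simp only [bulkGA, GA, G.pLow_symm hp i j, G.g_symm i j, G.lieG_symm _ i j]

theorem bulkFA_symm (hp : ∀ i j, p i j = p j i) (H Hi ξ : A) (ξv : Fin 3 → A) (i j : Fin 3) :
    G.bulkFA p H Hi ξ ξv i j = G.bulkFA p H Hi ξ ξv j i := by
  simp only [bulkFA, FA, G.pp_symm hp i j, G.gi_symm i j, G.lieP_symm hp _ i j, hp i j,
    G.up_symm G.ric_symm i j, G.up_symm (G.hess_symm _) i j]
  ring

end Geom

/-! ### Differentiability -/

theorem hasFunctionalDerivs_totalCharge {ε : ℝ} (hε : ε = 1 ∨ ε = -1) {χ : Smearing}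
    (hχ : χ.IsAdmissible) {z : Fields} (hz : InPhaseSpace ε z) :
    HasFunctionalDerivs ε (totalCharge ε χ) z (fun x => -bulkF χ z.g z.p x)
      (bulkG χ z.g z.p) := by
  have hc := hz.isVariation
  refine ⟨fun i j => ?_, fun i j => ?_, fun x => ?_, fun x => ?_, fun c hc' hz => ?_⟩
  · simp only [Matrix.neg_apply, hc.bulkF_eq hχ 0]
    exact (continuous_ev _ 0).neg
  · simp only [hc.bulkG_eq hχ 0]
    exact continuous_ev _ 0
  · refine Matrix.IsSymm.ext fun i j => ?_
    refine congrArg (- ·) ?_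
    rw [hc.bulkF_eq hχ 0, hc.bulkF_eq hχ 0, hc.geom.bulkFA_symm hc.pA_symm]
  · refine Matrix.IsSymm.ext fun i j => ?_
    rw [hc.bulkG_eq hχ 0, hc.bulkG_eq hχ 0, hc.geom.bulkGA_symm hc.pA_symm]
  · subst hz
    exact ⟨_, hc'.tendsto_bulk hχ hε,
      (hc'.hasDerivAt_bulkCharge hχ hε).add (hc'.hasDerivAt_boundaryCharge hχ)⟩

/-! ### The charge of time translations -/

/-- The smearing of the physical Hamiltonian. -/
def unitSmearing : Smearing where
  ξ _ := 1
  ξv _ _ := 0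
  f _ := 1
  W _ := 0
  Y _ _ := 0
  I _ _ := 0

theorem unitSmearing_isAdmissible : unitSmearing.IsAdmissible := by
  have h0 : IsBigSymbol (-1) fun _ => (0 : ℝ) := fun k => by
    simp only [iteratedFDeriv_fun_zero]; exact isBigO_zero _ _
  have hs (a : ℝ) : IsSphereFun fun _ => a := ⟨contDiffOn_const, fun _ _ _ => rfl⟩
  constructor <;> simp [unitSmearing, contDiff_const, hs, h0, pd]

-- For f = 1 the term D̄_Aλ̄^A integrates to zero, and 2ε times the integral of 2λ̄ is the boundary
-- Hamiltonian. The physical Hamiltonian is thus itself one of the charges.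
open Smearing.IsAdmissible in
theorem totalCharge_unitSmearing {ε : ℝ} {y : Fields} (hy : InPhaseSpace ε y) :
    totalCharge ε unitSmearing y = physHam y + bdyHam ε y := by
  have hc := hy.isVariation
  have hχ := unitSmearing_isAdmissible
  rw [totalCharge, physHam, bdyHam]
  congr 1
  · rw [bulkCharge]
    congr 1
    funext x
    simp [chargeDensity, unitSmearing]
  · have e1 : sphereInt (lamBar y) = 1 / 2 * sphO 0 (∑ i, nu i * ∑ k, hc.hB i k * nu k) := by
      rw [sphO_apply, ← sphereInt_const_mul]
      exact sphereInt_congr fun n hn => by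
        rw [IsVariation.evo_compRR y.hBar hc.hB (fun y hy i j => hc.evo_hB i j hy)
          (ne_zero_of_norm_one hn)]; rfl
    have e2 : sphO 0 (lamDiv hc.hB) = sphO 0 (∑ i, nu i * ∑ k, hc.hB i k * nu k) := by
      rw [lamDiv, map_sub, sphO_divergence (fun i => HomZ.sum fun k _ =>
        (hc.homZ_hB i k).mul (HomZ.nu k)), sphO_two_mul]
      ring
    have e3 : hχ.fO = 1 := evo_ext fun q hq => by
      rw [fO, evo_offX _ _ hq, ← evoHom_apply hq, map_one]; rfl
    have e4 : sphereInt (densf ε unitSmearing y) = ε * (2 * sphO 0 (lamDiv hc.hB)) := by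
      rw [sphereInt_congr fun n hn => hc.densf_eq (s := 0) hχ hn, ← sphO_apply, e3, mul_one,
        ← Algebra.smul_def, map_smul, sphO_two_mul, smul_eq_mul]
    have h0 : sphereInt (fun _ => (0 : ℝ)) = 0 := by simp [sphereInt]
    have eW : densW unitSmearing y = fun _ => 0 := by funext x; simp [densW, unitSmearing]
    have eY : densY unitSmearing y = fun _ => 0 := by
      funext x; simp [densY, unitSmearing, dotProduct]
    have eI : densI unitSmearing y = fun _ => 0 := by
      funext x; simp [densI, unitSmearing, dotProduct]
    rw [boundaryCharge, e4, eW, eY, eI, h0, e1, e2]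
    ring

end

section

/-! ### The flux in the bracket with the physical Hamiltonian -/

/-- The Lie derivative of a covariant tensor off the origin. -/
def lieO (u : Fin 3 → OffFn) (h : Fin 3 → Fin 3 → OffFn) (i j : Fin 3) : OffFn :=
  ∑ k, (u k * offD (ex k) (h i j) + h k j * offD (ex i) (u k) + h i k * offD (ex j) (u k))

/-- The Lie derivative of the Euclidean metric. -/
def gaugeO (l : Fin 3 → OffFn) (i j : Fin 3) : OffFn := offD (ex i) (l j) + offD (ex j) (l i)

/-- The exterior derivative of a covector of degree zero, rescaled to degree zero. -/
def curlO (l : Fin 3 → OffFn) (i k : Fin 3) : OffFn :=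
  rho * (offD (ex i) (l k) - offD (ex k) (l i))

/-- The radial component of `flatPal` on a perturbation of degree `-1`, rescaled. -/
def radialPal (hb : Fin 3 → Fin 3 → OffFn) : OffFn :=
  ∑ k, nu k * ∑ i, (rho * offD (ex i) (hb i k) - nu i * hb i k
    - (rho * offD (ex k) (hb i i) - nu k * hb i i))

theorem sum_nu_flatPal_mul_rhoI (hb : Fin 3 → Fin 3 → OffFn) :
    ∑ k, nu k * flatPal (fun i j => rhoI * hb i j) k = rhoI ^ 2 * radialPal hb := by
  simp only [flatPal, radialPal, Finset.mul_sum]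
  refine Finset.sum_congr rfl fun k _ => Finset.sum_congr rfl fun i _ => ?_
  simp only [Derivation.leibniz, smul_eq_mul, offD_rhoI]
  linear_combination -nu k * rhoI * (offD (ex i) (hb i k) - offD (ex k) (hb i i)) * rho_rhoI

theorem homZ_radialPal {hb : Fin 3 → Fin 3 → OffFn} (hh : ∀ i j, HomZ (hb i j)) :
    HomZ (radialPal hb) :=
  HomZ.sum fun k _ => (HomZ.nu k).mul (HomZ.sum fun i _ =>
    (((hh i k).rho_mul_offD i).sub ((HomZ.nu i).mul (hh i k))).sub
      (((hh i i).rho_mul_offD k).sub ((HomZ.nu k).mul (hh i i))))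

/-- The flux of a pure gauge perturbation is a divergence on the sphere. -/
theorem sum_nu_flatPal_gaugeO (l : Fin 3 → OffFn) : ∑ k, nu k * flatPal (gaugeO l) k
    = rhoI ^ 2 * (rho * ∑ i, offD (ex i) (∑ k, nu k * curlO l i k)) := by
  -- From ∂_i(∂_il_k + ∂_kl_i) − 2∂_k∂_il_i only the divergence of the curl of l survives.
  have h1 (k : Fin 3) : flatPal (gaugeO l) k = ∑ i, offD (ex i) (rhoI * curlO l i k) := by
    refine Finset.sum_congr rfl fun i _ => ?_
    have e : rhoI * curlO l i k = offD (ex i) (l k) - offD (ex k) (l i) := by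
      rw [curlO, ← mul_assoc, mul_comm rhoI, rho_rhoI, one_mul]
    rw [e, gaugeO, gaugeO, map_add, map_add, map_sub, offD_comm (ex k) (ex i)]
    ring
  have hs (i k : Fin 3) : curlO l i k = -curlO l k i := by unfold curlO; ring
  have h0 (i : Fin 3) : curlO l i i = 0 := by unfold curlO; ring
  have hr := rho_rhoI
  simp only [h1, Derivation.leibniz, smul_eq_mul, offD_nu, offD_rhoI, Fin.sum_univ_three,
    map_add, h0, hs 1 0, hs 2 0, hs 2 1, map_neg, map_zero]
  generalize curlO l 0 1 = f01
  generalize curlO l 0 2 = f02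
  generalize curlO l 1 2 = f12
  simp
  linear_combination rhoI * (nu 0 * (offD (ex 1) f01 + offD (ex 2) f02)
    + nu 1 * (offD (ex 2) f12 - offD (ex 0) f01) - nu 2 * (offD (ex 0) f02 + offD (ex 1) f12)) * hr

namespace Smearing.IsAdmissible

variable {χ : Smearing} (hχ : χ.IsAdmissible)

/-- The rotation vector field. -/
def rotO (i : Fin 3) : OffFn := rho * hχ.YO i

theorem offD_rotO_symm (i j : Fin 3) :
    offD (ex j) (hχ.rotO i) = -offD (ex i) (hχ.rotO j) := by
  have := hχ.killS_eq_zero i j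
  rw [killS] at this
  exact (neg_eq_of_add_eq_zero_right this).symm

theorem offD_offD_rotO (k i j : Fin 3) : offD (ex k) (offD (ex i) (hχ.rotO j)) = 0 :=
  hχ.offD_offD_YO k i j

/-- Rotations commute with `flatPal`. -/
theorem flatPal_lieO_rotO (h : Fin 3 → Fin 3 → OffFn) (k : Fin 3) :
    flatPal (lieO hχ.rotO h) k = ∑ m, (hχ.rotO m * offD (ex m) (flatPal h k)
      + offD (ex k) (hχ.rotO m) * flatPal h m) := by
  -- A rotation field has constant antisymmetric derivative, so no second derivatives of it appear
  -- and the first ones only rotate the indices.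
  have hK := hχ.offD_rotO_symm
  have hKK := hχ.offD_offD_rotO
  have h0 (i : Fin 3) : offD (ex i) (hχ.rotO i) = 0 := by
    have := hK i i
    have h2 := Geom.two_mul_half (A := OffFn)
    linear_combination Geom.half OffFn * this - offD (ex i) (hχ.rotO i) * h2
  simp only [flatPal, lieO, map_sub, map_add, Derivation.leibniz, smul_eq_mul, hKK,
    offD_comm (ex 1) (ex 0), offD_comm (ex 2) (ex 0), offD_comm (ex 2) (ex 1), Fin.sum_univ_three]
  fin_cases k <;> simp only [Fin.zero_eta, Fin.mk_one, Fin.reduceFinMk, h0, hK 0 1, hK 0 2, hK 1 2,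
    offD_comm (ex 1) (ex 0), offD_comm (ex 2) (ex 0), offD_comm (ex 2) (ex 1)] <;> ring

/-- The radial vector ν is invariant under rotations, so contraction with it commutes with the Lie
derivative. There remains the derivative along Y of the scalar `radialPal`; the term from the power
of r vanishes because Y is tangential. -/
theorem sum_nu_flatPal_lieO_rotO {hb : Fin 3 → Fin 3 → OffFn} :
    ∑ k, nu k * flatPal (lieO hχ.rotO fun i j => rhoI * hb i j) k
      = rhoI ^ 2 * ∑ m, hχ.YO m * (rho * offD (ex m) (radialPal hb)) := by
  set P := flatPal fun i j => rhoI * hb i j with hP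
  have h1 : ∑ k, nu k * P k = rhoI ^ 2 * radialPal hb := sum_nu_flatPal_mul_rhoI hb
  have h2 (m : Fin 3) : ∑ k, (nu k * offD (ex m) (P k) + P k * offD (ex m) (nu k))
      = rhoI ^ 2 * offD (ex m) (radialPal hb) - 2 * rhoI ^ 3 * nu m * radialPal hb := by
    have := congrArg (offD (ex m)) h1
    simp only [map_sum, Derivation.leibniz, Derivation.leibniz_pow, smul_eq_mul, offD_rhoI] at this
    rw [this]
    simp
    ring
  have hB (m : Fin 3) : ∑ k, nu k * offD (ex k) (hχ.rotO m) = hχ.YO m := by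
    have h3 := (hχ.homZ_YO m).euler
    have h4 := sum_nu_sq
    simp only [rotO, Derivation.leibniz, smul_eq_mul, offD_rho, Fin.sum_univ_three] at *
    linear_combination rho * h3 + hχ.YO m * h4
  have hA (m : Fin 3) : ∑ k, nu k * offD (ex m) (P k)
      = rhoI ^ 2 * offD (ex m) (radialPal hb) - 2 * rhoI ^ 3 * nu m * radialPal hb
        - rhoI * P m + rhoI * nu m * (rhoI ^ 2 * radialPal hb) := by
    have h5 : ∑ k, P k * offD (ex m) (nu k) = rhoI * P m - rhoI * nu m * ∑ k, nu k * P k := by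
      simp only [offD_nu, mul_sub, Finset.sum_sub_distrib, Finset.mul_sum]
      congr 1
      · simp [mul_comm]
      · exact Finset.sum_congr rfl fun k _ => by ring
    have := h2 m
    rw [Finset.sum_add_distrib, h5, h1] at this
    linear_combination this
  have e : ∑ k, nu k * flatPal (lieO hχ.rotO fun i j => rhoI * hb i j) k
      = ∑ m, (hχ.rotO m * (∑ k, nu k * offD (ex m) (P k))
        + P m * ∑ k, nu k * offD (ex k) (hχ.rotO m)) := by
    simp only [flatPal_lieO_rotO, ← hP, Finset.mul_sum, Finset.sum_add_distrib, mul_add]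
    rw [Finset.sum_comm]
    congr 1
    · exact Finset.sum_congr rfl fun k _ => Finset.sum_congr rfl fun m _ => by ring
    · rw [Finset.sum_comm]
      exact Finset.sum_congr rfl fun k _ => Finset.sum_congr rfl fun m _ => by ring
  rw [e]
  have h3 := hχ.sum_nu_YO
  have hr := rho_rhoI
  simp only [hA, hB]
  simp only [rotO, Fin.sum_univ_three] at h3 ⊢
  linear_combination (-rho * rhoI ^ 3 * radialPal hb) * h3
    - (hχ.YO 0 * P 0 + hχ.YO 1 * P 1 + hχ.YO 2 * P 2) * hr

/-- A Killing field is divergence free, so Y·∂φ is the divergence of φY, whose flux vanishes because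
Y is tangential. -/
theorem sphO_rotation (s : ℝ) {φ : OffFn} (hφ : HomZ φ) :
    sphO s (∑ m, hχ.YO m * (rho * offD (ex m) φ)) = 0 := by
  have h0 : rho * ∑ m, offD (ex m) (hχ.YO m) = 0 := by
    have h1 (i : Fin 3) := hχ.killS_eq_zero i i
    have h2 := Geom.two_mul_half (A := OffFn)
    have h3 := hχ.sum_nu_YO
    simp only [killS_eq, Fin.sum_univ_three] at *
    linear_combination Geom.half OffFn * (h1 0 + h1 1 + h1 2) - h3
      - (nu 0 * hχ.YO 0 + nu 1 * hχ.YO 1 + nu 2 * hχ.YO 2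
        + rho * (offD (ex 0) (hχ.YO 0) + offD (ex 1) (hχ.YO 1) + offD (ex 2) (hχ.YO 2))) * h2
  have e : ∑ m, hχ.YO m * (rho * offD (ex m) φ) = rho * ∑ m, offD (ex m) (hχ.YO m * φ) := by
    simp only [Derivation.leibniz, smul_eq_mul, Finset.sum_add_distrib, mul_add]
    rw [← Finset.mul_sum, mul_left_comm, h0, mul_zero, add_zero, Finset.mul_sum]
    exact Finset.sum_congr rfl fun m _ => by ring
  have e2 : 2 * ∑ m, nu m * (hχ.YO m * φ) = 0 := by
    have := hχ.sum_nu_YO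
    simp only [← mul_assoc, ← Finset.sum_mul]
    rw [this]; ring
  rw [e, sphO_divergence (fun m => (hχ.homZ_YO m).mul hφ), e2, map_zero]

end Smearing.IsAdmissible

theorem homZ_curlO {l : Fin 3 → OffFn} (hl : ∀ i, HomZ (l i)) (i : Fin 3) :
    HomZ (∑ k, nu k * curlO l i k) :=
  HomZ.sum fun k _ => (HomZ.nu k).mul (by
    rw [curlO, mul_sub]; exact ((hl k).rho_mul_offD i).sub ((hl i).rho_mul_offD k))

/-- The field ν_k(curl)_ik is tangential by antisymmetry of the curl, so its divergence integrates
to zero. -/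
theorem sphO_gauge (s : ℝ) {l : Fin 3 → OffFn} (hl : ∀ i, HomZ (l i)) :
    sphO s (rho * ∑ i, offD (ex i) (∑ k, nu k * curlO l i k)) = 0 := by
  have e : 2 * ∑ i, nu i * ∑ k, nu k * curlO l i k = 0 := by
    simp only [curlO, Fin.sum_univ_three]; ring
  rw [sphO_divergence (homZ_curlO hl), e, map_zero]

end

/-! ### Decay of the flux in the bracket -/

section

namespace IsVariation

open Smearing.IsAdmissible

variable {ε : ℝ} {c : ℝ → Fields} {χ : Smearing} (hc : IsVariation ε c) (hχ : χ.IsAdmissible)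
  {b : Bool}

theorem lieG_mem {a : ℝ} {u : Fin 3 → SmoothFn} (hu : ∀ i, toOff (u i) ∈ Sy b a) (i j : Fin 3) :
    toOff (hc.geom.lieG u i j) ∈ Sy b (a - 1) := by
  simp only [Geom.lieG, map_sum, map_add, map_mul, hc.toOff_D, hc.geom_g]
  exact sum_mem fun k _ => add_mem (add_mem
    (Sy.mul_le (hu k) (hc.offD_g_mem i j k) (by linarith : a + -2 ≤ a - 1))
    (Sy.mul_le (hc.near_g k j).mem (Sy.offD_le (hu k) i le_rfl) (by linarith)))
    (Sy.mul_le (hc.near_g i k).mem (Sy.offD_le (hu k) j le_rfl) (by linarith))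

/-- The leading part of `L_u g`. -/
def lieLead (i j : Fin 3) : OffFn :=
  lieO hχ.rotO (fun i j => rhoI * hc.hB i j) i j + gaugeO (fun i => hχ.WO * nu i + hχ.IvO i) i j

theorem homZ_gauge (i : Fin 3) : HomZ (hχ.WO * nu i + hχ.IvO i) :=
  (hχ.homZ_WO.mul (HomZ.nu i)).add (hχ.homZ_IvO i)

theorem rotO_mem (i : Fin 3) : hχ.rotO i ∈ Sy b 1 :=
  Sy.mul_le Sy.rho (Sy.hom (hχ.homZ_YO i)) (by norm_num)

theorem rhoI_hB_mem (i j : Fin 3) : rhoI * hc.hB i j ∈ Sy b (-1) :=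
  Sy.mul_le Sy.rhoI (Sy.hom (hc.homZ_hB i j)) (by norm_num)

theorem lieLead_mem (i j : Fin 3) : hc.lieLead hχ i j ∈ Sy b (-1) := by
  have hl (i : Fin 3) : hχ.WO * nu i + hχ.IvO i ∈ Sy b 0 := Sy.hom (homZ_gauge hχ i)
  refine add_mem (sum_mem fun k _ => add_mem (add_mem ?_ ?_) ?_)
    (add_mem (Sy.offD_le (hl j) i (by norm_num)) (Sy.offD_le (hl i) j (by norm_num)))
  · exact Sy.mul_le (rotO_mem hχ k) (Sy.offD_mem (hc.rhoI_hB_mem i j) k) (by norm_num)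
  · exact Sy.mul_le (hc.rhoI_hB_mem k j) (Sy.offD_mem (rotO_mem hχ k) i) (by norm_num)
  · exact Sy.mul_le (hc.rhoI_hB_mem i k) (Sy.offD_mem (rotO_mem hχ k) j) (by norm_num)

/-- The rotation part of u is an isometry of the flat metric, so the term of order zero cancels. At
order −1 there remain the rotation of h̄/r and the flat Lie derivative along Wn + I; the shift
contributes only at order −3/2. -/
theorem lieG_expansion (hε : ε = 1 ∨ ε = -1) (i j : Fin 3) :
    toOff (hc.geom.lieG (hc.uA hχ) i j) - hc.lieLead hχ i j ∈ Sy b (-3 / 2) := by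
  set u : Fin 3 → OffFn := fun i => toOff (hc.uA hχ i) with hu
  set l : Fin 3 → OffFn := fun i => hχ.WO * nu i + hχ.IvO i with hl
  set h : Fin 3 → Fin 3 → OffFn := fun i j => rhoI * hc.hB i j with hh
  have hlm (i : Fin 3) : l i ∈ Sy b 0 := Sy.hom (homZ_gauge hχ i)
  have hum (i : Fin 3) : u i ∈ Sy b 1 := hc.u_mem hχ hε i
  have hem (i : Fin 3) : u i - (hχ.rotO i + l i) ∈ Sy b (-1 / 2) := by
    have := hc.u_expansion (b := b) hχ hε i
    rwa [add_assoc] at this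
  have hvm (i : Fin 3) : u i - hχ.rotO i ∈ Sy b 0 :=
    near_add_mem (G := l i) (a := -1 / 2) (by convert hem i using 1; ring) (hlm i) (by norm_num)
  have hgm (i j : Fin 3) : hc.gO i j - ((if i = j then 1 else 0) + h i j) ∈ Sy b (-3 / 2) := by
    have := hc.metric_expansion (b := b) i j
    rwa [pow_one] at this
  have h1 : ∑ k, (u k * offD (ex k) (hc.gO i j - ((if i = j then 1 else 0) + h i j))
      + (hc.gO k j - ((if k = j then 1 else 0) + h k j)) * offD (ex i) (u k)
      + (hc.gO i k - ((if i = k then 1 else 0) + h i k)) * offD (ex j) (u k)) ∈ Sy b (-3 / 2) :=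
    sum_mem fun k _ => add_mem (add_mem
      (Sy.mul_le (hum k) (Sy.offD_mem (hgm i j) k) (by norm_num))
      (Sy.mul_le (hgm k j) (Sy.offD_mem (hum k) i) (by norm_num)))
      (Sy.mul_le (hgm i k) (Sy.offD_mem (hum k) j) (by norm_num))
  have h2 : ∑ k, ((u k - hχ.rotO k) * offD (ex k) (h i j)
      + h k j * offD (ex i) (u k - hχ.rotO k)
      + h i k * offD (ex j) (u k - hχ.rotO k)) ∈ Sy b (-3 / 2) :=
    sum_mem fun k _ => add_mem (add_mem
      (Sy.mul_le (hvm k) (Sy.offD_mem (hc.rhoI_hB_mem i j) k) (by norm_num))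
      (Sy.mul_le (hc.rhoI_hB_mem k j) (Sy.offD_mem (hvm k) i) (by norm_num)))
      (Sy.mul_le (hc.rhoI_hB_mem i k) (Sy.offD_mem (hvm k) j) (by norm_num))
  have h3 : offD (ex i) (u j - (hχ.rotO j + l j)) + offD (ex j) (u i - (hχ.rotO i + l i))
      ∈ Sy b (-3 / 2) := add_mem (Sy.offD_le (hem j) i (by norm_num))
    (Sy.offD_le (hem i) j (by norm_num))
  have hK := hχ.offD_rotO_symm i j
  have e1 : ∑ k, (if k = j then (1 : OffFn) else 0) * offD (ex i) (u k) = offD (ex i) (u j) := by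
    simp
  have e2 : ∑ k, (if i = k then (1 : OffFn) else 0) * offD (ex j) (u k) = offD (ex j) (u i) := by
    simp
  convert add_mem (add_mem h1 h2) h3 using 1
  simp only [Geom.lieG, map_sum, map_add, map_mul, map_sub, hc.toOff_D, hc.geom_g, lieLead, lieO,
    gaugeO, offD_ite, sub_mul, add_mul, mul_sub, Finset.sum_add_distrib,
    Finset.sum_sub_distrib, e1, e2, zero_add]
  simp only [hh, hl, hu, map_add]
  linear_combination hK

/-- The coefficient of `r⁻²` in the radial flux. -/
def bracketLead : OffFn := ∑ m, hχ.YO m * (rho * offD (ex m) (radialPal hc.hB))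
  + rho * ∑ i, offD (ex i) (∑ k, nu k * curlO (fun i => hχ.WO * nu i + hχ.IvO i) i k)

theorem homZ_bracketLead : HomZ (hc.bracketLead hχ) := by
  refine (HomZ.sum fun m _ =>
    (hχ.homZ_YO m).mul ((homZ_radialPal hc.homZ_hB).rho_mul_offD m)).add ?_
  rw [Finset.mul_sum]
  exact HomZ.sum fun i _ => (homZ_curlO (homZ_gauge hχ) i).rho_mul_offD i

theorem sphO_bracketLead (s : ℝ) : sphO s (hc.bracketLead hχ) = 0 := by
  rw [bracketLead, map_add, hχ.sphO_rotation s (homZ_radialPal hc.homZ_hB),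
    sphO_gauge s (homZ_gauge hχ), add_zero]

theorem sum_nu_flatPal_lieLead :
    ∑ k, nu k * flatPal (hc.lieLead hχ) k = rhoI ^ 2 * hc.bracketLead hχ := by
  have e (k : Fin 3) : flatPal (hc.lieLead hχ) k
      = flatPal (lieO hχ.rotO fun i j => rhoI * hc.hB i j) k
        + flatPal (gaugeO fun i => hχ.WO * nu i + hχ.IvO i) k := by
    simp only [flatPal, lieLead, map_add, ← Finset.sum_add_distrib]
    exact Finset.sum_congr rfl fun i _ => by ring
  simp only [e, mul_add, Finset.sum_add_distrib]
  rw [hχ.sum_nu_flatPal_lieO_rotO, sum_nu_flatPal_gaugeO, bracketLead, mul_add]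

/-- The radial flux in the bracket. -/
theorem bracketFlux_expansion (hε : ε = 1 ∨ ε = -1) :
    ∑ k, nu k * toOff (hc.geom.bracketFlux hc.pA hc.hamInvA hχ.ξA hχ.ξvA k)
      - rhoI ^ 2 * (-(algebraMap ℝ OffFn ε * hc.bracketLead hχ)) ∈ Sy b (-5 / 2) := by
  have hn (k : Fin 3) : nu k ∈ Sy b 0 := Sy.hom (HomZ.nu k)
  have hu (k : Fin 3) := hc.u_mem (b := b) hχ hε k
  have hr := hc.radial_u_mem (b := b) hχ hε
  have hs (k : Fin 3) : toOff (hc.NvA k) ∈ Sy b (-1 / 2) := hc.shift_mem hε k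
  have hN := hc.near_lapse (b := b) hε
  have hNm : toOff hc.NA ∈ Sy b 0 := hN.mem
  have hdN (i : Fin 3) : offD (ex i) (toOff hc.NA) ∈ Sy b (-2) := offD_mem_of_near hN i
  have hα := hc.α_expansion (b := b) hχ hε
  have hα0 : algebraMap ℝ OffFn ε * hχ.fO ∈ Sy b 0 :=
    Sy.mul_le (Sy.const_mem ε) (Sy.hom hχ.homZ_fO) (by norm_num)
  have hαm : toOff (hc.αA hχ) ∈ Sy b 0 := near_add_mem hα hα0 (by norm_num)
  have hC : toOff (hc.geom.C hc.pA) ∈ Sy b (-7 / 2) := hc.CO_mem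
  have hLu (i j : Fin 3) : toOff (hc.geom.lieG (hc.uA hχ) i j) ∈ Sy b 0 :=
    Sy.mono (hc.lieG_mem hu i j) (by norm_num)
  have hLs (i j : Fin 3) : toOff (hc.geom.lieG hc.NvA i j) ∈ Sy b (-3 / 2) :=
    Sy.mono (hc.lieG_mem hs i j) (by norm_num)
  have h1 : ∑ k, nu k * (2 * ∑ j, hc.pO k j * (toOff (hc.αA hχ) * offD (ex j) (toOff hc.NA)
      - toOff hc.NA * offD (ex j) (toOff (hc.αA hχ)))) ∈ Sy b (-5 / 2) :=
    sum_mem fun k _ => Sy.mul_le (a := 0) (a' := -3) (hn k) (Sy.ofNat_mul 2 (sum_mem fun j _ =>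
      Sy.mul_le (hc.p_mem k j) (sub_mem (Sy.mul_le hαm (hdN j) (by norm_num : (0 + -2 : ℝ) ≤ -1))
        (Sy.mul_le hNm (Sy.offD_mem hαm j) (by norm_num))) (by norm_num))) (by norm_num)
  have h2 : ∑ k, nu k * (toOff (hc.NvA k)
      * ∑ i, ∑ j, hc.pO i j * toOff (hc.geom.lieG (hc.uA hχ) i j)) ∈ Sy b (-5 / 2) :=
    sum_mem fun k _ => Sy.mul_le (a := 0) (a' := -5 / 2) (hn k) (Sy.mul_le (hs k)
      (sum_mem fun i _ => sum_mem fun j _ => Sy.mul (hc.p_mem i j) (hLu i j)) (by norm_num))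
      (by norm_num)
  have h3 : (∑ k, nu k * toOff (hc.uA hχ k))
      * ∑ i, ∑ j, hc.pO i j * toOff (hc.geom.lieG hc.NvA i j) ∈ Sy b (-5 / 2) :=
    Sy.mul_le hr (sum_mem fun i _ => sum_mem fun j _ => Sy.mul (hc.p_mem i j) (hLs i j))
      (by norm_num)
  have h4 : ∑ k, nu k * (2 * ∑ j, hc.pO k j * ∑ i, hc.gO j i
      * toOff (hc.geom.brk (hc.uA hχ) hc.NvA i)) ∈ Sy b (-5 / 2) := by
    refine sum_mem fun k _ => Sy.mul_le (a := 0) (a' := -5 / 2) (hn k) (Sy.ofNat_mul 2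
      (sum_mem fun j _ => Sy.mul_le (hc.p_mem k j) (sum_mem fun i _ => Sy.mul_le (a' := -1 / 2)
        (hc.near_g j i).mem ?_ le_rfl) (by norm_num))) (by norm_num)
    simp only [Geom.brk, map_sum, map_sub, map_mul, hc.toOff_D]
    exact sum_mem fun m _ => sub_mem (Sy.mul_le (hu m) (Sy.offD_mem (hs i) m) (by norm_num))
      (Sy.mul_le (hs m) (Sy.offD_mem (hu i) m) (by norm_num))
  have h5 : (∑ k, nu k * toOff (hc.uA hχ k)) * (toOff hc.NA * toOff (hc.geom.C hc.pA))
      ∈ Sy b (-5 / 2) := Sy.mul_le hr (Sy.mul hNm hC) (by norm_num)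
  have h6 : ∑ k, nu k * (toOff (hc.αA hχ) * (toOff (hc.NvA k) * toOff (hc.geom.C hc.pA)))
      ∈ Sy b (-5 / 2) := sum_mem fun k _ => Sy.mul_le (hn k) (Sy.mul hαm (Sy.mul (hs k) hC))
        (by norm_num)
  -- The only contribution of order r⁻²: the flux of C with lapse N → ε on the perturbation L_u g.
  -- Since the limit lapse is constant, only its `flatPal` part survives.
  have h7 : ∑ k, nu k * (toOff (hc.geom.VA hc.NA (hc.geom.lieG (hc.uA hχ)) k)
      - flatVA (algebraMap ℝ OffFn ε) (hc.lieLead hχ) k) ∈ Sy b (-5 / 2) :=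
    sum_mem fun k _ => Sy.mul_le (hn k) (hc.VA_sub (hc.geom.lieG_symm _) (hc.lieLead_mem hχ)
      (hc.lieG_expansion hχ hε) (Sy.const_mem ε) hN k) (by norm_num)
  have h8 : ∑ k, nu k * toOff (hc.geom.VA (hc.αA hχ) (hc.geom.lieG hc.NvA) k) ∈ Sy b (-5 / 2) := by
    refine sum_mem fun k _ => Sy.mul_le (hn k) ?_ (by norm_num : (0 + -5 / 2 : ℝ) ≤ -5 / 2)
    -- The Lie derivative along the shift is already of order −3/2, so its leading part is taken to
    -- be zero.
    have := hc.VA_sub (b := b) (hc.geom.lieG_symm hc.NvA) (q0 := fun _ _ => 0)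
      (fun _ _ => zero_mem _) (fun i j => by rw [sub_zero]; exact hLs i j) hα0 hα k
    convert this using 1
    simp [flatVA, flatPal]
  have h9 : ∑ k, nu k * flatVA (algebraMap ℝ OffFn ε) (hc.lieLead hχ) k
      = rhoI ^ 2 * (-(algebraMap ℝ OffFn ε * hc.bracketLead hχ)) := by
    have e (k : Fin 3) : flatVA (algebraMap ℝ OffFn ε) (hc.lieLead hχ) k
        = -(algebraMap ℝ OffFn ε * flatPal (hc.lieLead hχ) k) := by
      simp [flatVA, Derivation.map_algebraMap]
    have e2 := hc.sum_nu_flatPal_lieLead hχ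
    calc _ = -(algebraMap ℝ OffFn ε * ∑ k, nu k * flatPal (hc.lieLead hχ) k) := by
          simp only [e, Finset.mul_sum, ← Finset.sum_neg_distrib]
          exact Finset.sum_congr rfl fun k _ => by ring
      _ = _ := by rw [e2]; ring
  have key := add_mem (sub_mem (add_mem (sub_mem (add_mem (sub_mem (add_mem h1 h2) h3) h4) h5) h6)
    h8) h7
  convert key using 1
  rw [← h9, Finset.sum_mul, Finset.sum_mul]
  simp only [← Finset.sum_add_distrib, ← Finset.sum_sub_distrib]
  refine Finset.sum_congr rfl fun k _ => ?_
  rw [hc.geom.bracketFlux_eq (α := hc.αA hχ) (β := hc.uA hχ) (α' := hc.NA) (β' := hc.NvA) rfl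
    (fun _ => rfl) rfl rfl]
  simp only [map_add, map_sub, map_mul, map_sum, map_ofNat, hc.toOff_D, hc.geom_g]
  ring

end IsVariation

end

section

/-! ### The bracket with the physical Hamiltonian -/

namespace IsVariation

variable {ε : ℝ} {c : ℝ → Fields} {χ : Smearing} (hc : IsVariation ε c)

/-- The integrand of the bracket of a charge with the charge of time translations. -/
theorem bracketIntegrand_eq (hχ : χ.IsAdmissible) (x : Space) :
    ∑ i, ∑ j, (-bulkF χ (c 0).g (c 0).p x i j * bulkG unitSmearing (c 0).g (c 0).p x i j
        - bulkG χ (c 0).g (c 0).p x i j * -bulkF unitSmearing (c 0).g (c 0).p x i j)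
      = ∑ k, pd k (fun y => ev (0, y) (hc.geom.bracketFlux hc.pA hc.hamInvA hχ.ξA hχ.ξvA k)) x := by
  have h1 : unitSmearing_isAdmissible.ξA = 1 := ev_ext fun q => by rw [map_one]; rfl
  have h0 : unitSmearing_isAdmissible.ξvA = 0 := by
    funext i; exact ev_ext fun q => by rw [Pi.zero_apply, map_zero]; rfl
  have h := congrArg (ev ((0 : ℝ), x)) (hc.geom.bracket_identity hc.isHam hc.pA_symm hχ.ξA hχ.ξvA)
  rw [map_sum (ev ((0 : ℝ), x)) (fun k => hc.geom.D k _)] at h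
  simp only [hc.ev_D] at h
  rw [← h]
  simp only [hc.bulkF_eq hχ, hc.bulkG_eq hχ, hc.bulkF_eq unitSmearing_isAdmissible,
    hc.bulkG_eq unitSmearing_isAdmissible, h1, h0, map_sum, map_add, map_mul, map_neg]
  exact Finset.sum_congr rfl fun i _ => Finset.sum_congr rfl fun j _ => by ring

theorem tendsto_bracket (hc : IsVariation ε c) (hχ : χ.IsAdmissible)
    (hε : ε = 1 ∨ ε = -1) :
    Tendsto (ballInt fun x => ∑ i, ∑ j,
      (-bulkF χ (c 0).g (c 0).p x i j * bulkG unitSmearing (c 0).g (c 0).p x i j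
        - bulkG χ (c 0).g (c 0).p x i j * -bulkF unitSmearing (c 0).g (c 0).p x i j)) atTop
      (𝓝 0) := by
  set V : Fin 3 → SmoothFn := hc.geom.bracketFlux hc.pA hc.hamInvA hχ.ξA hχ.ξvA with hV
  have hz : HomZ (0 : OffFn) := by simpa using HomZ.const 0
  have h := tendsto_sphere_flux (b := false) hz hz
    ((HomZ.const ε).mul (hc.homZ_bracketLead hχ)).neg
    (by rw [mul_zero, mul_zero, zero_add, zero_add]; exact hc.bracketFlux_expansion hχ hε)
    ((sphO_apply 0 0).symm.trans (map_zero _)) ((sphO_apply 0 0).symm.trans (map_zero _))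
  rw [← sphO_apply, map_neg, ← Algebra.smul_def, map_smul, hc.sphO_bracketLead hχ, smul_zero,
    neg_zero] at h
  refine h.congr' ?_
  filter_upwards [eventually_gt_atTop 0] with R hR
  have hsm (k : Fin 3) : ContDiff ℝ ∞ (fun y : Space => ev ((0 : ℝ), y) (V k)) :=
    ContDiff.comp (g := fun q : PSpace => ev q (V k)) (smooth_contDiff (V k))
      (by fun_prop : ContDiff ℝ ∞ fun y : Space => ((0 : ℝ), y))
  simp only [hc.bracketIntegrand_eq hχ]
  rw [ball_divergence hsm hR]
  congr 1
  refine sphereInt_congr fun n hn => ?_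
  have hq : ((0 : ℝ), R • n) ∈ offZ := smul_mem_offZ hR (ne_zero_of_norm_one hn)
  rw [← evoHom_apply hq, map_sum]
  refine Finset.sum_congr rfl fun k _ => ?_
  rw [map_mul, evoHom_apply, evoHom_apply, evo_nu _ hq, evo_toOff _ hq]
  congr 1
  change radialVec (R • n) k = n k
  rw [radialVec_smul hR, radialVec_of_norm_one hn]

end IsVariation

/-- The two functionals agree on 𝒫 only, but this suffices: variations stay in 𝒫, so the derivatives
of the charge with ξ = 1 carry over. -/
theorem hasFunctionalDerivs_physHam {ε : ℝ} (hε : ε = 1 ∨ ε = -1) {z : Fields}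
    (hz : InPhaseSpace ε z) : HasFunctionalDerivs ε (fun y => physHam y + bdyHam ε y) z
      (fun x => -bulkF unitSmearing z.g z.p x) (bulkG unitSmearing z.g z.p) := by
  obtain ⟨h1, h2, h3, h4, h5⟩ := hasFunctionalDerivs_totalCharge hε unitSmearing_isAdmissible hz
  refine ⟨h1, h2, h3, h4, fun c hc hcz => ?_⟩
  obtain ⟨d, hd, hd'⟩ := h5 c hc hcz
  refine ⟨d, hd, ?_⟩
  simpa only [totalCharge_unitSmearing (hc.mem _)] using hd'

theorem hasPoissonBracket_totalCharge {ε : ℝ} (hε : ε = 1 ∨ ε = -1) {χ : Smearing}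
    (hχ : χ.IsAdmissible) {z : Fields} (hz : InPhaseSpace ε z) :
    HasPoissonBracket ε (totalCharge ε χ) (fun y => physHam y + bdyHam ε y) z 0 :=
  ⟨_, _, _, _, hasFunctionalDerivs_totalCharge hε hχ hz, hasFunctionalDerivs_physHam hε hz,
    hz.isVariation.tendsto_bracket hχ hε⟩

end

end DustCharge

end

/-! ### Assembly of the statements -/

theorem mainTheorem2 (ε : ℝ) (hε : ε = 1 ∨ ε = -1)
    (χ : DustCharge.Smearing) (hχ : χ.IsAdmissible) :
    -- finiteness of the bulk charge and of the four boundary charges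
    (∀ z : DustCharge.Fields, DustCharge.InPhaseSpace ε z →
      Filter.Tendsto (DustCharge.ballInt (DustCharge.chargeDensity χ z)) Filter.atTop
          (nhds (DustCharge.bulkCharge χ z)) ∧
        DustCharge.SphereIntegrable (DustCharge.densf ε χ z) ∧
        DustCharge.SphereIntegrable (DustCharge.densW χ z) ∧
        DustCharge.SphereIntegrable (DustCharge.densY χ z) ∧
        DustCharge.SphereIntegrable (DustCharge.densI χ z)) ∧
    -- the boundary term of the variation of the bulk charge is minus the variation of `ℬ`
    (∀ c : ℝ → DustCharge.Fields, DustCharge.IsVariation ε c →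
      (∀ R : ℝ, 0 < R →
        HasDerivAt (fun s => DustCharge.ballInt (DustCharge.chargeDensity χ (c s)) R)
          (DustCharge.ballInt (DustCharge.gradPairing
              (fun x => -DustCharge.bulkF χ (c 0).g (c 0).p x)
              (DustCharge.bulkG χ (c 0).g (c 0).p) c) R
            + DustCharge.boundaryTerm χ c R) 0) ∧
      ∃ bulk δB : ℝ,
        Filter.Tendsto (DustCharge.ballInt (DustCharge.gradPairing
            (fun x => -DustCharge.bulkF χ (c 0).g (c 0).p x)
            (DustCharge.bulkG χ (c 0).g (c 0).p) c)) Filter.atTop (nhds bulk) ∧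
          HasDerivAt (fun s => DustCharge.boundaryCharge ε χ (c s)) δB 0 ∧
          Filter.Tendsto (DustCharge.boundaryTerm χ c) Filter.atTop (nhds (-δB)) ∧
          HasDerivAt (fun s => DustCharge.bulkCharge χ (c s)) (bulk - δB) 0) ∧
    -- `G = J + ℬ` is differentiable
    (∀ z : DustCharge.Fields, DustCharge.InPhaseSpace ε z →
      DustCharge.HasFunctionalDerivs ε (DustCharge.totalCharge ε χ) z
        (fun x => -DustCharge.bulkF χ z.g z.p x) (DustCharge.bulkG χ z.g z.p)) ∧
    -- `G` Poisson-commutes with the total physical Hamiltonian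
    (∀ z : DustCharge.Fields, DustCharge.InPhaseSpace ε z →
      DustCharge.HasPoissonBracket ε (DustCharge.totalCharge ε χ)
        (fun y => DustCharge.physHam y + DustCharge.bdyHam ε y) z 0) := by
  refine ⟨fun z hz => ?_, fun c hc => ⟨fun R hR => hc.hasDerivAt_ballInt_charge hχ hR, ?_⟩,
    fun z hz => DustCharge.hasFunctionalDerivs_totalCharge hε hχ hz,
    fun z hz => DustCharge.hasPoissonBracket_totalCharge hε hχ hz⟩
  · have hc := hz.isVariation
    exact ⟨hc.tendsto_charge hχ hε,
      DustCharge.IsVariation.sphereIntegrable_of_evo (s := 0) fun x hx => hc.densf_eq hχ hx,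
      DustCharge.IsVariation.sphereIntegrable_of_evo (s := 0) fun x hx => hc.densW_eq hχ hx,
      DustCharge.IsVariation.sphereIntegrable_of_evo (s := 0) fun x hx => hc.densY_eq hχ hx,
      DustCharge.IsVariation.sphereIntegrable_of_evo (s := 0) fun x hx => hc.densI_eq hχ hx⟩
  · refine ⟨_, _, hc.tendsto_bulk hχ hε, hc.hasDerivAt_boundaryCharge hχ,
      hc.tendsto_boundaryTerm hχ hε, ?_⟩
    -- The limit supplied by `tendsto_bulk` is δJ + δℬ, so subtracting δℬ leaves δJ.
    rw [add_sub_cancel_right]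
    exact hc.hasDerivAt_bulkCharge hχ hε
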